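/- Let $G=(V,E)$ be a finite nonempty simple undirected graph with $n=|V|$ vertices and $m=|E|$ edges, and let $W\subseteq V$ be a set of terminals. A *Steiner subgraph* of $(G,W)$ is a subgraph of $G$ that contains a path between every pair of vertices of $W$ (in particular it contains every vertex of $W$); a *minimal Steiner tree* of $(G,W)$ is a Steiner subgraph of $(G,W)$ no proper subgraph of which is a Steiner subgraph of $(G,W)$. An *enumeration algorithm* outputs all minimal Steiner trees of $(G,W)$, each exactly once and given by the list of its edges, and then halts. Algorithms run on a word RAM with unit-cost operations (addition, truncated subtraction, multiplication, comparison, memory access, output of one word) on words of $O(\log (n+1))$ bits. The input is given by adjacency lists of $G$ (each in arbitrary order) and a list of the terminals. Space is the number of memory words, including those of the input; the output is write-only and is not counted. All constants in the $O$-notation are absolute. **(1)** There is an enumeration algorithm that uses $O(n^2)$ space and, after a preprocessing phase of $O(nm)$ time during which nothing is output, has delay $O(n+m)$: the time from the end of the preprocessing to the first solution, the time between any two consecutive solutions, and the time from the last solution (or from the end of the preprocessing, if there is no solution) to halting are all $O(n+m)$. **(2)** There is an enumeration algorithm that, without such a preprocessing phase, uses $O(n+m)$ space and runs in $O(n+m)$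 amortized time per solution: its total running time is $O((n+m)\cdot\max\{1,N\})$, where $N$ is the number of minimal Steiner trees of $(G,W)$. -/

import Mathlib

/-! ## Minimal Steiner trees -/

namespace SteinerEnum

/-- `H` is a Steiner subgraph of `(G, W)`: it is a subgraph of `G` that has a path between every
pair of terminals (in particular it contains every terminal). -/
def IsSteinerSubgraph {V : Type*} {G : SimpleGraph V} (W : Finset V) (H : G.Subgraph) : Prop :=
  ∀ u ∈ W, ∀ v ∈ W, ∃ (hu : u ∈ H.verts) (hv : v ∈ H.verts), H.coe.Reachable ⟨u, hu⟩ ⟨v, hv⟩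

/-- A minimal Steiner tree of `(G, W)` is a Steiner subgraph of `(G, W)` no proper subgraph of
which is a Steiner subgraph of `(G, W)` (`≤` on `G.Subgraph` is the subgraph relation). -/
def IsMinimalSteinerTree {V : Type*} {G : SimpleGraph V} (W : Finset V) (H : G.Subgraph) : Prop :=
  Minimal (IsSteinerSubgraph W) H

/-! ## The word RAM

Programs are structured imperative programs over finitely many registers (`R`) and finitely many
random-access arrays (`A`), all of whose cells hold words. A program is fixed once and for all, so
each of its expressions has constant size, and one step of the machine performs a bounded number
of word operations. Words are natural numbers; that they have a bounded number of bits and that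
the memory is bounded is expressed by `Config.Fits` below. -/

/-- The word operations. Subtraction is truncated; comparisons yield `1` (true) or `0` (false). -/
inductive Op where
  | add | sub | mul | lt | eq

/-- The value of a word operation. -/
def Op.eval : Op → ℕ → ℕ → ℕ
  | .add, a, b => a + b
  | .sub, a, b => a - b
  | .mul, a, b => a * b
  | .lt, a, b => if a < b then 1 else 0
  | .eq, a, b => if a = b then 1 else 0

/-- Expressions: constants, registers, array cells with a computed index, word operations. -/
inductive Expr (R A : Type) where
  | const (k : ℕ)
  | reg (x : R)
  | get (a : A) (i : Expr R A)
  | op (o : Op) (e f : Expr R A)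

/-- Commands. `emit e` appends the word `e` to the solution that is currently being written to the
write-only output; `finish` marks the end of that solution. -/
inductive Cmd (R A : Type) where
  | assign (x : R) (e : Expr R A)
  | store (a : A) (i e : Expr R A)
  | emit (e : Expr R A)
  | finish
  | seq (c d : Cmd R A)
  | ite (e : Expr R A) (c d : Cmd R A)
  | loop (e : Expr R A) (c : Cmd R A)

/-- A configuration: the commands still to be executed (a control state, of size bounded in terms
of the program), the registers, the arrays, the part of the current solution written so far, and
the solutions completed so far, in chronological order. -/
structure Config (R A : Type) where
  control : List (Cmd R A)
  regs : R → ℕ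
  mem : A → ℕ → ℕ
  current : List ℕ
  solutions : List (List ℕ)

/-- The value of an expression in a configuration. -/
def Expr.eval {R A : Type} (s : Config R A) : Expr R A → ℕ
  | .const k => k
  | .reg x => s.regs x
  | .get a i => s.mem a (i.eval s)
  | .op o e f => o.eval (e.eval s) (f.eval s)

/-- One step of the machine. A conditional tests whether its expression is nonzero, a `loop` runs
its body while its expression is nonzero; a configuration with nothing left to do is final. -/
def Config.step {R A : Type} [DecidableEq R] [DecidableEq A] (s : Config R A) : Config R A :=
  match s.control with
  | [] => s
  | .assign x e :: K => { s with control := K, regs := Function.update s.regs x (e.eval s) }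
  | .store a i e :: K =>
      { s with
        control := K
        mem := Function.update s.mem a (Function.update (s.mem a) (i.eval s) (e.eval s)) }
  | .emit e :: K => { s with control := K, current := s.current ++ [e.eval s] }
  | .finish :: K =>
      { s with control := K, current := [], solutions := s.solutions ++ [s.current] }
  | .seq c d :: K => { s with control := c :: d :: K }
  | .ite e c d :: K => { s with control := (if e.eval s = 0 then d else c) :: K }
  | .loop e c :: K =>
      { s with control := if e.eval s = 0 then K else c :: .loop e c :: K }

/-- The evaluation of an expression uses only words smaller than `B` and only array cells with
index smaller than `S`. -/
def Expr.Fits {R A : Type} (s : Config R A) (B S : ℕ) : Expr R A → Prop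
  | .const k => k < B
  | .reg x => s.regs x < B
  | .get a i => i.Fits s B S ∧ i.eval s < S ∧ s.mem a (i.eval s) < B
  | .op o e f => e.Fits s B S ∧ f.Fits s B S ∧ o.eval (e.eval s) (f.eval s) < B

/-- The next step of the machine uses only words smaller than `B` and only array cells with index
smaller than `S`. -/
def Config.Fits {R A : Type} (s : Config R A) (B S : ℕ) : Prop :=
  match s.control with
  | [] => True
  | .assign _ e :: _ => e.Fits s B S
  | .store _ i e :: _ => i.Fits s B S ∧ i.eval s < S ∧ e.Fits s B S
  | .emit e :: _ => e.Fits s B S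
  | .finish :: _ => True
  | .seq _ _ :: _ => True
  | .ite e _ _ :: _ => e.Fits s B S
  | .loop e _ :: _ => e.Fits s B S

/-- A program: finite sets of registers and of arrays, an array that receives the input, and the
program text. -/
structure Program where
  Reg : Type
  Arr : Type
  [fintypeReg : Fintype Reg]
  [decEqReg : DecidableEq Reg]
  [fintypeArr : Fintype Arr]
  [decEqArr : DecidableEq Arr]
  inp : Arr
  body : Cmd Reg Arr

attribute [instance] Program.fintypeReg Program.decEqReg Program.fintypeArr Program.decEqArr

namespace Program

/-- The initial configuration: the input array starts with the input words; all other cells and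
all registers are `0`; nothing has been output. -/
def init (p : Program) (input : List ℕ) : Config p.Reg p.Arr where
  control := [p.body]
  regs := fun _ => 0
  mem := fun a i => if a = p.inp then input.getD i 0 else 0
  current := []
  solutions := []

/-- The configuration after `k` steps. -/
def after (p : Program) (input : List ℕ) (k : ℕ) : Config p.Reg p.Arr :=
  Config.step^[k] (p.init input)

/-- The program has halted after at most `k` steps. -/
def HaltedAt (p : Program) (input : List ℕ) (k : ℕ) : Prop :=
  (p.after input k).control = []

/-- The run uses at most `s` words of memory (all registers and all arrays counted, the one with
the input included), and every word that occurs in a computation is smaller than `B`. -/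
def RunsInSpace (p : Program) (input : List ℕ) (B s : ℕ) : Prop :=
  ∃ S : ℕ, Fintype.card p.Reg + Fintype.card p.Arr * S ≤ s ∧
    ∀ k, (p.after input k).Fits B S

/-- After a preprocessing phase of at most `pre` steps, in which no solution is output, the time
to the first solution, the time between any two consecutive solutions, and the time between the
last solution and the halting of the program (from the end of the preprocessing, if there are no
solutions) are all at most `d`: at any moment at which the program has not halted, it completes
another solution or halts within the next `d` steps. -/
def HasDelay (p : Program) (input : List ℕ) (pre d : ℕ) : Prop :=
  ∃ q ≤ pre, (p.after input q).solutions = [] ∧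
    ∀ k, q ≤ k → ¬ p.HaltedAt input k →
      ∃ j, k < j ∧ j ≤ k + d ∧
        (p.HaltedAt input j ∨
          (p.after input k).solutions.length < (p.after input j).solutions.length)

end Program

/-! ## Input and output of the enumeration problem -/

/-- The lists `adj v` are adjacency lists of `G`: the list of `v` contains every neighbour of `v`
exactly once, in an arbitrary order. -/
def IsAdjacencyLists {n : ℕ} (G : SimpleGraph (Fin n)) (adj : Fin n → List (Fin n)) : Prop :=
  ∀ v, (adj v).Nodup ∧ ∀ u, u ∈ adj v ↔ G.Adj v u

/-- The number of edges. -/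
noncomputable def numEdges {n : ℕ} (G : SimpleGraph (Fin n)) : ℕ := G.edgeSet.ncard

/-- The input words: the numbers of vertices, edges and terminals; for every `i ≤ n` the position
at which the adjacency list of vertex `i` starts within the concatenation of all adjacency lists
(for `i = n`: where the last one ends); that concatenation; the terminals. -/
noncomputable def inputWords {n : ℕ} (G : SimpleGraph (Fin n)) (adj : Fin n → List (Fin n))
    (terminals : List (Fin n)) : List ℕ :=
  [n, numEdges G, terminals.length]
    ++ (List.range (n + 1)).map
        (fun i => (((List.finRange n).take i).map (fun v => (adj v).length)).sum)
    ++ (List.finRange n).flatMap (fun v => (adj v).map Fin.val)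
    ++ terminals.map Fin.val

/-- The words of an output solution describe the subgraph `T`: they list the two ends of each edge
of `T`, every edge occurring exactly once (in an arbitrary order). -/
def Describes {n : ℕ} {G : SimpleGraph (Fin n)} (T : G.Subgraph) (out : List ℕ) : Prop :=
  ∃ es : List (Fin n × Fin n),
    out = es.flatMap (fun e => [e.1.val, e.2.val]) ∧
    (es.map (fun e => s(e.1, e.2))).Nodup ∧
    ∀ e, e ∈ es.map (fun e => s(e.1, e.2)) ↔ e ∈ T.edgeSet

/-- The list of output solutions is an enumeration of all minimal Steiner trees of `(G, W)`,
without duplication. -/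
def IsEnumeration {n : ℕ} (G : SimpleGraph (Fin n)) (W : Finset (Fin n))
    (sols : List (List ℕ)) : Prop :=
  ∃ Ts : List G.Subgraph, Ts.Nodup ∧ (∀ T, T ∈ Ts ↔ IsMinimalSteinerTree W T) ∧
    List.Forall₂ Describes Ts sols

/-- On the given input the program halts, its output being an enumeration of all minimal Steiner
trees of `(G, W)`. -/
def Program.Enumerates (p : Program) (input : List ℕ) {n : ℕ} (G : SimpleGraph (Fin n))
    (W : Finset (Fin n)) : Prop :=
  ∃ k, p.HaltedAt input k ∧ (p.after input k).current = [] ∧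
    IsEnumeration G W (p.after input k).solutions

/-- The number of minimal Steiner trees of `(G, W)`. -/
noncomputable def numMinimalSteinerTrees {n : ℕ} (G : SimpleGraph (Fin n))
    (W : Finset (Fin n)) : ℕ :=
  {T : G.Subgraph | IsMinimalSteinerTree W T}.ncard

end SteinerEnum

/-!
# Enumerating minimal Steiner trees with linear delay

A single program `mainCmd` has linear delay, uses linear space and does no preprocessing; it serves
both parts of the theorem.

**Encoding of the trees.** All trees are rooted at the first terminal. A minimal Steiner tree is
the same as a parent function whose ancestor chains from the terminals reach the root, normalized
to be the identity off these chains (`Sol`; see `Encodes.isMinimalSteinerTree`,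
`Encodes.exists_sol`, `Encodes.treeOf_injOn`). If some of the parents are fixed such that they form
a subtree at the root (`Closed`), then the parents of any fixed spanning tree on the other vertices
complete them to a solution (`Closed.spanning`). Hence a partial solution can always be completed,
and no branch that has been checked to be nonempty is a dead end.

Without terminals, the empty tree is the only solution (`isMinimalSteinerTree_empty`).

**Branching.** The program keeps a stack of vertices with decided parents. Above the root it
consists of segments, each of them a path from a terminal to the subtree formed by the vertices
below; the other vertices have the parents of the initial search tree, so that there is always a
current tree. When the stack is a subtree `T`, the program tests whether the current tree is the
only solution that contains `T`. If not, it finds a terminal `w` with an alternative (`Alt`) and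
pushes the path of `w` to `T` as a new segment. The solutions that contain `T` are divided
(`partition`) according to the first vertex of this path at which they leave it. There is one branch
of the first kind (`SolB`) for every vertex of the path, and one of the second kind (`SolA`) for the
solutions that contain the whole path; the flags `fB` and `fA` record which of the branches are
nonempty and pending. A branch of the first kind at `v` is explored by excluding the arc from `v` to
its parent and rerouting `v` to `T`. This gives a new current tree, which is output at once.

**Linear time per solution.** All the information that is needed comes from graph searches of
linear total cost. Whether a completion is unique is decided by contracting `T` to a point and by
labelling every vertex with the vertex of the current tree from which a search reaches it: the
completion is unique iff no further edge joins different labels (`Labelled.not_alt`,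
`Labelled.alt`). The vertices of the path at which it can be left are found by one incremental
search, in which the vertices of the path are released from the last one on (`setFlags_spec`);
that a solution leaves the path at a vertex makes the arc by which it does so admissible for this
test (`Sol.av`). A branch of the second kind is only recorded if the test succeeds for it, so that
resuming it always uncovers a branch of the first kind (`Promising`); therefore every round of the
main loop but the last one outputs a solution (`round_spec`).

**Correctness.** The invariant `Stage` says that every solution either has been output, and only
once, or belongs to exactly one pending branch. It is kept in the form of an equation between
natural numbers, `count f + pend f = 1`, to which every operation on the stack contributes one
identity. When the stack is empty but for the root, nothing is pending, hence everything has been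
output.

**Running time.** Programs are verified by a weakest precondition calculus (`vc`, `vc_sound`) that
tracks the exact number of steps and the bounds on words and addresses. The run is a sequence of
linearly long pieces that end with additional output (`Paced`), which yields the delay with a factor
of two, since the output may happen anywhere within a piece (`Paced.delay`).
-/

set_option linter.constructorNameAsVariable false
set_option linter.unusedSectionVars false

namespace SteinerEnum

/-! ### Verification conditions for word RAM programs -/

section Machine

variable {R A : Type} [DecidableEq R] [DecidableEq A]

/-- Assign a register. -/
def Config.setR (s : Config R A) (x : R) (v : ℕ) : Config R A :=
  { s with regs := Function.update s.regs x v }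

/-- Write an array cell. -/
def Config.setA (s : Config R A) (a : A) (i v : ℕ) : Config R A :=
  { s with mem := Function.update s.mem a (Function.update (s.mem a) i v) }

/-- Append a word to the current solution. -/
def Config.put (s : Config R A) (v : ℕ) : Config R A :=
  { s with current := s.current ++ [v] }

/-- Complete the current solution. -/
def Config.fin (s : Config R A) : Config R A :=
  { s with current := [], solutions := s.solutions ++ [s.current] }

/-- Replace the control state. -/
def Config.withC (s : Config R A) (K : List (Cmd R A)) : Config R A :=
  { s with control := K }

section simps
variable (s : Config R A) (x y : R) (a b : A) (i v : ℕ) (K : List (Cmd R A))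

@[simp] theorem Config.setR_regs :
    (s.setR x v).regs y = if y = x then v else s.regs y := by
  simp [Config.setR, Function.update_apply]
@[simp] theorem Config.setR_mem : (s.setR x v).mem = s.mem := rfl
@[simp] theorem Config.setR_current : (s.setR x v).current = s.current := rfl
@[simp] theorem Config.setR_solutions : (s.setR x v).solutions = s.solutions := rfl
@[simp] theorem Config.setA_regs : (s.setA a i v).regs = s.regs := rfl
@[simp] theorem Config.setA_mem :
    (s.setA a i v).mem b = if b = a then Function.update (s.mem a) i v else s.mem b := by
  simp only [Config.setA, Function.update_apply]
@[simp] theorem Config.setA_current : (s.setA a i v).current = s.current := rfl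
@[simp] theorem Config.setA_solutions : (s.setA a i v).solutions = s.solutions := rfl
@[simp] theorem Config.put_regs : (s.put v).regs = s.regs := rfl
@[simp] theorem Config.put_mem : (s.put v).mem = s.mem := rfl
@[simp] theorem Config.put_current : (s.put v).current = s.current ++ [v] := rfl
@[simp] theorem Config.put_solutions : (s.put v).solutions = s.solutions := rfl
@[simp] theorem Config.fin_regs : (s.fin).regs = s.regs := rfl
@[simp] theorem Config.fin_mem : (s.fin).mem = s.mem := rfl
@[simp] theorem Config.fin_current : (s.fin).current = [] := rfl
@[simp] theorem Config.fin_solutions : (s.fin).solutions = s.solutions ++ [s.current] := rfl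
@[simp] theorem Config.withC_regs : (s.withC K).regs = s.regs := rfl
@[simp] theorem Config.withC_mem : (s.withC K).mem = s.mem := rfl
@[simp] theorem Config.withC_current : (s.withC K).current = s.current := rfl
@[simp] theorem Config.withC_solutions : (s.withC K).solutions = s.solutions := rfl
@[simp] theorem Config.withC_control : (s.withC K).control = K := rfl

@[simp] theorem Expr.eval_withC (e : Expr R A) : e.eval (s.withC K) = e.eval s := by
  induction e <;> simp_all [Expr.eval]

end simps

/-- Parameters of a run: all stored words are at most `M`, all intermediate words below `B`. An
expression with at most `16` nodes has intermediate values of at most `(M + 18) ^ 16`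
(`Expr.eval_le`). -/
structure Mach where
  B : ℕ
  M : ℕ
  one_le : 1 ≤ M
  big : (M + 18) ^ 16 < B

/-- All registers and all array cells hold words that are at most `M`. -/
def Config.Bdd (s : Config R A) (M : ℕ) : Prop :=
  (∀ x, s.regs x ≤ M) ∧ ∀ a i, s.mem a i ≤ M

/-- The value of the expression is at most `M`, in a form that is trivial where it holds in every
configuration with `Config.Bdd`. -/
def Expr.Small (M : ℕ) (s : Config R A) : Expr R A → Prop
  | .const k => k ≤ M
  | .reg _ => True
  | .get _ _ => True
  | .op .add e f => e.eval s + f.eval s ≤ M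
  | .op .mul e f => e.eval s * f.eval s ≤ M
  | .op .sub e _ => e.Small M s
  | .op .lt _ _ => True
  | .op .eq _ _ => True

/-- All indices of array accesses in the expression are at most `M`. -/
def Expr.Idx (M : ℕ) (s : Config R A) : Expr R A → Prop
  | .const _ => True
  | .reg _ => True
  | .get _ i => i.Idx M s ∧ i.Small M s
  | .op _ e f => e.Idx M s ∧ f.Idx M s

/-- The number of nodes of an expression. -/
def Expr.size : Expr R A → ℕ
  | .const _ => 1
  | .reg _ => 1
  | .get _ i => i.size + 1
  | .op _ e f => e.size + f.size

/-- All constants of the expression are at most `16`. -/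
def Expr.lowConst : Expr R A → Bool
  | .const k => decide (k ≤ 16)
  | .reg _ => true
  | .get _ i => i.lowConst
  | .op _ e f => e.lowConst && f.lowConst

/-- Size restriction on expressions that bounds their values by a fixed power of `M`. -/
def Expr.okay (e : Expr R A) : Bool := decide (e.size ≤ 16) && e.lowConst

/-- All expressions of the command are `okay`. -/
def Cmd.okay : Cmd R A → Bool
  | .assign _ e => e.okay
  | .store _ i e => i.okay && e.okay
  | .emit e => e.okay
  | .finish => true
  | .seq c d => c.okay && d.okay
  | .ite e c d => e.okay && c.okay && d.okay
  | .loop e c => e.okay && c.okay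

/-- The command may write the register. -/
def Cmd.wr (x : R) : Cmd R A → Bool
  | .assign y _ => decide (x = y)
  | .store _ _ _ => false
  | .emit _ => false
  | .finish => false
  | .seq c d => c.wr x || d.wr x
  | .ite _ c d => c.wr x || d.wr x
  | .loop _ c => c.wr x

/-- The command may write the array. -/
def Cmd.wa (a : A) : Cmd R A → Bool
  | .assign _ _ => false
  | .store b _ _ => decide (a = b)
  | .emit _ => false
  | .finish => false
  | .seq c d => c.wa a || d.wa a
  | .ite _ c d => c.wa a || d.wa a
  | .loop _ c => c.wa a

/-- The command may produce output. -/
def Cmd.out : Cmd R A → Bool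
  | .assign _ _ => false
  | .store _ _ _ => false
  | .emit _ => true
  | .finish => true
  | .seq c d => c.out || d.out
  | .ite _ c d => c.out || d.out
  | .loop _ c => c.out

/-- What a command does not write is unchanged between `s` and `s'`. -/
structure Frame (c : Cmd R A) (s s' : Config R A) : Prop where
  regs : ∀ x, c.wr x = false → s'.regs x = s.regs x
  mem : ∀ a, c.wa a = false → s'.mem a = s.mem a
  cur : c.out = false → s'.current = s.current
  sols : c.out = false → s'.solutions = s.solutions

theorem Frame.refl (c : Cmd R A) (s : Config R A) : Frame c s s :=
  ⟨fun _ _ => rfl, fun _ _ => rfl, fun _ => rfl, fun _ => rfl⟩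

theorem Frame.trans {c : Cmd R A} {s s' s'' : Config R A} (h : Frame c s s') (h' : Frame c s' s'') :
    Frame c s s'' :=
  ⟨fun x hx => (h'.regs x hx).trans (h.regs x hx), fun x hx => (h'.mem x hx).trans (h.mem x hx),
    fun hx => (h'.cur hx).trans (h.cur hx), fun hx => (h'.sols hx).trans (h.sols hx)⟩

theorem Frame.mono {c d : Cmd R A} {s s' : Config R A} (h : Frame c s s')
    (hr : ∀ x, d.wr x = false → c.wr x = false) (ha : ∀ x, d.wa x = false → c.wa x = false)
    (ho : d.out = false → c.out = false) : Frame d s s' :=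
  ⟨fun x hx => h.regs x (hr x hx), fun x hx => h.mem x (ha x hx),
    fun hx => h.cur (ho hx), fun hx => h.sols (ho hx)⟩

/-- `σ'` is reached from `σ` by exactly `t` steps, all of which respect the bounds on words and
addresses. -/
def Reaches (B S : ℕ) (σ : Config R A) (t : ℕ) (σ' : Config R A) : Prop :=
  Config.step^[t] σ = σ' ∧ ∀ i < t, (Config.step^[i] σ).Fits B S

theorem Reaches.trans {B S : ℕ} {σ σ' σ'' : Config R A} {t t' : ℕ} (h : Reaches B S σ t σ')
    (h' : Reaches B S σ' t' σ'') : Reaches B S σ (t + t') σ'' := by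
  obtain ⟨rfl, h2⟩ := h
  obtain ⟨rfl, h4⟩ := h'
  refine ⟨by rw [Nat.add_comm, Function.iterate_add_apply], fun i hi => ?_⟩
  rcases lt_or_ge i t with h | h
  · exact h2 i h
  · obtain ⟨j, rfl⟩ := Nat.exists_eq_add_of_le h
    rw [Nat.add_comm, Function.iterate_add_apply]
    exact h4 j (by omega)

theorem Reaches.one {B S : ℕ} {σ σ' : Config R A} (hf : σ.Fits B S) (h : σ.step = σ') :
    Reaches B S σ 1 σ' := by
  refine ⟨by simpa using h, fun i hi => ?_⟩
  obtain rfl : i = 0 := by omega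
  simpa using hf

/-- The command takes `s` to `s'` in exactly `t` steps, whatever is left to be done afterwards. -/
def Runs (B S : ℕ) (c : Cmd R A) (s : Config R A) (t : ℕ) (s' : Config R A) : Prop :=
  ∀ K, Reaches B S (s.withC (c :: K)) t (s'.withC K)

/-- The verification condition of a command: if it holds, then the command terminates, respects
the bounds of `μ`, and its running time and final configuration satisfy `Q` (`vc_sound`). -/
def vc (μ : Mach) : Cmd R A → (ℕ → Config R A → Prop) → Config R A → Prop
  | .assign x e, Q, s => e.Idx μ.M s ∧ e.Small μ.M s ∧ Q 1 (s.setR x (e.eval s))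
  | .store a i e, Q, s => i.Idx μ.M s ∧ i.Small μ.M s ∧ e.Idx μ.M s ∧ e.Small μ.M s ∧
      Q 1 (s.setA a (i.eval s) (e.eval s))
  | .emit e, Q, s => e.Idx μ.M s ∧ Q 1 (s.put (e.eval s))
  | .finish, Q, s => Q 1 s.fin
  | .seq c d, Q, s => vc μ c (fun t s1 => vc μ d (fun t' s2 => Q (t + t' + 1) s2) s1) s
  | .ite e c d, Q, s => e.Idx μ.M s ∧ (e.eval s ≠ 0 → vc μ c (fun t => Q (t + 1)) s) ∧
      (e.eval s = 0 → vc μ d (fun t => Q (t + 1)) s)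
  | .loop e c, Q, s => s.Bdd μ.M → ∃ t s', Runs μ.B (μ.M + 1) (.loop e c) s t s' ∧ s'.Bdd μ.M ∧
      Frame (.loop e c) s s' ∧ Q t s'

theorem vc_mono {μ : Mach} {c : Cmd R A} {Q Q' : ℕ → Config R A → Prop} {s : Config R A}
    (h : vc μ c Q s) (hQ : ∀ t s', Q t s' → Q' t s') : vc μ c Q' s := by
  induction c generalizing Q Q' s with
  | assign x e => exact ⟨h.1, h.2.1, hQ _ _ h.2.2⟩
  | store a i e => exact ⟨h.1, h.2.1, h.2.2.1, h.2.2.2.1, hQ _ _ h.2.2.2.2⟩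
  | emit e => exact ⟨h.1, hQ _ _ h.2⟩
  | finish => exact hQ _ _ h
  | seq c d ihc ihd => exact ihc h fun t s1 h1 => ihd h1 fun t' s2 h2 => hQ _ _ h2
  | ite e c d ihc ihd =>
    exact ⟨h.1, fun h0 => ihc (h.2.1 h0) fun t s1 h1 => hQ _ _ h1,
      fun h0 => ihd (h.2.2 h0) fun t s1 h1 => hQ _ _ h1⟩
  | loop e c ih =>
    intro hb
    obtain ⟨t, s', h1, h2, h3, h4⟩ := h hb
    exact ⟨t, s', h1, h2, h3, hQ _ _ h4⟩

theorem vc_frame {μ : Mach} {c : Cmd R A} {Q : ℕ → Config R A → Prop} {s : Config R A}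
    (h : vc μ c Q s) : vc μ c (fun t s' => Q t s' ∧ Frame c s s') s := by
  induction c generalizing Q s with
  | assign x e =>
    refine ⟨h.1, h.2.1, h.2.2, ?_⟩
    constructor <;> simp +contextual [Cmd.wr]
  | store a i e =>
    refine ⟨h.1, h.2.1, h.2.2.1, h.2.2.2.1, h.2.2.2.2, ?_⟩
    constructor <;> simp +contextual [Cmd.wa]
  | emit e => exact ⟨h.1, h.2, by constructor <;> simp [Cmd.out]⟩
  | finish => exact ⟨h, by constructor <;> simp [Cmd.out]⟩
  | seq c d ihc ihd =>
    refine vc_mono (c := c) (ihc h) fun t s1 h1 => vc_mono (ihd h1.1) fun t' s2 h2 => ⟨h2.1, ?_⟩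
    refine (h1.2.mono ?_ ?_ ?_).trans (h2.2.mono ?_ ?_ ?_) <;>
      simp +contextual [Cmd.wr, Cmd.wa, Cmd.out]
  | ite e c d ihc ihd =>
    refine ⟨h.1, fun h0 => vc_mono (ihc (h.2.1 h0)) fun t s1 h1 => ⟨h1.1, h1.2.mono ?_ ?_ ?_⟩,
      fun h0 => vc_mono (ihd (h.2.2 h0)) fun t s1 h1 => ⟨h1.1, h1.2.mono ?_ ?_ ?_⟩⟩ <;>
      simp +contextual [Cmd.wr, Cmd.wa, Cmd.out]
  | loop e c ih =>
    intro hb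
    obtain ⟨t, s', h1, h2, h3, h4⟩ := h hb
    exact ⟨t, s', h1, h2, h3, h4, h3⟩

/-- Use of a specification of a command inside a longer program. -/
theorem vc_call {μ : Mach} {c : Cmd R A} {P Q : ℕ → Config R A → Prop} {s : Config R A}
    (h : vc μ c P s) (hQ : ∀ t s', P t s' → Frame c s s' → Q t s') : vc μ c Q s :=
  vc_mono (vc_frame h) fun t s' h => hQ t s' h.1 h.2

theorem Expr.eval_le {M : ℕ} {s : Config R A} (hb : s.Bdd M) (e : Expr R A)
    (hc : e.lowConst = true) : e.eval s ≤ (M + 18) ^ e.size := by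
  have hM : 2 ≤ M + 18 := by omega
  have hpos : ∀ e : Expr R A, 1 ≤ e.size := by
    intro e; induction e <;> simp only [Expr.size] <;> omega
  induction e with
  | const k => simp [Expr.lowConst] at hc; simp [Expr.eval, Expr.size]; omega
  | reg x => simp [Expr.eval, Expr.size]; have := hb.1 x; omega
  | get a i ih =>
    have h1 := hb.2 a (i.eval s)
    calc _ ≤ (M + 18) ^ 1 := by simp only [Expr.eval, pow_one]; omega
      _ ≤ _ := Nat.pow_le_pow_right (by omega) (by simp [Expr.size])
  | op o e f ihe ihf =>
    simp only [Expr.lowConst, Bool.and_eq_true] at hc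
    have h1 := ihe hc.1
    have h2 := ihf hc.2
    have e1 : 2 ≤ (M + 18) ^ e.size :=
      hM.trans (Nat.le_self_pow (by have := hpos e; omega) _)
    have f1 : 2 ≤ (M + 18) ^ f.size :=
      hM.trans (Nat.le_self_pow (by have := hpos f; omega) _)
    simp only [Expr.eval, Expr.size, pow_add]
    cases o <;> simp only [Op.eval]
    · nlinarith
    · calc _ ≤ (M + 18) ^ e.size := by omega
        _ ≤ _ := Nat.le_mul_of_pos_right _ (by omega)
    · exact Nat.mul_le_mul h1 h2
    · split_ifs <;> nlinarith
    · split_ifs <;> nlinarith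

theorem Expr.eval_le_of_small {M : ℕ} {s : Config R A} (hM : 1 ≤ M) (hb : s.Bdd M) (e : Expr R A)
    (hs : e.Small M s) : e.eval s ≤ M := by
  induction e with
  | const k => exact hs
  | reg x => exact hb.1 x
  | get a i ih => exact hb.2 _ _
  | op o e f ihe ihf =>
    cases o <;> simp only [Expr.eval, Op.eval]
    · exact hs
    · have := ihe hs; omega
    · exact hs
    · split_ifs <;> omega
    · split_ifs <;> omega

theorem Expr.fits {μ : Mach} {s : Config R A} (hb : s.Bdd μ.M) (e : Expr R A)
    (hc : e.okay = true) (hi : e.Idx μ.M s) (K : List (Cmd R A)) :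
    e.Fits (s.withC K) μ.B (μ.M + 1) := by
  simp only [Expr.okay, Bool.and_eq_true, decide_eq_true_eq] at hc
  obtain ⟨hs, hc⟩ := hc
  have key : ∀ e : Expr R A, e.size ≤ 16 → e.lowConst = true → e.eval s < μ.B := by
    intro e h1 h2
    refine lt_of_le_of_lt ((Expr.eval_le hb e h2).trans ?_) μ.big
    exact Nat.pow_le_pow_right (by omega) h1
  have hpos : ∀ e : Expr R A, 1 ≤ e.size := by
    intro e; induction e <;> simp only [Expr.size] <;> omega
  induction e with
  | const k => exact key _ hs hc
  | reg x => exact key _ hs hc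
  | get a i ih =>
    have := key _ hs hc
    simp only [Expr.size] at hs
    simp only [Expr.lowConst] at hc
    refine ⟨ih hi.1 (by omega) hc, ?_, ?_⟩
    · have := Expr.eval_le_of_small μ.one_le hb i hi.2
      rw [Expr.eval_withC]; omega
    · rw [Expr.eval_withC]; exact this
  | op o e f ihe ihf =>
    have := key _ hs hc
    simp only [Expr.size] at hs
    simp only [Expr.lowConst, Bool.and_eq_true] at hc
    have := hpos e
    have := hpos f
    refine ⟨ihe hi.1 (by omega) hc.1, ihf hi.2 (by omega) hc.2, ?_⟩
    rw [Expr.eval_withC, Expr.eval_withC]; assumption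

theorem Config.Bdd.setR {M : ℕ} {s : Config R A} (h : s.Bdd M) {x : R} {v : ℕ} (hv : v ≤ M) :
    (s.setR x v).Bdd M := by
  refine ⟨fun y => ?_, h.2⟩
  rw [Config.setR_regs]; split_ifs
  · exact hv
  · exact h.1 y

theorem Config.Bdd.setA {M : ℕ} {s : Config R A} (h : s.Bdd M) {a : A} {i v : ℕ} (hv : v ≤ M) :
    (s.setA a i v).Bdd M := by
  refine ⟨h.1, fun b j => ?_⟩
  rw [Config.setA_mem]; split_ifs
  · rw [Function.update_apply]; split_ifs
    · exact hv
    · exact h.2 _ _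
  · exact h.2 _ _

/-- A command whose verification condition holds terminates, with the asserted outcome. -/
theorem vc_sound {μ : Mach} {c : Cmd R A} {Q : ℕ → Config R A → Prop} {s : Config R A}
    (hc : c.okay = true) (hb : s.Bdd μ.M) (h : vc μ c Q s) :
    ∃ t s', Runs μ.B (μ.M + 1) c s t s' ∧ s'.Bdd μ.M ∧ Q t s' := by
  induction c generalizing Q s with
  | assign x e =>
    refine ⟨1, _, fun K => Reaches.one (e.fits hb hc h.1 _) ?_,
      hb.setR (e.eval_le_of_small μ.one_le hb h.2.1), h.2.2⟩
    simp only [Config.step, Config.withC_control, Expr.eval_withC]; rfl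
  | store a i e =>
    simp only [Cmd.okay, Bool.and_eq_true] at hc
    refine ⟨1, _, fun K => Reaches.one ⟨i.fits hb hc.1 h.1 _, ?_, e.fits hb hc.2 h.2.2.1 _⟩ ?_,
      hb.setA (e.eval_le_of_small μ.one_le hb h.2.2.2.1), h.2.2.2.2⟩
    · have := i.eval_le_of_small μ.one_le hb h.2.1
      rw [Expr.eval_withC]; omega
    · simp only [Config.step, Config.withC_control, Expr.eval_withC]; rfl
  | emit e =>
    refine ⟨1, s.put (e.eval s), fun K => Reaches.one (e.fits hb hc h.1 _) ?_, hb, h.2⟩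
    simp only [Config.step, Config.withC_control, Expr.eval_withC]; rfl
  | finish => exact ⟨1, s.fin, fun K => Reaches.one trivial rfl, hb, h⟩
  | seq c d ihc ihd =>
    simp only [Cmd.okay, Bool.and_eq_true] at hc
    obtain ⟨t, s1, h1, hb1, h2⟩ := ihc hc.1 hb h
    obtain ⟨t', s2, h3, hb2, h4⟩ := ihd hc.2 hb1 h2
    refine ⟨_, s2, fun K => ?_, hb2, h4⟩
    have h0 : Reaches μ.B (μ.M + 1) (s.withC (.seq c d :: K)) 1 (s.withC (c :: d :: K)) :=
      Reaches.one trivial rfl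
    have := (h0.trans (h1 (d :: K))).trans (h3 K)
    rwa [show 1 + t + t' = t + t' + 1 by omega] at this
  | ite e c d ihc ihd =>
    simp only [Cmd.okay, Bool.and_eq_true] at hc
    by_cases h0 : e.eval s = 0
    · obtain ⟨t, s1, h1, hb1, h2⟩ := ihd hc.2 hb (h.2.2 h0)
      refine ⟨_, s1, fun K => ?_, hb1, h2⟩
      rw [Nat.add_comm t 1]
      refine Reaches.trans (Reaches.one (e.fits hb hc.1.1 h.1 _) ?_) (h1 K)
      simp only [Config.step, Config.withC_control, Expr.eval_withC, h0, if_true]; rfl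
    · obtain ⟨t, s1, h1, hb1, h2⟩ := ihc hc.1.2 hb (h.2.1 h0)
      refine ⟨_, s1, fun K => ?_, hb1, h2⟩
      rw [Nat.add_comm t 1]
      refine Reaches.trans (Reaches.one (e.fits hb hc.1.1 h.1 _) ?_) (h1 K)
      simp only [Config.step, Config.withC_control, Expr.eval_withC, h0, if_false]; rfl
  | loop e c ih =>
    obtain ⟨t, s', h1, h2, _, h4⟩ := h hb
    exact ⟨t, s', h1, h2, h4⟩

/-- The loop rule. The rank bounds both the number of iterations and the time: each iteration,
including the test, is paid for by the decrease of the rank. -/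
theorem vc_loop {μ : Mach} {e : Expr R A} {c : Cmd R A} {Q : ℕ → Config R A → Prop}
    {s : Config R A} (I : Config R A → Prop) (rank : Config R A → ℕ)
    (hok : (Cmd.loop e c).okay = true) (h0 : I s)
    (hI : ∀ s1, I s1 → Frame c s s1 → s1.Bdd μ.M → e.Idx μ.M s1 ∧
      (e.eval s1 ≠ 0 → vc μ c (fun t s' => I s' ∧ t + 1 + rank s' ≤ rank s1) s1))
    (hQ : ∀ t s', I s' → e.eval s' = 0 → t + rank s' ≤ rank s + 1 → Frame c s s' → Q t s') :
    vc μ (.loop e c) Q s := by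
  intro hb
  simp only [Cmd.okay, Bool.and_eq_true] at hok
  have key : ∀ N s1, rank s1 ≤ N → I s1 → Frame c s s1 → s1.Bdd μ.M →
      ∃ t s', Runs μ.B (μ.M + 1) (.loop e c) s1 t s' ∧ s'.Bdd μ.M ∧ Frame c s s' ∧ I s' ∧
        e.eval s' = 0 ∧ t + rank s' ≤ rank s1 + 1 := by
    intro N
    induction N with
    | zero =>
      intro s1 hr hi hf hb1
      obtain ⟨h1, h2⟩ := hI s1 hi hf hb1
      by_cases he : e.eval s1 = 0
      · refine ⟨1, s1, fun K => Reaches.one (e.fits hb1 hok.1 h1 _) ?_, hb1, hf, hi, he, by omega⟩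
        simp only [Config.step, Config.withC_control, Expr.eval_withC, he, if_true]; rfl
      · obtain ⟨t, s', -, -, -, h⟩ := vc_sound hok.2 hb1 (h2 he)
        omega
    | succ N ih =>
      intro s1 hr hi hf hb1
      obtain ⟨h1, h2⟩ := hI s1 hi hf hb1
      by_cases he : e.eval s1 = 0
      · refine ⟨1, s1, fun K => Reaches.one (e.fits hb1 hok.1 h1 _) ?_, hb1, hf, hi, he, by omega⟩
        simp only [Config.step, Config.withC_control, Expr.eval_withC, he, if_true]; rfl
      · obtain ⟨t, s2, hr2, hb2, ⟨hi2, ht2⟩, hf2⟩ := vc_sound hok.2 hb1 (vc_frame (h2 he))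
        obtain ⟨t', s3, hr3, hb3, hf3, hi3, he3, ht3⟩ :=
          ih s2 (by omega) hi2 (hf.trans hf2) hb2
        refine ⟨1 + t + t', s3, fun K => ?_, hb3, hf3, hi3, he3, by omega⟩
        refine Reaches.trans (Reaches.trans (Reaches.one (e.fits hb1 hok.1 h1 _) ?_)
          (hr2 (.loop e c :: K))) (hr3 K)
        simp only [Config.step, Config.withC_control, Expr.eval_withC, he, if_false]; rfl
  obtain ⟨t, s', h1, h2, h3, h4, h5, h6⟩ := key (rank s) s le_rfl h0 (Frame.refl _ _) hb
  exact ⟨t, s', h1, h2, h3.mono (fun _ h => h) (fun _ h => h) (fun h => h), hQ t s' h4 h5 h6 h3⟩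

end Machine

/-! ### Steiner trees as parent functions -/

section Trees

variable {E : ℕ → ℕ → Prop} {W : ℕ → Prop} {r : ℕ}

/-- Following the parent function `f` from `u` leads to the root. -/
def ToRoot (r : ℕ) (f : ℕ → ℕ) (u : ℕ) : Prop := ∃ k, f^[k] u = r

/-- `u` lies on the chain of ancestors of some terminal. -/
def Used (W : ℕ → Prop) (f : ℕ → ℕ) (u : ℕ) : Prop := ∃ w, W w ∧ ∃ k, f^[k] w = u

/-- Parent functions that represent minimal Steiner trees: rooted at the terminal `r`, the tree
consists of the ancestor chains of the terminals, and it is normalized to be the identity outside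
the tree. -/
structure Sol (E : ℕ → ℕ → Prop) (W : ℕ → Prop) (r : ℕ) (f : ℕ → ℕ) : Prop where
  root : f r = r
  toRoot : ∀ w, W w → ToRoot r f w
  adj : ∀ u, Used W f u → u ≠ r → E u (f u)
  unused : ∀ u, ¬ Used W f u → f u = u

/-- `u` can be connected to `T` by a path that avoids `P`. -/
inductive Av (E : ℕ → ℕ → Prop) (T P : ℕ → Prop) : ℕ → Prop
  | base {u : ℕ} : T u → Av E T P u
  | step {u v : ℕ} : ¬ P u → E u v → Av E T P v → Av E T P u

theorem Av.mono {T T' P P' : ℕ → Prop} {u : ℕ} (h : Av E T P u) (hT : ∀ x, T x → Av E T' P' x)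
    (hP : ∀ x, P' x → P x) : Av E T' P' u := by
  induction h with
  | base h => exact hT _ h
  | step h1 h2 _ ih => exact .step (fun h => h1 (hP _ h)) h2 ih

theorem iterate_root {f : ℕ → ℕ} (hr : f r = r) (k : ℕ) : f^[k] r = r :=
  Function.iterate_fixed hr k

theorem ToRoot.of_next {f : ℕ → ℕ} {u : ℕ} (h : ToRoot r f (f u)) : ToRoot r f u := by
  obtain ⟨k, hk⟩ := h
  exact ⟨k + 1, hk⟩

theorem ToRoot.iterate {f : ℕ → ℕ} {u : ℕ} (hr : f r = r) (h : ToRoot r f u) (i : ℕ) :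
    ToRoot r f (f^[i] u) := by
  obtain ⟨k, hk⟩ := h
  refine ⟨k, ?_⟩
  rw [← Function.iterate_add_apply, Nat.add_comm, Function.iterate_add_apply, hk, iterate_root hr]

theorem ToRoot.next {f : ℕ → ℕ} {u : ℕ} (hr : f r = r) (h : ToRoot r f u) :
    ToRoot r f (f u) := h.iterate hr 1

/-- A chain that leads to the root has no cycle other than the root itself. -/
theorem ToRoot.eq_root {f : ℕ → ℕ} {u : ℕ} (hr : f r = r) (h : ToRoot r f u) {c : ℕ}
    (hc : f^[c + 1] u = u) : u = r := by
  obtain ⟨k, hk⟩ := h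
  have h1 : f^[(c + 1) * k] u = u := by
    rw [Function.iterate_mul]; exact Function.iterate_fixed hc k
  have h2 : f^[(c + 1) * k] u = r := by
    rw [show (c + 1) * k = c * k + k by ring, Function.iterate_add_apply, hk, iterate_root hr]
  exact h1.symm.trans h2

theorem Used.terminal {f : ℕ → ℕ} {w : ℕ} (h : W w) : Used W f w := ⟨w, h, 0, rfl⟩

theorem Used.next {f : ℕ → ℕ} {u : ℕ} (h : Used W f u) : Used W f (f u) := by
  obtain ⟨w, hw, k, rfl⟩ := h
  exact ⟨w, hw, k + 1, Function.iterate_succ_apply' f k w⟩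

theorem Used.iterate {f : ℕ → ℕ} {u : ℕ} (h : Used W f u) (k : ℕ) : Used W f (f^[k] u) := by
  induction k with
  | zero => exact h
  | succ k ih => rw [Function.iterate_succ_apply']; exact ih.next

theorem Used.toRoot {f : ℕ → ℕ} (hr : f r = r) (hW : ∀ w, W w → ToRoot r f w) {u : ℕ}
    (h : Used W f u) : ToRoot r f u := by
  obtain ⟨w, hw, k, rfl⟩ := h
  exact (hW w hw).iterate hr k

open Classical in
/-- The normalization of a parent function: the identity off the ancestor chains of the
terminals. -/
noncomputable def prune (W : ℕ → Prop) (f : ℕ → ℕ) (u : ℕ) : ℕ := if Used W f u then f u else u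

theorem prune_used {f : ℕ → ℕ} {u : ℕ} (h : Used W f u) : prune W f u = f u := if_pos h

theorem iterate_congr_used {f g : ℕ → ℕ} (h : ∀ u, Used W f u → g u = f u) {w : ℕ} (hw : W w)
    (k : ℕ) : g^[k] w = f^[k] w := by
  induction k with
  | zero => rfl
  | succ k ih =>
    rw [Function.iterate_succ_apply', Function.iterate_succ_apply', ih]
    exact h _ ⟨w, hw, k, rfl⟩

theorem used_congr {f g : ℕ → ℕ} (h : ∀ w, W w → ∀ k, g^[k] w = f^[k] w) (u : ℕ) :
    Used W g u ↔ Used W f u := by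
  constructor
  · rintro ⟨w, hw, k, rfl⟩; exact ⟨w, hw, k, (h w hw k).symm⟩
  · rintro ⟨w, hw, k, rfl⟩; exact ⟨w, hw, k, h w hw k⟩

theorem used_prune {f : ℕ → ℕ} (u : ℕ) : Used W (prune W f) u ↔ Used W f u :=
  used_congr (fun _ hw k => iterate_congr_used (fun _ h => prune_used h) hw k) u

/-- A parent function along which the terminals reach the root gives a solution. -/
theorem sol_prune {f : ℕ → ℕ} (hr : f r = r) (hW : ∀ w, W w → ToRoot r f w)
    (hE : ∀ u, Used W f u → u ≠ r → E u (f u)) : Sol E W r (prune W f) where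
  root := by unfold prune; split_ifs <;> simp [hr]
  toRoot w hw := by
    obtain ⟨k, hk⟩ := hW w hw
    exact ⟨k, (iterate_congr_used (fun _ h => prune_used h) hw k).trans hk⟩
  adj u hu hur := by
    rw [used_prune] at hu
    rw [prune_used hu]; exact hE u hu hur
  unused u hu := by
    rw [used_prune] at hu
    exact if_neg hu

/-- A solution is determined by the ancestor chains of the terminals. -/
theorem Sol.eq_prune {g f : ℕ → ℕ} (hg : Sol E W r g)
    (h : ∀ w, W w → ∀ k, g^[k] w = f^[k] w) : g = prune W f := by
  funext u
  by_cases hu : Used W f u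
  · rw [prune_used hu]
    obtain ⟨w, hw, k, rfl⟩ := hu
    have := h w hw (k + 1)
    rwa [Function.iterate_succ_apply', Function.iterate_succ_apply', h w hw k] at this
  · rw [hg.unused u (fun h' => hu ((used_congr h u).1 h'))]
    exact (if_neg hu).symm

/-- If a solution follows a given chain that starts at a terminal, then its next step off the
chain leads to the root avoiding the chain. -/
theorem Sol.av {f : ℕ → ℕ} (hf : Sol E W r f) {T : ℕ → Prop} (hT : T r) {p : ℕ → ℕ} {j : ℕ}
    (h0 : W (p 0)) (hp : ∀ i < j, f (p i) = p (i + 1)) (hj : p j ≠ r) :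
    Av E T (fun u => ∃ i ≤ j, u = p i) (f (p j)) := by
  have hchain : ∀ i ≤ j, ∀ d, i + d ≤ j → f^[d] (p i) = p (i + d) := by
    intro i _ d hd
    induction d with
    | zero => rfl
    | succ d ih =>
      rw [Function.iterate_succ_apply', ih (by omega), hp _ (by omega)]; rfl
  have hU : Used W f (p j) := ⟨p 0, h0, j, by have := hchain 0 (by omega) j (by omega); simpa⟩
  have hR := hU.toRoot hf.root hf.toRoot
  have hoff : ∀ c, ∀ i ≤ j, f^[c + 1] (p j) ≠ p i := by
    intro c i hi h
    refine hj (hR.eq_root hf.root (c := (j - i) + c) ?_)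
    rw [show j - i + c + 1 = (j - i) + (c + 1) by ring, Function.iterate_add_apply, h,
      hchain i hi _ (by omega)]
    congr 1; omega
  have key : ∀ k c, f^[k] (f^[c + 1] (p j)) = r →
      Av E T (fun u => ∃ i ≤ j, u = p i) (f^[c + 1] (p j)) := by
    intro k
    induction k with
    | zero => intro c h; exact .base (by rw [Function.iterate_zero_apply] at h; rwa [h])
    | succ k ih =>
      intro c h
      by_cases hr : f^[c + 1] (p j) = r
      · exact .base (by rwa [hr])
      · have h1 := ih (c + 1) (by
          rw [Function.iterate_succ_apply] at h
          rw [Function.iterate_succ_apply' f (c + 1)]; exact h)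
        rw [Function.iterate_succ_apply' f (c + 1)] at h1
        refine .step ?_ (hf.adj _ (hU.iterate _) hr) h1
        rintro ⟨i, hi, h⟩; exact hoff c i hi h
  obtain ⟨k, hk⟩ := hR.next hf.root
  exact key k 0 hk

/-- `T` is the vertex set of a subtree that contains the root, with parent function `f`. -/
structure Closed (E : ℕ → ℕ → Prop) (r : ℕ) (f : ℕ → ℕ) (T : ℕ → Prop) : Prop where
  root : T r
  adj : ∀ u, T u → u ≠ r → E u (f u)
  next : ∀ u, T u → u ≠ r → T (f u)
  toRoot : ∀ u, T u → ToRoot r f u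

theorem Closed.iterate {f : ℕ → ℕ} {T : ℕ → Prop} (h : Closed E r f T) (hr : f r = r) {u : ℕ}
    (hu : T u) (k : ℕ) : T (f^[k] u) := by
  induction k with
  | zero => exact hu
  | succ k ih =>
    rw [Function.iterate_succ_apply']
    by_cases h' : f^[k] u = r
    · rw [h', hr]; exact h.root
    · exact h.next _ ih h'

theorem iterate_congr_closed {f g : ℕ → ℕ} {T : ℕ → Prop} (h : Closed E r f T) (hr : f r = r)
    (hfg : ∀ u, T u → g u = f u) {u : ℕ} (hu : T u) (k : ℕ) : g^[k] u = f^[k] u := by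
  induction k with
  | zero => rfl
  | succ k ih =>
    rw [Function.iterate_succ_apply', Function.iterate_succ_apply', ih]
    exact hfg _ (h.iterate hr hu k)

theorem Closed.congr {f g : ℕ → ℕ} {T T' : ℕ → Prop} (h : Closed E r f T) (hr : f r = r)
    (hfg : ∀ u, T u → g u = f u) (hT : ∀ u, T' u ↔ T u) : Closed E r g T' := by
  obtain rfl : T' = T := funext fun u => propext (hT u)
  refine ⟨h.root, fun u hu hur => ?_, fun u hu hur => ?_, fun u hu => ?_⟩
  · rw [hfg u hu]; exact h.adj u hu hur
  · rw [hfg u hu]; exact h.next u hu hur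
  · obtain ⟨k, hk⟩ := h.toRoot u hu
    exact ⟨k, (iterate_congr_closed h hr hfg hu k).trans hk⟩

/-- `F` is the parent function of a spanning tree of the component `Rd` of the root. -/
structure Spanning (E : ℕ → ℕ → Prop) (r : ℕ) (Rd : ℕ → Prop) (F : ℕ → ℕ) : Prop where
  root : F r = r
  closed : ∀ u v, Rd u → E u v → Rd v
  rank : ∃ rk : ℕ → ℕ, ∀ u, Rd u → u ≠ r → E u (F u) ∧ rk (F u) < rk u

/-- Outside a subtree at the root any spanning tree can be used to complete it. -/
theorem Closed.spanning {f F : ℕ → ℕ} {T Rd : ℕ → Prop} (h : Closed E r f T)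
    (hF : Spanning E r Rd F) (hfF : ∀ u, ¬ T u → f u = F u) :
    ∀ u, Rd u → ToRoot r f u ∧ (u ≠ r → E u (f u)) := by
  obtain ⟨rk, hrk⟩ := hF.rank
  have key : ∀ N u, rk u ≤ N → Rd u → ToRoot r f u := by
    intro N
    induction N with
    | zero =>
      intro u hu hR
      by_cases hT : T u
      · exact h.toRoot u hT
      · have hur : u ≠ r := fun e => hT (e ▸ h.root)
        have := (hrk u hR hur).2
        omega
    | succ N ih =>
      intro u hu hR
      by_cases hT : T u
      · exact h.toRoot u hT
      · have hur : u ≠ r := fun e => hT (e ▸ h.root)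
        obtain ⟨h1, h2⟩ := hrk u hR hur
        refine ToRoot.of_next ?_
        rw [hfF u hT]
        exact ih _ (by omega) (hF.closed _ _ hR h1)
  intro u hu
  refine ⟨key _ u le_rfl hu, fun hur => ?_⟩
  by_cases hT : T u
  · exact h.adj u hT hur
  · rw [hfF u hT]; exact (hrk u hu hur).1

/-- Some vertex on the chain from the terminal `w` to the subtree `T` could continue to `T` by
another edge, avoiding the earlier vertices of the chain. -/
def Alt (E : ℕ → ℕ → Prop) (T : ℕ → Prop) (f : ℕ → ℕ) (w : ℕ) : Prop :=
  ∃ k u, (∀ i ≤ k, ¬ T (f^[i] w)) ∧ E (f^[k] w) u ∧ u ≠ f (f^[k] w) ∧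
    Av E T (fun z => ∃ i ≤ k, z = f^[i] w) u

/-- Without alternatives on the chains of terminals, a solution that contains the subtree `T` is
determined. -/
theorem Sol.eq_prune_of_not_alt {g f : ℕ → ℕ} {T : ℕ → Prop} (hg : Sol E W r g)
    (hT : Closed E r f T) (hr : f r = r) (hfg : ∀ u, T u → g u = f u)
    (h : ∀ w, W w → ¬ Alt E T f w) : g = prune W f := by
  refine hg.eq_prune fun w hw k => ?_
  have key : ∀ k, ∀ i ≤ k, g^[i] w = f^[i] w := by
    intro k
    induction k with
    | zero => intro i hi; obtain rfl : i = 0 := by omega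
              rfl
    | succ k ih =>
      intro i hi
      rcases Nat.lt_or_eq_of_le hi with hi | rfl
      · exact ih i (by omega)
      · rw [Function.iterate_succ_apply', Function.iterate_succ_apply', ih k le_rfl]
        by_cases hx : T (f^[k] w)
        · exact hfg _ hx
        · by_contra hne
          refine h w hw ⟨k, g (f^[k] w), fun i hi hTi => hx ?_, hg.adj _ ?_ ?_, hne, ?_⟩
          · have := hT.iterate hr hTi (k - i)
            rwa [← Function.iterate_add_apply, Nat.sub_add_cancel hi] at this
          · exact ⟨w, hw, k, ih k le_rfl⟩
          · exact fun e => hx (e ▸ hT.root)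
          · refine hg.av hT.root (p := fun i => f^[i] w) hw (fun i hi => ?_)
              fun e => hx (e ▸ hT.root)
            have := ih (i + 1) (by omega)
            rwa [Function.iterate_succ_apply', ih i (by omega)] at this
  exact key k k le_rfl

/-! ### Labels: testing whether a completion is unique -/

/-- Every vertex of the component carries the label `x + 2` of the vertex `x` of the current tree
(where the subtree `T` counts as the single vertex `r`) from which a graph search reached it;
`que` is the order of discovery and `np` the search parent. -/
structure Labelled (E : ℕ → ℕ → Prop) (W : ℕ → Prop) (r : ℕ) (f : ℕ → ℕ) (T : ℕ → Prop)
    (lab que np : ℕ → ℕ) (tail : ℕ) : Prop where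
  ofT : ∀ u, T u → lab u = r + 2
  ofUsed : ∀ u, Used W f u → ¬ T u → lab u = u + 2
  mem : ∀ u, 2 ≤ lab u ↔ ∃ i < tail, que i = u
  closed : ∀ u v, 2 ≤ lab u → E u v → 2 ≤ lab v
  src : ∀ i < tail, (T (que i) ∨ Used W f (que i)) ∨ (¬ T (que i) ∧ ¬ Used W f (que i)) ∧
    ∃ i' < i, np (que i) = que i' ∧ E (que i') (que i) ∧ lab (que i) = lab (que i')

/-- An edge outside the current tree that joins vertices with different labels. -/
def Cross (E : ℕ → ℕ → Prop) (f lab : ℕ → ℕ) (a b : ℕ) : Prop :=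
  2 ≤ lab a ∧ E a b ∧ lab a ≠ lab b ∧ ¬ (lab a = a + 2 ∧ f a = b) ∧ ¬ (lab b = b + 2 ∧ f b = a)

variable {f lab que np : ℕ → ℕ} {T : ℕ → Prop} {tail : ℕ}

theorem Labelled.label_src (h : Labelled E W r f T lab que np tail) {u : ℕ}
    (hu : 2 ≤ lab u) :
    ∃ x, lab u = x + 2 ∧ (x = r ∨ (Used W f x ∧ ¬ T x)) := by
  obtain ⟨i, hi, rfl⟩ := (h.mem u).1 hu
  induction i using Nat.strong_induction_on with
  | _ i ih =>
    rcases h.src i hi with hs | ⟨-, i', hi', -, -, h3⟩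
    · by_cases hTi : T (que i)
      · exact ⟨r, h.ofT _ hTi, .inl rfl⟩
      · have := hs.resolve_left hTi
        exact ⟨_, h.ofUsed _ this hTi, .inr ⟨this, hTi⟩⟩
    · rw [h3] at hu ⊢
      exact ih i' hi' (by omega) hu

/-- If there is no crossing edge, the edges of the tree are bridges of the contracted graph. -/
theorem Labelled.not_alt (h : Labelled E W r f T lab que np tail) (hT : Closed E r f T)
    (hr : f r = r) (hno : ∀ a b, ¬ Cross E f lab a b) {w : ℕ}
    (hw : W w) : ¬ Alt E T f w := by
  rintro ⟨k, u, hk, hxu, hux, hav⟩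
  set x := f^[k] w with hx
  have hxT : ¬ T x := hk k le_rfl
  have hxU : Used W f x := ⟨w, hw, k, rfl⟩
  have hxr : x ≠ r := fun e => hxT (e ▸ hT.root)
  -- `D` is the part of the graph that the tree edge above `x` separates from the root.
  let D : ℕ → Prop := fun z => 2 ≤ lab z ∧ ∃ i, f^[i] (lab z - 2) = x
  have hxD : D x := by
    have := h.ofUsed x hxU hxT
    exact ⟨by omega, 0, by simp [this]⟩
  have hTD : ∀ z, T z → ¬ D z := by
    rintro z hz ⟨-, i, hi⟩
    rw [h.ofT z hz] at hi
    simp only [Nat.add_sub_cancel, iterate_root hr] at hi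
    exact hxr hi.symm
  have hcut : ∀ z z', D z → ¬ D z' → E z z' → z = x ∧ z' = f x := by
    rintro z z' ⟨hz, i, hi⟩ hz' he
    have hz2 : 2 ≤ lab z' := h.closed _ _ hz he
    have hne : lab z ≠ lab z' := fun e => hz' ⟨hz2, i, by rwa [← e]⟩
    by_contra hcon
    refine hno z z' ⟨hz, he, hne, ?_, ?_⟩
    · rintro ⟨h1, rfl⟩
      rw [h1, Nat.add_sub_cancel] at hi
      cases i with
      | zero => exact hcon ⟨hi, by rw [← hi]; rfl⟩
      | succ i =>
        rw [Function.iterate_succ_apply] at hi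
        by_cases hTz : T (f z)
        · exact hxT (hi ▸ hT.iterate hr hTz i)
        · obtain ⟨y, hy, hy'⟩ := h.label_src hz
          have hyz : y = z := by omega
          subst hyz
          rcases hy' with rfl | hy'
          · rw [hr] at hTz; exact hTz hT.root
          · exact hz' ⟨hz2, i, by rw [h.ofUsed _ hy'.1.next hTz, Nat.add_sub_cancel]; exact hi⟩
    · rintro ⟨h1, rfl⟩
      obtain ⟨y, hy, hy'⟩ := h.label_src hz2
      have hyz : y = z' := by omega
      subst hyz
      have hTz : ¬ T (f y) := fun hTz => hTD _ hTz ⟨hz, i, hi⟩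
      rcases hy' with rfl | hy'
      · rw [hr] at hTz; exact hTz hT.root
      · rw [h.ofUsed _ hy'.1.next hTz, Nat.add_sub_cancel] at hi
        exact hz' ⟨hz2, i + 1, by rw [h1, Nat.add_sub_cancel]; exact hi⟩
  have key : ∀ z, Av E T (fun z => ∃ i ≤ k, z = f^[i] w) z → ¬ D z := by
    intro z hz
    induction hz with
    | base hz => exact hTD _ hz
    | step h1 h2 _ ih =>
      intro hD
      exact h1 ⟨k, le_rfl, (hcut _ _ hD ih h2).1⟩
  exact hux (hcut x u hxD (key u hav) hxu).2

/-- A crossing edge gives an alternative on the chain of any terminal below one of its labels, as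
long as this label is not an ancestor of the other one. -/
theorem Labelled.alt (h : Labelled E W r f T lab que np tail) (hT : Closed E r f T)
    (hr : f r = r) (hE : ∀ u v, E u v → E v u)
    (hadj : ∀ u, Used W f u → u ≠ r → E u (f u))
    (hroot : ∀ u, Used W f u → ToRoot r f u) {a b x y : ℕ}
    (hab : Cross E f lab a b) (hx : lab a = x + 2) (hy : lab b = y + 2)
    (hxT : ¬ T x) (hxy : ∀ i, f^[i] y ≠ x) {w k : ℕ} (hw : W w) (hk : f^[k] w = x) :
    Alt E T f w := by
  have hpre : ∀ i ≤ k, ¬ T (f^[i] w) := by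
    intro i hi hTi
    have := hT.iterate hr hTi (k - i)
    rw [← Function.iterate_add_apply, Nat.sub_add_cancel hi, hk] at this
    exact hxT this
  have hPx : ∀ i ≤ k, ∃ j, f^[j] (f^[i] w) = x := fun i hi =>
    ⟨k - i, by rw [← Function.iterate_add_apply, Nat.sub_add_cancel hi, hk]⟩
  set P : ℕ → Prop := fun z => ∃ i ≤ k, z = f^[i] w with hP
  have hPU : ∀ z, P z → Used W f z := by rintro z ⟨i, -, rfl⟩; exact ⟨w, hw, i, rfl⟩
  have hxU : Used W f x := ⟨w, hw, k, hk⟩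
  have hxr : x ≠ r := fun e => hxT (e ▸ hT.root)
  -- tree vertices that are not below `x` reach `T` along the tree
  have h1 : ∀ c z, Used W f z → (∀ i, f^[i] z ≠ x) → f^[c] z = r → Av E T P z := by
    intro c
    induction c with
    | zero =>
      intro z _ _ hz
      exact .base (by rw [Function.iterate_zero_apply] at hz; exact hz ▸ hT.root)
    | succ c ih =>
      intro z hz hzx hc
      by_cases hzr : z = r
      · exact .base (hzr ▸ hT.root)
      · refine .step ?_ (hadj z hz hzr) (ih (f z) hz.next (fun i => hzx (i + 1)) hc)
        rintro ⟨i, hi, rfl⟩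
        obtain ⟨j, hj⟩ := hPx i hi
        exact hzx j hj
  have hb2 : 2 ≤ lab b := by omega
  have hyAv : ∀ z, lab z = y + 2 → (T z ∨ Used W f z) → Av E T P z := by
    intro z hz hs
    by_cases hTz : T z
    · exact .base hTz
    · have hU := hs.resolve_left hTz
      have h2 := h.ofUsed z hU hTz
      have hzy : z = y := by omega
      subst hzy
      obtain ⟨c, hc⟩ := hroot z hU
      exact h1 c z hU hxy hc
  -- the region of `y` reaches `T`
  have h2 : ∀ i < tail, lab (que i) = y + 2 → Av E T P (que i) := by
    intro i
    induction i using Nat.strong_induction_on with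
    | _ i ih =>
      intro hi hl
      rcases h.src i hi with hs | ⟨⟨hs1, hs2⟩, i', hi', -, he, h3⟩
      · exact hyAv _ hl hs
      · exact .step (fun hp => hs2 (hPU _ hp)) (hE _ _ he) (ih i' hi' (by omega) (by omega))
  obtain ⟨j, hj, rfl⟩ := (h.mem b).1 hb2
  have hbAv := h2 j hj hy
  -- follow the region of `x` back from `a`
  have h3 : ∀ i < tail, lab (que i) = x + 2 → ∀ b', Av E T P b' → E (que i) b' →
      (que i = x → b' ≠ f x) → ∃ u, E x u ∧ u ≠ f x ∧ Av E T P u := by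
    intro i
    induction i using Nat.strong_induction_on with
    | _ i ih =>
      intro hi hl b' hb' he hne
      rcases h.src i hi with hs | ⟨⟨hs1, hs2⟩, i', hi', -, he', h3⟩
      · by_cases hTi : T (que i)
        · have := h.ofT _ hTi; omega
        · have := h.ofUsed _ (hs.resolve_left hTi) hTi
          have hix : que i = x := by omega
          exact ⟨b', hix ▸ he, hne hix, hb'⟩
      · refine ih i' hi' (by omega) (by omega) (que i)
          (.step (fun hp => hs2 (hPU _ hp)) he hb') he' fun _ e => ?_
        exact hs2 (e ▸ hxU.next)
  obtain ⟨i, hi, rfl⟩ := (h.mem a).1 hab.1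
  obtain ⟨u, hu1, hu2, hu3⟩ := h3 i hi hx _ hbAv hab.2.1 (by
    intro e hcon
    exact hab.2.2.2.1 ⟨by rw [hx, e], by rw [e]; exact hcon.symm⟩)
  exact ⟨k, u, hpre, by rwa [hk], by rwa [hk], hu3⟩

end Trees

/-! ### The program -/

/-- Registers. -/
inductive Reg where
  | n | k | base | tb | root | rl | len | head | tail | x | j | e | y | i | t | hi | z | q
  | w | found | a | b | s | j0 | v | fl | u | ok | cont | skip
  deriving DecidableEq

/-- Arrays. `inp` is the input. `ord` (of length `len`) is the stack of decided vertices, `pos` its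
indicator, `seg` the index at which the segment of a vertex starts. `fp` is the parent function of
the current spanning tree, `f0` that of the initial one. `exc` marks the arcs that are excluded,
`fB` and `fA` the two kinds of pending branches. The arrays `lab`, `que`, `np`, `wit` belong to
graph searches: label, queue, search parent, and a terminal below a tree vertex. -/
inductive Arr where
  | inp | f0 | fp | lab | que | np | wit | ord | pos | seg | exc | fB | fA
  deriving DecidableEq

instance : Fintype Reg where
  elems := {.n, .k, .base, .tb, .root, .rl, .len, .head, .tail, .x, .j, .e, .y, .i, .t, .hi, .z,
    .q, .w, .found, .a, .b, .s, .j0, .v, .fl, .u, .ok, .cont, .skip}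
  complete := by rintro ⟨⟩ <;> decide

instance : Fintype Arr where
  elems := {.inp, .f0, .fp, .lab, .que, .np, .wit, .ord, .pos, .seg, .exc, .fB, .fA}
  complete := by rintro ⟨⟩ <;> decide

/-- Expressions of the program. -/
abbrev Ex := Expr Reg Arr
/-- Commands of the program. -/
abbrev Cm := Cmd Reg Arr
/-- Configurations of the program. -/
abbrev Cf := Config Reg Arr

local infixr:60 " ;; " => Cmd.seq
local infix:65 " ≔ " => Cmd.assign
local infixl:75 " ∔ " => Expr.op Op.add
local infixl:75 " ∸ " => Expr.op Op.sub
local infixl:78 " ⊠ " => Expr.op Op.mul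
local infix:72 " ≺ " => Expr.op Op.lt
local infix:72 " ≗ " => Expr.op Op.eq

/-- A constant. -/
abbrev cst (k : ℕ) : Ex := Expr.const k
/-- The content of a register. -/
abbrev rg (x : Reg) : Ex := Expr.reg x
/-- The content of an array cell. -/
abbrev ar (a : Arr) (i : Ex) : Ex := Expr.get a i

/-- Increment a register. -/
def inc (x : Reg) : Cm := x ≔ rg x ∔ cst 1

/-- Run `c` on every arc `j` that leaves the vertex in the register `x`, its head being in `y`. -/
def forArcs (x : Reg) (c : Cm) : Cm :=
  .j ≔ ar .inp (cst 3 ∔ rg x) ;; .e ≔ ar .inp (cst 4 ∔ rg x) ;;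
  .loop (rg .j ≺ rg .e) (.y ≔ ar .inp (rg .base ∔ rg .j) ;; c ;; inc .j)

/-- Start a search from the first `t` vertices of the stack, with those from `t` to `hi` blocked. -/
def initSearch : Cm :=
  .i ≔ cst 0 ;;
  .loop (rg .i ≺ rg .n) (.store .lab (rg .i) (cst 0) ;; inc .i) ;;
  .i ≔ cst 0 ;;
  .loop (rg .i ≺ rg .t)
    (.store .lab (ar .ord (rg .i)) (rg .rl) ;; .store .que (rg .i) (ar .ord (rg .i)) ;; inc .i) ;;
  .loop (rg .i ≺ rg .hi) (.store .lab (ar .ord (rg .i)) (cst 1) ;; inc .i) ;;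
  .head ≔ cst 0 ;; .tail ≔ rg .t

/-- Breadth-first search: process the queue; labels are inherited. -/
def explore : Cm :=
  .loop (rg .head ≺ rg .tail)
    (.x ≔ ar .que (rg .head) ;; inc .head ;;
     forArcs .x (.ite (ar .lab (rg .y) ≗ cst 0)
      (.store .lab (rg .y) (ar .lab (rg .x)) ;; .store .np (rg .y) (rg .x) ;;
       .store .que (rg .tail) (rg .y) ;; inc .tail)
      (.skip ≔ cst 0)))

/-- Label the vertices of the current tree and enter them into the queue, the first `t` vertices
of the stack counting as one. -/
def markTree : Cm :=
  initSearch ;; .i ≔ cst 0 ;;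
  .loop (rg .i ≺ rg .k)
    (.q ≔ ar .inp (rg .tb ∔ rg .i) ;; .z ≔ rg .q ;;
     .loop (ar .lab (rg .z) ≗ cst 0)
      (.store .lab (rg .z) (rg .z ∔ cst 2) ;; .store .wit (rg .z) (rg .q) ;;
       .store .que (rg .tail) (rg .z) ;; inc .tail ;; .z ≔ ar .fp (rg .z)) ;;
     inc .i)

/-- Output the current tree. -/
def output : Cm :=
  .t ≔ cst 1 ;; .hi ≔ cst 1 ;; markTree ;; .i ≔ cst 1 ;;
  .loop (rg .i ≺ rg .tail)
    (.emit (ar .que (rg .i)) ;; .emit (ar .fp (ar .que (rg .i))) ;; inc .i) ;;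
  .finish

/-- Look for an edge that joins different labels. -/
def findCross : Cm :=
  .found ≔ cst 0 ;; .i ≔ cst 0 ;;
  .loop (rg .i ≺ rg .n)
    (.ite (cst 1 ≺ ar .lab (rg .i))
      (forArcs .i
        (.ite (ar .lab (rg .i) ≗ ar .lab (rg .y)) (.skip ≔ cst 0)
          (.ite ((ar .lab (rg .i) ≗ rg .i ∔ cst 2) ⊠ (ar .fp (rg .i) ≗ rg .y)) (.skip ≔ cst 0)
            (.ite ((ar .lab (rg .y) ≗ rg .y ∔ cst 2) ⊠ (ar .fp (rg .y) ≗ rg .i)) (.skip ≔ cst 0)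
              (.found ≔ cst 1 ;; .a ≔ ar .lab (rg .i) ∸ cst 2 ;;
               .b ≔ ar .lab (rg .y) ∸ cst 2)))))
      (.skip ≔ cst 0) ;;
     inc .i)

/-- Of the two labels of the crossing edge, choose one that is not an ancestor of the other one,
and put a terminal below it into `w`. -/
def choose : Cm :=
  .z ≔ rg .a ;;
  .loop ((ar .pos (rg .z) ≗ cst 0) ⊠ ((rg .z ≗ rg .b) ≗ cst 0)) (.z ≔ ar .fp (rg .z)) ;;
  .ite ((ar .pos (rg .z) ≗ cst 0) ∔ (rg .b ≗ rg .root))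
    (.w ≔ ar .wit (rg .a)) (.w ≔ ar .wit (rg .b))

/-- Test whether the subtree on the stack has more than one completion; if so, put a terminal that
can be connected to it in several ways into `w`. -/
def test : Cm :=
  .t ≔ rg .len ;; .hi ≔ rg .len ;; markTree ;; explore ;; findCross ;;
  .ite (rg .found) choose (.skip ≔ cst 0)

/-- Push the chain of `w` in the current tree onto the stack, as part of the segment `s`. -/
def pushPath : Cm :=
  .z ≔ rg .w ;;
  .loop (ar .pos (rg .z) ≗ cst 0)
    (.store .ord (rg .len) (rg .z) ;; .store .pos (rg .z) (cst 1) ;;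
     .store .seg (rg .z) (rg .s) ;; inc .len ;; .z ≔ ar .fp (rg .z))

/-- Determine for which positions from `j0` on, all in the last segment `s`, the path could
continue differently, and flag them. -/
def setFlags : Cm :=
  .t ≔ rg .s ;; .hi ≔ rg .len ;; initSearch ;; explore ;; .i ≔ rg .len ;;
  .loop (rg .j0 ≺ rg .i)
    (.i ≔ rg .i ∸ cst 1 ;; .v ≔ ar .ord (rg .i) ;; .fl ≔ cst 0 ;;
     forArcs .v
      (.ite (((ar .exc (rg .j) ≗ cst 0) ⊠ ((rg .y ≗ ar .fp (rg .v)) ≗ cst 0)) ⊠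
          (cst 1 ≺ ar .lab (rg .y)))
        (.fl ≔ cst 1) (.skip ≔ cst 0)) ;;
     .store .fB (rg .v) (rg .fl) ;; .store .lab (rg .v) (rg .rl) ;;
     .store .que (rg .tail) (rg .v) ;; inc .tail ;; explore)

/-- Pop the top of the stack, and reset what belongs to it. -/
def undoTop : Cm :=
  .u ≔ ar .ord (rg .len ∸ cst 1) ;; .store .pos (rg .u) (cst 0) ;;
  .store .fp (rg .u) (ar .f0 (rg .u)) ;;
  forArcs .u (.store .exc (rg .j) (cst 0)) ;; .len ≔ rg .len ∸ cst 1

/-- Pop the stack until its top has a pending branch. -/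
def undo : Cm :=
  .loop ((cst 1 ≺ rg .len) ⊠ (ar .fB (ar .ord (rg .len ∸ cst 1)) ≗ cst 0) ⊠
      (ar .fA (ar .ord (rg .len ∸ cst 1)) ≗ cst 0))
    undoTop

/-- Resume the exploration of the solutions that contain the initial path of the segment whose
first vertex is on top. -/
def popA : Cm :=
  .w ≔ ar .ord (rg .len ∸ cst 1) ;; .store .fA (rg .w) (cst 0) ;; undoTop ;;
  .s ≔ rg .len ;; pushPath

/-- Exclude the arc that leaves the top vertex, and complete the segment in another way. -/
def reroute : Cm :=
  .v ≔ ar .ord (rg .len ∸ cst 1) ;; .s ≔ ar .seg (rg .v) ;;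
  forArcs .v (.ite (rg .y ≗ ar .fp (rg .v)) (.store .exc (rg .j) (cst 1)) (.skip ≔ cst 0)) ;;
  .t ≔ rg .s ;; .hi ≔ rg .len ;; initSearch ;; explore ;;
  forArcs .v
    (.ite ((ar .exc (rg .j) ≗ cst 0) ⊠ (cst 1 ≺ ar .lab (rg .y)))
      (.store .fp (rg .v) (rg .y)) (.skip ≔ cst 0)) ;;
  .store .pos (rg .v) (cst 0) ;; .len ≔ rg .len ∸ cst 1 ;; .j0 ≔ rg .len ;;
  .z ≔ ar .fp (rg .v) ;;
  .loop (ar .pos (rg .z) ≗ cst 0)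
    (.store .fp (rg .z) (ar .np (rg .z)) ;; .z ≔ ar .fp (rg .z)) ;;
  .w ≔ rg .v ;; pushPath

/-- Branch on the top vertex. -/
def popB : Cm := reroute ;; output ;; setFlags

/-- Branch on the solutions that contain the subtree on the stack. -/
def expand : Cm :=
  test ;;
  .ite (rg .found)
    (.s ≔ rg .len ;; .j0 ≔ rg .len ;; pushPath ;; setFlags ;; test ;;
     .ite (rg .found) (.store .fA (ar .ord (rg .s)) (cst 1)) (.skip ≔ cst 0))
    (.skip ≔ cst 0)

/-- One round of the enumeration; it outputs one solution, or ends the enumeration. -/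
def round : Cm :=
  undo ;;
  .ite (cst 1 ≺ rg .len)
    (.ite (ar .fB (ar .ord (rg .len ∸ cst 1)) ≗ cst 0) (popA ;; expand ;; undo) (.skip ≔ cst 0) ;;
     popB ;; expand)
    (.cont ≔ cst 0)

/-- Read the parameters of the input, and search the graph from the first terminal. -/
def startSearch : Cm :=
  .n ≔ ar .inp (cst 0) ;; .k ≔ ar .inp (cst 2) ;; .base ≔ rg .n ∔ cst 4 ;;
  .tb ≔ rg .base ∔ ar .inp (rg .n ∔ cst 3) ;; .root ≔ ar .inp (rg .tb) ;;
  .rl ≔ rg .root ∔ cst 2 ;; .store .ord (cst 0) (rg .root) ;; .store .pos (rg .root) (cst 1) ;;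
  .len ≔ cst 1 ;; .t ≔ cst 1 ;; .hi ≔ cst 1 ;;
  initSearch ;; explore

/-- Use the search tree as the initial and as the current tree. -/
def copyTree : Cm :=
  .i ≔ cst 0 ;;
  .loop (rg .i ≺ rg .n)
    (.store .f0 (rg .i) (ar .np (rg .i)) ;; .store .fp (rg .i) (ar .np (rg .i)) ;; inc .i) ;;
  .store .f0 (rg .root) (rg .root) ;; .store .fp (rg .root) (rg .root)

/-- Test whether the search has reached all terminals. -/
def checkTerminals : Cm :=
  .ok ≔ cst 1 ;; .i ≔ cst 0 ;;
  .loop (rg .i ≺ rg .k)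
    (.ite (ar .lab (ar .inp (rg .tb ∔ rg .i)) ≗ cst 0) (.ok ≔ cst 0) (.skip ≔ cst 0) ;; inc .i)

/-- Compute the initial tree. -/
def setup : Cm := startSearch ;; copyTree ;; checkTerminals

/-- Output the first solution if there is any. Without terminals, this is the empty tree, and it
is the only one. -/
def start : Cm :=
  .ite (ar .inp (cst 2) ≗ cst 0) .finish
    (setup ;; .ite (rg .ok) (output ;; expand ;; .cont ≔ cst 1) (.skip ≔ cst 0))

/-- The enumeration algorithm. -/
def mainCmd : Cm := start ;; .loop (rg .cont) round

/-! ### The input in memory -/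

/-- An instance of the problem: a graph on `{0, …, n - 1}` by adjacency lists (the one of `u` holds
the entries of `adj` from `off u` to `off (u + 1)`), and a nonempty list of terminals. -/
structure Inst where
  n : ℕ
  k : ℕ
  off : ℕ → ℕ
  adj : ℕ → ℕ
  term : ℕ → ℕ
  off_zero : off 0 = 0
  off_le : ∀ u < n, off u ≤ off (u + 1)
  off_ge : ∀ u, n ≤ u → off (u + 1) = off u
  adj_lt : ∀ j < off n, adj j < n
  term_lt : ∀ i < k, term i < n
  k_le : k ≤ n
  k_pos : 0 < k
  symm' : ∀ u v, (u < n ∧ ∃ j, off u ≤ j ∧ j < off (u + 1) ∧ adj j = v) →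
    (v < n ∧ ∃ j, off v ≤ j ∧ j < off (v + 1) ∧ adj j = u)

namespace Inst

variable (I : Inst)

/-- Adjacency. -/
def E (u v : ℕ) : Prop := u < I.n ∧ ∃ j, I.off u ≤ j ∧ j < I.off (u + 1) ∧ I.adj j = v

/-- The set of terminals. -/
def W (w : ℕ) : Prop := ∃ i < I.k, I.term i = w

/-- The root of all trees, the first terminal. -/
def root : ℕ := I.term 0

/-- The length of an adjacency list. -/
def deg (u : ℕ) : ℕ := I.off (u + 1) - I.off u

theorem E_symm {u v : ℕ} (h : I.E u v) : I.E v u := I.symm' u v h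

theorem E_lt_left {u v : ℕ} (h : I.E u v) : u < I.n := h.1

theorem E_lt_right {u v : ℕ} (h : I.E u v) : v < I.n := (I.E_symm h).1

theorem root_W : I.W I.root := ⟨0, I.k_pos, rfl⟩

theorem W_lt {w : ℕ} (h : I.W w) : w < I.n := by
  obtain ⟨i, hi, rfl⟩ := h; exact I.term_lt i hi

theorem root_lt : I.root < I.n := I.W_lt I.root_W

theorem off_mono {u v : ℕ} (huv : u ≤ v) (hv : v ≤ I.n) : I.off u ≤ I.off v := by
  induction v with
  | zero => obtain rfl : u = 0 := by omega
            exact le_rfl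
  | succ v ih =>
    rcases Nat.lt_or_eq_of_le huv with h | rfl
    · exact (ih (by omega) (by omega)).trans (I.off_le v (by omega))
    · exact le_rfl

theorem sum_deg (u : ℕ) (hu : u ≤ I.n) :
    ∑ x ∈ Finset.range u, (I.deg x + 1) = I.off u + u := by
  induction u with
  | zero => simp [I.off_zero]
  | succ u ih =>
    rw [Finset.sum_range_succ, ih (by omega)]
    have := I.off_le u (by omega)
    simp only [deg]; omega

/-- The work for processing the first `h` vertices of a list. -/
def spent (que : ℕ → ℕ) (h : ℕ) : ℕ := ∑ i ∈ Finset.range h, (I.deg (que i) + 1)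

theorem spent_le {que : ℕ → ℕ} {h : ℕ} (hlt : ∀ i < h, que i < I.n)
    (hinj : ∀ i < h, ∀ j < h, que i = que j → i = j) : I.spent que h ≤ I.off I.n + I.n := by
  rw [← I.sum_deg I.n le_rfl, spent]
  rw [← Finset.sum_image (s := Finset.range h) (g := que) (f := fun x => I.deg x + 1)]
  · refine Finset.sum_le_sum_of_subset ?_
    intro x hx
    simp only [Finset.mem_image, Finset.mem_range] at hx ⊢
    obtain ⟨i, hi, rfl⟩ := hx
    exact hlt i hi
  · intro i hi j hj h
    simp only [Finset.coe_range, Set.mem_Iio] at hi hj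
    exact hinj i hi j hj h

theorem spent_congr {que que' : ℕ → ℕ} {h : ℕ} (hq : ∀ i < h, que' i = que i) :
    I.spent que' h = I.spent que h :=
  Finset.sum_congr rfl fun i hi => by rw [hq i (Finset.mem_range.1 hi)]

theorem spent_succ (que : ℕ → ℕ) (h : ℕ) :
    I.spent que (h + 1) = I.spent que h + (I.deg (que h) + 1) := Finset.sum_range_succ _ _

end Inst

/-- A list of distinct vertices has at most `n` entries. -/
theorem length_le_of_inj {n : ℕ} {que : ℕ → ℕ} {h : ℕ} (hlt : ∀ i < h, que i < n)
    (hinj : ∀ i < h, ∀ j < h, que i = que j → i = j) : h ≤ n := by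
  have := Finset.card_le_card_of_injOn (s := Finset.range h) (t := Finset.range n) que
    (fun i hi => by simpa using hlt i (by simpa using hi))
    (fun i hi j hj e => hinj i (by simpa using hi) j (by simpa using hj) e)
  simpa using this

/-- The input is in memory, its parameters are in their registers, and words are large enough. -/
structure Ctx (μ : Mach) (I : Inst) (s : Cf) : Prop where
  bound : 3 * I.n + I.off I.n + 20 ≤ μ.M
  n : s.regs .n = I.n
  k : s.regs .k = I.k
  base : s.regs .base = I.n + 4
  tb : s.regs .tb = I.n + 4 + I.off I.n
  root : s.regs .root = I.root
  rl : s.regs .rl = I.root + 2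
  off : ∀ i ≤ I.n, s.mem .inp (i + 3) = I.off i
  adj : ∀ j < I.off I.n, s.mem .inp (I.n + 4 + j) = I.adj j
  term : ∀ i < I.k, s.mem .inp (I.n + 4 + I.off I.n + i) = I.term i

/-- The registers that hold the parameters of the input. -/
def Reg.static : Reg → Bool
  | .n | .k | .base | .tb | .root | .rl => true
  | _ => false

theorem Ctx.congr {μ : Mach} {I : Inst} {s s' : Cf} (h : Ctx μ I s)
    (hr : ∀ x : Reg, x.static = true → s'.regs x = s.regs x) (hm : s'.mem .inp = s.mem .inp) :
    Ctx μ I s' := by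
  refine ⟨h.bound, ?_, ?_, ?_, ?_, ?_, ?_, ?_, ?_, ?_⟩
  · rw [hr _ rfl, h.n]
  · rw [hr _ rfl, h.k]
  · rw [hr _ rfl, h.base]
  · rw [hr _ rfl, h.tb]
  · rw [hr _ rfl, h.root]
  · rw [hr _ rfl, h.rl]
  · rw [hm]; exact h.off
  · rw [hm]; exact h.adj
  · rw [hm]; exact h.term

theorem Ctx.setR {μ : Mach} {I : Inst} {s : Cf} (h : Ctx μ I s) {x : Reg} {v : ℕ}
    (hx : x.static = false) : Ctx μ I (s.setR x v) :=
  h.congr (fun y hy => by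
    rw [Config.setR_regs, if_neg]; rintro rfl; simp [hx] at hy) rfl

theorem Ctx.setA {μ : Mach} {I : Inst} {s : Cf} (h : Ctx μ I s) {a : Arr} {i v : ℕ}
    (ha : a ≠ .inp) : Ctx μ I (s.setA a i v) :=
  h.congr (fun _ _ => rfl) (by rw [Config.setA_mem, if_neg ha.symm])

/-- The command leaves the input and its parameters alone. -/
def Cmd.keeps (c : Cm) : Bool :=
  !c.wr .n && !c.wr .k && !c.wr .base && !c.wr .tb && !c.wr .root && !c.wr .rl && !c.wa .inp

theorem Ctx.frame {μ : Mach} {I : Inst} {s s' : Cf} {c : Cm} (h : Ctx μ I s) (hf : Frame c s s')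
    (hc : c.keeps = true) : Ctx μ I s' := by
  simp only [Cmd.keeps, Bool.and_eq_true, Bool.not_eq_true'] at hc
  refine h.congr (fun x hx => hf.regs x ?_) (hf.mem _ hc.2)
  cases x <;> simp_all [Reg.static]

section

variable {μ : Mach} {I : Inst}

/-- Side conditions on the body of `forArcs`. -/
def arcOk (x : Reg) (c : Cm) : Bool :=
  !(forArcs .x c).wr x && (forArcs .x c).okay && !c.wr x && !c.wr .j && !c.wr .e && c.keeps &&
    decide (x ≠ .j) && decide (x ≠ .e) && decide (x ≠ .y)

/-- The rule for a loop over the arcs that leave a vertex. -/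
theorem vc_forArcs {x : Reg} {c : Cm} {s : Cf} {v K : ℕ} (Inv : ℕ → Cf → Prop)
    (hok : arcOk x c = true) (hx : x ≠ .y) (hc : Ctx μ I s) (hv : s.regs x = v) (hvn : v < I.n)
    (hset : ∀ j s1 r m, (r = .j ∨ r = .e ∨ r = .y) → Inv j s1 → Inv j (s1.setR r m))
    (h0 : Inv (I.off v) s)
    (hbody : ∀ j s1, I.off v ≤ j → j < I.off (v + 1) → Inv j s1 → Frame (forArcs x c) s s1 →
      Ctx μ I s1 → s1.regs x = v → s1.regs .j = j → s1.regs .y = I.adj j →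
      vc μ c (fun t s' => t ≤ K ∧ Inv (j + 1) s') s1) :
    vc μ (forArcs x c) (fun t s' => t ≤ (K + 5) * I.deg v + 5 ∧ Inv (I.off (v + 1)) s' ∧
      Frame (forArcs x c) s s' ∧ Ctx μ I s') s := by
  simp only [arcOk, Bool.and_eq_true, Bool.not_eq_true', decide_eq_true_eq] at hok
  obtain ⟨⟨⟨⟨⟨⟨⟨⟨hk1, hk2⟩, hcx⟩, hcj⟩, hce⟩, hck⟩, hxj⟩, hxe⟩, -⟩ := hok
  have hb := hc.bound
  have hlt : I.off (v + 1) ≤ I.off I.n := I.off_mono hvn le_rfl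
  have hle := I.off_le v hvn
  have hkeep : (forArcs x c).keeps = true := by
    simpa [Cmd.keeps, forArcs, Cmd.wr, Cmd.wa, inc] using hck
  suffices h : vc μ (forArcs x c) (fun t s' => t ≤ (K + 5) * I.deg v + 5 ∧
      Inv (I.off (v + 1)) s') s from
    vc_call h fun t s' h hf => ⟨h.1, h.2, hf, hc.frame hf hkeep⟩
  have hs0 : s.mem .inp (v + 3) = I.off v := hc.off v (by omega)
  have hs1 : s.mem .inp (v + 4) = I.off (v + 1) := hc.off (v + 1) (by omega)
  simp only [forArcs, vc, Expr.Idx, Expr.Small, Expr.eval, Op.eval, Config.setR_mem,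
    Config.setR_regs, hv, if_neg hxj, true_and, Nat.add_comm 3, Nat.add_comm 4, hs0, hs1]
  refine ⟨by omega, by omega, ?_⟩
  set s2 := (s.setR .j (I.off v)).setR .e (I.off (v + 1)) with hs2
  refine vc_loop (fun s' => (∃ j, s'.regs .j = j ∧ I.off v ≤ j ∧ j ≤ I.off (v + 1) ∧ Inv j s') ∧
      s'.regs .e = I.off (v + 1) ∧ s'.regs x = v ∧ Frame (forArcs x c) s s')
    (fun s' => (K + 5) * (I.off (v + 1) - s'.regs .j)) ?_ ?_ ?_ ?_
  · simp only [forArcs, Cmd.okay, Bool.and_eq_true] at hk2 ⊢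
    exact hk2.2.2
  · refine ⟨⟨I.off v, by simp [hs2], le_rfl, hle, hset _ _ _ _ (.inr (.inl rfl))
      (hset _ _ _ _ (.inl rfl) h0)⟩, by simp [hs2], ?_, ?_⟩
    · simp [hs2, hxj, hxe, hv]
    · constructor
      · intro r hr
        simp [forArcs, Cmd.wr] at hr
        simp [hs2, hr]
      all_goals simp [hs2]
  · rintro s1 ⟨⟨j, hj, hj1, hj2, hinv⟩, he, hxv, hf⟩ - hbd
    have hc1 := hc.frame hf hkeep
    refine ⟨by simp [Expr.Idx], fun hlt' => ?_⟩
    simp only [Expr.eval, Op.eval, hj, he, ne_eq, ite_eq_right_iff, Classical.not_imp] at hlt'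
    have hjlt := hlt'.1
    have hy : s1.mem .inp (I.n + 4 + j) = I.adj j := hc1.adj j (by omega)
    simp only [vc, Expr.Idx, Expr.Small, Expr.eval, Op.eval, hc1.base, hj, hy, true_and, inc]
    refine ⟨by omega, ?_⟩
    refine vc_call (hbody j (s1.setR .y (I.adj j)) hj1 hjlt (hset _ _ _ _ (.inr (.inr rfl)) hinv)
      ?_ (hc1.setR rfl) (by simp [hx, hxv]) (by simp [hj]) (by simp)) ?_
    · refine hf.trans ⟨fun r hr => ?_, fun _ _ => rfl, fun _ => rfl, fun _ => rfl⟩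
      simp [forArcs, Cmd.wr] at hr
      simp [hr]
    · rintro t s3 ⟨ht, hinv3⟩ hf3
      have e1 : s3.regs .j = j := by rw [hf3.regs _ hcj]; simp [hj]
      have e2 : s3.regs .e = I.off (v + 1) := by rw [hf3.regs _ hce]; simp [he]
      have e3 : s3.regs x = v := by rw [hf3.regs _ hcx]; simp [hxv, hx]
      refine ⟨by rw [e1]; omega, ⟨⟨j + 1, by simp [e1], by omega, by omega, ?_⟩, ?_, ?_,
        ?_⟩, ?_⟩
      · exact hset _ _ _ _ (.inl rfl) hinv3
      · simp [e2]
      · simp [e3, hxj]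
      · refine hf.trans ⟨fun r hr => ?_, fun a ha => ?_, fun ho => ?_, fun ho => ?_⟩
        · simp [forArcs, Cmd.wr, inc] at hr
          have := hf3.regs r hr.2.2.2.1
          simp [hr, this]
        · simp [forArcs, Cmd.wa, inc] at ha
          rw [Config.setR_mem, hf3.mem _ ha, Config.setR_mem]
        · simp [forArcs, Cmd.out, inc] at ho
          rw [Config.setR_current, hf3.cur ho, Config.setR_current]
        · simp [forArcs, Cmd.out, inc] at ho
          rw [Config.setR_solutions, hf3.sols ho, Config.setR_solutions]
      · simp only [Config.setR_regs, if_true, e1]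
        have : I.off (v + 1) - j = I.off (v + 1) - (j + 1) + 1 := by omega
        rw [this, Nat.mul_add]
        omega
  · rintro t s' ⟨⟨j, hj, hj1, hj2, hinv⟩, he, hxv, hf⟩ h0' ht -
    simp only [Expr.eval, Op.eval, hj, he, ite_eq_right_iff, one_ne_zero, imp_false, not_lt] at h0'
    obtain rfl : j = I.off (v + 1) := by omega
    refine ⟨?_, hinv⟩
    simp only [hj, Nat.sub_self, Nat.mul_zero, hs2, Config.setR_regs, if_true, reduceCtorEq,
      if_false] at ht
    simp only [Inst.deg]
    omega

end

/-! ### Graph search -/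

/-- A graph search started from the set `Src`: the vertices found so far are listed by `que`, and
carry a label that is at least `2`; the neighbours of the first `dn` of them have been looked at.
Label `0` means not found, and label `1` means blocked. -/
structure Search (I : Inst) (Src : ℕ → Prop) (lab que np : ℕ → ℕ) (dn tail : ℕ) : Prop where
  le : dn ≤ tail
  lt : ∀ i < tail, que i < I.n
  inj : ∀ i < tail, ∀ j < tail, que i = que j → i = j
  mem : ∀ u < I.n, 2 ≤ lab u ↔ ∃ i < tail, que i = u
  sub : ∀ u, Src u → 2 ≤ lab u
  done : ∀ i < dn, ∀ v, I.E (que i) v → lab v ≠ 0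
  src : ∀ i < tail, Src (que i) ∨ (¬ Src (que i) ∧
    ∃ i' < i, np (que i) = que i' ∧ I.E (que i') (que i) ∧ lab (que i) = lab (que i'))

/-- Search data at a later stage extend those at an earlier one. -/
structure Grown (lab que np : ℕ → ℕ) (tail : ℕ) (lab' que' np' : ℕ → ℕ) (tail' : ℕ) : Prop where
  lab_eq : ∀ u, lab u ≠ 0 → lab' u = lab u
  new : ∀ u, lab u = 0 → lab' u ≠ 1
  np_eq : ∀ u, lab u ≠ 0 → np' u = np u
  que_eq : ∀ i < tail, que' i = que i
  le : tail ≤ tail'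

theorem Grown.refl (lab que np : ℕ → ℕ) (tail : ℕ) : Grown lab que np tail lab que np tail :=
  ⟨fun _ _ => rfl, fun _ h => by omega, fun _ _ => rfl, fun _ _ => rfl, le_rfl⟩

theorem Grown.trans {lab que np lab' que' np' lab'' que'' np'' : ℕ → ℕ} {t t' t'' : ℕ}
    (h : Grown lab que np t lab' que' np' t') (h' : Grown lab' que' np' t' lab'' que'' np'' t'') :
    Grown lab que np t lab'' que'' np'' t'' := by
  refine ⟨fun u hu => ?_, fun u hu h1 => ?_, fun u hu => ?_, fun i hi => ?_, h.le.trans h'.le⟩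
  · rw [h'.lab_eq u (by rw [h.lab_eq u hu]; exact hu), h.lab_eq u hu]
  · by_cases h2 : lab' u = 0
    · exact h'.new u h2 h1
    · rw [h'.lab_eq u h2] at h1; exact h.new u hu h1
  · rw [h'.np_eq u (by rw [h.lab_eq u hu]; exact hu), h.np_eq u hu]
  · rw [h'.que_eq i (hi.trans_le h.le), h.que_eq i hi]

section

variable {μ : Mach} {I : Inst} {Src : ℕ → Prop} {lab que np : ℕ → ℕ} {dn tail : ℕ}

theorem Search.que_lab (h : Search I Src lab que np dn tail) {i : ℕ} (hi : i < tail) :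
    2 ≤ lab (que i) := (h.mem _ (h.lt i hi)).2 ⟨i, hi, rfl⟩

theorem Search.tail_le (h : Search I Src lab que np dn tail) : tail ≤ I.n :=
  length_le_of_inj h.lt h.inj

/-- Extend a search by a new vertex `y`, a neighbour of the vertex `que i`. -/
theorem Search.push (h : Search I Src lab que np dn tail) {i y : ℕ} (hi : i < tail)
    (hy : lab y = 0) (hE : I.E (que i) y) :
    Search I Src (Function.update lab y (lab (que i))) (Function.update que tail y)
      (Function.update np y (que i)) dn (tail + 1) ∧
    Grown lab que np tail (Function.update lab y (lab (que i))) (Function.update que tail y)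
      (Function.update np y (que i)) (tail + 1) := by
  have h2 := h.que_lab hi
  have hne : ∀ i' < tail, que i' ≠ y := fun i' hi' e => by
    have := h.que_lab hi'; rw [e] at this; omega
  have hlab : ∀ u, lab u ≠ 0 → Function.update lab y (lab (que i)) u = lab u := fun u hu =>
    Function.update_of_ne (by rintro rfl; exact hu hy) _ _
  have hque : ∀ i' < tail, Function.update que tail y i' = que i' := fun i' hi' =>
    Function.update_of_ne (by omega) _ _
  have hnz : ∀ u, lab u ≠ 0 → Function.update lab y (lab (que i)) u ≠ 0 := fun u hu => by
    rw [hlab u hu]; exact hu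
  constructor
  · refine ⟨h.le.trans (by omega), ?_, ?_, ?_, ?_, ?_, ?_⟩
    · intro i' hi'
      rcases Nat.lt_succ_iff_lt_or_eq.1 hi' with h' | rfl
      · rw [hque i' h']; exact h.lt i' h'
      · rw [Function.update_self]; exact I.E_lt_right hE
    · intro a ha b hb e
      rcases Nat.lt_succ_iff_lt_or_eq.1 ha with ha | rfl <;>
        rcases Nat.lt_succ_iff_lt_or_eq.1 hb with hb | rfl
      · rw [hque a ha, hque b hb] at e; exact h.inj a ha b hb e
      · rw [hque a ha, Function.update_self] at e; exact absurd e (hne a ha)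
      · rw [hque b hb, Function.update_self] at e; exact absurd e.symm (hne b hb)
      · rfl
    · intro u hu
      by_cases huy : u = y
      · subst huy
        simp only [Function.update_self, h2, true_iff]
        exact ⟨tail, by omega, by simp⟩
      · rw [Function.update_of_ne huy, h.mem u hu]
        constructor
        · rintro ⟨i', hi', e⟩; exact ⟨i', by omega, by rw [hque i' hi']; exact e⟩
        · rintro ⟨i', hi', e⟩
          rcases Nat.lt_succ_iff_lt_or_eq.1 hi' with h' | rfl
          · rw [hque i' h'] at e; exact ⟨i', h', e⟩
          · rw [Function.update_self] at e; exact absurd e.symm huy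
    · intro u hu
      have := h.sub u hu
      rw [hlab u (by omega)]; exact this
    · intro i' hi' v hv
      rw [hque i' (hi'.trans_le h.le)] at hv
      exact hnz v (h.done i' hi' v hv)
    · intro i' hi'
      rcases Nat.lt_succ_iff_lt_or_eq.1 hi' with h' | rfl
      · rw [hque i' h']
        rcases h.src i' h' with h1 | ⟨h1, i'', hi'', h3, h4, h5⟩
        · exact .inl h1
        · refine .inr ⟨h1, i'', hi'', ?_⟩
          rw [hque i'' (hi''.trans h'), Function.update_of_ne (hne i' h'),
            hlab _ (by have := h.que_lab h'; omega),
            hlab _ (by have := h.que_lab (hi''.trans h'); omega)]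
          exact ⟨h3, h4, h5⟩
      · rw [Function.update_self]
        refine .inr ⟨fun hs => ?_, i, hi, ?_, ?_, ?_⟩
        · have := h.sub y hs; omega
        · rw [hque i hi, Function.update_self]
        · rw [hque i hi]; exact hE
        · rw [hque i hi, Function.update_self, hlab _ (by omega)]
  · refine ⟨hlab, fun u hu h1 => ?_, fun u hu => Function.update_of_ne
      (by rintro rfl; exact hu hy) _ _, hque, by omega⟩
    rw [Function.update_apply] at h1
    split_ifs at h1 <;> omega

/-- After a complete search avoiding `P`, the vertices found are those that can be connected to
the sources by a path that avoids `P`. -/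
theorem Search.av_iff (h : Search I Src lab que np tail tail) {P : ℕ → Prop}
    (hP : ∀ u, u < I.n → (lab u = 1 ↔ P u)) {u : ℕ} (hu : u < I.n) :
    2 ≤ lab u ↔ Av I.E Src P u := by
  constructor
  · intro h2
    obtain ⟨i, hi, rfl⟩ := (h.mem u hu).1 h2
    clear h2 hu
    induction i using Nat.strong_induction_on with
    | _ i ih =>
      rcases h.src i hi with h1 | ⟨-, i', hi', -, h3, -⟩
      · exact .base h1
      · refine .step (fun hp => ?_) (I.E_symm h3) (ih i' hi' (hi'.trans hi))
        have h1 := (hP _ (h.lt i hi)).2 hp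
        have h2 := h.que_lab hi
        omega
  · intro h2
    induction h2 with
    | base h1 => exact h.sub _ h1
    | @step u v h1 h2 _ ih =>
      have := ih (I.E_lt_right h2)
      obtain ⟨i, hi, rfl⟩ := (h.mem v (I.E_lt_right h2)).1 this
      have h3 := h.done i hi u (I.E_symm h2)
      have h4 : lab u ≠ 1 := fun e => h1 ((hP u hu).1 e)
      omega

/-- The search data in a configuration. -/
abbrev SearchAt (I : Inst) (Src : ℕ → Prop) (s : Cf) (dn tail : ℕ) : Prop :=
  Search I Src (s.mem .lab) (s.mem .que) (s.mem .np) dn tail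

/-- `Grown` for the search data in configurations. -/
abbrev GrownAt (s : Cf) (tail : ℕ) (s' : Cf) (tail' : ℕ) : Prop :=
  Grown (s.mem .lab) (s.mem .que) (s.mem .np) tail (s'.mem .lab) (s'.mem .que) (s'.mem .np) tail'

attribute [local simp] SearchAt GrownAt

/-- A search is completed in time linear in the sizes of the adjacency lists of the vertices that
are processed. A search may be resumed after the addition of sources, hence the amortized bound. -/
theorem explore_spec {s : Cf} (hc : Ctx μ I s)
    (hs : SearchAt I Src s (s.regs .head) (s.regs .tail)) :
    vc μ explore (fun t s' => SearchAt I Src s' (s'.regs .tail) (s'.regs .tail) ∧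
      s'.regs .head = s'.regs .tail ∧ GrownAt s (s.regs .tail) s' (s'.regs .tail) ∧
      t + 20 * I.spent (s.mem .que) (s.regs .head) ≤
        20 * I.spent (s'.mem .que) (s'.regs .tail) + 1 ∧ Ctx μ I s') s := by
  refine vc_loop (fun s' => SearchAt I Src s' (s'.regs .head) (s'.regs .tail) ∧
      s.regs .head ≤ s'.regs .head ∧ GrownAt s (s.regs .tail) s' (s'.regs .tail) ∧
      I.spent (s'.mem .que) (s'.regs .head) ≤ I.off I.n + I.n)
    (fun s' => 20 * (I.off I.n + I.n - I.spent (s'.mem .que) (s'.regs .head))) (by decide)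
    ⟨hs, le_rfl, Grown.refl _ _ _ _, I.spent_le (fun i hi => hs.lt i (hi.trans_le hs.le))
      fun i hi j hj => hs.inj i (hi.trans_le hs.le) j (hj.trans_le hs.le)⟩ ?_ ?_
  · rintro s1 ⟨h1, hh, hg, hsp⟩ hf -
    have hc1 := hc.frame hf (by decide)
    refine ⟨by simp [Expr.Idx], fun hlt => ?_⟩
    replace hlt : s1.regs .head < s1.regs .tail := by
      by_contra h; simp [Expr.eval, Op.eval, h] at hlt
    have hb := hc.bound
    set hd := s1.regs .head with hhd
    set tl := s1.regs .tail with htl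
    have htn := h1.tail_le
    set v := s1.mem .que hd with hv
    have hvn : v < I.n := h1.lt _ hlt
    simp only [vc, Expr.Idx, Expr.Small, Expr.eval, Op.eval, inc, true_and,
      Config.setR_regs, reduceCtorEq, if_false, ← hhd, ← hv]
    refine ⟨by omega, ?_⟩
    set s2 := (s1.setR .x v).setR .head (hd + 1) with hs2
    have hc2 : Ctx μ I s2 := (hc1.setR rfl).setR rfl
    refine vc_mono (vc_forArcs (K := 9) (v := v)
      (fun j s' => SearchAt I Src s' hd (s'.regs .tail) ∧ s'.regs .head = hd + 1 ∧
        GrownAt s1 tl s' (s'.regs .tail) ∧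
        ∀ j', I.off v ≤ j' → j' < j → s'.mem .lab (I.adj j') ≠ 0)
      (by decide) (by decide) hc2 (by simp [hs2]) hvn ?_ ?_ ?_) ?_
    · rintro j s' q m (rfl | rfl | rfl) h <;> simpa using h
    · exact ⟨by simpa [hs2] using h1, by simp [hs2], by simpa [hs2] using Grown.refl _ _ _ _,
        by omega⟩
    · rintro j s3 hj1 hj2 ⟨i1, i2, i3, i4⟩ hf3 hc3 hx hj hy
      have hq : s3.mem .que hd = v := i3.que_eq hd hlt
      have hE : I.E v (I.adj j) := ⟨hvn, j, hj1, hj2, rfl⟩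
      have hdt : hd < s3.regs .tail := hlt.trans_le i3.le
      simp only [vc, Expr.Idx, Expr.Small, Expr.eval, Op.eval, true_and, Config.setR_mem,
        Config.setR_regs, reduceCtorEq, if_false, Config.setA_regs, Config.setA_mem, hx, hy]
      refine ⟨fun h0 => ?_, fun h0 => ?_⟩
      · replace h0 : s3.mem .lab (I.adj j) = 0 := by simpa using h0
        have hp := i1.push hdt h0 (by rw [hq]; exact hE)
        rw [hq] at hp
        have hl := hp.1.tail_le
        refine ⟨by omega, by omega, ?_, ?_, ?_, ?_⟩
        · simpa using hp.1
        · simpa using i2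
        · simpa using i3.trans hp.2
        · intro j' h1' h2'
          rcases Nat.lt_succ_iff_lt_or_eq.1 h2' with h' | rfl
          · have := i4 j' h1' h'
            simp [Function.update_apply]
            split_ifs
            · have := i1.que_lab hdt; rw [hq] at this; omega
            · exact this
          · simp
            have := i1.que_lab hdt; rw [hq] at this; omega
      · replace h0 : s3.mem .lab (I.adj j) ≠ 0 := by simpa using h0
        refine ⟨Nat.zero_le _, by omega, by simpa using i1, by simpa using i2,
          by simpa using i3, ?_⟩
        intro j' h1' h2'
        rcases Nat.lt_succ_iff_lt_or_eq.1 h2' with h' | rfl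
        · simpa using i4 j' h1' h'
        · simpa using h0
    · rintro t s' ⟨ht, ⟨i1, i2, i3, i4⟩, hf', hc'⟩
      have hq : s'.mem .que hd = v := i3.que_eq hd hlt
      have hsp' : I.spent (s'.mem .que) (hd + 1) = I.spent (s1.mem .que) hd + (I.deg v + 1) := by
        rw [I.spent_succ, hq, I.spent_congr fun i hi => i3.que_eq i (hi.trans hlt)]
      have hse : SearchAt I Src s' (s'.regs .head) (s'.regs .tail) := by
        refine ⟨?_, i1.lt, i1.inj, i1.mem, i1.sub, ?_, i1.src⟩
        · rw [i2]; exact hlt.trans_le i3.le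
        · intro i hi w hw
          rw [i2] at hi
          rcases Nat.lt_succ_iff_lt_or_eq.1 hi with h' | rfl
          · exact i1.done i h' w hw
          · rw [hq] at hw
            obtain ⟨-, j, hj1, hj2, rfl⟩ := hw
            exact i4 j hj1 hj2
      have hle' : I.spent (s'.mem .que) (s'.regs .head) ≤ I.off I.n + I.n :=
        I.spent_le (fun i hi => hse.lt i (hi.trans_le hse.le))
          fun i hi j hj => hse.inj i (hi.trans_le hse.le) j (hj.trans_le hse.le)
      refine ⟨⟨hse, by omega, hg.trans i3, hle'⟩, ?_⟩
      rw [i2, hsp'] at hle' ⊢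
      rw [I.spent_congr (que := s1.mem .que) (que' := s1.mem .que) fun _ _ => rfl]
      have : 20 * (I.off I.n + I.n - I.spent (s1.mem .que) hd) =
          20 * (I.off I.n + I.n - (I.spent (s1.mem .que) hd + (I.deg v + 1))) +
            20 * (I.deg v + 1) := by omega
      omega
  · rintro t s' ⟨h1, hh, hg, hsp⟩ h0 ht hf
    have hc1 := hc.frame hf (by decide)
    have heq : s'.regs .head = s'.regs .tail := by
      have := h1.le
      by_contra hne
      have : s'.regs .head < s'.regs .tail := by omega
      simp [Expr.eval, Op.eval, this] at h0
    refine ⟨by rw [heq] at h1; exact h1, heq, hg, ?_, hc1⟩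
    have hle0 : I.spent (s.mem .que) (s.regs .head) ≤ I.off I.n + I.n :=
      I.spent_le (fun i hi => hs.lt i (hi.trans_le hs.le))
        fun i hi j hj => hs.inj i (hi.trans_le hs.le) j (hj.trans_le hs.le)
    rw [heq] at ht hsp
    omega

end

/-! ### Marking and printing the current tree -/

/-- The set of the first `t` entries of a list. -/
def Pre (ord : ℕ → ℕ) (t u : ℕ) : Prop := ∃ i < t, ord i = u

theorem Pre.mono {ord : ℕ → ℕ} {t t' u : ℕ} (h : Pre ord t u) (ht : t ≤ t') : Pre ord t' u := by
  obtain ⟨i, hi, e⟩ := h; exact ⟨i, by omega, e⟩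

theorem Pre.succ {ord : ℕ → ℕ} {t u : ℕ} : Pre ord (t + 1) u ↔ Pre ord t u ∨ ord t = u := by
  constructor
  · rintro ⟨i, hi, e⟩
    rcases Nat.lt_succ_iff_lt_or_eq.1 hi with h | rfl
    · exact .inl ⟨i, h, e⟩
    · exact .inr e
  · rintro (⟨i, hi, e⟩ | e)
    · exact ⟨i, by omega, e⟩
    · exact ⟨t, by omega, e⟩

theorem Pre.congr {ord ord' : ℕ → ℕ} {t u : ℕ} (h : ∀ i < t, ord' i = ord i) :
    Pre ord' t u ↔ Pre ord t u := by
  constructor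
  · rintro ⟨i, hi, e⟩; exact ⟨i, hi, by rw [← h i hi, e]⟩
  · rintro ⟨i, hi, e⟩; exact ⟨i, hi, by rw [h i hi, e]⟩

/-- The array `fp` holds the parent function of a tree, and the first `t` entries of `ord` are the
distinct vertices of a subtree at the root. -/
structure Tree (I : Inst) (ord fp : ℕ → ℕ) (t : ℕ) : Prop where
  pos : 1 ≤ t
  lt : ∀ i < t, ord i < I.n
  inj : ∀ i < t, ∀ j < t, ord i = ord j → i = j
  head : ord 0 = I.root
  closed : Closed I.E I.root fp (Pre ord t)
  root : fp I.root = I.root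
  toRoot : ∀ w, I.W w → ToRoot I.root fp w
  adj : ∀ u, Used I.W fp u → u ≠ I.root → I.E u (fp u)

section

variable {μ : Mach} {I : Inst}

theorem Tree.le {ord fp : ℕ → ℕ} {t : ℕ} (h : Tree I ord fp t) : t ≤ I.n :=
  length_le_of_inj h.lt h.inj

theorem Tree.used_lt {ord fp : ℕ → ℕ} {t : ℕ} (h : Tree I ord fp t) {u : ℕ}
    (hu : Used I.W fp u) : u < I.n := by
  by_cases hr : u = I.root
  · rw [hr]; exact I.root_lt
  · exact (h.adj u hu hr).1

theorem Tree.one {ord fp : ℕ → ℕ} {t : ℕ} (h : Tree I ord fp t) : Tree I ord fp 1 := by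
  have hp : ∀ u, Pre ord 1 u → u = I.root := by
    rintro u ⟨i, hi, rfl⟩
    obtain rfl : i = 0 := by omega
    exact h.head
  refine ⟨le_rfl, fun i hi => h.lt i (hi.trans_le h.pos), fun i hi j hj _ => by omega, h.head,
    ⟨⟨0, by omega, h.head⟩, fun u hu hr => absurd (hp u hu) hr,
      fun u hu hr => absurd (hp u hu) hr, fun u hu => ⟨0, hp u hu⟩⟩, h.root, h.toRoot, h.adj⟩

/-- The sources, the first `t` vertices of the stack, get the label of the root, the blocked
vertices get the label `1`, and all other vertices are unlabelled. -/
theorem initSearch_spec {s : Cf} {t hi : ℕ} (hc : Ctx μ I s) (ht : s.regs .t = t)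
    (hhi : s.regs .hi = hi) (hth : t ≤ hi) (hlt : ∀ i < hi, s.mem .ord i < I.n)
    (hinj : ∀ i < hi, ∀ j < hi, s.mem .ord i = s.mem .ord j → i = j) :
    vc μ initSearch (fun T s' => T ≤ 30 * I.n + 30 ∧ Ctx μ I s' ∧
      (∀ i < t, s'.mem .lab (s.mem .ord i) = I.root + 2) ∧
      (∀ i, t ≤ i → i < hi → s'.mem .lab (s.mem .ord i) = 1) ∧
      (∀ u < I.n, ¬ Pre (s.mem .ord) hi u → s'.mem .lab u = 0) ∧
      SearchAt I (Pre (s.mem .ord) t) s' 0 t ∧ s'.regs .head = 0 ∧ s'.regs .tail = t ∧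
      (∀ i < t, s'.mem .que i = s.mem .ord i)) s := by
  have hb := hc.bound
  have hhn : hi ≤ I.n := length_le_of_inj hlt hinj
  suffices h : vc μ initSearch (fun T s' => T ≤ 30 * I.n + 30 ∧
      (∀ i < t, s'.mem .lab (s.mem .ord i) = I.root + 2) ∧
      (∀ i, t ≤ i → i < hi → s'.mem .lab (s.mem .ord i) = 1) ∧
      (∀ u < I.n, ¬ Pre (s.mem .ord) hi u → s'.mem .lab u = 0) ∧
      s'.regs .head = 0 ∧ s'.regs .tail = t ∧ (∀ i < t, s'.mem .que i = s.mem .ord i)) s by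
    refine vc_call h ?_
    rintro T s' ⟨h1, h2, h3, h4, h5, h6, h7⟩ hf
    refine ⟨h1, hc.frame hf (by decide), h2, h3, h4, ⟨Nat.zero_le _, ?_, ?_, ?_, ?_, ?_, ?_⟩,
      h5, h6, h7⟩
    · intro i hi'; rw [h7 i hi']; exact hlt i (by omega)
    · intro i hi' j hj e
      rw [h7 i hi', h7 j hj] at e; exact hinj i (by omega) j (by omega) e
    · intro u hu
      constructor
      · intro hl
        by_cases hp : Pre (s.mem .ord) hi u
        · obtain ⟨i, hi', rfl⟩ := hp
          by_cases hit : i < t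
          · exact ⟨i, hit, h7 i hit⟩
          · have := h3 i (by omega) hi'; omega
        · have := h4 u hu hp; omega
      · rintro ⟨i, hi', rfl⟩
        rw [h7 i hi', h2 i hi']; omega
    · rintro u ⟨i, hi', rfl⟩
      rw [h2 i hi']; omega
    · intro i hi'; omega
    · intro i hi'; rw [h7 i hi']; exact .inl ⟨i, hi', rfl⟩
  simp only [initSearch, vc, Expr.Idx, Expr.Small, Expr.eval, true_and]
  refine ⟨Nat.zero_le _, ?_⟩
  set s1 := s.setR .i 0 with hs1
  refine vc_loop (fun s' => s'.regs .i ≤ I.n ∧ ∀ u < s'.regs .i, s'.mem .lab u = 0)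
    (fun s' => 6 * (I.n - s'.regs .i)) (by decide) (by simp [hs1]) ?_ ?_
  · rintro s2 ⟨h1, h2⟩ hf -
    have hn : s2.regs .n = I.n := by rw [hf.regs .n (by decide)]; simp [hs1, hc.n]
    refine ⟨by simp [Expr.Idx], fun hlt => ?_⟩
    simp [Expr.eval, Op.eval, hn] at hlt
    simp only [inc, vc, Expr.Idx, Expr.Small, Expr.eval, Op.eval, true_and, Config.setA_regs,
      Config.setR_mem, Config.setR_regs, if_true, Config.setA_mem]
    refine ⟨Nat.zero_le _, by omega, ⟨by omega, fun u hu => ?_⟩, by omega⟩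
    rw [Function.update_apply]
    split_ifs with h
    · rfl
    · exact h2 u (by omega)
  rintro t1 s2 ⟨h1, h2⟩ h0 ht1 hf1
  have hn : s2.regs .n = I.n := by rw [hf1.regs .n (by decide)]; simp [hs1, hc.n]
  simp [Expr.eval, Op.eval, hn] at h0
  have hi2 : s2.regs .i = I.n := by omega
  rw [hi2] at h2
  have e1 : (s2.setR .i 0).mem .ord = s.mem .ord := by
    simp [hf1.mem .ord (by decide), hs1]
  have e2 : (s2.setR .i 0).regs .t = t := by simp [hf1.regs .t (by decide), hs1, ht]
  have e3 : (s2.setR .i 0).regs .hi = hi := by simp [hf1.regs .hi (by decide), hs1, hhi]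
  have e4 : (s2.setR .i 0).regs .rl = I.root + 2 := by
    simp [hf1.regs .rl (by decide), hs1, hc.rl]
  refine ⟨Nat.zero_le _, ?_⟩
  have hT1 : t1 ≤ 6 * I.n + 1 := by simp [hs1] at ht1; omega
  clear_value s1
  clear ht1
  set s3 := s2.setR .i 0 with hs3
  refine vc_loop (fun s' => ∃ c, s'.regs .i = c ∧ c ≤ t ∧
      (∀ i < c, s'.mem .lab (s.mem .ord i) = I.root + 2) ∧
      (∀ u < I.n, ¬ Pre (s.mem .ord) c u → s'.mem .lab u = 0) ∧
      (∀ i < c, s'.mem .que i = s.mem .ord i))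
    (fun s' => 8 * (t - s'.regs .i)) (by decide)
    ⟨0, by simp [hs3], Nat.zero_le _, by simp, fun u hu _ => by simpa [hs3] using h2 u hu,
      by simp⟩ ?_ ?_
  · rintro s4 ⟨c, h3, h4, h5, h6, h7⟩ hf -
    refine ⟨by simp [Expr.Idx], fun hlt' => ?_⟩
    simp [Expr.eval, Op.eval, h3, hf.regs .t (by decide), e2] at hlt'
    simp only [inc, vc, Expr.Idx, Expr.Small, Expr.eval, Op.eval, true_and, Config.setA_regs,
      Config.setR_mem, Config.setR_regs, if_true, Config.setA_mem, reduceCtorEq, if_false,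
      hf.mem .ord (by decide), e1, h3, hf.regs .rl (by decide), e4]
    refine ⟨by omega, ⟨c + 1, rfl, by omega, ?_, ?_, ?_⟩, by omega⟩
    · intro i hi'
      rw [Function.update_apply]
      split_ifs with h
      · rfl
      · refine h5 i ?_
        rcases Nat.lt_succ_iff_lt_or_eq.1 hi' with h' | rfl
        · exact h'
        · exact absurd rfl h
    · intro u hu hp
      rw [Pre.succ] at hp
      rw [Function.update_of_ne (fun e => hp (.inr e.symm))]
      exact h6 u hu fun h => hp (.inl h)
    · intro i hi'
      rw [Function.update_apply]
      split_ifs with h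
      · rw [h]
      · exact h7 i (by omega)
  rintro t2 s4 ⟨c, h3, h4, h5, h6, h7⟩ h0' ht2 hf2
  simp [Expr.eval, Op.eval, h3, hf2.regs .t (by decide), e2] at h0'
  obtain rfl : c = t := by omega
  rw [← hf2.mem .ord (by decide)] at e1
  rw [← hf2.regs .t (by decide)] at e2
  rw [← hf2.regs .hi (by decide)] at e3
  have hT2 : t2 ≤ 8 * c + 1 := by simp [hs3] at ht2; omega
  refine vc_loop (fun s' => ∃ d, s'.regs .i = d ∧ c ≤ d ∧ d ≤ hi ∧
      (∀ i < c, s'.mem .lab (s.mem .ord i) = I.root + 2) ∧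
      (∀ i, c ≤ i → i < d → s'.mem .lab (s.mem .ord i) = 1) ∧
      (∀ u < I.n, ¬ Pre (s.mem .ord) d u → s'.mem .lab u = 0))
    (fun s' => 8 * (hi - s'.regs .i)) (by decide)
    ⟨c, h3, le_rfl, hth, h5, fun i _ _ => by omega, h6⟩ ?_ ?_
  · rintro s5 ⟨d, g3, g4, g5, g6, g7, g8⟩ hf -
    refine ⟨by simp [Expr.Idx], fun hlt' => ?_⟩
    simp [Expr.eval, Op.eval, g3, hf.regs .hi (by decide), e3] at hlt'
    simp only [inc, vc, Expr.Idx, Expr.Small, Expr.eval, Op.eval, true_and, Config.setA_regs,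
      Config.setR_mem, Config.setR_regs, if_true, Config.setA_mem,
      hf.mem .ord (by decide), e1, g3]
    refine ⟨by omega, by omega, ⟨d + 1, rfl, by omega, by omega, ?_, ?_, ?_⟩, by omega⟩
    · intro i hi'
      rw [Function.update_of_ne (fun e => ?_)]
      · exact g6 i hi'
      · have := hinj i (by omega) d hlt' e; omega
    · intro i hi1 hi2
      rw [Function.update_apply]
      split_ifs with h
      · rfl
      · refine g7 i hi1 ?_
        rcases Nat.lt_succ_iff_lt_or_eq.1 hi2 with h' | rfl
        · exact h'
        · exact absurd rfl h
    · intro u hu hp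
      rw [Pre.succ] at hp
      rw [Function.update_of_ne (fun e => hp (.inr e.symm))]
      exact g8 u hu fun h => hp (.inl h)
  rintro t3 s5 ⟨d, g3, g4, g5, g6, g7, g8⟩ h0'' ht3 hf3
  simp [Expr.eval, Op.eval, g3, hf3.regs .hi (by decide), e3] at h0''
  obtain rfl : d = hi := by omega
  simp only [h3] at ht3
  have htf : s5.regs .t = c := by rw [hf3.regs .t (by decide), e2]
  simp only [Config.setR_mem, Config.setR_regs, if_true, if_false, reduceCtorEq, htf]
  refine ⟨Nat.zero_le _, by omega, g6, g7, g8, trivial, trivial, fun i hi' => ?_⟩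
  rw [hf3.mem .que (by decide)]; exact h7 i hi'

end

/-- The vertices of the current tree and of the subtree `T` that have been marked so far, listed
by `que`. Marked vertices have marked parents, except that the parent `z` may still be missing
if `pend z` holds. -/
structure Marking (I : Inst) (T : ℕ → Prop) (fp lab que wit : ℕ → ℕ) (tail : ℕ)
    (pend : ℕ → Prop) : Prop where
  lt : ∀ i < tail, que i < I.n
  inj : ∀ i < tail, ∀ j < tail, que i = que j → i = j
  mem : ∀ u < I.n, lab u ≠ 0 ↔ ∃ i < tail, que i = u
  ofT : ∀ u, T u → lab u = I.root + 2
  sound : ∀ u < I.n, lab u ≠ 0 → ¬ T u →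
    Used I.W fp u ∧ lab u = u + 2 ∧ I.W (wit u) ∧ ∃ k, fp^[k] (wit u) = u
  next : ∀ u < I.n, lab u ≠ 0 → lab (fp u) ≠ 0 ∨ pend (fp u)

section

variable {μ : Mach} {I : Inst}

/-- Mark the next vertex `z` of the chain of the terminal `q`. -/
theorem Marking.push {T : ℕ → Prop} {fp lab que wit : ℕ → ℕ} {tail q z k : ℕ}
    (h : Marking I T fp lab que wit tail (· = z)) (hz : lab z = 0) (hzn : z < I.n)
    (hq : I.W q) (hk : fp^[k] q = z) :
    Marking I T fp (Function.update lab z (z + 2)) (Function.update que tail z)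
      (Function.update wit z q) (tail + 1) (· = fp z) := by
  have hne : ∀ i < tail, que i ≠ z := fun i hi e =>
    (h.mem z hzn).2 ⟨i, hi, e⟩ hz
  have hque : ∀ i < tail, Function.update que tail z i = que i := fun i hi =>
    Function.update_of_ne (by omega) _ _
  have hTz : ¬ T z := fun ht => by have := h.ofT z ht; omega
  refine ⟨?_, ?_, ?_, ?_, ?_, ?_⟩
  · intro i hi
    rcases Nat.lt_succ_iff_lt_or_eq.1 hi with h' | rfl
    · rw [hque i h']; exact h.lt i h'
    · rw [Function.update_self]; exact hzn
  · intro a ha b hb e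
    rcases Nat.lt_succ_iff_lt_or_eq.1 ha with ha | rfl <;>
      rcases Nat.lt_succ_iff_lt_or_eq.1 hb with hb | rfl
    · rw [hque a ha, hque b hb] at e; exact h.inj a ha b hb e
    · rw [hque a ha, Function.update_self] at e; exact absurd e (hne a ha)
    · rw [hque b hb, Function.update_self] at e; exact absurd e.symm (hne b hb)
    · rfl
  · intro u hu
    by_cases huz : u = z
    · subst huz
      simp only [Function.update_self]
      exact ⟨fun _ => ⟨tail, by omega, by simp⟩, fun _ => by omega⟩
    · rw [Function.update_of_ne huz, h.mem u hu]
      constructor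
      · rintro ⟨i, hi, e⟩; exact ⟨i, by omega, by rw [hque i hi]; exact e⟩
      · rintro ⟨i, hi, e⟩
        rcases Nat.lt_succ_iff_lt_or_eq.1 hi with h' | rfl
        · rw [hque i h'] at e; exact ⟨i, h', e⟩
        · rw [Function.update_self] at e; exact absurd e.symm huz
  · intro u hu
    rw [Function.update_of_ne (by rintro rfl; exact hTz hu)]
    exact h.ofT u hu
  · intro u hu hl hT
    by_cases huz : u = z
    · subst huz
      simp only [Function.update_self]
      exact ⟨⟨q, hq, k, hk⟩, trivial, hq, k, hk⟩
    · rw [Function.update_of_ne huz] at hl ⊢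
      rw [Function.update_of_ne huz]
      exact h.sound u hu hl hT
  · intro u hu hl
    by_cases huz : u = z
    · subst huz; exact .inr rfl
    · rw [Function.update_of_ne huz] at hl
      rcases h.next u hu hl with h1 | h1
      · refine .inl ?_
        rw [Function.update_apply]; split_ifs
        · omega
        · exact h1
      · refine .inl ?_
        rw [h1, Function.update_self]; omega

/-- The marked vertices are those of the current tree. Each vertex is visited once, since the walk
from a terminal towards the root stops at the first vertex that is marked. -/
theorem markTree_spec {s : Cf} {t : ℕ} (hc : Ctx μ I s) (ht : s.regs .t = t)
    (hhi : s.regs .hi = t) (hT : Tree I (s.mem .ord) (s.mem .fp) t) :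
    vc μ markTree (fun n s' => n ≤ 60 * I.n + 60 ∧ Ctx μ I s' ∧
      Marking I (Pre (s.mem .ord) t) (s.mem .fp) (s'.mem .lab) (s'.mem .que) (s'.mem .wit)
        (s'.regs .tail) (fun _ => False) ∧
      (∀ w, I.W w → s'.mem .lab w ≠ 0) ∧
      s'.regs .head = 0 ∧ t ≤ s'.regs .tail ∧ (∀ i < t, s'.mem .que i = s.mem .ord i)) s := by
  have hb := hc.bound
  have htn := hT.le
  unfold markTree
  simp only [vc]
  refine vc_call (initSearch_spec hc ht hhi le_rfl hT.lt hT.inj) ?_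
  rintro t1 s1 ⟨hT1, hc1, hl1, -, hl0, hsr, hhd, htl, hq⟩ hf1
  simp only [Expr.Idx, Expr.Small, Expr.eval, true_and]
  refine ⟨Nat.zero_le _, ?_⟩
  have eord : s1.mem .ord = s.mem .ord := hf1.mem _ (by decide)
  have efp : s1.mem .fp = s.mem .fp := hf1.mem _ (by decide)
  have hm1 : Marking I (Pre (s.mem .ord) t) (s.mem .fp) (s1.mem .lab) (s1.mem .que)
      (s1.mem .wit) (s1.regs .tail) (fun _ => False) := by
    have hz : ∀ u < I.n, s1.mem .lab u ≠ 0 → Pre (s.mem .ord) t u := fun u hu h => by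
      by_contra hp; exact h (hl0 u hu hp)
    refine ⟨by rw [htl]; exact hsr.lt, by rw [htl]; exact hsr.inj, ?_, ?_, ?_, ?_⟩
    · intro u hu
      rw [htl, ← hsr.mem u hu]
      constructor
      · intro h
        obtain ⟨i, hi, rfl⟩ := hz u hu h
        rw [hl1 i hi]; omega
      · intro h; omega
    · rintro u ⟨i, hi, rfl⟩; exact hl1 i hi
    · intro u hu h hp; exact absurd (hz u hu h) hp
    · intro u hu h
      left
      obtain ⟨i, hi, e⟩ := hT.closed.iterate hT.root (hz u hu h) 1
      rw [Function.iterate_one] at e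
      rw [← e, hl1 i hi]; omega
  refine vc_loop (fun s' => ∃ c, s'.regs .i = c ∧ c ≤ I.k ∧
      Marking I (Pre (s.mem .ord) t) (s.mem .fp) (s'.mem .lab) (s'.mem .que) (s'.mem .wit)
        (s'.regs .tail) (fun _ => False) ∧ (∀ i < c, s'.mem .lab (I.term i) ≠ 0) ∧
      t ≤ s'.regs .tail ∧ (∀ i < t, s'.mem .que i = s.mem .ord i))
    (fun s' => 12 * (I.k - s'.regs .i) + 12 * (I.n - s'.regs .tail)) (by decide)
    ⟨0, by simp, Nat.zero_le _, by simpa using hm1, by simp, by simp [htl], by simpa using hq⟩ ?_ ?_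
  · rintro s2 ⟨c, hi, hck, hm, hlc, htt, hqq⟩ hf -
    have hc2 : Ctx μ I s2 := (hc1.setR (x := .i) (v := 0) rfl).frame hf (by decide)
    have efp2 : s2.mem .fp = s.mem .fp := by rw [hf.mem _ (by decide)]; simpa using efp
    refine ⟨by simp [Expr.Idx], fun hlt => ?_⟩
    simp [Expr.eval, Op.eval, hi, hc2.k] at hlt
    have hte := hc2.term c hlt
    have htln : I.term c < I.n := I.term_lt c hlt
    have hkn := I.k_le
    simp only [vc, Expr.Idx, Expr.Small, Expr.eval, Op.eval, true_and, Config.setR_regs,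
      if_true, hi, hc2.tb, hte]
    refine ⟨by omega, ?_⟩
    set q := I.term c with hqdef
    set s3 := (s2.setR .q q).setR .z q with hs3
    refine vc_loop (fun s' => ∃ z k, s'.regs .z = z ∧ z < I.n ∧ (s.mem .fp)^[k] q = z ∧
        Marking I (Pre (s.mem .ord) t) (s.mem .fp) (s'.mem .lab) (s'.mem .que) (s'.mem .wit)
          (s'.regs .tail) (· = z) ∧ (∀ i < c, s'.mem .lab (I.term i) ≠ 0) ∧
        (s'.mem .lab q ≠ 0 ∨ q = z) ∧
        t ≤ s'.regs .tail ∧ (∀ i < t, s'.mem .que i = s.mem .ord i) ∧ s2.regs .tail ≤ s'.regs .tail)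
      (fun s' => 12 * (I.n - s'.regs .tail)) (by decide)
      ⟨q, 0, by simp [hs3], htln, rfl, ⟨hm.lt, hm.inj, hm.mem, hm.ofT, hm.sound,
        fun u hu hl => .inl ((hm.next u hu hl).resolve_right id)⟩,
          by simpa [hs3] using hlc, .inr rfl, by simpa [hs3] using htt,
        by simpa [hs3] using hqq, by simp [hs3]⟩ ?_ ?_
    · rintro s4 ⟨z, k, hz, hzn, hk, hm4, hlc4, hq4, htt4, hqq4, hle4⟩ hf4 -
      have efp4 : s4.mem .fp = s.mem .fp := by
        rw [hf4.mem _ (by decide)]; simpa [hs3] using efp2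
      have eq4 : s4.regs .q = q := by rw [hf4.regs _ (by decide)]; simp [hs3]
      refine ⟨by simp [Expr.Idx, Expr.Small], fun hlt4 => ?_⟩
      simp [Expr.eval, Op.eval, hz] at hlt4
      have hqW : I.W q := ⟨c, hlt, rfl⟩
      have hp := hm4.push hlt4 hzn hqW hk
      have htail := length_le_of_inj hp.lt hp.inj
      simp only [inc, vc, Expr.Idx, Expr.Small, Expr.eval, Op.eval, true_and, Config.setR_regs,
        Config.setR_mem, if_true, Config.setA_mem, Config.setA_regs, reduceCtorEq, if_false, hz,
        efp4, eq4]
      have hU : Used I.W (s.mem .fp) (s.mem .fp z) := Used.next ⟨q, hqW, k, hk⟩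
      refine ⟨by omega, by omega, ⟨_, k + 1, rfl, hT.used_lt hU, ?_, hp, ?_, ?_, by omega, ?_,
        by omega⟩, by omega⟩
      · rw [Function.iterate_succ_apply', hk]
      · intro i hi'
        rw [Function.update_apply]; split_ifs
        · omega
        · exact hlc4 i hi'
      · left
        rw [Function.update_apply]; split_ifs with h
        · omega
        · exact hq4.resolve_right h
      · intro i hi'
        rw [Function.update_of_ne (by omega)]; exact hqq4 i hi'
    · rintro t4 s4 ⟨z, k, hz, hzn, hk, hm4, hlc4, hq4, htt4, hqq4, hle4⟩ h04 ht4 hf4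
      simp [Expr.eval, Op.eval, hz] at h04
      have ei : s4.regs .i = c := by rw [hf4.regs _ (by decide)]; simp [hs3, hi]
      have hle := length_le_of_inj hm4.lt hm4.inj
      simp only [inc, vc, Expr.Idx, Expr.Small, Expr.eval, Op.eval, true_and, Config.setR_regs,
        Config.setR_mem, if_true, reduceCtorEq, if_false, ei]
      refine ⟨by omega, ⟨c + 1, rfl, by omega, ⟨hm4.lt, hm4.inj, hm4.mem, hm4.ofT, hm4.sound, ?_⟩,
        ?_, htt4, hqq4⟩, ?_⟩
      · intro u hu hl
        rcases hm4.next u hu hl with h | h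
        · exact .inl h
        · exact .inl (by rw [h]; exact h04)
      · intro i hi'
        rcases Nat.lt_succ_iff_lt_or_eq.1 hi' with h' | rfl
        · exact hlc4 i h'
        · rcases hq4 with h | h
          · exact h
          · rw [← hqdef, h]; exact h04
      · simp [hs3] at ht4
        omega
  rintro t2 s2 ⟨c, hi, hck, hm, hlc, htt, hqq⟩ h0 ht2 hf
  have hc2 : Ctx μ I s2 := (hc1.setR (x := .i) (v := 0) rfl).frame hf (by decide)
  simp [Expr.eval, Op.eval, hi, hc2.k] at h0
  obtain rfl : c = I.k := by omega
  have hkn := I.k_le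
  refine ⟨?_, hc2, hm, ?_, ?_, htt, hqq⟩
  · simp at ht2
    have : 12 * (I.n - s1.regs .tail) ≤ 12 * I.n := by omega
    omega
  · rintro w ⟨i, hi, rfl⟩; exact hlc i hi
  · rw [hf.regs _ (by decide)]; simp [hhd]

theorem Marking.mem_iff {ord fp lab que wit : ℕ → ℕ} {t tail : ℕ} (hT : Tree I ord fp t)
    (h : Marking I (Pre ord t) fp lab que wit tail (fun _ => False))
    (hW : ∀ w, I.W w → lab w ≠ 0) {u : ℕ} (hu : u < I.n) :
    lab u ≠ 0 ↔ Pre ord t u ∨ Used I.W fp u := by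
  constructor
  · intro hl
    by_cases hp : Pre ord t u
    · exact .inl hp
    · exact .inr (h.sound u hu hl hp).1
  · rintro (hp | ⟨w, hw, k, rfl⟩)
    · rw [h.ofT u hp]; omega
    · clear hu
      induction k with
      | zero => exact hW w hw
      | succ k ih =>
        rw [Function.iterate_succ_apply']
        exact (h.next _ (hT.used_lt ⟨w, hw, k, rfl⟩) ih).resolve_right id

/-- A list of words is a description of the tree with parent function `f`. -/
def Desc (I : Inst) (f : ℕ → ℕ) (out : List ℕ) : Prop :=
  ∃ us : List ℕ, us.Nodup ∧ (∀ u, u ∈ us ↔ Used I.W f u ∧ u ≠ I.root) ∧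
    out = us.flatMap fun u => [u, f u]

theorem output_spec {s : Cf} {t : ℕ} (hc : Ctx μ I s) (hT : Tree I (s.mem .ord) (s.mem .fp) t)
    (hcur : s.current = []) :
    vc μ output (fun n s' => n ≤ 80 * I.n + 80 ∧ Ctx μ I s' ∧ s'.current = [] ∧
      ∃ out, Desc I (s.mem .fp) out ∧ s'.solutions = s.solutions ++ [out]) s := by
  have hb := hc.bound
  simp only [output, vc, Expr.Idx, Expr.Small, Expr.eval, true_and]
  refine ⟨by omega, by omega, ?_⟩
  set s1 := (s.setR .t 1).setR .hi 1 with hs1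
  have hc1 : Ctx μ I s1 := (hc.setR rfl).setR rfl
  have hT1 : Tree I (s1.mem .ord) (s1.mem .fp) 1 := by simpa [hs1] using hT.one
  refine vc_call (markTree_spec (t := 1) hc1 (by simp [hs1]) (by simp [hs1]) hT1) ?_
  rintro t2 s2 ⟨ht2, hc2, hm, hW, -, htl, hq⟩ hf2
  have efp : s2.mem .fp = s.mem .fp := by rw [hf2.mem _ (by decide)]; simp [hs1]
  have ecur : s2.current = [] := by rw [hf2.cur (by decide)]; simpa [hs1] using hcur
  have esol : s2.solutions = s.solutions := by rw [hf2.sols (by decide)]; simp [hs1]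
  have hle := length_le_of_inj hm.lt hm.inj
  have hq0 : s2.mem .que 0 = I.root := by rw [hq 0 (by omega)]; exact hT1.head
  refine ⟨by omega, ?_⟩
  refine vc_loop (fun s' => ∃ c, s'.regs .i = c ∧ 1 ≤ c ∧ c ≤ s2.regs .tail ∧
      s'.current = ((List.range' 1 (c - 1)).map (s2.mem .que)).flatMap
        (fun u => [u, s.mem .fp u]) ∧ s'.solutions = s.solutions)
    (fun s' => 6 * (s2.regs .tail - s'.regs .i)) (by decide)
    ⟨1, by simp, le_rfl, htl, by simpa using ecur, by simpa using esol⟩ ?_ ?_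
  · rintro s3 ⟨c, hi, h1, h2, hcu, hso⟩ hf -
    refine ⟨by simp [Expr.Idx], fun hlt => ?_⟩
    have e1 : s3.regs .tail = s2.regs .tail := by rw [hf.regs _ (by decide)]; simp
    have e2 : s3.mem .que = s2.mem .que := by rw [hf.mem _ (by decide)]; simp
    have e3 : s3.mem .fp = s.mem .fp := by rw [hf.mem _ (by decide)]; simpa using efp
    simp [Expr.eval, Op.eval, hi, e1] at hlt
    simp only [inc, vc, Expr.Idx, Expr.Small, Expr.eval, Op.eval, true_and, Config.setR_regs,
      if_true, hi, Config.setR_current, Config.put_current, Config.put_regs, Config.put_mem, hcu,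
      e2, e3]
    refine ⟨by omega, ⟨c + 1, rfl, by omega, by omega, ?_, hso⟩, by omega⟩
    have : c + 1 - 1 = (c - 1) + 1 := by omega
    rw [this, List.range'_concat]
    simp only [one_mul, List.map_append, List.map_cons, List.map_nil, List.flatMap_append,
      List.flatMap_cons, List.flatMap_nil, List.append_nil, List.append_assoc]
    rw [show 1 + (c - 1) = c by omega]
    rfl
  rintro t3 s3 ⟨c, hi, h1, h2, hcu, hso⟩ h0 ht3 hf3
  have e1 : s3.regs .tail = s2.regs .tail := by rw [hf3.regs _ (by decide)]; simp
  simp [Expr.eval, Op.eval, hi, e1] at h0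
  obtain rfl : c = s2.regs .tail := by omega
  have hc3 : Ctx μ I s3 := (hc2.setR (x := .i) (v := 1) rfl).frame hf3 (by decide)
  refine ⟨?_, hc3.congr (fun _ _ => rfl) rfl, rfl, _, ⟨_, ?_, ?_, hcu⟩, ?_⟩
  · simp at ht3; omega
  · refine List.Nodup.map_on ?_ List.nodup_range'
    intro a ha b hb e
    rw [List.mem_range'_1] at ha hb
    exact hm.inj a (by omega) b (by omega) e
  · intro u
    have hpr : ∀ u, Pre (s1.mem .ord) 1 u ↔ u = I.root := by
      intro u
      constructor
      · rintro ⟨i, hi, rfl⟩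
        obtain rfl : i = 0 := by omega
        exact hT1.head
      · rintro rfl; exact ⟨0, by omega, hT1.head⟩
    have efp1 : s1.mem .fp = s.mem .fp := by simp [hs1]
    simp only [List.mem_map, List.mem_range'_1]
    constructor
    · rintro ⟨i, hi, rfl⟩
      have hin : i < s2.regs .tail := by omega
      have hl := (hm.mem _ (hm.lt i hin)).2 ⟨i, hin, rfl⟩
      have hne : s2.mem .que i ≠ I.root := by
        rw [← hq0]; intro e; have := hm.inj i hin 0 (by omega) e; omega
      rw [hm.mem_iff hT1 hW (hm.lt i hin), hpr, efp1] at hl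
      exact ⟨hl.resolve_left hne, hne⟩
    · rintro ⟨hU, hne⟩
      have hun := hT.used_lt hU
      have hl := (hm.mem_iff hT1 hW hun).2 (.inr (by rw [efp1]; exact hU))
      obtain ⟨i, hi, rfl⟩ := (hm.mem u hun).1 hl
      refine ⟨i, ⟨?_, by omega⟩, rfl⟩
      by_contra hcon
      obtain rfl : i = 0 := by omega
      exact hne hq0
  · simp only [Config.fin_solutions]
    rw [hso]

end

/-! ### Testing whether there is more than one completion -/

/-- The loop rule with an auxiliary rank that need not be a function of the configuration. -/
theorem vc_loop_ghost {R A : Type} [DecidableEq R] [DecidableEq A] {μ : Mach} {e : Expr R A}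
    {c : Cmd R A} {Q : ℕ → Config R A → Prop}
    {s : Config R A} (I : ℕ → Config R A → Prop) (N : ℕ)
    (hok : (Cmd.loop e c).okay = true) (h0 : I N s)
    (hI : ∀ m s1, I m s1 → Frame c s s1 → e.Idx μ.M s1 ∧
      (e.eval s1 ≠ 0 → vc μ c (fun t s' => ∃ m', I m' s' ∧ t + 1 + m' ≤ m) s1))
    (hQ : ∀ t m s', I m s' → e.eval s' = 0 → t + m ≤ N + 1 → Frame c s s' → Q t s') :
    vc μ (.loop e c) Q s := by
  refine vc_loop (fun s1 => ∃ m, I m s1) (fun s1 => sInf {m | I m s1}) hok ⟨N, h0⟩ ?_ ?_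
  · intro s1 hm hf _
    obtain ⟨h1, h2⟩ := hI _ s1 (Nat.sInf_mem (s := {m | I m s1}) hm) hf
    refine ⟨h1, fun he => vc_mono (h2 he) ?_⟩
    rintro t s' ⟨m', hm', ht⟩
    have : sInf {m | I m s'} ≤ m' := Nat.sInf_le hm'
    exact ⟨⟨m', hm'⟩, by omega⟩
  · intro t s' hm he ht hf
    have : sInf {m | I m s} ≤ N := Nat.sInf_le h0
    exact hQ t _ s' (Nat.sInf_mem (s := {m | I m s'}) hm) he (by omega) hf

section

variable {μ : Mach} {I : Inst}

/-- The vertices of a chain are distinct until it reaches the root. -/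
theorem chain_inj {f : ℕ → ℕ} {r x i : ℕ} (hr : f r = r) (hx : ToRoot r f x)
    (hne : ∀ j < i, f^[j] x ≠ r) {a b : ℕ} (ha : a < i) (hb : b < i) (e : f^[a] x = f^[b] x) :
    a = b := by
  have key : ∀ a b, a < b → b < i → f^[a] x ≠ f^[b] x := by
    intro a b hab hb e
    obtain ⟨d, rfl⟩ := Nat.exists_eq_add_of_lt hab
    refine hne a (by omega) ((hx.iterate hr a).eq_root hr (c := d) ?_)
    rw [← Function.iterate_add_apply, show d + 1 + a = a + d + 1 by omega]
    exact e.symm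
  rcases lt_trichotomy a b with h | h | h
  · exact absurd e (key a b h hb)
  · exact h
  · exact absurd e.symm (key b a h ha)

/-- A chain of vertices that has not reached the root yet has at most `n` vertices. -/
theorem chain_length {f : ℕ → ℕ} {r n x i : ℕ} (hr : f r = r) (hx : ToRoot r f x)
    (hlt : ∀ j < i, f^[j] x < n) (hne : ∀ j < i, f^[j] x ≠ r) : i ≤ n :=
  length_le_of_inj (que := fun j => f^[j] x) hlt fun _ ha _ hb e => chain_inj hr hx hne ha hb e

/-- All arcs are inspected once. -/
theorem findCross_spec {s : Cf} (hc : Ctx μ I s) :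
    vc μ findCross (fun t s' => t ≤ 20 * (I.off I.n + I.n) + 20 ∧ Ctx μ I s' ∧
      (s'.regs .found = 0 → ∀ a b, ¬ Cross I.E (s.mem .fp) (s.mem .lab) a b) ∧
      (s'.regs .found ≠ 0 → ∃ a b, Cross I.E (s.mem .fp) (s.mem .lab) a b ∧
        s'.regs .a = s.mem .lab a - 2 ∧ s'.regs .b = s.mem .lab b - 2)) s := by
  have hb := hc.bound
  simp only [findCross, vc, Expr.Idx, Expr.Small, Expr.eval, true_and]
  refine ⟨Nat.zero_le _, Nat.zero_le _, ?_⟩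
  set s1 := (s.setR .found 0).setR .i 0 with hs1
  have hc1 : Ctx μ I s1 := (hc.setR rfl).setR rfl
  refine vc_loop (fun s' => s'.regs .i ≤ I.n ∧
      (s'.regs .found = 0 → ∀ a < s'.regs .i, ∀ b, ¬ Cross I.E (s.mem .fp) (s.mem .lab) a b) ∧
      (s'.regs .found ≠ 0 → ∃ a b, Cross I.E (s.mem .fp) (s.mem .lab) a b ∧
        s'.regs .a = s.mem .lab a - 2 ∧ s'.regs .b = s.mem .lab b - 2))
    (fun s' => 20 * (I.off I.n + I.n - (I.off (s'.regs .i) + s'.regs .i))) (by decide)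
    ⟨by simp [hs1], by simp [hs1], by simp [hs1]⟩ ?_ ?_
  · rintro s2 ⟨h1, h2, h3⟩ hf -
    have hc2 := hc1.frame hf (by decide)
    refine ⟨by simp [Expr.Idx], fun hlt => ?_⟩
    simp [Expr.eval, Op.eval, hc2.n] at hlt
    have elb : s2.mem .lab = s.mem .lab := by rw [hf.mem _ (by decide)]; simp [hs1]
    have efp : s2.mem .fp = s.mem .fp := by rw [hf.mem _ (by decide)]; simp [hs1]
    have hm1 := I.off_mono (u := s2.regs .i + 1) (v := I.n) (by omega) le_rfl
    have hm2 := I.off_le (s2.regs .i) hlt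
    obtain ⟨c, hi⟩ : ∃ c, s2.regs .i = c := ⟨_, rfl⟩
    rw [hi] at h1 h2 hlt hm1 hm2
    simp only [vc, inc, Expr.Idx, Expr.Small, Expr.eval, Op.eval, true_and, elb, hi]
    refine ⟨fun hl => ?_, fun hl => ?_⟩
    · replace hl : 2 ≤ s.mem .lab c := by
        by_contra h; exact hl (if_neg (by omega))
      refine vc_mono (vc_forArcs (K := 10) (v := c)
        (fun j s' => (s'.regs .found = 0 → (∀ a < c, ∀ b, ¬ Cross I.E (s.mem .fp) (s.mem .lab) a b)
            ∧ ∀ j', I.off c ≤ j' → j' < j →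
              ¬ Cross I.E (s.mem .fp) (s.mem .lab) c (I.adj j')) ∧
          (s'.regs .found ≠ 0 → ∃ a b, Cross I.E (s.mem .fp) (s.mem .lab) a b ∧
            s'.regs .a = s.mem .lab a - 2 ∧ s'.regs .b = s.mem .lab b - 2))
        (by decide) (by decide) hc2 hi hlt ?_ ⟨fun h => ⟨h2 h, fun _ _ _ => by omega⟩, h3⟩ ?_) ?_
      · rintro j s' q m (rfl | rfl | rfl) h <;> simpa using h
      · rintro j s3 hj1 hj2 ⟨i1, i2⟩ hf3 hc3 hx hj hy
        have elb3 : s3.mem .lab = s.mem .lab := by rw [hf3.mem _ (by decide), elb]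
        have efp3 : s3.mem .fp = s.mem .fp := by rw [hf3.mem _ (by decide), efp]
        have hE : I.E c (I.adj j) := ⟨hlt, j, hj1, hj2, rfl⟩
        have hskip : ¬ Cross I.E (s.mem .fp) (s.mem .lab) c (I.adj j) →
            ((s3.regs .found = 0 → (∀ a < c, ∀ b, ¬ Cross I.E (s.mem .fp) (s.mem .lab) a b)
            ∧ ∀ j', I.off c ≤ j' → j' < j + 1 →
              ¬ Cross I.E (s.mem .fp) (s.mem .lab) c (I.adj j')) ∧
          (s3.regs .found ≠ 0 → ∃ a b, Cross I.E (s.mem .fp) (s.mem .lab) a b ∧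
            s3.regs .a = s.mem .lab a - 2 ∧ s3.regs .b = s.mem .lab b - 2)) := by
          intro hn
          refine ⟨fun h => ⟨(i1 h).1, fun j' h1' h2' => ?_⟩, i2⟩
          rcases Nat.lt_succ_iff_lt_or_eq.1 h2' with h' | rfl
          · exact (i1 h).2 j' h1' h'
          · exact hn
        simp only [vc, Expr.Idx, Expr.Small, Expr.eval, Op.eval, true_and, Config.setR_regs,
          Config.setR_mem, reduceCtorEq, if_false, if_true, elb3, efp3, hx, hy]
        refine ⟨fun e1 => ⟨Nat.zero_le _, by omega, ?_⟩, fun e1 => ⟨fun e2 =>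
          ⟨Nat.zero_le _, by omega, ?_⟩, fun e2 => ⟨fun e3 => ⟨Nat.zero_le _, by omega,
            ?_⟩, fun e3 => ⟨by omega, by omega, fun h => h.elim, fun _ =>
              ⟨c, I.adj j, ?_, rfl, rfl⟩⟩⟩⟩⟩
        · refine hskip fun h => h.2.2.1 ?_
          simpa using e1
        · refine hskip fun h => h.2.2.2.1 ?_
          simpa [and_comm] using e2
        · refine hskip fun h => h.2.2.2.2 ?_
          simpa [and_comm] using e3
        · refine ⟨hl, hE, by simpa using e1, ?_, ?_⟩
          · rintro ⟨g1, g2⟩; simp [g1, g2] at e2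
          · rintro ⟨g1, g2⟩; simp [g1, g2] at e3
      · rintro t s' ⟨ht, ⟨i1, i2⟩, hf', hc'⟩
        have ei : s'.regs .i = c := by rw [hf'.regs _ (by decide), hi]
        simp only [ei, Config.setR_regs, if_true, reduceCtorEq, if_false]
        refine ⟨by omega, ⟨by omega, fun h a ha b hcr => ?_, i2⟩, ?_⟩
        · rcases Nat.lt_succ_iff_lt_or_eq.1 ha with h' | rfl
          · exact (i1 h).1 a h' b hcr
          · obtain ⟨-, j, hj1, hj2, rfl⟩ := hcr.2.1
            exact (i1 h).2 j hj1 hj2 hcr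
        · have : I.deg c = I.off (c + 1) - I.off c := rfl
          omega
    · replace hl : ¬ 2 ≤ s.mem .lab c := by
        intro h
        rw [if_pos (show 1 < s.mem .lab c by omega)] at hl
        exact one_ne_zero hl
      simp only [Config.setR_regs, if_true, reduceCtorEq, if_false, hi]
      refine ⟨Nat.zero_le _, by omega, ⟨by omega, fun h a ha b hcr => ?_, h3⟩, by omega⟩
      rcases Nat.lt_succ_iff_lt_or_eq.1 ha with h' | rfl
      · exact h2 h a h' b hcr
      · exact hl hcr.1
  · rintro t s2 ⟨h1, h2, h3⟩ h0 ht hf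
    have hc2 := hc1.frame hf (by decide)
    simp [Expr.eval, Op.eval, hc2.n] at h0
    refine ⟨?_, hc2, fun h a b hcr => h2 h a (by have := hcr.2.1.1; omega) b hcr, h3⟩
    simp [hs1, I.off_zero] at ht
    omega

theorem Cross.symm {f lab : ℕ → ℕ} {a b : ℕ} (h : Cross I.E f lab a b) (hb : 2 ≤ lab b) :
    Cross I.E f lab b a :=
  ⟨hb, I.E_symm h.2.1, h.2.2.1.symm, h.2.2.2.2, h.2.2.2.1⟩

/-- The chosen label is not an ancestor of the other one, which is what `Labelled.alt` requires; the
walk from the label `a` towards the root decides which of the two labels it is. -/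
theorem choose_spec {s : Cf} {t : ℕ} {que np lab : ℕ → ℕ} {tail a b : ℕ} (hc : Ctx μ I s)
    (hT : Tree I (s.mem .ord) (s.mem .fp) t)
    (hpos : ∀ u < I.n, s.mem .pos u ≠ 0 ↔ Pre (s.mem .ord) t u)
    (hL : Labelled I.E I.W I.root (s.mem .fp) (Pre (s.mem .ord) t) lab que np tail)
    (hwit : ∀ u, Used I.W (s.mem .fp) u → ¬ Pre (s.mem .ord) t u →
      I.W (s.mem .wit u) ∧ ∃ k, (s.mem .fp)^[k] (s.mem .wit u) = u)
    (hcr : Cross I.E (s.mem .fp) lab a b) (ha : s.regs .a = lab a - 2)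
    (hb' : s.regs .b = lab b - 2) :
    vc μ choose (fun n s' => n ≤ 10 * I.n + 10 ∧ Ctx μ I s' ∧ I.W (s'.regs .w) ∧
      Alt I.E (Pre (s.mem .ord) t) (s.mem .fp) (s'.regs .w)) s := by
  have hbd := hc.bound
  have hrT : Pre (s.mem .ord) t I.root := hT.closed.root
  have hb2 : 2 ≤ lab b := hL.closed _ _ hcr.1 hcr.2.1
  obtain ⟨x, hx, hx'⟩ := hL.label_src hcr.1
  obtain ⟨y, hy, hy'⟩ := hL.label_src hb2
  have hxy : x ≠ y := fun e => hcr.2.2.1 (by rw [hx, hy, e])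
  rw [hx, Nat.add_sub_cancel] at ha
  rw [hy, Nat.add_sub_cancel] at hb'
  have hroot : ∀ u, Used I.W (s.mem .fp) u → ToRoot I.root (s.mem .fp) u := fun u hu =>
    hu.toRoot hT.root hT.toRoot
  have hxU : Used I.W (s.mem .fp) x := by
    rcases hx' with rfl | h
    · exact .terminal I.root_W
    · exact h.1
  have hxR := hroot x hxU
  -- the two outcomes of the choice
  have outx : x ≠ I.root → (∀ i, (s.mem .fp)^[i] y ≠ x) →
      I.W (s.mem .wit x) ∧ Alt I.E (Pre (s.mem .ord) t) (s.mem .fp) (s.mem .wit x) := by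
    intro h1 h2
    have h3 := hx'.resolve_left h1
    obtain ⟨h4, k, h5⟩ := hwit x h3.1 h3.2
    exact ⟨h4, hL.alt hT.closed hT.root (fun _ _ => I.E_symm) hT.adj hroot hcr hx hy h3.2 h2 h4 h5⟩
  have outy : y ≠ I.root → (∀ i, (s.mem .fp)^[i] x ≠ y) →
      I.W (s.mem .wit y) ∧ Alt I.E (Pre (s.mem .ord) t) (s.mem .fp) (s.mem .wit y) := by
    intro h1 h2
    have h3 := hy'.resolve_left h1
    obtain ⟨h4, k, h5⟩ := hwit y h3.1 h3.2
    exact ⟨h4, hL.alt hT.closed hT.root (fun _ _ => I.E_symm) hT.adj hroot (hcr.symm hb2) hy hx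
      h3.2 h2 h4 h5⟩
  simp only [choose, vc, Expr.Idx, Expr.Small, Expr.eval, true_and, ha]
  refine vc_loop_ghost (fun m s' => ∃ i, m + 6 * i = 6 * I.n ∧ s'.regs .z = (s.mem .fp)^[i] x ∧
      ∀ j < i, ¬ Pre (s.mem .ord) t ((s.mem .fp)^[j] x) ∧ (s.mem .fp)^[j] x ≠ y)
    (6 * I.n) (by decide) ⟨0, by omega, by simp, by simp⟩ ?_ ?_
  · rintro m s1 ⟨i, hm, hz, hpre⟩ hf
    have e1 : s1.mem .pos = s.mem .pos := by rw [hf.mem _ (by decide)]; simp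
    have e2 : s1.mem .fp = s.mem .fp := by rw [hf.mem _ (by decide)]; simp
    have e3 : s1.regs .b = y := by rw [hf.regs _ (by decide)]; simp [hb']
    refine ⟨by simp [Expr.Idx, Expr.Small], fun hlt => ?_⟩
    simp [Expr.eval, Op.eval, e1, e3, hz] at hlt
    have hzn : (s.mem .fp)^[i] x < I.n := hT.used_lt (hxU.iterate i)
    have hzT : ¬ Pre (s.mem .ord) t ((s.mem .fp)^[i] x) := fun h =>
      (hpos _ hzn).2 h hlt.2
    have hall : ∀ j < i + 1, ¬ Pre (s.mem .ord) t ((s.mem .fp)^[j] x) ∧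
        (s.mem .fp)^[j] x ≠ y := by
      intro j hj
      rcases Nat.lt_succ_iff_lt_or_eq.1 hj with h' | rfl
      · exact hpre j h'
      · exact ⟨hzT, hlt.1⟩
    have hle : i + 1 ≤ I.n := chain_length hT.root hxR
      (fun j _ => hT.used_lt (hxU.iterate j)) fun j hj e => (hall j hj).1 (by rw [e]; exact hrT)
    simp only [vc, Expr.Idx, Expr.Small, Expr.eval, true_and, Config.setR_regs, if_true, e2, hz]
    refine ⟨6 * (I.n - (i + 1)), ⟨i + 1, by omega, ?_, hall⟩, by omega⟩
    rw [Function.iterate_succ_apply']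
  · rintro n m s1 ⟨i, hm, hz, hpre⟩ h0 hn hf
    have e1 : s1.mem .pos = s.mem .pos := by rw [hf.mem _ (by decide)]; simp
    have e2 : s1.mem .wit = s.mem .wit := by rw [hf.mem _ (by decide)]; simp
    have e3 : s1.regs .b = y := by rw [hf.regs _ (by decide)]; simp [hb']
    have e4 : s1.regs .a = x := by rw [hf.regs _ (by decide)]; simp [ha]
    have hc1 : Ctx μ I s1 := (hc.setR (x := .z) (v := x) rfl).frame hf (by decide)
    have hzn : (s.mem .fp)^[i] x < I.n := hT.used_lt (hxU.iterate i)
    simp only [Op.eval, Config.setR_regs, if_true, e1, e2, e3, e4, hz, hc1.root]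
    simp [Expr.eval, Op.eval, e1, e3, hz] at h0
    refine ⟨fun h => ⟨by omega, hc1.setR rfl, ?_⟩, fun h => ⟨by omega, hc1.setR rfl, ?_⟩⟩
    · by_cases hyr : y = I.root
      · refine outx (fun e => hxy (e.trans hyr.symm)) fun j e => ?_
        rw [hyr, iterate_root hT.root] at e
        exact hxy (e.symm.trans hyr.symm)
      · have hpz : s.mem .pos ((s.mem .fp)^[i] x) = 0 := by
          by_contra hne; simp [hne, hyr] at h
        have hzy : (s.mem .fp)^[i] x = y := by by_contra hne; exact h0 hne hpz
        have hxr : x ≠ I.root := fun e => by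
          rw [e, iterate_root hT.root] at hpz
          exact (hpos _ I.root_lt).2 hrT hpz
        refine outx hxr fun j e => ?_
        rw [← hzy, ← Function.iterate_add_apply] at e
        cases hji : j + i with
        | zero =>
          obtain rfl : i = 0 := by omega
          exact hxy hzy
        | succ d => rw [hji] at e; exact hxr (hxR.eq_root hT.root e)
    · have hyr : y ≠ I.root := fun e => by simp [e] at h
      have hpz : s.mem .pos ((s.mem .fp)^[i] x) ≠ 0 := fun e => by simp [e] at h
      have hzT := (hpos _ hzn).1 hpz
      have hyT := (hy'.resolve_left hyr).2
      refine outy hyr fun j e => ?_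
      rcases lt_or_ge j i with hj | hj
      · exact (hpre j hj).2 e
      · have := hT.closed.iterate hT.root hzT (j - i)
        rw [← Function.iterate_add_apply, Nat.sub_add_cancel hj, e] at this
        exact hyT this

/-- The test decides whether the subtree on the stack has more than one completion. -/
theorem test_spec {s : Cf} {t : ℕ} (hc : Ctx μ I s) (ht : s.regs .len = t)
    (hT : Tree I (s.mem .ord) (s.mem .fp) t)
    (hpos : ∀ u < I.n, s.mem .pos u ≠ 0 ↔ Pre (s.mem .ord) t u) :
    vc μ test (fun n s' => n ≤ 200 * (I.off I.n + I.n) + 200 ∧ Ctx μ I s' ∧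
      (s'.regs .found = 0 → ∀ w, I.W w → ¬ Alt I.E (Pre (s.mem .ord) t) (s.mem .fp) w) ∧
      (s'.regs .found ≠ 0 → I.W (s'.regs .w) ∧
        Alt I.E (Pre (s.mem .ord) t) (s.mem .fp) (s'.regs .w))) s := by
  have hbd := hc.bound
  unfold test
  simp only [vc, Expr.Idx, Expr.Small, Expr.eval, true_and, ht, Config.setR_regs, reduceCtorEq,
    if_false]
  set s1 := (s.setR .t t).setR .hi t with hs1
  have hc1 : Ctx μ I s1 := (hc.setR rfl).setR rfl
  have eo1 : s1.mem .ord = s.mem .ord := by simp [hs1]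
  have ef1 : s1.mem .fp = s.mem .fp := by simp [hs1]
  refine vc_call (markTree_spec (t := t) hc1 (by simp [hs1]) (by simp [hs1])
    (by rw [eo1, ef1]; exact hT)) ?_
  rw [eo1, ef1]
  rintro t2 s2 ⟨ht2, hc2, hm, hW, hhd, htl, hq⟩ hf2
  have eo2 : s2.mem .ord = s.mem .ord := by rw [hf2.mem _ (by decide), eo1]
  have ef2 : s2.mem .fp = s.mem .fp := by rw [hf2.mem _ (by decide), ef1]
  have ep2 : s2.mem .pos = s.mem .pos := by rw [hf2.mem _ (by decide)]; simp [hs1]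
  have hlt : ∀ u, (Pre (s.mem .ord) t u ∨ Used I.W (s.mem .fp) u) → u < I.n := by
    rintro u (⟨i, hi, rfl⟩ | h)
    · exact hT.lt i hi
    · exact hT.used_lt h
  have hval : ∀ u < I.n, s2.mem .lab u ≠ 0 → 2 ≤ s2.mem .lab u := by
    intro u hu h
    by_cases hp : Pre (s.mem .ord) t u
    · rw [hm.ofT u hp]; omega
    · rw [(hm.sound u hu h hp).2.1]; omega
  have hse : SearchAt I (fun u => Pre (s.mem .ord) t u ∨ Used I.W (s.mem .fp) u) s2
      (s2.regs .head) (s2.regs .tail) := by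
    rw [hhd]
    refine ⟨Nat.zero_le _, hm.lt, hm.inj, ?_, ?_, fun i hi => by omega, ?_⟩
    · intro u hu
      rw [← hm.mem u hu]
      exact ⟨fun h => by omega, hval u hu⟩
    · intro u hu
      exact hval u (hlt u hu) ((hm.mem_iff hT hW (hlt u hu)).2 hu)
    · intro i hi
      exact .inl ((hm.mem_iff hT hW (hm.lt i hi)).1 ((hm.mem _ (hm.lt i hi)).2 ⟨i, hi, rfl⟩))
  refine vc_call (explore_spec hc2 hse) ?_
  rintro t3 s3 ⟨hs3, -, hg, ht3, hc3⟩ hf3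
  have eo3 : s3.mem .ord = s.mem .ord := by rw [hf3.mem _ (by decide), eo2]
  have ef3 : s3.mem .fp = s.mem .fp := by rw [hf3.mem _ (by decide), ef2]
  have ep3 : s3.mem .pos = s.mem .pos := by rw [hf3.mem _ (by decide), ep2]
  have ew3 : s3.mem .wit = s2.mem .wit := by rw [hf3.mem _ (by decide)]
  have ht3' : t3 ≤ 20 * (I.off I.n + I.n) + 1 := by
    have h1 : I.spent (s3.mem .que) (s3.regs .tail) ≤ I.off I.n + I.n := I.spent_le hs3.lt hs3.inj
    omega
  -- cells beyond the vertex range are not searched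
  let lab' : ℕ → ℕ := fun u => if u < I.n then s3.mem .lab u else 0
  have hlab' : ∀ u < I.n, lab' u = s3.mem .lab u := fun u hu => if_pos hu
  have hlab2 : ∀ u, 2 ≤ lab' u → u < I.n := by
    intro u h; by_contra hn; simp [lab', hn] at h
  have hL : Labelled I.E I.W I.root (s.mem .fp) (Pre (s.mem .ord) t) lab' (s3.mem .que)
      (s3.mem .np) (s3.regs .tail) := by
    refine ⟨?_, ?_, ?_, ?_, ?_⟩
    · intro u hu
      rw [hlab' u (hlt u (.inl hu)), hg.lab_eq u (by rw [hm.ofT u hu]; omega), hm.ofT u hu]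
    · intro u hu hp
      have hun := hlt u (.inr hu)
      have h0 := (hm.mem_iff hT hW hun).2 (.inr hu)
      rw [hlab' u hun, hg.lab_eq u h0, (hm.sound u hun h0 hp).2.1]
    · intro u
      constructor
      · intro h
        have hu := hlab2 u h
        rw [hlab' u hu] at h
        exact (hs3.mem u hu).1 h
      · rintro ⟨i, hi, rfl⟩
        rw [hlab' _ (hs3.lt i hi)]
        exact hs3.que_lab hi
    · intro u v hu hE
      have hun := hlab2 u hu
      rw [hlab' u hun] at hu
      obtain ⟨i, hi, rfl⟩ := (hs3.mem u hun).1 hu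
      have h1 := hs3.done i hi v hE
      have hvn := I.E_lt_right hE
      rw [hlab' v hvn]
      have h2 : s3.mem .lab v ≠ 1 := by
        by_cases h0 : s2.mem .lab v = 0
        · exact hg.new v h0
        · rw [hg.lab_eq v h0]; have := hval v hvn h0; omega
      omega
    · intro i hi
      have hin := hs3.lt i hi
      rcases hs3.src i hi with h | ⟨h, i', hi', h1, h2, h3⟩
      · exact .inl h
      · refine .inr ⟨by tauto, i', hi', h1, h2, ?_⟩
        rw [hlab' _ hin, hlab' _ (hs3.lt i' (hi'.trans hi))]; exact h3
  have hcross : ∀ a b, Cross I.E (s.mem .fp) (s3.mem .lab) a b ↔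
      Cross I.E (s.mem .fp) lab' a b := by
    intro a b
    by_cases hE : I.E a b
    · simp only [Cross, hlab' a (I.E_lt_left hE), hlab' b (I.E_lt_right hE)]
    · simp only [Cross, hE, false_and, and_false]
  refine vc_call (findCross_spec hc3) ?_
  rintro t4 s4 ⟨ht4, hc4, h40, h41⟩ hf4
  rw [ef3] at h40 h41
  have eo4 : s4.mem .ord = s.mem .ord := by rw [hf4.mem _ (by decide), eo3]
  have ef4 : s4.mem .fp = s.mem .fp := by rw [hf4.mem _ (by decide), ef3]
  have ep4 : s4.mem .pos = s.mem .pos := by rw [hf4.mem _ (by decide), ep3]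
  have ew4 : s4.mem .wit = s2.mem .wit := by rw [hf4.mem _ (by decide), ew3]
  refine ⟨fun hfd => ?_, fun hfd => ?_⟩
  · obtain ⟨a, b, hcr, ha, hb⟩ := h41 hfd
    rw [hcross] at hcr
    rw [← hlab' a (I.E_lt_left hcr.2.1)] at ha
    rw [← hlab' b (I.E_lt_right hcr.2.1)] at hb
    refine vc_call (choose_spec (t := t) hc4 (by rw [eo4, ef4]; exact hT)
      (by rw [eo4, ep4]; exact hpos) (by rw [eo4, ef4]; exact hL) ?_ (by rw [ef4]; exact hcr)
      ha hb) ?_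
    · rw [eo4, ef4, ew4]
      intro u hU hp
      have hun := hlt u (.inr hU)
      exact (hm.sound u hun ((hm.mem_iff hT hW hun).2 (.inr hU)) hp).2.2
    · rintro t5 s5 ⟨ht5, hc5, hW5, hA5⟩ hf5
      rw [eo4, ef4] at hA5
      refine ⟨by omega, hc5, fun h => ?_, fun _ => ⟨hW5, hA5⟩⟩
      rw [hf5.regs _ (by decide)] at h
      exact absurd h hfd
  · refine ⟨Nat.zero_le _, by omega, hc4.setR rfl, fun _ w hw => ?_, fun h => absurd hfd h⟩
    refine hL.not_alt hT.closed hT.root (fun a b hcr => ?_) hw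
    exact h40 hfd a b ((hcross a b).2 hcr)

end

/-! ### The stack -/

/-- The data that record the state of the enumeration: the stack `ord` of length `len` with its
indicator `pos`, the segment starts `seg`, the current and the initial parent function, the marks
of excluded arcs, and the flags of pending branches. -/
structure Stack where
  ord : ℕ → ℕ
  pos : ℕ → ℕ
  seg : ℕ → ℕ
  fp : ℕ → ℕ
  f0 : ℕ → ℕ
  exc : ℕ → ℕ
  fB : ℕ → ℕ
  fA : ℕ → ℕ
  len : ℕ

/-- The stack in a configuration. -/
def stk (s : Cf) : Stack :=
  ⟨s.mem .ord, s.mem .pos, s.mem .seg, s.mem .fp, s.mem .f0, s.mem .exc, s.mem .fB, s.mem .fA,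
    s.regs .len⟩

@[simp] theorem stk_ord (s : Cf) : (stk s).ord = s.mem .ord := rfl
@[simp] theorem stk_pos (s : Cf) : (stk s).pos = s.mem .pos := rfl
@[simp] theorem stk_seg (s : Cf) : (stk s).seg = s.mem .seg := rfl
@[simp] theorem stk_fp (s : Cf) : (stk s).fp = s.mem .fp := rfl
@[simp] theorem stk_f0 (s : Cf) : (stk s).f0 = s.mem .f0 := rfl
@[simp] theorem stk_exc (s : Cf) : (stk s).exc = s.mem .exc := rfl
@[simp] theorem stk_fB (s : Cf) : (stk s).fB = s.mem .fB := rfl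
@[simp] theorem stk_fA (s : Cf) : (stk s).fA = s.mem .fA := rfl
@[simp] theorem stk_len (s : Cf) : (stk s).len = s.regs .len := rfl

/-- The command leaves the stack alone. -/
def Cmd.calm (c : Cm) : Bool :=
  !c.wa .ord && !c.wa .pos && !c.wa .seg && !c.wa .fp && !c.wa .f0 && !c.wa .exc && !c.wa .fB &&
    !c.wa .fA && !c.wr .len

theorem stk_frame {c : Cm} {s s' : Cf} (hf : Frame c s s') (hc : c.calm = true) :
    stk s' = stk s := by
  simp only [Cmd.calm, Bool.and_eq_true, Bool.not_eq_true'] at hc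
  obtain ⟨⟨⟨⟨⟨⟨⟨⟨h1, h2⟩, h3⟩, h4⟩, h5⟩, h6⟩, h7⟩, h8⟩, h9⟩ := hc
  simp only [stk, hf.mem _ h1, hf.mem _ h2, hf.mem _ h3, hf.mem _ h4, hf.mem _ h5, hf.mem _ h6,
    hf.mem _ h7, hf.mem _ h8, hf.regs _ h9]

/-- There is an arc from `v` to `u` that is not excluded. -/
def Allowed (I : Inst) (D : Stack) (v u : ℕ) : Prop :=
  v < I.n ∧ ∃ j, I.off v ≤ j ∧ j < I.off (v + 1) ∧ I.adj j = u ∧ D.exc j = 0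

/-- The path of the segment that starts at position `s` can leave it at position `i` in another,
not excluded way. -/
def AltB (I : Inst) (D : Stack) (s i : ℕ) : Prop :=
  ∃ u, Allowed I D (D.ord i) u ∧ u ≠ D.fp (D.ord i) ∧
    Av I.E (Pre D.ord s) (fun z => ∃ l, s ≤ l ∧ l ≤ i ∧ D.ord l = z) u

theorem Allowed.E {I : Inst} {D : Stack} {v u : ℕ} (h : Allowed I D v u) : I.E v u :=
  ⟨h.1, h.2.imp fun _ h => ⟨h.1, h.2.1, h.2.2.1⟩⟩

/-- `D'` arises from `D` by pushing the first `k` vertices of the chain of `w`, up to the first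
vertex that is already on the stack, as part of the segment `s`. -/
structure Pushed (D : Stack) (w s k : ℕ) (D' : Stack) : Prop where
  len : D'.len = D.len + k
  old : ∀ i < D.len, D'.ord i = D.ord i
  new : ∀ j < k, D'.ord (D.len + j) = D.fp^[j] w
  off : ∀ j < k, ¬ Pre D.ord D.len (D.fp^[j] w)
  pos : ∀ u, D'.pos u ≠ 0 ↔ Pre D'.ord D'.len u
  segNew : ∀ j < k, D'.seg (D.fp^[j] w) = s
  segOld : ∀ u, (∀ j < k, D.fp^[j] w ≠ u) → D'.seg u = D.seg u
  fp : D'.fp = D.fp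
  f0 : D'.f0 = D.f0
  exc : D'.exc = D.exc
  fB : D'.fB = D.fB
  fA : D'.fA = D.fA

section

variable {μ : Mach} {I : Inst}

/-- The chain is pushed up to, and not including, its first vertex on the stack. -/
theorem pushPath_spec {s : Cf} {w sg : ℕ} (hc : Ctx μ I s) (hw : s.regs .w = w)
    (hsg : s.regs .s = sg)
    (hpos : ∀ u, s.mem .pos u ≠ 0 ↔ Pre (s.mem .ord) (s.regs .len) u)
    (hlt : ∀ i < s.regs .len, s.mem .ord i < I.n)
    (hinj : ∀ i < s.regs .len, ∀ j < s.regs .len, s.mem .ord i = s.mem .ord j → i = j)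
    (hroot : s.mem .fp I.root = I.root) (hrT : Pre (s.mem .ord) (s.regs .len) I.root)
    (hwr : ToRoot I.root (s.mem .fp) w) (hwn : ∀ j, (s.mem .fp)^[j] w < I.n) :
    vc μ pushPath (fun t s' => t ≤ 20 * I.n + 20 ∧ Ctx μ I s' ∧
      ∃ k, Pushed (stk s) w sg k (stk s') ∧
        Pre (s.mem .ord) (s.regs .len) ((s.mem .fp)^[k] w)) s := by
  have hbd := hc.bound
  obtain ⟨L, hL⟩ : ∃ L, s.regs .len = L := ⟨_, rfl⟩
  rw [hL] at hpos hlt hinj hrT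
  simp only [pushPath, vc, Expr.Idx, Expr.Small, Expr.eval, true_and, hw, hL]
  -- the entries of the extended stack are distinct
  have hlen : ∀ k, (∀ j < k, ¬ Pre (s.mem .ord) L ((s.mem .fp)^[j] w)) → L + k ≤ I.n := by
    intro k hk
    refine length_le_of_inj
      (que := fun i => if i < L then s.mem .ord i else (s.mem .fp)^[i - L] w) ?_ ?_
    · intro i hi
      split_ifs with h
      · exact hlt i h
      · exact hwn _
    · intro a ha b hb e
      split_ifs at e with h1 h2 h2
      · exact hinj a h1 b h2 e
      · exact absurd ⟨a, h1, e⟩ (hk (b - L) (by omega))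
      · exact absurd ⟨b, h2, e.symm⟩ (hk (a - L) (by omega))
      · have := chain_inj hroot hwr (fun j hj e' => hk j hj (by rw [e']; exact hrT))
          (a := a - L) (b := b - L) (i := k) (by omega) (by omega) e
        omega
  refine vc_loop_ghost (fun m s' => ∃ k, m + 12 * k = 12 * I.n ∧ s'.regs .z = (s.mem .fp)^[k] w ∧
      s'.regs .len = L + k ∧ (∀ i < L, s'.mem .ord i = s.mem .ord i) ∧
      (∀ j < k, s'.mem .ord (L + j) = (s.mem .fp)^[j] w) ∧
      (∀ j < k, ¬ Pre (s.mem .ord) L ((s.mem .fp)^[j] w)) ∧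
      (∀ u, s'.mem .pos u ≠ 0 ↔ Pre (s.mem .ord) L u ∨ ∃ j < k, (s.mem .fp)^[j] w = u) ∧
      (∀ j < k, s'.mem .seg ((s.mem .fp)^[j] w) = sg) ∧
      (∀ u, (∀ j < k, (s.mem .fp)^[j] w ≠ u) → s'.mem .seg u = s.mem .seg u))
    (12 * I.n) (by decide) ⟨0, by omega, by simp, by simp [hL], by simp, by simp, by simp,
      by simpa using hpos, by simp, by simp⟩ ?_ ?_
  · rintro m s1 ⟨k, hm, hz, hl, h1, h2, h3, h4, h5, h6⟩ hf
    refine ⟨by simp [Expr.Idx, Expr.Small], fun hlt' => ?_⟩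
    simp [Expr.eval, Op.eval, hz] at hlt'
    have efp : s1.mem .fp = s.mem .fp := by rw [hf.mem _ (by decide)]; simp
    have esg : s1.regs .s = sg := by rw [hf.regs _ (by decide)]; simp [hsg]
    have hnew : ¬ (Pre (s.mem .ord) L ((s.mem .fp)^[k] w) ∨
        ∃ j < k, (s.mem .fp)^[j] w = (s.mem .fp)^[k] w) := fun h => (h4 _).2 h hlt'
    have h3' : ∀ j < k + 1, ¬ Pre (s.mem .ord) L ((s.mem .fp)^[j] w) := by
      intro j hj
      rcases Nat.lt_succ_iff_lt_or_eq.1 hj with h | rfl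
      · exact h3 j h
      · exact fun h => hnew (.inl h)
    have hle := hlen (k + 1) h3'
    simp only [inc, vc, Expr.Idx, Expr.Small, Expr.eval, Op.eval, true_and, Config.setR_regs,
      Config.setR_mem, if_true, Config.setA_mem, Config.setA_regs, reduceCtorEq, if_false, hz, hl,
      efp, esg]
    refine ⟨by omega, by omega, 12 * (I.n - (k + 1)), ⟨k + 1, by omega, ?_, by omega, ?_, ?_, h3',
      ?_, ?_, ?_⟩, by omega⟩
    · rw [Function.iterate_succ_apply']
    · intro i hi
      rw [Function.update_of_ne (by omega)]; exact h1 i hi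
    · intro j hj
      rcases Nat.lt_succ_iff_lt_or_eq.1 hj with h | rfl
      · rw [Function.update_of_ne (by omega)]; exact h2 j h
      · rw [Function.update_self]
    · intro u
      rw [Function.update_apply]
      split_ifs with h
      · subst h
        simp only [ne_eq, one_ne_zero, not_false_eq_true, true_iff]
        exact .inr ⟨k, by omega, rfl⟩
      · rw [h4 u]
        refine or_congr Iff.rfl ⟨fun ⟨j, hj, e⟩ => ⟨j, by omega, e⟩, fun ⟨j, hj, e⟩ => ?_⟩
        rcases Nat.lt_succ_iff_lt_or_eq.1 hj with h' | rfl
        · exact ⟨j, h', e⟩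
        · exact absurd e.symm h
    · intro j hj
      rw [Function.update_apply]
      split_ifs with h
      · rfl
      · rcases Nat.lt_succ_iff_lt_or_eq.1 hj with h' | rfl
        · exact h5 j h'
        · exact absurd rfl h
    · intro u hu
      rw [Function.update_of_ne (fun e => hu k (by omega) e.symm)]
      exact h6 u fun j hj => hu j (by omega)
  · rintro t m s1 ⟨k, hm, hz, hl, h1, h2, h3, h4, h5, h6⟩ h0 ht hf
    simp [Expr.eval, Op.eval, hz] at h0
    have hjoin := (h4 _).1 h0
    refine ⟨by omega, (hc.setR (x := .z) (v := w) rfl).frame hf (by decide), k,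
      ⟨?_, ?_, ?_, ?_, ?_, h5, h6, ?_, ?_, ?_, ?_, ?_⟩, ?_⟩
    · simp [hl, hL]
    · simpa [hL] using h1
    · simpa [hL] using h2
    · simpa [hL] using h3
    · intro u
      simp only [stk_pos, h4 u, stk_ord, stk_len, hl]
      constructor
      · rintro (⟨i, hi, rfl⟩ | ⟨j, hj, rfl⟩)
        · exact ⟨i, by omega, h1 i hi⟩
        · exact ⟨L + j, by omega, h2 j hj⟩
      · rintro ⟨i, hi, rfl⟩
        rcases lt_or_ge i L with h | h
        · exact .inl ⟨i, h, (h1 i h).symm⟩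
        · exact .inr ⟨i - L, by omega, by rw [← h2 (i - L) (by omega)]; congr 1; omega⟩
    all_goals try (simp only [stk_fp, stk_f0, stk_exc, stk_fB, stk_fA];
                       rw [hf.mem _ (by decide)]; simp)
    rcases hjoin with h | ⟨j, hj, e⟩
    · exact h
    · have hne : ∀ j < k, (s.mem .fp)^[j] w ≠ I.root := fun j hj e' =>
        h3 j hj (by rw [e']; exact hrT)
      refine absurd ?_ (hne j hj)
      refine (hwr.iterate hroot j).eq_root hroot (c := k - j - 1) ?_
      rw [← Function.iterate_add_apply, show k - j - 1 + 1 + j = k by omega]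
      exact e.symm

/-- A finished search remains one when a blocked vertex is released and becomes a new source. -/
theorem Search.addSource {Src : ℕ → Prop} {lab que np : ℕ → ℕ} {tail v m : ℕ}
    (h : Search I Src lab que np tail tail) (hv : lab v = 1) (hvn : v < I.n) (hm : 2 ≤ m) :
    Search I (fun u => Src u ∨ u = v) (Function.update lab v m) (Function.update que tail v) np
      tail (tail + 1) := by
  have hne : ∀ i < tail, que i ≠ v := fun i hi e => by
    have := h.que_lab hi; rw [e] at this; omega
  have hlab : ∀ u, u ≠ v → Function.update lab v m u = lab u := fun u hu =>
    Function.update_of_ne hu _ _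
  have hque : ∀ i < tail, Function.update que tail v i = que i := fun i hi =>
    Function.update_of_ne (by omega) _ _
  refine ⟨by omega, ?_, ?_, ?_, ?_, ?_, ?_⟩
  · intro i hi
    rcases Nat.lt_succ_iff_lt_or_eq.1 hi with h' | rfl
    · rw [hque i h']; exact h.lt i h'
    · rw [Function.update_self]; exact hvn
  · intro a ha b hb e
    rcases Nat.lt_succ_iff_lt_or_eq.1 ha with ha | rfl <;>
      rcases Nat.lt_succ_iff_lt_or_eq.1 hb with hb | rfl
    · rw [hque a ha, hque b hb] at e; exact h.inj a ha b hb e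
    · rw [hque a ha, Function.update_self] at e; exact absurd e (hne a ha)
    · rw [hque b hb, Function.update_self] at e; exact absurd e.symm (hne b hb)
    · rfl
  · intro u hu
    by_cases huv : u = v
    · subst huv
      simp only [Function.update_self, hm, true_iff]
      exact ⟨tail, by omega, by simp⟩
    · rw [hlab u huv, h.mem u hu]
      constructor
      · rintro ⟨i, hi, e⟩; exact ⟨i, by omega, by rw [hque i hi]; exact e⟩
      · rintro ⟨i, hi, e⟩
        rcases Nat.lt_succ_iff_lt_or_eq.1 hi with h' | rfl
        · rw [hque i h'] at e; exact ⟨i, h', e⟩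
        · rw [Function.update_self] at e; exact absurd e.symm huv
  · rintro u (hu | rfl)
    · have := h.sub u hu
      rw [hlab u (by rintro rfl; omega)]; exact this
    · rw [Function.update_self]; exact hm
  · intro i hi w hw
    rw [hque i hi] at hw
    have := h.done i hi w hw
    rw [Function.update_apply]; split_ifs
    · omega
    · exact this
  · intro i hi
    rcases Nat.lt_succ_iff_lt_or_eq.1 hi with h' | rfl
    · rw [hque i h']
      rcases h.src i h' with h1 | ⟨h1, i', hi', h3, h4, h5⟩
      · exact .inl (.inl h1)
      · refine .inr ⟨fun h2 => h2.elim h1 (hne i h'), i', hi', ?_⟩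
        rw [hque i' (hi'.trans h'), hlab _ (hne i h'), hlab _ (hne i' (hi'.trans h'))]
        exact ⟨h3, h4, h5⟩
    · rw [Function.update_self]; exact .inl (.inr rfl)

attribute [local simp] SearchAt GrownAt

/-- Position `i` can be left iff `ord i` has an admissible arc to a vertex that is found when the
positions from `i` on are still blocked in the search from the subtree: the vertices of the path
after position `i` have been released by then, and those up to `i` have not. -/
theorem setFlags_spec {s : Cf} {sg j0 L : ℕ} (hc : Ctx μ I s) (hsg : s.regs .s = sg)
    (hj0 : s.regs .j0 = j0) (hL : s.regs .len = L) (h0 : sg ≤ j0) (h1 : j0 ≤ L)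
    (hlt : ∀ i < L, s.mem .ord i < I.n)
    (hinj : ∀ i < L, ∀ j < L, s.mem .ord i = s.mem .ord j → i = j)
    (hup : ∀ l, sg ≤ l → l < L → I.E (s.mem .ord l) (s.mem .fp (s.mem .ord l)) ∧
      (Pre (s.mem .ord) sg (s.mem .fp (s.mem .ord l)) ∨
        l + 1 < L ∧ s.mem .fp (s.mem .ord l) = s.mem .ord (l + 1))) :
    vc μ setFlags (fun t s' => t ≤ 100 * (I.off I.n + I.n) + 100 ∧ Ctx μ I s' ∧
      (∀ i, j0 ≤ i → i < L → (s'.mem .fB (s.mem .ord i) ≠ 0 ↔ AltB I (stk s) sg i)) ∧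
      (∀ u, (∀ i, j0 ≤ i → i < L → s.mem .ord i ≠ u) → s'.mem .fB u = s.mem .fB u)) s := by
  have hbd := hc.bound
  have hLn : L ≤ I.n := length_le_of_inj hlt hinj
  -- released parts of the path are connected to the subtree
  have hrel : ∀ c, ∀ d, d ≤ L → c + d = L → ∀ l, sg ≤ l → c ≤ l → l < L →
      Av I.E (Pre (s.mem .ord) sg) (fun z => ∃ l, sg ≤ l ∧ l < c ∧ s.mem .ord l = z)
        (s.mem .ord l) := by
    intro c d hd hcd l
    induction hm : L - l generalizing l with
    | zero => intro _ _ _; omega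
    | succ m ih =>
      intro h2 h3 h4
      obtain ⟨h5, h6⟩ := hup l h2 h4
      refine .step ?_ h5 ?_
      · rintro ⟨l', -, h8, h9⟩
        have := hinj l' (by omega) l h4 h9
        omega
      · rcases h6 with h6 | ⟨h6, h7⟩
        · exact .base h6
        · rw [h7]; exact ih (l + 1) (by omega) (by omega) (by omega) h6
  unfold setFlags
  simp only [vc, Expr.Idx, Expr.Small, Expr.eval, true_and, hsg, hL, Config.setR_regs,
    reduceCtorEq, if_false]
  set s1 := (s.setR .t sg).setR .hi L with hs1
  have hc1 : Ctx μ I s1 := (hc.setR rfl).setR rfl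
  refine vc_call (initSearch_spec (t := sg) (hi := L) hc1 (by simp [hs1]) (by simp [hs1])
    (h0.trans h1) (by simpa [hs1] using hlt) (by simpa [hs1] using hinj)) ?_
  have eo1 : s1.mem .ord = s.mem .ord := by simp [hs1]
  rw [eo1]
  rintro t2 s2 ⟨ht2, hc2, hT2, hP2, hO2, hse2, hhd2, htl2, hq2⟩ hf2
  refine vc_call (explore_spec (Src := Pre (s.mem .ord) sg) hc2
    (by rw [hhd2, htl2]; exact hse2)) ?_
  rintro t3 s3 ⟨hse3, hhd3, hg3, ht3, hc3⟩ hf3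
  simp only [hhd2, Inst.spent, Finset.range_zero, Finset.sum_empty] at ht3
  have el3 : s3.regs .len = L := by
    rw [hf3.regs _ (by decide), hf2.regs _ (by decide)]; simp [hs1, hL]
  simp only [el3]
  have eo3 : s3.mem .ord = s.mem .ord := by
    rw [hf3.mem _ (by decide), hf2.mem _ (by decide), eo1]
  have hone3 : ∀ u < I.n, s3.mem .lab u = 1 ↔ ∃ l, sg ≤ l ∧ l < L ∧ s.mem .ord l = u := by
    intro u hu
    by_cases hz : s2.mem .lab u = 0
    · refine iff_of_false (hg3.new u hz) ?_
      rintro ⟨l, h2, h3, rfl⟩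
      have := hP2 l h2 h3; omega
    · rw [hg3.lab_eq u hz]
      constructor
      · intro h
        by_cases hp : Pre (s.mem .ord) L u
        · obtain ⟨l, hl, rfl⟩ := hp
          refine ⟨l, ?_, hl, rfl⟩
          by_contra hcon
          have := hT2 l (by omega); omega
        · have := hO2 u hu hp; omega
      · rintro ⟨l, h2, h3, rfl⟩; exact hP2 l h2 h3
  have hspent : ∀ {Src : ℕ → Prop} {s' : Cf} {dn tail : ℕ}, SearchAt I Src s' dn tail →
      I.spent (s'.mem .que) tail ≤ I.off I.n + I.n := fun h => I.spent_le h.lt h.inj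
  have hsp3 := hspent hse3
  have hspL : I.spent (s.mem .ord) L ≤ I.off I.n + I.n := I.spent_le hlt hinj
  refine vc_loop (fun s' => ∃ c, s'.regs .i = c ∧ j0 ≤ c ∧ c ≤ L ∧
      SearchAt I (fun u => Pre (s.mem .ord) sg u ∨ ∃ l, c ≤ l ∧ l < L ∧ s.mem .ord l = u) s'
        (s'.regs .tail) (s'.regs .tail) ∧ s'.regs .head = s'.regs .tail ∧
      (∀ u < I.n, s'.mem .lab u = 1 ↔ ∃ l, sg ≤ l ∧ l < c ∧ s.mem .ord l = u) ∧
      (∀ i, c ≤ i → i < L → (s'.mem .fB (s.mem .ord i) ≠ 0 ↔ AltB I (stk s) sg i)) ∧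
      (∀ u, (∀ i, c ≤ i → i < L → s.mem .ord i ≠ u) → s'.mem .fB u = s.mem .fB u))
    (fun s' => 20 * (I.off I.n + I.n - I.spent (s'.mem .que) (s'.regs .tail)) +
      30 * I.spent (s.mem .ord) (s'.regs .i)) (by decide)
    ⟨L, by simp, h1, le_rfl, ?_, by simpa using hhd3, by simpa using hone3, fun i _ _ => by omega,
      fun u _ => ?_⟩ ?_ ?_
  · have he : (fun u => Pre (s.mem .ord) sg u ∨ ∃ l, L ≤ l ∧ l < L ∧ s.mem .ord l = u) =
        Pre (s.mem .ord) sg := by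
      funext u
      refine propext (or_iff_left ?_)
      rintro ⟨l, h2, h3, -⟩; omega
    rw [he]; simpa using hse3
  · simp only [Config.setR_mem]
    rw [hf3.mem _ (by decide), hf2.mem _ (by decide)]; simp [hs1]
  · rintro s4 ⟨c, hi, hjc, hcL, hse, hhd, hone, hfl, hfr⟩ hf -
    have hc4 : Ctx μ I s4 := (hc3.setR (x := .i) (v := L) rfl).frame hf (by decide)
    have ej : s4.regs .j0 = j0 := by
      rw [hf.regs _ (by decide)]
      simp [hf3.regs .j0 (by decide), hf2.regs .j0 (by decide), hs1, hj0]
    have eo : s4.mem .ord = s.mem .ord := by rw [hf.mem _ (by decide)]; simpa using eo3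
    have efp : s4.mem .fp = s.mem .fp := by
      rw [hf.mem _ (by decide)]
      simp [hf3.mem .fp (by decide), hf2.mem .fp (by decide), hs1]
    have eex : s4.mem .exc = s.mem .exc := by
      rw [hf.mem _ (by decide)]
      simp [hf3.mem .exc (by decide), hf2.mem .exc (by decide), hs1]
    refine ⟨by simp [Expr.Idx], fun hlt' => ?_⟩
    simp [Expr.eval, Op.eval, hi, ej] at hlt'
    obtain ⟨b, rfl⟩ : ∃ b, c = b + 1 := ⟨c - 1, by omega⟩
    simp only [vc, Expr.Idx, Expr.Small, Expr.eval, Op.eval, true_and, Config.setR_regs,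
      Config.setR_mem, if_true, hi, Nat.add_sub_cancel, eo]
    obtain ⟨v, hv⟩ : ∃ v, s.mem .ord b = v := ⟨_, rfl⟩
    have hvn : v < I.n := hv ▸ hlt b (by omega)
    simp only [hv]
    refine ⟨Nat.zero_le _, ?_⟩
    -- the search tells which alternatives exist
    have hav : ∀ u < I.n, 2 ≤ s4.mem .lab u ↔
        Av I.E (Pre (s.mem .ord) sg) (fun z => ∃ l, sg ≤ l ∧ l ≤ b ∧ s.mem .ord l = z) u := by
      intro u hu
      rw [hse.av_iff hone hu]
      constructor
      · intro h
        refine h.mono ?_ ?_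
        · rintro x (hx | ⟨l, h2, h3, rfl⟩)
          · exact .base hx
          · have := hrel (b + 1) (L - (b + 1)) (by omega) (by omega) l (by omega) h2 h3
            exact this.mono (fun _ => .base) fun x ⟨l, h4, h5, h6⟩ => ⟨l, h4, by omega, h6⟩
        · rintro x ⟨l, h4, h5, h6⟩; exact ⟨l, h4, by omega, h6⟩
      · intro h
        exact h.mono (fun _ h => .base (.inl h)) fun x ⟨l, h4, h5, h6⟩ => ⟨l, h4, by omega, h6⟩
    set s5 := ((s4.setR .i b).setR .v v).setR .fl 0 with hs5
    have hc5 : Ctx μ I s5 := ((hc4.setR rfl).setR rfl).setR rfl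
    refine vc_call (vc_forArcs (K := 3) (v := v)
      (fun j s' => s'.regs .fl ≠ 0 ↔ ∃ j', I.off v ≤ j' ∧ j' < j ∧ s.mem .exc j' = 0 ∧
        I.adj j' ≠ s.mem .fp v ∧ 2 ≤ s4.mem .lab (I.adj j'))
      (by decide) (by decide) hc5 (by simp [hs5]) hvn ?_ ?_ ?_) ?_
    · rintro j s' q m (rfl | rfl | rfl) h <;> simpa using h
    · simp only [hs5, Config.setR_regs, if_true, ne_eq, not_true_eq_false, false_iff]
      rintro ⟨j', h2, h3, -⟩; omega
    · rintro j s6 hj1 hj2 hinv hf6 hc6 hv6 hj hy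
      have e1 : s6.mem .exc = s.mem .exc := by rw [hf6.mem _ (by decide)]; simpa [hs5] using eex
      have e2 : s6.mem .fp = s.mem .fp := by rw [hf6.mem _ (by decide)]; simpa [hs5] using efp
      have e3 : s6.mem .lab = s4.mem .lab := by rw [hf6.mem _ (by decide)]; simp [hs5]
      simp only [vc, Expr.Idx, Expr.Small, Expr.eval, Op.eval, true_and, Config.setR_regs,
        if_true, hj, hy, hv6, e1, e2, e3, reduceCtorEq, if_false]
      refine ⟨fun h => ⟨by omega, by omega, ?_⟩, fun h => ⟨Nat.zero_le _, by omega, ?_⟩⟩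
      · simp at h
        simp only [ne_eq, one_ne_zero, not_false_eq_true, true_iff]
        exact ⟨j, hj1, by omega, by tauto, by tauto, by omega⟩
      · rw [hinv]
        constructor
        · rintro ⟨j', h2, h3, h4⟩; exact ⟨j', h2, by omega, h4⟩
        · rintro ⟨j', h2, h3, h4, h5, h6⟩
          rcases Nat.lt_succ_iff_lt_or_eq.1 h3 with h' | rfl
          · exact ⟨j', h2, h', h4, h5, h6⟩
          · exfalso
            simp [h4, h5, show 1 < s4.mem .lab (I.adj j') by omega] at h
    rintro t6 s6 ⟨ht6, hfl6, -, hc6⟩ hf6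
    have ei6 : s6.regs .i = b := by rw [hf6.regs _ (by decide)]; simp [hs5]
    have ev6 : s6.regs .v = v := by rw [hf6.regs _ (by decide)]; simp [hs5]
    have et6 : s6.regs .tail = s4.regs .tail := by rw [hf6.regs _ (by decide)]; simp [hs5]
    have eh6 : s6.regs .head = s4.regs .tail := by
      rw [hf6.regs _ (by decide)]; simp [hs5, hhd]
    have el6 : s6.mem .lab = s4.mem .lab := by rw [hf6.mem _ (by decide)]; simp [hs5]
    have eq6 : s6.mem .que = s4.mem .que := by rw [hf6.mem _ (by decide)]; simp [hs5]
    have en6 : s6.mem .np = s4.mem .np := by rw [hf6.mem _ (by decide)]; simp [hs5]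
    have ef6 : s6.mem .fB = s4.mem .fB := by rw [hf6.mem _ (by decide)]; simp [hs5]
    have hfl6' : s6.regs .fl ≠ 0 ↔ AltB I (stk s) sg b := by
      rw [hfl6]
      constructor
      · rintro ⟨j', h2, h3, h4, h5, h6⟩
        refine ⟨I.adj j', ⟨by simpa [hv] using hvn, j', by simpa [hv] using h2,
          by simpa [hv] using h3, rfl, h4⟩, by simpa [hv] using h5, ?_⟩
        refine (hav _ (I.adj_lt j' ?_)).1 h6
        have := I.off_mono (u := v + 1) hvn le_rfl
        omega
      · rintro ⟨u, ⟨-, j', h2, h3, rfl, h4⟩, h5, h6⟩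
        simp only [stk_ord, stk_fp, hv] at h2 h3 h5
        refine ⟨j', h2, h3, h4, h5, (hav _ (I.adj_lt j' ?_)).2 h6⟩
        have := I.off_mono (u := v + 1) hvn le_rfl
        omega
    have hlv : s4.mem .lab v = 1 := (hone v hvn).2 ⟨b, by omega, by omega, hv⟩
    have hnew := hse.addSource hlv hvn (m := I.root + 2) (by omega)
    have htn := hnew.tail_le
    simp only [inc, vc, Expr.Idx, Expr.Small, Expr.eval, Op.eval, true_and, Config.setA_regs, ev6,
      hc6.rl, et6]
    refine ⟨by omega, ?_⟩
    set s7 := (((s6.setA .fB v (s6.regs .fl)).setA .lab v (I.root + 2)).setA .que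
      (s4.regs .tail) v).setR .tail (s4.regs .tail + 1) with hs7
    have hc7 : Ctx μ I s7 := (((hc6.setA (by decide)).setA (by decide)).setA (by decide)).setR rfl
    have hse7 : SearchAt I (fun u => (Pre (s.mem .ord) sg u ∨
        ∃ l, b + 1 ≤ l ∧ l < L ∧ s.mem .ord l = u) ∨ u = v) s7 (s7.regs .head)
        (s7.regs .tail) := by
      simpa [hs7, eh6, el6, eq6, en6] using hnew
    have hsrc : (fun u => (Pre (s.mem .ord) sg u ∨
        ∃ l, b + 1 ≤ l ∧ l < L ∧ s.mem .ord l = u) ∨ u = v) =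
        (fun u => Pre (s.mem .ord) sg u ∨ ∃ l, b ≤ l ∧ l < L ∧ s.mem .ord l = u) := by
      funext u
      refine propext ?_
      rw [or_assoc]
      refine or_congr Iff.rfl ⟨?_, ?_⟩
      · rintro (⟨l, h2, h3, h4⟩ | rfl)
        · exact ⟨l, by omega, h3, h4⟩
        · exact ⟨b, le_rfl, by omega, hv⟩
      · rintro ⟨l, h2, h3, h4⟩
        rcases Nat.lt_or_eq_of_le h2 with h | rfl
        · exact .inl ⟨l, h, h3, h4⟩
        · exact .inr (h4.symm.trans hv)
    refine vc_call (explore_spec hc7 hse7) ?_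
    rintro t8 s8 ⟨hse8, hhd8, hg8, ht8, hc8⟩ hf8
    have ei8 : s8.regs .i = b := by
      rw [hf8.regs _ (by decide)]; simp [hs7, ei6]
    have ef8 : s8.mem .fB = Function.update (s4.mem .fB) v (s6.regs .fl) := by
      rw [hf8.mem _ (by decide)]; simp [hs7, ef6]
    have elab7 : s7.mem .lab = Function.update (s4.mem .lab) v (I.root + 2) := by
      simp [hs7, el6]
    have hsp7 : I.spent (s7.mem .que) (s7.regs .head) = I.spent (s4.mem .que) (s4.regs .tail) := by
      simp only [hs7, Config.setR_regs, Config.setR_mem, Config.setA_regs, Config.setA_mem,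
        reduceCtorEq, if_false, if_true, eh6, eq6]
      exact I.spent_congr fun i hi => Function.update_of_ne (by omega) _ _
    rw [hsrc] at hse8
    refine ⟨⟨b, ei8, by omega, by omega, hse8, hhd8, ?_, ?_, ?_⟩, ?_⟩
    · intro u hu
      have h2 : s8.mem .lab u = 1 ↔ s7.mem .lab u = 1 := by
        by_cases hz : s7.mem .lab u = 0
        · exact iff_of_false (hg8.new u hz) (by omega)
        · rw [hg8.lab_eq u hz]
      rw [h2, elab7, Function.update_apply]
      split_ifs with h
      · refine iff_of_false (by omega) ?_
        rintro ⟨l, h3, h4, h5⟩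
        have := hinj l (by omega) b (by omega) (by rw [h5, hv, h])
        omega
      · rw [hone u hu]
        constructor
        · rintro ⟨l, h3, h4, h5⟩
          rcases Nat.lt_succ_iff_lt_or_eq.1 h4 with h' | rfl
          · exact ⟨l, h3, h', h5⟩
          · exact absurd (h5.symm.trans hv) h
        · rintro ⟨l, h3, h4, h5⟩; exact ⟨l, h3, by omega, h5⟩
    · intro i h2 h3
      rw [ef8]
      rcases Nat.lt_or_eq_of_le h2 with h | rfl
      · rw [Function.update_of_ne]
        · exact hfl i h h3
        · intro e
          have := hinj i h3 b (by omega) (e.trans hv.symm)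
          omega
      · rw [hv, Function.update_self]; exact hfl6'
    · intro u hu
      rw [ef8, Function.update_of_ne (fun e => hu b le_rfl (by omega) (hv.trans e.symm))]
      exact hfr u fun i h2 h3 => hu i (by omega) h3
    · rw [hsp7] at ht8
      have h2 := hspent hse8
      have h3 := hspent hse
      have h4 : I.spent (s.mem .ord) (b + 1) = I.spent (s.mem .ord) b + (I.deg v + 1) := by
        rw [I.spent_succ, hv]
      rw [ei8, h4]
      omega
  · rintro t4 s4 ⟨c, hi, hjc, hcL, hse, hhd, hone, hfl, hfr⟩ h04 ht4 hf
    have hc4 : Ctx μ I s4 := (hc3.setR (x := .i) (v := L) rfl).frame hf (by decide)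
    have ej : s4.regs .j0 = j0 := by
      rw [hf.regs _ (by decide)]
      simp [hf3.regs .j0 (by decide), hf2.regs .j0 (by decide), hs1, hj0]
    simp [Expr.eval, Op.eval, hi, ej] at h04
    obtain rfl : c = j0 := by omega
    refine ⟨?_, hc4, hfl, hfr⟩
    simp only [Config.setR_mem, Config.setR_regs, if_true, reduceCtorEq, if_false] at ht4
    simp only [Inst.spent] at ht3 ht4 hsp3 hspL
    omega

end

/-! ### The invariant of the enumeration -/

variable {I : Inst}

/-- Position `i` of the stack belongs to a segment: a path of the current tree that starts at a
terminal, on top of a subtree. -/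
structure OnSegment (I : Inst) (D : Stack) (i : ℕ) : Prop where
  one_le : 1 ≤ D.seg (D.ord i)
  le : D.seg (D.ord i) ≤ i
  start : I.W (D.ord (D.seg (D.ord i)))
  next : ∀ l, D.seg (D.ord i) ≤ l → l < i → D.fp (D.ord l) = D.ord (l + 1) ∧
    I.E (D.ord l) (D.ord (l + 1)) ∧ D.seg (D.ord l) = D.seg (D.ord i)
  closed : Closed I.E I.root D.fp (Pre D.ord (D.seg (D.ord i)))

/-- The solution follows the current tree on the first `i` vertices of the stack. -/
def Agree (D : Stack) (i : ℕ) (f : ℕ → ℕ) : Prop := ∀ u, Pre D.ord i u → f u = D.fp u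

/-- The solutions of the branch of the first kind at position `i`: they follow the current tree
below `i`, and leave `i` by another arc, not excluded. -/
def SolB (I : Inst) (D : Stack) (i : ℕ) (f : ℕ → ℕ) : Prop :=
  Agree D i f ∧ f (D.ord i) ≠ D.fp (D.ord i) ∧ Allowed I D (D.ord i) (f (D.ord i))

open Classical in
/-- The current tree on the first `i` vertices of the stack, completed by the initial one. -/
noncomputable def treeAt (D : Stack) (i : ℕ) (u : ℕ) : ℕ :=
  if Pre D.ord i u then D.fp u else D.f0 u

/-- The first `i` vertices of the stack, and the chain of the next one in `treeAt D i`. -/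
def treeSet (D : Stack) (i : ℕ) (u : ℕ) : Prop :=
  Pre D.ord i u ∨ ∃ k, (treeAt D i)^[k] (D.ord i) = u

/-- The solutions of the branch of the second kind at position `i`: they contain the subtree
`treeSet D i`, and differ from the tree `treeAt D i`, which has been output already. -/
def SolA (I : Inst) (D : Stack) (i : ℕ) (f : ℕ → ℕ) : Prop :=
  (∀ u, treeSet D i u → f u = treeAt D i u) ∧ f ≠ prune I.W (treeAt D i)

/-- The test for further completions of the subtree `treeSet D i` succeeds. -/
def AltA (I : Inst) (D : Stack) (i : ℕ) : Prop :=
  ∃ w, I.W w ∧ Alt I.E (treeSet D i) (treeAt D i) w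

/-- The initial parent function describes a spanning tree of a component that contains all
terminals. -/
def Initial (I : Inst) (f : ℕ → ℕ) : Prop :=
  ∃ Rd : ℕ → Prop, Spanning I.E I.root Rd f ∧ ∀ w, I.W w → Rd w

/-- The invariant of the stack; the flags of the first kind have to be right only up to
position `b`. -/
structure Valid (I : Inst) (D : Stack) (b : ℕ) : Prop where
  len_pos : 1 ≤ D.len
  lt : ∀ i < D.len, D.ord i < I.n
  inj : ∀ i < D.len, ∀ j < D.len, D.ord i = D.ord j → i = j
  head : D.ord 0 = I.root
  pos : ∀ u, D.pos u ≠ 0 ↔ Pre D.ord D.len u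
  initial : Initial I D.f0
  root : D.fp I.root = I.root
  clean : ∀ u, ¬ Pre D.ord D.len u → D.fp u = D.f0 u ∧ D.fB u = 0 ∧ D.fA u = 0
  cleanArc : ∀ u, ¬ Pre D.ord D.len u → ∀ j, I.off u ≤ j → j < I.off (u + 1) → D.exc j = 0
  seg : ∀ i, 1 ≤ i → i < D.len → OnSegment I D i
  flagB : ∀ i < b, D.fB (D.ord i) ≠ 0 → 1 ≤ i ∧ AltB I D (D.seg (D.ord i)) i
  flagA : ∀ i < D.len, D.fA (D.ord i) ≠ 0 → 1 ≤ i ∧ D.seg (D.ord i) = i ∧ AltA I D i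

/-- The vertices on the stack form a subtree. -/
abbrev Complete (I : Inst) (D : Stack) : Prop := Closed I.E I.root D.fp (Pre D.ord D.len)

/-- `1` or `0` according to whether the proposition holds. -/
noncomputable def ind (p : Prop) : ℕ := open Classical in if p then 1 else 0

theorem ind_true {p : Prop} (h : p) : ind p = 1 := if_pos h
theorem ind_false {p : Prop} (h : ¬ p) : ind p = 0 := if_neg h
theorem ind_congr {p q : Prop} (h : p ↔ q) : ind p = ind q := by rw [propext h]

theorem ind_split {p q : Prop} : ind p = ind (p ∧ ¬ q) + ind (p ∧ q) := by
  by_cases hp : p <;> by_cases hq : q <;> simp [ind, hp, hq]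

/-- The number of pending branches that contain the solution `f`; those of the first kind are
counted up to position `b`. -/
noncomputable def pend (I : Inst) (D : Stack) (b : ℕ) (f : ℕ → ℕ) : ℕ :=
  ∑ i ∈ Finset.range b, ind (D.fB (D.ord i) ≠ 0 ∧ SolB I D i f) +
    ∑ i ∈ Finset.range D.len, ind (D.fA (D.ord i) ≠ 0 ∧ SolA I D i f)

/-! ### Dependence on the lower part of the stack -/

/-- The stacks coincide on the first `m` positions. -/
structure Same (I : Inst) (D D' : Stack) (m : ℕ) : Prop where
  f0 : D'.f0 = D.f0
  ord : ∀ l < m, D'.ord l = D.ord l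
  fp : ∀ l < m, D'.fp (D.ord l) = D.fp (D.ord l)
  seg : ∀ l < m, D'.seg (D.ord l) = D.seg (D.ord l)
  fA : ∀ l < m, D'.fA (D.ord l) = D.fA (D.ord l)
  fB : ∀ l < m, D'.fB (D.ord l) = D.fB (D.ord l)
  exc : ∀ l < m, ∀ j, I.off (D.ord l) ≤ j → j < I.off (D.ord l + 1) → D'.exc j = D.exc j

section

variable {D D' : Stack} {m i : ℕ} {f : ℕ → ℕ}

theorem Same.pre (h : Same I D D' m) (hi : i ≤ m) (u : ℕ) : Pre D'.ord i u ↔ Pre D.ord i u :=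
  Pre.congr fun l hl => h.ord l (by omega)

theorem Same.fp_pre (h : Same I D D' m) (hi : i ≤ m) {u : ℕ} (hu : Pre D.ord i u) :
    D'.fp u = D.fp u := by
  obtain ⟨l, hl, rfl⟩ := hu
  exact h.fp l (by omega)

theorem Same.agree (h : Same I D D' m) (hi : i ≤ m) : Agree D' i f ↔ Agree D i f := by
  constructor
  · intro h1 u hu
    rw [h1 u ((h.pre hi u).2 hu), h.fp_pre hi hu]
  · intro h1 u hu
    rw [h.pre hi u] at hu
    rw [h1 u hu, h.fp_pre hi hu]

theorem Same.allowed (h : Same I D D' m) (hi : i < m) (u : ℕ) :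
    Allowed I D' (D'.ord i) u ↔ Allowed I D (D.ord i) u := by
  rw [h.ord i hi]
  refine and_congr Iff.rfl (exists_congr fun j => and_congr_right fun h1 =>
    and_congr_right fun h2 => and_congr Iff.rfl ?_)
  rw [h.exc i hi j h1 h2]

theorem Same.solB (h : Same I D D' m) (hi : i < m) : SolB I D' i f ↔ SolB I D i f := by
  rw [SolB, SolB, h.agree hi.le, h.allowed hi, h.ord i hi, h.fp i hi]

theorem Same.treeAt (h : Same I D D' m) (hi : i ≤ m) : treeAt D' i = treeAt D i := by
  funext u
  by_cases hu : Pre D.ord i u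
  · rw [SteinerEnum.treeAt, SteinerEnum.treeAt, if_pos hu, if_pos ((h.pre hi u).2 hu),
      h.fp_pre hi hu]
  · rw [SteinerEnum.treeAt, SteinerEnum.treeAt, if_neg hu, if_neg (mt (h.pre hi u).1 hu), h.f0]

theorem Same.treeSet (h : Same I D D' m) (hi : i ≤ m) (ho : D'.ord i = D.ord i) :
    treeSet D' i = treeSet D i := by
  funext u
  rw [SteinerEnum.treeSet, SteinerEnum.treeSet, h.treeAt hi, ho]
  exact propext (or_congr (h.pre hi u) Iff.rfl)

theorem Same.solA (h : Same I D D' m) (hi : i ≤ m) (ho : D'.ord i = D.ord i) :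
    SolA I D' i f ↔ SolA I D i f := by
  rw [SolA, SolA, h.treeSet hi ho, h.treeAt hi]

theorem Same.altA (h : Same I D D' m) (hi : i ≤ m) (ho : D'.ord i = D.ord i) :
    AltA I D' i ↔ AltA I D i := by
  rw [AltA, AltA, h.treeSet hi ho, h.treeAt hi]

theorem Same.altB (h : Same I D D' m) (hi : i < m) {s : ℕ} (hs : s ≤ i) :
    AltB I D' s i ↔ AltB I D s i := by
  have h1 : Pre D'.ord s = Pre D.ord s := funext fun u => propext (h.pre (by omega) u)
  have h2 : (fun z => ∃ l, s ≤ l ∧ l ≤ i ∧ D'.ord l = z) =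
      (fun z => ∃ l, s ≤ l ∧ l ≤ i ∧ D.ord l = z) := by
    funext z
    refine propext (exists_congr fun l => and_congr_right fun _ => and_congr_right fun hl => ?_)
    rw [h.ord l (by omega)]
  refine exists_congr fun u => ?_
  rw [h.allowed hi, h1, h2, h.ord i hi, h.fp i hi]

theorem closed_same (h : Same I D D' m) (hi : i ≤ m) (hr : D.fp I.root = I.root)
    (hcl : Closed I.E I.root D.fp (Pre D.ord i)) : Closed I.E I.root D'.fp (Pre D'.ord i) :=
  hcl.congr hr (fun _ hu => h.fp_pre hi hu) (h.pre hi)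

theorem Same.onSegment (h : Same I D D' m) (hi : i < m) (hr : D.fp I.root = I.root)
    (ho : OnSegment I D i) : OnSegment I D' i := by
  have e : D'.seg (D'.ord i) = D.seg (D.ord i) := by rw [h.ord i hi, h.seg i hi]
  have hle := ho.le
  refine ⟨by rw [e]; exact ho.one_le, by rw [e]; exact hle, ?_, ?_, ?_⟩
  · rw [e, h.ord _ (by omega)]; exact ho.start
  · intro l h1 h2
    rw [e] at h1
    have := ho.next l h1 h2
    rw [e, h.ord l (by omega), h.ord (l + 1) (by omega), h.fp l (by omega), h.seg l (by omega)]
    exact this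
  · rw [e]
    exact closed_same h (by omega) hr ho.closed

/-! ### Consequences of the invariant -/

theorem Valid.le_n {b : ℕ} (h : Valid I D b) : D.len ≤ I.n := length_le_of_inj h.lt h.inj

theorem Valid.ne_root {b : ℕ} (h : Valid I D b) (h1 : 1 ≤ i) (hi : i < D.len) :
    D.ord i ≠ I.root := by
  rw [← h.head]
  intro e
  have := h.inj i hi 0 (by omega) e
  omega

theorem Valid.fp_lt {b : ℕ} (h : Valid I D b) (hc : Complete I D) :
    ∃ Rd : ℕ → Prop, (∀ w, I.W w → Rd w) ∧ (∀ u, Rd u → u < I.n) ∧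
      (∀ u v, Rd u → I.E u v → Rd v) ∧
      ∀ u, Rd u → ToRoot I.root D.fp u ∧ (u ≠ I.root → I.E u (D.fp u)) := by
  obtain ⟨Rd, hs, hW⟩ := h.initial
  have key := hc.spanning hs fun u hu => (h.clean u hu).1
  refine ⟨Rd, hW, fun u hu => ?_, hs.closed, key⟩
  by_cases hur : u = I.root
  · rw [hur]; exact I.root_lt
  · exact ((key u hu).2 hur).1

theorem Valid.tree {b : ℕ} (h : Valid I D b) (hc : Complete I D) : Tree I D.ord D.fp D.len := by
  obtain ⟨Rd, hW, hlt, hcl, key⟩ := h.fp_lt hc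
  refine ⟨h.len_pos, h.lt, h.inj, h.head, hc, h.root, fun w hw => (key w (hW w hw)).1, ?_⟩
  rintro u ⟨w, hw, k, rfl⟩ hur
  have : ∀ k, Rd (D.fp^[k] w) := by
    intro k
    induction k with
    | zero => exact hW w hw
    | succ k ih =>
      rw [Function.iterate_succ_apply']
      by_cases hr : D.fp^[k] w = I.root
      · rw [hr, h.root]; exact hW _ I.root_W
      · exact hcl _ _ ih ((key _ ih).2 hr)
  exact (key _ (this k)).2 hur

/-- The path from the start of the segment to position `i`. -/
theorem OnSegment.iterate (ho : OnSegment I D i) {g : ℕ → ℕ}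
    (hg : ∀ l, D.seg (D.ord i) ≤ l → l < i → g (D.ord l) = D.fp (D.ord l)) (d : ℕ)
    (hd : D.seg (D.ord i) + d ≤ i) :
    g^[d] (D.ord (D.seg (D.ord i))) = D.ord (D.seg (D.ord i) + d) := by
  induction d with
  | zero => rfl
  | succ d ih =>
    rw [Function.iterate_succ_apply', ih (by omega), hg _ (by omega) (by omega),
      (ho.next _ (by omega) (by omega)).1]
    rfl

theorem OnSegment.used (ho : OnSegment I D i) (ha : Agree D i f) : Used I.W f (D.ord i) := by
  have hle := ho.le
  refine ⟨_, ho.start, i - D.seg (D.ord i), ?_⟩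
  rw [ho.iterate (fun l _ hl => ha _ ⟨l, hl, rfl⟩) _ (by omega)]
  congr 1; omega

/-- A branch of the first kind that contains a solution has an alternative arc. -/
theorem OnSegment.altB_of_solB (ho : OnSegment I D i) (hr : D.ord i ≠ I.root)
    (hf : Sol I.E I.W I.root f) (hs : SolB I D i f) : AltB I D (D.seg (D.ord i)) i := by
  obtain ⟨h1, h2, h3⟩ := hs
  have hle := ho.le
  obtain ⟨s, hsd⟩ : ∃ s, D.seg (D.ord i) = s := ⟨_, rfl⟩
  have hcl := ho.closed
  have hst := ho.start
  have hnx := ho.next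
  rw [hsd] at hle hcl hst hnx ⊢
  refine ⟨f (D.ord i), h3, h2, ?_⟩
  have := hf.av hcl.root (p := fun l => D.ord (s + l)) (j := i - s) hst
    (fun l hl => by
      rw [h1 _ ⟨s + l, by omega, rfl⟩, (hnx (s + l) (by omega) (by omega)).1]; rfl)
    (by rwa [show s + (i - s) = i by omega])
  rw [show s + (i - s) = i by omega] at this
  refine this.mono (fun _ h => .base h) ?_
  rintro x ⟨l, h4, h5, rfl⟩
  exact ⟨l - s, by omega, by rw [show s + (l - s) = l by omega]⟩

theorem allowed_of_clean {v u : ℕ} (hE : I.E v u)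
    (hx : ∀ j, I.off v ≤ j → j < I.off (v + 1) → D.exc j = 0) : Allowed I D v u := by
  obtain ⟨h1, j, h2, h3, h4⟩ := hE
  exact ⟨h1, j, h2, h3, h4, hx j h2 h3⟩

/-- The solutions that follow the current tree below position `j` and leave it by an arc that is
not excluded are divided according to the first position, from `j` on, where they leave the
current tree. -/
theorem partition {L j : ℕ} (hjL : j < L)
    (hseg : ∀ l, j ≤ l → l < L → OnSegment I D l ∧ D.ord l ≠ I.root)
    (hfp : ∀ l, j ≤ l → l < L → Allowed I D (D.ord l) (D.fp (D.ord l)))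
    (hx : ∀ l, j < l → l < L →
      ∀ a, I.off (D.ord l) ≤ a → a < I.off (D.ord l + 1) → D.exc a = 0)
    (hf : Sol I.E I.W I.root f) :
    ind (Agree D j f ∧ Allowed I D (D.ord j) (f (D.ord j))) =
      ∑ l ∈ Finset.Ico j L, ind (SolB I D l f) + ind (Agree D L f) := by
  have step : ∀ l, j ≤ l → l < L → ind (Agree D l f ∧ Allowed I D (D.ord l) (f (D.ord l))) =
      ind (SolB I D l f) + ind (Agree D (l + 1) f) := by
    intro l h1 h2
    rw [ind_split (q := f (D.ord l) = D.fp (D.ord l))]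
    congr 1
    · refine ind_congr ?_
      rw [SolB]; tauto
    · refine ind_congr ⟨?_, ?_⟩
      · rintro ⟨⟨h3, -⟩, h4⟩ u hu
        rcases Pre.succ.1 hu with hu | rfl
        · exact h3 u hu
        · exact h4
      · intro h3
        have h4 := h3 _ ⟨l, by omega, rfl⟩
        exact ⟨⟨fun u hu => h3 u (hu.mono (by omega)), by rw [h4]; exact hfp l h1 h2⟩, h4⟩
  have step' : ∀ l, j < l → l < L → ind (Agree D l f) =
      ind (SolB I D l f) + ind (Agree D (l + 1) f) := by
    intro l h1 h2
    rw [← step l h1.le h2]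
    refine ind_congr (iff_self_and.2 fun h3 => allowed_of_clean ?_ (hx l h1 h2))
    exact hf.adj _ ((hseg l h1.le h2).1.used h3) (hseg l h1.le h2).2
  have key : ∀ d, j + 1 + d ≤ L →
      ind (Agree D j f ∧ Allowed I D (D.ord j) (f (D.ord j))) =
      ∑ l ∈ Finset.Ico j (j + 1 + d), ind (SolB I D l f) + ind (Agree D (j + 1 + d) f) := by
    intro d
    induction d with
    | zero =>
      intro _
      rw [step j le_rfl hjL, Finset.sum_Ico_succ_top (by omega)]; simp
    | succ d ih =>
      intro h
      rw [ih (by omega), step' (j + 1 + d) (by omega) (by omega),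
        show j + 1 + (d + 1) = (j + 1 + d) + 1 by omega, Finset.sum_Ico_succ_top (by omega)]
      omega
  have := key (L - (j + 1)) (by omega)
  rwa [show j + 1 + (L - (j + 1)) = L by omega] at this

end

/-! ### Popping -/

theorem Op.lt_eq_zero {a b : ℕ} : Op.lt.eval a b = 0 ↔ b ≤ a := by simp [Op.eval]

theorem Op.eq_eq_zero {a b : ℕ} : Op.eq.eval a b = 0 ↔ ¬ a = b := by simp [Op.eval]

theorem Op.mul_eq_zero {a b : ℕ} : Op.mul.eval a b = 0 ↔ a = 0 ∨ b = 0 := by simp [Op.eval]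

theorem Op.sub_eq {a b : ℕ} : Op.sub.eval a b = a - b := rfl

/-- Different vertices have disjoint adjacency lists. -/
theorem Inst.arc_unique (I : Inst) {u v j : ℕ} (hu : u < I.n) (hv : v < I.n) (h1 : I.off u ≤ j)
    (h2 : j < I.off (u + 1)) (h3 : I.off v ≤ j) (h4 : j < I.off (v + 1)) : u = v := by
  rcases lt_trichotomy u v with h | h | h
  · have := I.off_mono (u := u + 1) (v := v) h (by omega); omega
  · exact h
  · have := I.off_mono (u := v + 1) (v := u) h (by omega); omega

section

variable {μ : Mach} {I : Inst} {D D' : Stack} {m b : ℕ}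

/-- The part of the invariant that concerns the lower part of the stack. -/
theorem Valid.lower (h : Valid I D b) (hs : Same I D D' m) (hm : m ≤ D.len) :
    (∀ i, 1 ≤ i → i < m → OnSegment I D' i) ∧
    (∀ i < m, i < b → D'.fB (D'.ord i) ≠ 0 → 1 ≤ i ∧ AltB I D' (D'.seg (D'.ord i)) i) ∧
    (∀ i < m, D'.fA (D'.ord i) ≠ 0 → 1 ≤ i ∧ D'.seg (D'.ord i) = i ∧ AltA I D' i) := by
  refine ⟨fun i h1 hi => hs.onSegment hi h.root (h.seg i h1 (by omega)), fun i hi hb hf => ?_,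
    fun i hi hf => ?_⟩
  · rw [hs.ord i hi, hs.fB i hi] at hf
    obtain ⟨h1, h2⟩ := h.flagB i hb hf
    refine ⟨h1, ?_⟩
    rw [hs.ord i hi, hs.seg i hi, hs.altB hi (h.seg i h1 (by omega)).le]
    exact h2
  · rw [hs.ord i hi, hs.fA i hi] at hf
    obtain ⟨h1, h2, h3⟩ := h.flagA i (by omega) hf
    refine ⟨h1, ?_, ?_⟩
    · rw [hs.ord i hi, hs.seg i hi]; exact h2
    · rw [hs.altA hi.le (hs.ord i hi)]; exact h3

/-- `D'` arises from `D` by removing the top vertex and resetting what belongs to it. -/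
structure Popped (I : Inst) (D D' : Stack) : Prop where
  len : D'.len + 1 = D.len
  ord : D'.ord = D.ord
  seg : D'.seg = D.seg
  f0 : D'.f0 = D.f0
  fB : D'.fB = D.fB
  fA : D'.fA = D.fA
  pos : D'.pos = Function.update D.pos (D.ord D'.len) 0
  fp : D'.fp = Function.update D.fp (D.ord D'.len) (D.f0 (D.ord D'.len))
  exc : ∀ j, D'.exc j = if I.off (D.ord D'.len) ≤ j ∧ j < I.off (D.ord D'.len + 1) then 0
    else D.exc j

/-- Resetting the marks of the arcs costs time proportional to the degree of the popped vertex. -/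
theorem undoTop_spec {s : Cf} {L : ℕ} (hc : Ctx μ I s) (hL : s.regs .len = L + 1)
    (hlt : s.mem .ord L < I.n) :
    vc μ undoTop (fun t s' => t ≤ 9 * I.deg (s.mem .ord L) + 20 ∧ Ctx μ I s' ∧
      Popped I (stk s) (stk s')) s := by
  have hbd := hc.bound
  obtain ⟨v, hv⟩ : ∃ v, s.mem .ord L = v := ⟨_, rfl⟩
  rw [hv] at hlt ⊢
  simp only [undoTop, vc, Expr.Idx, Expr.Small, Expr.eval, Op.eval, true_and, hL,
    Nat.add_sub_cancel, hv, Config.setR_mem, Config.setR_regs, Config.setA_mem, Config.setA_regs,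
    if_true, reduceCtorEq, if_false]
  refine ⟨Nat.zero_le _, ?_⟩
  set s1 := ((s.setR .u v).setA .pos v 0).setA .fp v (s.mem .f0 v) with hs1
  have hc1 : Ctx μ I s1 := ((hc.setR rfl).setA (by decide)).setA (by decide)
  refine vc_call (vc_forArcs (K := 1) (v := v)
    (fun j s' => ∀ a, s'.mem .exc a = if I.off v ≤ a ∧ a < j then 0 else s.mem .exc a)
    (by decide) (by decide) hc1 (by simp [hs1]) hlt ?_ ?_ ?_) ?_
  · rintro j s' q x (rfl | rfl | rfl) h <;> simpa using h
  · intro a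
    rw [if_neg (by omega)]; simp [hs1]
  · rintro j s2 hj1 hj2 hinv hf2 hc2 hu hj hy
    simp only [vc, Expr.Idx, Expr.Small, Expr.eval, true_and, hj, Config.setA_mem, if_true]
    refine ⟨Nat.zero_le _, le_rfl, fun a => ?_⟩
    rw [Function.update_apply]
    by_cases h : a = j
    · rw [if_pos h, if_pos (by omega)]
    · rw [if_neg h, hinv a]
      refine if_congr ?_ rfl rfl
      omega
  rintro t2 s2 ⟨ht2, hinv, -, hc2⟩ hf2
  have hl2 : s2.regs .len = L + 1 := by rw [hf2.regs _ (by decide)]; simp [hs1, hL]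
  refine ⟨by omega, hc2.setR rfl, ?_⟩
  constructor <;> simp only [stk, Config.setR_regs, Config.setR_mem, if_true, hl2, hL,
    Nat.add_sub_cancel]
  case pos => rw [hf2.mem _ (by decide), hv]; simp [hs1]
  case fp => rw [hf2.mem _ (by decide), hv]; simp [hs1]
  case exc => rw [hv]; exact hinv
  all_goals (rw [hf2.mem _ (by decide)]; simp [hs1])

theorem Popped.same (hp : Popped I D D') (h : Valid I D b) : Same I D D' D'.len := by
  have hlen := hp.len
  have hne : ∀ l < D'.len, D.ord l ≠ D.ord D'.len := fun l hl e => by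
    have := h.inj l (by omega) D'.len (by omega) e; omega
  refine ⟨hp.f0, fun l _ => by rw [hp.ord], fun l hl => ?_, fun l _ => by rw [hp.seg],
    fun l _ => by rw [hp.fA], fun l _ => by rw [hp.fB], fun l hl j h1 h2 => ?_⟩
  · rw [hp.fp, Function.update_of_ne (hne l hl)]
  · rw [hp.exc, if_neg]
    rintro ⟨h3, h4⟩
    exact hne l hl (I.arc_unique (h.lt l (by omega)) (h.lt _ (by omega)) h1 h2 h3 h4)

/-- A vertex without pending branches can be removed from the stack. -/
theorem Popped.valid (hp : Popped I D D') (h : Valid I D D.len) (h2 : 2 ≤ D.len)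
    (hB : D.fB (D.ord D'.len) = 0) (hA : D.fA (D.ord D'.len) = 0) :
    Valid I D' D'.len ∧ ∀ f, pend I D' D'.len f = pend I D D.len f := by
  have hlen := hp.len
  have hs := hp.same h
  obtain ⟨l1, l2, l3⟩ := h.lower hs (by omega)
  have hpre : ∀ u, Pre D.ord D.len u ↔ Pre D'.ord D'.len u ∨ D.ord D'.len = u := by
    intro u; rw [← hlen, Pre.succ, hp.ord]
  have htop : ¬ Pre D.ord D'.len (D.ord D'.len) := by
    rintro ⟨l, hl, e⟩
    have := h.inj l (by omega) _ (by omega) e; omega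
  refine ⟨⟨by omega, ?_, ?_, ?_, ?_, ?_, ?_, ?_, ?_, l1, fun i hi => l2 i hi (by omega), l3⟩, ?_⟩
  · rw [hp.ord]; exact fun i hi => h.lt i (by omega)
  · rw [hp.ord]; exact fun i hi j hj => h.inj i (by omega) j (by omega)
  · rw [hp.ord]; exact h.head
  · intro u
    rw [hp.pos, Function.update_apply]
    split_ifs with hu
    · rw [hu, hp.ord]; simpa using htop
    · rw [h.pos, hpre]; exact or_iff_left (Ne.symm hu)
  · rw [hp.f0]; exact h.initial
  · rw [hp.fp, Function.update_of_ne]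
    · exact h.root
    · exact (h.ne_root (i := D'.len) (by omega) (by omega)).symm
  · intro u hu
    rw [hp.fp, hp.f0, hp.fB, hp.fA, Function.update_apply]
    split_ifs with he
    · subst he; exact ⟨rfl, hB, hA⟩
    · exact h.clean u fun h' => ((hpre u).1 h').elim hu (Ne.symm he)
  · intro u hu j h3 h4
    rw [hp.exc]
    split_ifs with he
    · rfl
    · refine h.cleanArc u (fun h' => ?_) j h3 h4
      rcases (hpre u).1 h' with h' | rfl
      · exact hu h'
      · exact he ⟨h3, h4⟩
  · intro f
    rw [pend, pend, ← hlen, Finset.sum_range_succ, Finset.sum_range_succ]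
    rw [ind_false (p := D.fB (D.ord D'.len) ≠ 0 ∧ _) (fun h => h.1 hB),
      ind_false (p := D.fA (D.ord D'.len) ≠ 0 ∧ _) (fun h => h.1 hA), add_zero, add_zero]
    congr 1 <;> refine Finset.sum_congr rfl fun i hi => ?_ <;> rw [Finset.mem_range] at hi
    · rw [hs.solB hi, hs.ord i hi, hs.fB i hi]
    · rw [hs.solA hi.le (hs.ord i hi), hs.ord i hi, hs.fA i hi]

/-- Some position has a pending branch of the first kind, and there are none of the second kind
above it. -/
def Promising (D : Stack) : Prop :=
  ∃ i < D.len, D.fB (D.ord i) ≠ 0 ∧ ∀ l, i < l → l < D.len → D.fA (D.ord l) = 0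

/-- The stack is reduced to its highest pending branch. Since each vertex is popped once, this takes
linear time. -/
theorem undo_spec {s : Cf} (hc : Ctx μ I s) (h : Valid I (stk s) (s.regs .len)) :
    vc μ undo (fun t s' => t ≤ 60 * (I.off I.n + I.n) + 60 ∧ Ctx μ I s' ∧
      Valid I (stk s') (s'.regs .len) ∧
      (∀ f, pend I (stk s') (s'.regs .len) f = pend I (stk s) (s.regs .len) f) ∧
      (s'.regs .len = 1 ∨ 2 ≤ s'.regs .len ∧
        (s'.mem .fB (s'.mem .ord (s'.regs .len - 1)) ≠ 0 ∨
          s'.mem .fA (s'.mem .ord (s'.regs .len - 1)) ≠ 0)) ∧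
      (Promising (stk s) → 2 ≤ s'.regs .len ∧
        s'.mem .fB (s'.mem .ord (s'.regs .len - 1)) ≠ 0)) s := by
  have hsp : ∀ {s' : Cf}, Valid I (stk s') (s'.regs .len) →
      I.spent (s'.mem .ord) (s'.regs .len) ≤ I.off I.n + I.n := fun h =>
    I.spent_le h.lt h.inj
  refine vc_loop (fun s' => Valid I (stk s') (s'.regs .len) ∧
      (∀ f, pend I (stk s') (s'.regs .len) f = pend I (stk s) (s.regs .len) f) ∧
      (Promising (stk s) → Promising (stk s')))
    (fun s' => 40 * I.spent (s'.mem .ord) (s'.regs .len)) (by decide)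
    ⟨h, fun _ => rfl, id⟩ ?_ ?_
  · rintro s1 ⟨hv, hp, hpr⟩ hf -
    have hc1 := hc.frame hf (by decide)
    refine ⟨by simp [Expr.Idx, Expr.Small], fun hlt => ?_⟩
    simp only [Expr.eval, Op.mul_eq_zero, Op.lt_eq_zero, Op.eq_eq_zero, Op.sub_eq, ne_eq, not_or,
      not_le, not_not] at hlt
    obtain ⟨L, hL⟩ : ∃ L, s1.regs .len = L + 1 := ⟨s1.regs .len - 1, by omega⟩
    rw [hL, Nat.add_sub_cancel] at hlt
    refine vc_mono (undoTop_spec hc1 hL (hv.lt L (by simp [hL]))) ?_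
    rintro t s2 ⟨ht, hc2, hpop⟩
    have hL2 : s2.regs .len = L := by have := hpop.len; simp [hL] at this; omega
    have eo : s2.mem .ord = s1.mem .ord := hpop.ord
    have eB : s2.mem .fB = s1.mem .fB := hpop.fB
    have eA : s2.mem .fA = s1.mem .fA := hpop.fA
    have hzB : s1.mem .fB (s1.mem .ord L) = 0 := by tauto
    have hzA : s1.mem .fA (s1.mem .ord L) = 0 := by tauto
    obtain ⟨hv2, hp2⟩ := hpop.valid hv (by simp only [stk_len]; omega)
      (by simpa [hL2] using hzB) (by simpa [hL2] using hzA)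
    refine ⟨⟨hv2, fun f => (hp2 f).trans (hp f), fun h' => ?_⟩, ?_⟩
    · obtain ⟨i, hi, h3, h4⟩ := hpr h'
      simp only [stk_len, stk_fB, stk_fA, stk_ord, hL] at hi h3 h4
      refine ⟨i, ?_, ?_, ?_⟩
      · simp only [stk_len, hL2]
        rcases Nat.lt_succ_iff_lt_or_eq.1 hi with h5 | rfl
        · exact h5
        · exact absurd hzB h3
      · simpa [eo, eB] using h3
      · intro l h5 h6
        simp only [stk_len, hL2] at h6
        simpa [eo, eA] using h4 l h5 (by omega)
    · rw [eo, hL2, hL, I.spent_succ]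
      omega
  · rintro t s' ⟨hv, hp, hpr⟩ h0 ht hf
    have hc1 := hc.frame hf (by decide)
    have hlp : 1 ≤ s'.regs .len := hv.len_pos
    have hend : s'.regs .len = 1 ∨ 2 ≤ s'.regs .len ∧
        (s'.mem .fB (s'.mem .ord (s'.regs .len - 1)) ≠ 0 ∨
          s'.mem .fA (s'.mem .ord (s'.regs .len - 1)) ≠ 0) := by
      simp only [Expr.eval, Op.mul_eq_zero, Op.lt_eq_zero, Op.eq_eq_zero, Op.sub_eq] at h0
      by_cases h1 : s'.regs .len = 1
      · exact .inl h1
      · refine .inr ⟨by omega, ?_⟩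
        by_contra hcon
        push Not at hcon
        have h2 : ¬ s'.regs .len ≤ 1 := by omega
        tauto
    refine ⟨?_, hc1, hv, hp, hend, fun h' => ?_⟩
    · have := hsp h; omega
    · obtain ⟨i, hi, h3, h4⟩ := hpr h'
      simp only [stk_len, stk_fB, stk_fA, stk_ord] at hi h3 h4
      have h5 := (hv.flagB i hi h3).1
      have h6 : 2 ≤ s'.regs .len := by omega
      refine ⟨h6, ?_⟩
      rcases Nat.lt_or_ge i (s'.regs .len - 1) with h7 | h7
      · have := h4 (s'.regs .len - 1) h7 (by omega)
        rcases hend with h8 | ⟨-, h8⟩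
        · omega
        · exact h8.resolve_right (by simp [this])
      · obtain rfl : i = s'.regs .len - 1 := by omega
        exact h3

end

/-! ### Pushing -/

section

variable {μ : Mach} {I : Inst} {D D' : Stack} {m b : ℕ}

/-- A stack that agrees with a valid one up to a position `m` in the last segment `sg` or at its
start, and is a path to the subtree below `sg` from there on, is valid. -/
theorem Valid.extend {b' sg : ℕ} (h : Valid I D b) (hs : Same I D D' m) (hm1 : 1 ≤ m)
    (hm : m ≤ D.len) (hmL : m ≤ D'.len) (hb' : b' ≤ m) (hb : b' ≤ b)
    (hlt : ∀ i < D'.len, D'.ord i < I.n)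
    (hinj : ∀ i < D'.len, ∀ j < D'.len, D'.ord i = D'.ord j → i = j)
    (hpos : ∀ u, D'.pos u ≠ 0 ↔ Pre D'.ord D'.len u)
    (hclean : ∀ u, ¬ Pre D'.ord D'.len u → D'.fp u = D'.f0 u ∧ D'.fB u = 0 ∧ D'.fA u = 0)
    (hcleanArc : ∀ u, ¬ Pre D'.ord D'.len u →
      ∀ j, I.off u ≤ j → j < I.off (u + 1) → D'.exc j = 0)
    (hsg1 : 1 ≤ sg) (hsg : sg ≤ m) (hst : I.W (D'.ord sg))
    (hcl : Closed I.E I.root D'.fp (Pre D'.ord sg))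
    (hseg : ∀ l, sg ≤ l → l < D'.len → D'.seg (D'.ord l) = sg)
    (hup : ∀ l, sg ≤ l → l < D'.len → I.E (D'.ord l) (D'.fp (D'.ord l)) ∧
      (l + 1 = D'.len ∧ Pre D'.ord sg (D'.fp (D'.ord l)) ∨
        l + 1 < D'.len ∧ D'.fp (D'.ord l) = D'.ord (l + 1)))
    (hA : ∀ l, m ≤ l → l < D'.len → D'.fA (D'.ord l) ≠ 0 → l = m ∧ sg = m ∧ AltA I D' m) :
    Valid I D' b' ∧ Complete I D' := by
  obtain ⟨l1, l2, l3⟩ := h.lower hs hm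
  have hhead : D'.ord 0 = I.root := (hs.ord 0 (by omega)).trans h.head
  have hroot : D'.fp I.root = I.root := by
    have := hs.fp 0 (by omega)
    rwa [h.head, h.root] at this
  have hup' : ∀ l, sg ≤ l → l < D'.len → Pre D'.ord D'.len (D'.fp (D'.ord l)) := by
    intro l h1 h2
    rcases (hup l h1 h2).2 with ⟨-, h3⟩ | ⟨h3, h4⟩
    · exact h3.mono (by omega)
    · exact ⟨l + 1, h3, h4.symm⟩
  refine ⟨⟨by omega, hlt, hinj, hhead, hpos, by rw [hs.f0]; exact h.initial, hroot, hclean,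
    hcleanArc, ?_, fun i hi => l2 i (by omega) (by omega), ?_⟩, ?_⟩
  · intro i h1 h2
    rcases lt_or_ge i m with h3 | h3
    · exact l1 i h1 h3
    · have e := hseg i (by omega) h2
      refine ⟨by rw [e]; exact hsg1, by rw [e]; omega, by rw [e]; exact hst, ?_,
        by rw [e]; exact hcl⟩
      intro l h4 h5
      rw [e] at h4 ⊢
      obtain ⟨h6, h7⟩ := hup l h4 (by omega)
      have h8 := (h7.resolve_left (by omega)).2
      exact ⟨h8, h8 ▸ h6, hseg l h4 (by omega)⟩
  · intro i hi hf
    rcases lt_or_ge i m with h3 | h3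
    · exact l3 i h3 hf
    · obtain ⟨rfl, rfl, h4⟩ := hA i h3 hi hf
      exact ⟨hsg1, hseg _ le_rfl hi, h4⟩
  · have hR : ∀ d l, sg ≤ l → l < D'.len → D'.len - l = d →
        ToRoot I.root D'.fp (D'.ord l) := by
      intro d
      induction d with
      | zero => intro l _ _ _; omega
      | succ d ih =>
        intro l h1 h2 h3
        refine ToRoot.of_next ?_
        rcases (hup l h1 h2).2 with ⟨-, h4⟩ | ⟨h4, h5⟩
        · exact hcl.toRoot _ h4
        · rw [h5]; exact ih (l + 1) (by omega) h4 (by omega)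
    refine ⟨⟨0, by omega, hhead⟩, ?_, ?_, ?_⟩
    · rintro u ⟨l, hl, rfl⟩ hr
      rcases lt_or_ge l sg with h3 | h3
      · exact hcl.adj _ ⟨l, h3, rfl⟩ hr
      · exact (hup l h3 hl).1
    · rintro u ⟨l, hl, rfl⟩ hr
      rcases lt_or_ge l sg with h3 | h3
      · exact (hcl.next _ ⟨l, h3, rfl⟩ hr).mono (by omega)
      · exact hup' l h3 hl
    · rintro u ⟨l, hl, rfl⟩
      rcases lt_or_ge l sg with h3 | h3
      · exact hcl.toRoot _ ⟨l, h3, rfl⟩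
      · exact hR _ l h3 hl rfl

theorem Pushed.up {w s k : ℕ} (hp : Pushed D w s k D') {l : ℕ} (h1 : D.len ≤ l)
    (h2 : l < D'.len) : D'.ord l = D.fp^[l - D.len] w ∧
      (l + 1 < D'.len → D'.fp (D'.ord l) = D'.ord (l + 1)) ∧
      (l + 1 = D'.len → D'.fp (D'.ord l) = D.fp^[k] w) := by
  have hlen := hp.len
  have e : ∀ l, D.len ≤ l → l < D'.len → D'.ord l = D.fp^[l - D.len] w := by
    intro l h1 h2
    have := hp.new (l - D.len) (by omega)
    rwa [show D.len + (l - D.len) = l by omega] at this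
  refine ⟨e l h1 h2, fun h3 => ?_, fun h3 => ?_⟩
  · rw [e l h1 h2, e (l + 1) (by omega) h3, hp.fp, ← Function.iterate_succ_apply' D.fp]
    congr 2; omega
  · rw [e l h1 h2, hp.fp, ← Function.iterate_succ_apply' D.fp]
    congr 2; omega

theorem Pushed.same {w s k : ℕ} (hp : Pushed D w s k D') : Same I D D' D.len := by
  refine ⟨hp.f0, hp.old, fun l _ => by rw [hp.fp], fun l hl => ?_, fun l _ => by rw [hp.fA],
    fun l _ => by rw [hp.fB], fun l _ j _ _ => by rw [hp.exc]⟩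
  exact hp.segOld _ fun j hj e => hp.off j hj ⟨l, hl, e.symm⟩

/-- The entries of the extended stack are distinct. -/
theorem Pushed.inj {w s k : ℕ} (hp : Pushed D w s k D')
    (hinj : ∀ i < D.len, ∀ j < D.len, D.ord i = D.ord j → i = j)
    (hr : D.fp I.root = I.root) (hrT : Pre D.ord D.len I.root) (hw : ToRoot I.root D.fp w) :
    ∀ i < D'.len, ∀ j < D'.len, D'.ord i = D'.ord j → i = j := by
  have hlen := hp.len
  intro i hi j hj e
  rcases lt_or_ge i D.len with h1 | h1 <;> rcases lt_or_ge j D.len with h2 | h2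
  · rw [hp.old i h1, hp.old j h2] at e; exact hinj i h1 j h2 e
  · rw [hp.old i h1, (hp.up h2 hj).1] at e
    exact absurd ⟨i, h1, e⟩ (hp.off (j - D.len) (by omega))
  · rw [hp.old j h2, (hp.up h1 hi).1] at e
    exact absurd ⟨j, h2, e.symm⟩ (hp.off (i - D.len) (by omega))
  · rw [(hp.up h1 hi).1, (hp.up h2 hj).1] at e
    have := chain_inj hr hw (i := k) (fun j hj e' => hp.off j hj (by rw [e']; exact hrT))
      (by omega) (by omega) e
    omega

/-- Pushing the chain of a terminal as a new segment. -/
theorem Valid.pushed {w k : ℕ} (h : Valid I D D.len) (hc : Complete I D) (hw : I.W w)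
    (hwT : ¬ Pre D.ord D.len w) (hp : Pushed D w D.len k D')
    (hjoin : Pre D.ord D.len (D.fp^[k] w)) :
    Valid I D' D.len ∧ Complete I D' ∧ D.len < D'.len ∧ D'.ord D.len = w ∧
      treeAt D' D.len = D'.fp ∧ treeSet D' D.len = Pre D'.ord D'.len ∧
      (∀ l, D.len ≤ l → l < D'.len → D'.seg (D'.ord l) = D.len ∧
        I.E (D'.ord l) (D'.fp (D'.ord l)) ∧
        (l + 1 = D'.len ∧ Pre D'.ord D.len (D'.fp (D'.ord l)) ∨
          l + 1 < D'.len ∧ D'.fp (D'.ord l) = D'.ord (l + 1)) ∧ ¬ Pre D.ord D.len (D'.ord l)) := by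
  have hT := h.tree hc
  have hlen := hp.len
  have hlp := h.len_pos
  have hs : Same I D D' D.len := hp.same
  have hrT : Pre D.ord D.len I.root := hc.root
  have hk : 0 < k := by
    rcases Nat.eq_zero_or_pos k with rfl | hk
    · exact absurd hjoin hwT
    · exact hk
  have hwr := hT.toRoot w hw
  have hU : ∀ j, Used I.W D.fp (D.fp^[j] w) := fun j => ⟨w, hw, j, rfl⟩
  have hord : D'.ord D.len = w := by
    rw [(hp.up le_rfl (by omega)).1, Nat.sub_self]; rfl
  have hnew : ∀ l, D.len ≤ l → l < D'.len → ¬ Pre D.ord D.len (D'.ord l) := by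
    intro l h1 h2
    rw [(hp.up h1 h2).1]
    exact hp.off (l - D.len) (by omega)
  have hpre : ∀ u, Pre D.ord D.len u → Pre D'.ord D'.len u := fun u hu =>
    ((hs.pre le_rfl u).2 hu).mono (by omega)
  have hpath : ∀ l, D.len ≤ l → l < D'.len → D'.seg (D'.ord l) = D.len ∧
        I.E (D'.ord l) (D'.fp (D'.ord l)) ∧
        (l + 1 = D'.len ∧ Pre D'.ord D.len (D'.fp (D'.ord l)) ∨
          l + 1 < D'.len ∧ D'.fp (D'.ord l) = D'.ord (l + 1)) ∧
        ¬ Pre D.ord D.len (D'.ord l) := by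
    intro l h1 h2
    obtain ⟨h3, h4, h5⟩ := hp.up h1 h2
    refine ⟨?_, ?_, ?_, hnew l h1 h2⟩
    · rw [h3]; exact hp.segNew _ (by omega)
    · rw [h3, hp.fp]
      refine hT.adj _ (hU _) fun e => ?_
      exact hp.off (l - D.len) (by omega) (by rw [e]; exact hrT)
    · rcases Nat.lt_or_ge (l + 1) D'.len with h6 | h6
      · exact .inr ⟨h6, h4 h6⟩
      · refine .inl ⟨by omega, ?_⟩
        rw [h5 (by omega), hs.pre le_rfl]; exact hjoin
  have hcl : Closed I.E I.root D'.fp (Pre D'.ord D.len) := closed_same hs le_rfl h.root hc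
  have hext : Valid I D' D.len ∧ Complete I D' := by
    refine h.extend (D' := D') (b' := D.len) (sg := D.len) hs hlp le_rfl (by omega)
      le_rfl le_rfl ?_ (hp.inj h.inj h.root hrT hwr) hp.pos ?_ ?_ hlp le_rfl
      (by rw [hord]; exact hw)
      hcl (fun l h1 h2 => (hpath l h1 h2).1)
      (fun l h1 h2 => ⟨(hpath l h1 h2).2.1, (hpath l h1 h2).2.2.1⟩) ?_
    · intro i hi
      rcases lt_or_ge i D.len with h1 | h1
      · rw [hp.old i h1]; exact h.lt i h1
      · rw [(hp.up h1 hi).1]; exact hT.used_lt (hU _)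
    · intro u hu
      rw [hp.fp, hp.f0, hp.fB, hp.fA]
      exact h.clean u (mt (hpre u) hu)
    · intro u hu
      rw [hp.exc]
      exact h.cleanArc u (mt (hpre u) hu)
    · intro l h1 h2 h3
      rw [hp.fA, (h.clean _ (hnew l h1 h2)).2.2] at h3
      exact absurd rfl h3
  obtain ⟨hv, hc'⟩ := hext
  have htree : treeAt D' D.len = D'.fp := by
    funext u
    rw [treeAt]
    split_ifs with hu
    · rfl
    · rw [hp.fp, hp.f0, (h.clean u (mt (hs.pre le_rfl u).2 hu)).1]
  refine ⟨hv, hc', by omega, hord, htree, ?_, hpath⟩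
  funext u
  rw [treeSet, htree, hord]
  refine propext ⟨?_, ?_⟩
  · rintro (hu | ⟨j, rfl⟩)
    · exact hu.mono (by omega)
    · exact hc'.iterate hv.root ⟨D.len, by omega, hord⟩ j
  · rintro ⟨l, hl, rfl⟩
    rcases lt_or_ge l D.len with h1 | h1
    · exact .inl ⟨l, h1, rfl⟩
    · exact .inr ⟨l - D.len, by rw [hp.fp, (hp.up h1 hl).1]⟩

/-! ### Updating the flags -/

/-- Replace the flags of the first kind. -/
abbrev Stack.setB (D : Stack) (g : ℕ → ℕ) : Stack :=
  ⟨D.ord, D.pos, D.seg, D.fp, D.f0, D.exc, g, D.fA, D.len⟩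

/-- Replace the flags of the second kind. -/
abbrev Stack.setA (D : Stack) (g : ℕ → ℕ) : Stack :=
  ⟨D.ord, D.pos, D.seg, D.fp, D.f0, D.exc, D.fB, g, D.len⟩

/-- When the flags of the positions from `j0` on are set according to `AltB`, the branches that are
not flagged contain no solutions. -/
theorem Valid.setB {g : ℕ → ℕ} {j0 sg : ℕ} (h : Valid I D j0) (h1 : 1 ≤ j0) (hj : j0 ≤ D.len)
    (hsg : ∀ l, j0 ≤ l → l < D.len → D.seg (D.ord l) = sg)
    (hfl : ∀ l, j0 ≤ l → l < D.len → (g (D.ord l) ≠ 0 ↔ AltB I D sg l))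
    (hfr : ∀ u, (∀ l, j0 ≤ l → l < D.len → D.ord l ≠ u) → g u = D.fB u) :
    Valid I (D.setB g) D.len ∧ ∀ f, Sol I.E I.W I.root f →
      pend I (D.setB g) D.len f =
        pend I D j0 f + ∑ l ∈ Finset.Ico j0 D.len, ind (SolB I D l f) := by
  have hlow : ∀ l < j0, g (D.ord l) = D.fB (D.ord l) := fun l hl =>
    hfr _ fun l' h2 h3 e => by have := h.inj l' h3 l (by omega) e; omega
  refine ⟨⟨h.len_pos, h.lt, h.inj, h.head, h.pos, h.initial, h.root, fun u hu => ?_, h.cleanArc,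
    fun i h2 h3 => ?_, fun i hi hf => ?_, h.flagA⟩, fun f hf => ?_⟩
  · have := h.clean u hu
    refine ⟨this.1, ?_, this.2.2⟩
    exact (hfr u fun l _ h3 e => hu ⟨l, h3, e⟩).trans this.2.1
  · have := h.seg i h2 h3
    exact ⟨this.one_le, this.le, this.start, this.next, this.closed⟩
  · rcases lt_or_ge i j0 with h2 | h2
    · refine h.flagB i h2 ?_
      rw [← hlow i h2]; exact hf
    · refine ⟨by omega, ?_⟩
      have h3 := (hfl i h2 hi).1 hf
      rw [← hsg i h2 hi] at h3
      exact h3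
  · change ∑ i ∈ Finset.range D.len, ind (g (D.ord i) ≠ 0 ∧ SolB I D i f) +
      ∑ i ∈ Finset.range D.len, ind (D.fA (D.ord i) ≠ 0 ∧ SolA I D i f) = _
    rw [pend, ← Finset.sum_range_add_sum_Ico (fun i => ind (g (D.ord i) ≠ 0 ∧ SolB I D i f)) hj,
      add_right_comm]
    refine congrArg₂ (· + ·) (congrArg (· + _) ?_) ?_
    · refine Finset.sum_congr rfl fun i hi => ?_
      rw [Finset.mem_range] at hi
      rw [hlow i hi]
    · refine Finset.sum_congr rfl fun i hi => ?_
      rw [Finset.mem_Ico] at hi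
      refine ind_congr ⟨fun h' => h'.2, fun h' => ⟨?_, h'⟩⟩
      have h2 := (h.seg i (by omega) hi.2).altB_of_solB (h.ne_root (by omega) hi.2) hf h'
      rw [hsg i hi.1 hi.2] at h2
      exact (hfl i hi.1 hi.2).2 h2

/-- Set or delete a flag of the second kind. -/
theorem Valid.updA {i c : ℕ} (h : Valid I D D.len) (hi : i < D.len)
    (hc : c ≠ 0 → 1 ≤ i ∧ D.seg (D.ord i) = i ∧ AltA I D i) :
    Valid I (D.setA (Function.update D.fA (D.ord i) c)) D.len ∧ ∀ f,
      pend I (D.setA (Function.update D.fA (D.ord i) c)) D.len f +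
        ind (D.fA (D.ord i) ≠ 0 ∧ SolA I D i f) =
      pend I D D.len f + ind (c ≠ 0 ∧ SolA I D i f) := by
  have hne : ∀ l < D.len, l ≠ i → Function.update D.fA (D.ord i) c (D.ord l) = D.fA (D.ord l) :=
    fun l hl hli => Function.update_of_ne (fun e => hli (h.inj l hl i hi e)) _ _
  refine ⟨⟨h.len_pos, h.lt, h.inj, h.head, h.pos, h.initial, h.root, fun u hu => ?_, h.cleanArc,
    fun i h2 h3 => ?_, h.flagB, fun l hl hf => ?_⟩, fun f => ?_⟩
  · have := h.clean u hu
    refine ⟨this.1, this.2.1, ?_⟩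
    exact (Function.update_of_ne (fun e => hu ⟨i, hi, e.symm⟩) _ _).trans this.2.2
  · have := h.seg i h2 h3
    exact ⟨this.one_le, this.le, this.start, this.next, this.closed⟩
  · change Function.update D.fA (D.ord i) c (D.ord l) ≠ 0 at hf
    by_cases hli : l = i
    · subst hli
      rw [Function.update_self] at hf
      exact hc hf
    · rw [hne l hl hli] at hf
      exact h.flagA l hl hf
  · change ∑ i ∈ Finset.range D.len, ind (D.fB (D.ord i) ≠ 0 ∧ SolB I D i f) +
      ∑ l ∈ Finset.range D.len, ind (Function.update D.fA (D.ord i) c (D.ord l) ≠ 0 ∧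
        SolA I D l f) + _ = _
    rw [pend, ← Finset.sum_erase_add _ _ (Finset.mem_range.2 hi),
      ← Finset.sum_erase_add (Finset.range D.len)
        (fun i => ind (D.fA (D.ord i) ≠ 0 ∧ SolA I D i f)) (Finset.mem_range.2 hi),
      ← Finset.sum_erase_add (Finset.range D.len)
        (fun l => ind (Function.update D.fA (D.ord i) c (D.ord l) ≠ 0 ∧ SolA I D l f))
        (Finset.mem_range.2 hi), Function.update_self]
    have e1 : ∑ x ∈ (Finset.range D.len).erase i,
        ind (Function.update D.fA (D.ord i) c (D.ord x) ≠ 0 ∧ SolA I D x f) =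
        ∑ x ∈ (Finset.range D.len).erase i, ind (D.fA (D.ord x) ≠ 0 ∧ SolA I D x f) := by
      refine Finset.sum_congr rfl fun l hl => ?_
      rw [Finset.mem_erase, Finset.mem_range] at hl
      rw [hne l hl.2 hl.1]
    rw [e1]
    omega

end

/-! ### Branching -/

section

variable {μ : Mach} {I : Inst} {D D' D'' : Stack} {m b : ℕ} {f : ℕ → ℕ}

theorem Same.trans (h : Same I D D' m) (h' : Same I D' D'' m) : Same I D D'' m := by
  refine ⟨h'.f0.trans h.f0, fun l hl => (h'.ord l hl).trans (h.ord l hl), fun l hl => ?_,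
    fun l hl => ?_, fun l hl => ?_, fun l hl => ?_, fun l hl j h1 h2 => ?_⟩
  all_goals have e := h.ord l hl
  · rw [← h.fp l hl, ← e]; exact h'.fp l hl
  · rw [← h.seg l hl, ← e]; exact h'.seg l hl
  · rw [← h.fA l hl, ← e]; exact h'.fA l hl
  · rw [← h.fB l hl, ← e]; exact h'.fB l hl
  · rw [← h.exc l hl j h1 h2]
    exact h'.exc l hl j (by rw [e]; exact h1) (by rw [e]; exact h2)

theorem Valid.used (h : Valid I D b) {i : ℕ} (hi : i < D.len) : Used I.W D.fp (D.ord i) := by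
  rcases Nat.eq_zero_or_pos i with rfl | h1
  · rw [h.head]; exact .terminal I.root_W
  · exact (h.seg i h1 hi).used fun _ _ => rfl

theorem Valid.agree_prune (h : Valid I D b) {i : ℕ} (hi : i ≤ D.len) :
    Agree D i (prune I.W D.fp) := by
  rintro u ⟨l, hl, rfl⟩
  exact prune_used (h.used (by omega))

/-- The current tree is one of the solutions that follow it on the whole stack. -/
theorem Valid.ind_agree (h : Valid I D b) : ind (Agree D D.len f) =
    ind (f = prune I.W D.fp) + ind (Agree D D.len f ∧ f ≠ prune I.W D.fp) := by
  rw [ind_split (q := f = prune I.W D.fp), add_comm]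
  congr 1
  exact ind_congr ⟨fun h => h.2, fun e => ⟨e ▸ h.agree_prune le_rfl, e⟩⟩

/-- The solutions other than the current tree that contain the subtree on the stack, after a new
segment has been pushed. -/
theorem Valid.ind_pushed {j : ℕ} (h : Valid I D b) (hj : 1 ≤ j) (hjL : j < D.len)
    (hE : ∀ l, j ≤ l → l < D.len → I.E (D.ord l) (D.fp (D.ord l)))
    (hx : ∀ l, j ≤ l → l < D.len →
      ∀ a, I.off (D.ord l) ≤ a → a < I.off (D.ord l + 1) → D.exc a = 0)
    (hf : Sol I.E I.W I.root f) :
    ind (Agree D j f ∧ f ≠ prune I.W D.fp) = ∑ l ∈ Finset.Ico j D.len, ind (SolB I D l f) +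
      ind (Agree D D.len f ∧ f ≠ prune I.W D.fp) := by
  by_cases he : f = prune I.W D.fp
  · rw [ind_false (fun h => h.2 he), ind_false (fun h => h.2 he), add_zero]
    refine (Finset.sum_eq_zero fun l hl => ?_).symm
    rw [Finset.mem_Ico] at hl
    refine ind_false fun hs => hs.2.1 ?_
    rw [he]
    exact prune_used (h.used hl.2)
  · have h1 := partition (I := I) (D := D) hjL
      (fun l h1 h2 => ⟨h.seg l (by omega) h2, h.ne_root (by omega) h2⟩)
      (fun l h1 h2 => allowed_of_clean (hE l h1 h2) (hx l h1 h2))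
      (fun l h1 h2 => hx l h1.le h2) hf
    have h2 : ∀ i, ind (Agree D i f ∧ f ≠ prune I.W D.fp) = ind (Agree D i f) := fun i =>
      ind_congr (and_iff_left he)
    rw [h2, h2, ← h1]
    refine ind_congr (iff_self_and.2 fun h3 => allowed_of_clean ?_ (hx j le_rfl hjL))
    exact hf.adj _ ((h.seg j hj hjL).used h3) (h.ne_root hj hjL)

/-- Pushing a segment does not affect the branches below it. -/
theorem Pushed.pend_eq {w k : ℕ} (hp : Pushed D w D.len k D')
    (hfA : ∀ l, D.len ≤ l → l < D'.len → D.fA (D'.ord l) = 0) :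
    pend I D' D.len f = pend I D D.len f := by
  have hs : Same I D D' D.len := hp.same
  have hlen := hp.len
  rw [pend, pend, ← Finset.sum_range_add_sum_Ico (n := D'.len) _ (show D.len ≤ D'.len by omega)]
  have e0 : ∑ i ∈ Finset.Ico D.len D'.len, ind (D'.fA (D'.ord i) ≠ 0 ∧ SolA I D' i f) = 0 := by
    refine Finset.sum_eq_zero fun l hl => ind_false fun h' => h'.1 ?_
    rw [Finset.mem_Ico] at hl
    rw [hp.fA]; exact hfA l hl.1 hl.2
  rw [e0, add_zero]
  refine congrArg₂ (· + ·) ?_ ?_ <;> refine Finset.sum_congr rfl fun i hi => ?_ <;>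
    rw [Finset.mem_range] at hi
  · rw [hs.solB hi, hs.ord i hi, hs.fB i hi]
  · rw [hs.solA hi.le (hs.ord i hi), hs.ord i hi, hs.fA i hi]

/-- The effect of `setFlags` on the invariant. -/
theorem setFlags_valid {s : Cf} {sg j0 L : ℕ} (hc : Ctx μ I s) (hsg : s.regs .s = sg)
    (hj0 : s.regs .j0 = j0) (hL : s.regs .len = L) (h1 : 1 ≤ sg) (h2 : sg ≤ j0) (h3 : j0 ≤ L)
    (h : Valid I (stk s) j0)
    (hseg : ∀ l, j0 ≤ l → l < L → s.mem .seg (s.mem .ord l) = sg)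
    (hup : ∀ l, sg ≤ l → l < L → I.E (s.mem .ord l) (s.mem .fp (s.mem .ord l)) ∧
      (l + 1 = L ∧ Pre (s.mem .ord) sg (s.mem .fp (s.mem .ord l)) ∨
        l + 1 < L ∧ s.mem .fp (s.mem .ord l) = s.mem .ord (l + 1))) :
    vc μ setFlags (fun t s' => t ≤ 100 * (I.off I.n + I.n) + 100 ∧ Ctx μ I s' ∧
      stk s' = (stk s).setB (s'.mem .fB) ∧ Valid I (stk s') L ∧
      (∀ f, Sol I.E I.W I.root f → pend I (stk s') L f =
        pend I (stk s) j0 f + ∑ l ∈ Finset.Ico j0 L, ind (SolB I (stk s) l f)) ∧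
      ∀ i, j0 ≤ i → i < L → (s'.mem .fB (s.mem .ord i) ≠ 0 ↔ AltB I (stk s) sg i)) s := by
  refine vc_call (setFlags_spec hc hsg hj0 hL h2 h3 (by simpa [hL] using h.lt)
    (by simpa [hL] using h.inj) fun l h4 h5 => ⟨(hup l h4 h5).1,
      (hup l h4 h5).2.imp (fun h => h.2) id⟩) ?_
  rintro t s' ⟨ht, hc', hfl, hfr⟩ hf
  have e : stk s' = (stk s).setB (s'.mem .fB) := by
    simp only [stk, hf.mem .ord (by decide), hf.mem .pos (by decide), hf.mem .seg (by decide),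
      hf.mem .fp (by decide), hf.mem .f0 (by decide), hf.mem .exc (by decide),
      hf.mem .fA (by decide), hf.regs .len (by decide)]
  have hL' : (stk s).len = L := hL
  obtain ⟨h4, h5⟩ := h.setB (g := s'.mem .fB) (sg := sg) (by omega) (by omega)
    (by rw [hL']; exact hseg) (by rw [hL']; exact hfl) (by rw [hL']; exact hfr)
  rw [← e, hL'] at h4
  rw [← e, hL'] at h5
  exact ⟨ht, hc', e, h4, h5, hfl⟩

/-- A call of `pushPath` on a valid and complete stack. -/
theorem pushPath_valid {s : Cf} {w L : ℕ} (hc : Ctx μ I s) (hw : s.regs .w = w)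
    (hL : s.regs .len = L) (hsg : s.regs .s = L) (h : Valid I (stk s) L)
    (hcp : Complete I (stk s)) (hwW : I.W w) :
    vc μ pushPath (fun t s' => t ≤ 20 * I.n + 20 ∧ Ctx μ I s' ∧
      ∃ k, Pushed (stk s) w L k (stk s') ∧
        Pre (s.mem .ord) L ((s.mem .fp)^[k] w)) s := by
  have h' : Valid I (stk s) (stk s).len := by rw [stk_len, hL]; exact h
  have hT := h'.tree hcp
  have := pushPath_spec hc hw hsg h.pos h.lt h.inj h.root hcp.root (hT.toRoot w hwW)
    fun j => hT.used_lt ⟨w, hwW, j, rfl⟩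
  rwa [hL] at this

/-- Let `C` count the solutions found elsewhere. The solutions that contain the subtree on the
stack, apart from the current tree, are distributed to new branches; none are left over if the test
says that the current tree is the only one. -/
theorem expand_spec {s : Cf} {C : (ℕ → ℕ) → ℕ} (hc : Ctx μ I s)
    (h : Valid I (stk s) (s.regs .len)) (hcp : Complete I (stk s))
    (hC : ∀ f, Sol I.E I.W I.root f → C f + pend I (stk s) (s.regs .len) f +
      ind (Agree (stk s) (s.regs .len) f ∧ f ≠ prune I.W (s.mem .fp)) = 1) :
    vc μ expand (fun t s' => t ≤ 600 * (I.off I.n + I.n) + 600 ∧ Ctx μ I s' ∧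
      Valid I (stk s') (s'.regs .len) ∧
      (∀ f, Sol I.E I.W I.root f → C f + pend I (stk s') (s'.regs .len) f = 1) ∧
      ((∃ w, I.W w ∧ Alt I.E (Pre (s.mem .ord) (s.regs .len)) (s.mem .fp) w) →
        Promising (stk s'))) s := by
  have hbd := hc.bound
  obtain ⟨L, hL⟩ : ∃ L, s.regs .len = L := ⟨_, rfl⟩
  have hLlen : (stk s).len = L := hL
  rw [hL] at h hC ⊢
  have hT : Tree I (s.mem .ord) (s.mem .fp) L := by
    have := h.tree hcp; rwa [hLlen] at this
  have hcpL : Closed I.E I.root (s.mem .fp) (Pre (s.mem .ord) L) := by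
    have := hcp; simp only [Complete, hLlen] at this; exact this
  unfold expand
  simp only [vc]
  refine vc_call (test_spec hc hL hT fun u _ => by simpa [hL] using h.pos u) ?_
  rintro t1 s1 ⟨ht1, hc1, hno, hyes⟩ hf1
  have e1 : stk s1 = stk s := stk_frame hf1 (by decide)
  have hL1 : s1.regs .len = L := (congrArg Stack.len e1).trans hL
  simp only [Expr.Idx, Expr.Small, Expr.eval, true_and]
  refine ⟨fun hfd => ?_, fun hfd => ?_⟩
  swap
  · -- no alternative: the current tree is the only solution that contains the subtree
    refine ⟨Nat.zero_le _, by omega, hc1.setR rfl, ?_⟩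
    have e2 : stk (s1.setR .skip 0) = stk s := by rw [← e1]; simp [stk]
    rw [e2]
    simp only [Config.setR_regs, reduceCtorEq, if_false, hL1]
    refine ⟨h, fun f hf => ?_, fun ⟨w, hw, ha⟩ => absurd ha (hno hfd w hw)⟩
    have := hC f hf
    rw [ind_false] at this
    · exact this
    · rintro ⟨ha, hne⟩
      exact hne (hf.eq_prune_of_not_alt hcpL h.root ha (hno hfd))
  obtain ⟨hwW, hAlt⟩ := hyes hfd
  obtain ⟨w, hw⟩ : ∃ w, s1.regs .w = w := ⟨_, rfl⟩
  rw [hw] at hwW hAlt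
  simp only [hL1, Config.setR_regs, reduceCtorEq, if_false]
  set s2 := (s1.setR .s L).setR .j0 L with hs2
  have hc2 : Ctx μ I s2 := (hc1.setR rfl).setR rfl
  have e2 : stk s2 = stk s := by rw [← e1]; simp [stk, hs2]
  have hwT : ¬ Pre (stk s).ord (stk s).len w := by
    obtain ⟨k, u, h1, -⟩ := hAlt
    rw [hLlen]
    exact h1 0 (by omega)
  refine vc_call (pushPath_valid (w := w) (L := L) hc2 (by simp [hs2, hw]) (by simp [hs2, hL1])
    (by simp [hs2]) (by rw [e2]; exact h) (by rw [e2]; exact hcp) hwW) ?_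
  have eo2 : s2.mem .ord = s.mem .ord := congrArg Stack.ord e2
  have ef2 : s2.mem .fp = s.mem .fp := congrArg Stack.fp e2
  rw [e2, eo2, ef2]
  rintro t3 s3 ⟨ht3, hc3, k, hp, hjoin⟩ hf3
  have h' : Valid I (stk s) (stk s).len := by rw [hLlen]; exact h
  rw [← hLlen] at hp hjoin
  obtain ⟨hv3, hcp3, hlen3, hord3, htree3, hset3, hpath3⟩ := h'.pushed hcp hwW hwT hp hjoin
  have hsame3 : Same I (stk s) (stk s3) L := by have := hp.same (I := I); rwa [hLlen] at this
  have hclean3 : ∀ l, L ≤ l → l < (stk s3).len → ¬ Pre (stk s).ord (stk s).len ((stk s3).ord l) :=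
    fun l h1 h2 => (hpath3 l (by omega) h2).2.2.2
  have hpend3 : ∀ f, pend I (stk s3) L f = pend I (stk s) L f := by
    intro f
    have := hp.pend_eq (I := I) (f := f) fun l h1 h2 =>
      (h.clean _ (hclean3 l (by omega) h2)).2.2
    rwa [hLlen] at this
  rw [hLlen] at hv3 hlen3 hord3 htree3 hset3 hpath3
  have hfp3 : (stk s3).fp = s.mem .fp := hp.fp
  have hx3 : ∀ l, L ≤ l → l < (stk s3).len → ∀ a, I.off ((stk s3).ord l) ≤ a →
      a < I.off ((stk s3).ord l + 1) → (stk s3).exc a = 0 := by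
    intro l h1 h2
    rw [hp.exc]
    exact h.cleanArc _ (hclean3 l h1 h2)
  have hL1' : 1 ≤ L := by have := h'.len_pos; omega
  have hcount3 : ∀ f, Sol I.E I.W I.root f →
      ind (Agree (stk s) L f ∧ f ≠ prune I.W (s.mem .fp)) =
      ∑ l ∈ Finset.Ico L (stk s3).len, ind (SolB I (stk s3) l f) +
        ind (Agree (stk s3) (stk s3).len f ∧ f ≠ prune I.W (s.mem .fp)) := by
    intro f hf
    have := hv3.ind_pushed hL1' hlen3 (fun l h1 h2 => (hpath3 l h1 h2).2.1) hx3 hf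
    rw [hfp3, hsame3.agree le_rfl] at this
    exact this
  -- the alternative that the test has found is flagged
  obtain ⟨ka, ua, hka, hEa, hnea, hava⟩ := hAlt
  have hordk : ∀ i ≤ ka, L + i < (stk s3).len ∧ (stk s3).ord (L + i) = (s.mem .fp)^[i] w := by
    have hk' : ka < k := by
      by_contra hcon
      refine hka k (by omega) ?_
      rw [← hLlen]; exact hjoin
    intro i hi
    have hl := hp.len
    have := hp.new i (by omega)
    rw [hLlen] at this hl
    exact ⟨by omega, this⟩
  have hAB : AltB I (stk s3) L (L + ka) := by
    obtain ⟨h1, h2⟩ := hordk ka le_rfl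
    refine ⟨ua, ?_, ?_, ?_⟩
    · exact allowed_of_clean (by rw [h2]; exact hEa) (hx3 _ (by omega) h1)
    · rw [h2, hfp3]; exact hnea
    · refine hava.mono (fun x hx => .base ((hsame3.pre le_rfl x).2 hx)) ?_
      rintro x ⟨l, h3, h4, rfl⟩
      refine ⟨l - L, by omega, ?_⟩
      rw [← (hordk (l - L) (by omega)).2, show L + (l - L) = l by omega]
  have es3 : s3.regs .s = L := by rw [hf3.regs _ (by decide)]; simp [hs2]
  have ej3 : s3.regs .j0 = L := by rw [hf3.regs _ (by decide)]; simp [hs2]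
  obtain ⟨L', hL'⟩ : ∃ L', s3.regs .len = L' := ⟨_, rfl⟩
  have hlen3' : (stk s3).len = L' := hL'
  rw [hlen3'] at hlen3 hset3 hpath3 hcount3 hordk hx3 hclean3
  refine vc_call (setFlags_valid hc3 es3 ej3 hL' hL1' le_rfl hlen3.le hv3
    (fun l h1 h2 => (hpath3 l h1 h2).1)
    (fun l h1 h2 => ⟨(hpath3 l h1 h2).2.1, (hpath3 l h1 h2).2.2.1⟩)) ?_
  rintro t4 s4 ⟨ht4, hc4, e4, hv4, hpend4, hfl4⟩ hf4
  have hL4 : s4.regs .len = L' := (congrArg Stack.len e4).trans hL'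
  have eo4 : s4.mem .ord = s3.mem .ord := congrArg Stack.ord e4
  have ef4 : s4.mem .fp = s.mem .fp := (congrArg Stack.fp e4).trans hfp3
  have ea4 : s4.mem .fA = s.mem .fA := (congrArg Stack.fA e4).trans hp.fA
  have hcp4 : Complete I (stk s4) := by rw [e4]; exact hcp3
  have hv4' : Valid I (stk s4) (stk s4).len := by rw [stk_len, hL4]; exact hv4
  have hset4 : treeSet (stk s4) L = Pre (s4.mem .ord) L' := by
    rw [eo4]; rw [e4]; exact hset3
  have htree4 : treeAt (stk s4) L = s4.mem .fp := by
    rw [ef4, e4]; exact htree3.trans hfp3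
  have hordL4 : s4.mem .ord L = w := by rw [eo4]; exact hord3
  have hfAw : ∀ l, L ≤ l → l < L' → s4.mem .fA (s4.mem .ord l) = 0 := by
    intro l h1 h2
    rw [ea4, eo4]
    exact (h.clean _ (hclean3 l h1 h2)).2.2
  have hcount4 : ∀ f, Sol I.E I.W I.root f → C f + pend I (stk s4) L' f +
      ind (Agree (stk s4) L' f ∧ f ≠ prune I.W (s4.mem .fp)) = 1 := by
    intro f hf
    have h1 := hC f hf
    have h2 : ind (Agree (stk s4) L' f ∧ f ≠ prune I.W (s4.mem .fp)) =
        ind (Agree (stk s3) L' f ∧ f ≠ prune I.W (s.mem .fp)) := by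
      rw [ef4, e4]; rfl
    rw [hcount3 f hf] at h1
    rw [hpend4 f hf, hpend3, h2]
    omega
  have hT4 : Tree I (s4.mem .ord) (s4.mem .fp) L' := by
    have := hv4'.tree hcp4; rwa [stk_len, hL4] at this
  have hcpL4 : Closed I.E I.root (s4.mem .fp) (Pre (s4.mem .ord) L') := hT4.closed
  -- the stack after the second test, with either value of the flag
  have hprom : ∀ g : ℕ → ℕ, (∀ l, L < l → l < L' → g (s4.mem .ord l) = 0) →
      Promising ((stk s4).setA g) := by
    intro g hg
    obtain ⟨h1, h2⟩ := hordk ka le_rfl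
    refine ⟨L + ka, by simpa [hL4] using h1, ?_, fun l h3 h4 => ?_⟩
    · simp only [stk_fB, stk_ord]
      rw [eo4]
      exact (hfl4 (L + ka) (by omega) h1).2 hAB
    · simp only [stk_len, hL4] at h4
      exact hg l (by omega) h4
  refine vc_call (test_spec hc4 hL4 hT4 fun u _ => by simpa [hL4] using hv4.pos u) ?_
  rintro t5 s5 ⟨ht5, hc5, hno5, hyes5⟩ hf5
  have e5 : stk s5 = stk s4 := stk_frame hf5 (by decide)
  have hL5 : s5.regs .len = L' := (congrArg Stack.len e5).trans hL4
  have eo5 : s5.mem .ord = s4.mem .ord := congrArg Stack.ord e5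
  have ea5 : s5.mem .fA = s4.mem .fA := congrArg Stack.fA e5
  have es5 : s5.regs .s = L := by rw [hf5.regs _ (by decide), hf4.regs _ (by decide), es3]
  simp only [es5, eo5, hordL4]
  refine ⟨fun hfd5 => ⟨by omega, by omega, hc5.setA (by decide), ?_⟩,
    fun hfd5 => ⟨Nat.zero_le _, by omega, hc5.setR rfl, ?_⟩⟩
  · obtain ⟨hw5, hA5⟩ := hyes5 hfd5
    have e6 : stk (s5.setA .fA w 1) =
        (stk s4).setA (Function.update (stk s4).fA ((stk s4).ord L) 1) := by
      rw [← e5]; simp [stk, eo5, hordL4]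
    have hLlt : L < (stk s4).len := by rw [stk_len, hL4]; exact hlen3
    have hsegL : (stk s4).seg ((stk s4).ord L) = L := by
      simp only [stk_seg, stk_ord]
      have := (hpath3 L le_rfl hlen3).1
      rw [eo4]
      rw [show s4.mem .seg = s3.mem .seg from congrArg Stack.seg e4]
      exact this
    have hAA : AltA I (stk s4) L := by
      refine ⟨_, hw5, ?_⟩
      rw [hset4, htree4]; exact hA5
    obtain ⟨h6, h7⟩ := hv4'.updA (i := L) (c := 1) hLlt (fun _ => ⟨hL1', hsegL, hAA⟩)
    rw [e6]
    simp only [Config.setA_regs, hL5]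
    rw [stk_len, hL4] at h6 h7
    refine ⟨h6, fun f hf => ?_, fun _ => hprom _ fun l h1 h2 => ?_⟩
    · have h8 := h7 f
      have h0 : ind ((stk s4).fA ((stk s4).ord L) ≠ 0 ∧ SolA I (stk s4) L f) = 0 :=
        ind_false fun h => h.1 (hfAw L le_rfl hlen3)
      rw [h0, add_zero] at h8
      rw [h8]
      have h9 := hcount4 f hf
      have h10 : ind (1 ≠ 0 ∧ SolA I (stk s4) L f) =
          ind (Agree (stk s4) L' f ∧ f ≠ prune I.W (s4.mem .fp)) := by
        refine ind_congr ((and_iff_right one_ne_zero).trans ?_)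
        rw [SolA, hset4, htree4]; rfl
      rw [h10]; omega
    · simp only [stk_fA, stk_ord]
      rw [Function.update_of_ne]
      · exact hfAw l h1.le h2
      · intro e
        have := hv4.inj l (by simpa [hL4] using h2) L hLlt e
        omega
  · have e6 : stk (s5.setR .skip 0) = stk s4 := by rw [← e5]; simp [stk]
    rw [e6]
    simp only [hL5]
    refine ⟨hv4, fun f hf => ?_, fun _ => hprom _ fun l h1 h2 => hfAw l h1.le h2⟩
    have := hcount4 f hf
    rw [ind_false] at this
    · exact this
    · rintro ⟨ha, hne⟩
      exact hne (hf.eq_prune_of_not_alt hcpL4 hv4.root ha (hno5 hfd5))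

end

/-! ### Resuming a branch of the second kind -/

section

variable {μ : Mach} {I : Inst} {D D' D1 : Stack} {m b : ℕ} {f : ℕ → ℕ}

theorem Inst.deg_le (I : Inst) {u : ℕ} (hu : u < I.n) : I.deg u ≤ I.off I.n := by
  have := I.off_mono (u := u + 1) hu le_rfl
  simp only [Inst.deg]; omega

/-- Flags of the first kind that are not set are right. -/
theorem Valid.of_le (h : Valid I D b) (hb : b ≤ m)
    (hz : ∀ i, b ≤ i → i < m → D.fB (D.ord i) = 0) :
    Valid I D m ∧ pend I D m f = pend I D b f := by
  refine ⟨⟨h.len_pos, h.lt, h.inj, h.head, h.pos, h.initial, h.root, h.clean, h.cleanArc, h.seg,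
    fun i hi hf => ?_, h.flagA⟩, ?_⟩
  · rcases lt_or_ge i b with h1 | h1
    · exact h.flagB i h1 hf
    · exact absurd (hz i h1 hi) hf
  · rw [pend, pend, ← Finset.sum_range_add_sum_Ico _ hb]
    have e0 : ∑ i ∈ Finset.Ico b m, ind (D.fB (D.ord i) ≠ 0 ∧ SolB I D i f) = 0 := by
      refine Finset.sum_eq_zero fun l hl => ind_false fun h' => h'.1 ?_
      rw [Finset.mem_Ico] at hl
      exact hz l hl.1 hl.2
    rw [e0, add_zero]

/-- After a branch of the second kind has been resumed, its solutions are those that contain the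
subtree on the stack, and its current tree has been output already. -/
theorem popA_spec {s : Cf} {L : ℕ} (hc : Ctx μ I s) (hL : s.regs .len = L + 1) (hL1 : 1 ≤ L)
    (h : Valid I (stk s) (L + 1)) (hB : s.mem .fB (s.mem .ord L) = 0)
    (hA : s.mem .fA (s.mem .ord L) ≠ 0) :
    vc μ popA (fun t s' => t ≤ 60 * (I.off I.n + I.n) + 60 ∧ Ctx μ I s' ∧
      Valid I (stk s') (s'.regs .len) ∧ Complete I (stk s') ∧
      (∀ f, pend I (stk s) (L + 1) f = pend I (stk s') (s'.regs .len) f +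
        ind (Agree (stk s') (s'.regs .len) f ∧ f ≠ prune I.W (s'.mem .fp))) ∧
      ∃ w, I.W w ∧ Alt I.E (Pre (s'.mem .ord) (s'.regs .len)) (s'.mem .fp) w) s := by
  have hbd := hc.bound
  have hlen : (stk s).len = L + 1 := hL
  have hLlt : L < (stk s).len := by omega
  obtain ⟨w, hw⟩ : ∃ w, s.mem .ord L = w := ⟨_, rfl⟩
  have hwn : w < I.n := by rw [← hw]; exact h.lt L hLlt
  obtain ⟨-, hsegL, hAlt⟩ := h.flagA L hLlt hA
  have hon := h.seg L hL1 hLlt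
  have hst := hon.start
  have hcl := hon.closed
  rw [hsegL] at hst hcl
  have hwW : I.W w := by rw [← hw]; exact hst
  rw [hw] at hB hA
  unfold popA
  simp only [vc, Expr.Idx, Expr.Small, Expr.eval, Op.eval, true_and, hL, Nat.add_sub_cancel, hw,
    Config.setR_regs, if_true]
  refine ⟨by omega, ?_⟩
  set s1 := (s.setR .w w).setA .fA w 0 with hs1
  have hc1 : Ctx μ I s1 := (hc.setR rfl).setA (by decide)
  have e1 : stk s1 = (stk s).setA (Function.update (stk s).fA ((stk s).ord L) 0) := by
    simp [stk, hs1, hw]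
  have h' : Valid I (stk s) (stk s).len := by rw [hlen]; exact h
  obtain ⟨hv1, hp1⟩ := h'.updA (i := L) (c := 0) hLlt (fun h => absurd rfl h)
  rw [← e1, hlen] at hv1 hp1
  have hl1 : (stk s1).len = L + 1 := by rw [e1]; exact hlen
  have hsame1 : Same I (stk s) (stk s1) L := by
    rw [e1]
    refine ⟨rfl, fun _ _ => rfl, fun _ _ => rfl, fun _ _ => rfl, fun l hl => ?_, fun _ _ => rfl,
      fun _ _ _ _ _ => rfl⟩
    refine Function.update_of_ne (fun e => ?_) _ _
    have := h.inj l (by omega) L hLlt e; omega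
  refine vc_call (undoTop_spec (L := L) hc1 (by simp [hs1, hL]) (by simpa [hs1, hw] using hwn)) ?_
  have eo1 : s1.mem .ord L = w := by simp [hs1, hw]
  rw [eo1]
  rintro t2 s2 ⟨ht2, hc2, hpop⟩ hf2
  have hl2 : (stk s2).len = L := by have := hpop.len; omega
  obtain ⟨hv2, hp2⟩ := hpop.valid (by rw [hl1]; exact hv1) (by omega)
    (by rw [hl2, e1]; simpa [hw] using hB) (by rw [hl2, e1]; simp)
  have hsame2 := hpop.same hv1
  rw [hl2] at hv2 hp2 hsame2
  rw [hl1] at hp2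
  have hL2 : s2.regs .len = L := hl2
  have hsame02 := hsame1.trans hsame2
  have hcp2 : Complete I (stk s2) := by
    have := closed_same hsame02 le_rfl h.root hcl
    rwa [← hl2] at this
  have hw2 : s2.regs .w = w := by rw [hf2.regs _ (by decide)]; simp [hs1]
  set s3 := s2.setR .s L with hs3
  have e3 : stk s3 = stk s2 := by simp [stk, hs3]
  simp only [hL2]
  have hwT : ¬ Pre (stk s2).ord (stk s2).len w := by
    rintro ⟨l, hl, he⟩
    rw [hl2] at hl
    rw [hsame02.ord l hl, ← hw] at he
    have := h.inj l (by omega) L hLlt he; omega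
  refine vc_mono (pushPath_valid (s := s3) (w := w) (L := L) (hc2.setR rfl) (by simp [hs3, hw2])
    (by simp [hs3, hL2]) (by simp [hs3]) (by rw [e3]; exact hv2) (by rw [e3]; exact hcp2) hwW) ?_
  rw [e3]
  have eo3 : s3.mem .ord = s2.mem .ord := congrArg Stack.ord e3
  have ef3 : s3.mem .fp = s2.mem .fp := congrArg Stack.fp e3
  rw [eo3, ef3]
  rintro t4 s4 ⟨ht4, hc4, k, hp, hjoin⟩
  have hv2' : Valid I (stk s2) (stk s2).len := by rw [hl2]; exact hv2
  rw [← hl2] at hp hjoin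
  obtain ⟨hv4, hcp4, hlen4, hord4, htree4, hset4, hpath4⟩ := hv2'.pushed hcp2 hwW hwT hp hjoin
  have hpend4 : ∀ f, pend I (stk s4) (stk s2).len f = pend I (stk s2) (stk s2).len f := fun f =>
    hp.pend_eq fun l h1 h2 => (hv2.clean _ (hpath4 l h1 h2).2.2.2).2.2
  have hz4 : ∀ i, (stk s2).len ≤ i → i < (stk s4).len → (stk s4).fB ((stk s4).ord i) = 0 := by
    intro i h1 h2
    rw [hp.fB]
    exact (hv2.clean _ (hpath4 i h1 h2).2.2.2).2.1
  have hsame4 : Same I (stk s) (stk s4) L := by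
    have := hp.same (I := I)
    rw [hl2] at this
    exact hsame02.trans this
  have hoL : (stk s4).ord L = (stk s).ord L := by
    rw [← hl2, hord4, hl2]; exact hw.symm
  rw [hl2] at htree4 hset4
  have hset : treeSet (stk s) L = Pre (s4.mem .ord) (s4.regs .len) :=
    (hsame4.treeSet le_rfl hoL).symm.trans hset4
  have htr : treeAt (stk s) L = s4.mem .fp := (hsame4.treeAt le_rfl).symm.trans htree4
  have hd := I.deg_le hwn
  refine ⟨by omega, hc4, (hv4.of_le (f := id) hlen4.le hz4).1, hcp4, fun f => ?_, ?_⟩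
  · have e5 := (hv4.of_le (f := f) hlen4.le hz4).2
    rw [hpend4, hl2, hp2] at e5
    have e6 := hp1 f
    have e7 : ind (0 ≠ 0 ∧ SolA I (stk s) L f) = 0 := ind_false fun h => h.1 rfl
    have e8 : ind ((stk s).fA ((stk s).ord L) ≠ 0 ∧ SolA I (stk s) L f) =
        ind (Agree (stk s4) (s4.regs .len) f ∧ f ≠ prune I.W (s4.mem .fp)) := by
      refine ind_congr ((and_iff_right (by simpa [hw] using hA)).trans ?_)
      rw [SolA, hset, htr]; rfl
    rw [e7, e8] at e6
    rw [stk_len] at e5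
    rw [e5]
    omega
  · rw [AltA, hset, htr] at hAlt
    exact hAlt

/-! ### Resuming a branch of the first kind -/

/-- `D1` arises from `D` by removing the top vertex, at position `L` and in the segment `sg`, and
redirecting it along the path `c 0, …, c d` to the subtree below the segment; its old arc is
excluded. -/
structure Redirected (I : Inst) (D : Stack) (L sg : ℕ) (D1 : Stack) (c : ℕ → ℕ) (d : ℕ) :
    Prop where
  len : D1.len = L
  ord : D1.ord = D.ord
  seg : D1.seg = D.seg
  f0 : D1.f0 = D.f0
  fB : D1.fB = D.fB
  fA : D1.fA = D.fA
  exc : ∀ j, ¬ (I.off (D.ord L) ≤ j ∧ j < I.off (D.ord L + 1)) → D1.exc j = D.exc j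
  allowed : ∀ y, Allowed I D1 (D.ord L) y ↔ Allowed I D (D.ord L) y ∧ y ≠ D.fp (D.ord L)
  fp_top : D1.fp (D.ord L) = c 0
  fp_path : ∀ e < d, D1.fp (c e) = c (e + 1)
  fp_off : ∀ u, u ≠ D.ord L → (∀ e < d, c e ≠ u) → D1.fp u = D.fp u
  ne_top : ∀ e < d, c e ≠ D.ord L
  off : ∀ e < d, ¬ Pre D.ord L (c e)
  attach : Pre D.ord sg (c d)
  arc : Allowed I D1 (D.ord L) (c 0)
  adj : ∀ e < d, I.E (c e) (c (e + 1))

/-- `D'` arises from `D` by replacing the part of the last segment `sg` from position `L` on, and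
it takes over the solutions of the pending branches. -/
structure Rerouted (I : Inst) (D : Stack) (L sg : ℕ) (D' : Stack) : Prop where
  one_le : 1 ≤ sg
  le : sg ≤ L
  lt : L < D'.len
  valid : Valid I D' L
  complete : Complete I D'
  seg : ∀ l, L ≤ l → l < D'.len → D'.seg (D'.ord l) = sg
  up : ∀ l, sg ≤ l → l < D'.len → I.E (D'.ord l) (D'.fp (D'.ord l)) ∧
    (l + 1 = D'.len ∧ Pre D'.ord sg (D'.fp (D'.ord l)) ∨
      l + 1 < D'.len ∧ D'.fp (D'.ord l) = D'.ord (l + 1))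
  count : ∀ f, Sol I.E I.W I.root f → pend I D (L + 1) f = pend I D' L f +
    ∑ l ∈ Finset.Ico L D'.len, ind (SolB I D' l f) + ind (Agree D' D'.len f)

section

variable {L sg d : ℕ} {c : ℕ → ℕ}

theorem Redirected.iterate (hr : Redirected I D L sg D1 c d) {e : ℕ} (he : e ≤ d) :
    D1.fp^[e + 1] (D.ord L) = c e := by
  induction e with
  | zero => exact hr.fp_top
  | succ e ih => rw [Function.iterate_succ_apply', ih (by omega), hr.fp_path e (by omega)]

theorem Redirected.path_lt (hr : Redirected I D L sg D1 c d) {e : ℕ} (he : e ≤ d) : c e < I.n := by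
  rcases Nat.eq_zero_or_pos e with rfl | h
  · exact I.E_lt_right hr.arc.E
  · have := hr.adj (e - 1) (by omega)
    rw [show e - 1 + 1 = e by omega] at this
    exact I.E_lt_right this

theorem Redirected.same (hr : Redirected I D L sg D1 c d) (h : Valid I D b) (hlen : D.len = L + 1) :
    Same I D D1 L := by
  have hne : ∀ l < L, D.ord l ≠ D.ord L := fun l hl e => by
    have := h.inj l (by omega) L (by omega) e; omega
  refine ⟨hr.f0, fun l _ => by rw [hr.ord], fun l hl => ?_, fun l _ => by rw [hr.seg],
    fun l _ => by rw [hr.fA], fun l _ => by rw [hr.fB], fun l hl j h1 h2 => ?_⟩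
  · exact hr.fp_off _ (hne l hl) fun e he e' => hr.off e he ⟨l, hl, e'.symm⟩
  · refine hr.exc j ?_
    rintro ⟨h3, h4⟩
    exact hne l hl (I.arc_unique (h.lt l (by omega)) (h.lt _ (by omega)) h1 h2 h3 h4)

theorem Redirected.root (hr : Redirected I D L sg D1 c d) (h : Valid I D b) (hlen : D.len = L + 1)
    (hL : 1 ≤ L) : D1.fp I.root = I.root := by
  have := (hr.same h hlen).fp 0 hL
  rwa [h.head, h.root] at this

/-- The chain of the redirected vertex leads to the root. -/
theorem Redirected.chain (hr : Redirected I D L sg D1 c d) (h : Valid I D b)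
    (hlen : D.len = L + 1) (hL : 1 ≤ L) (hsg : D.seg (D.ord L) = sg) :
    Closed I.E I.root D1.fp (Pre D1.ord sg) ∧ ToRoot I.root D1.fp (D.ord L) ∧
      ∀ j, D1.fp^[j] (D.ord L) < I.n := by
  have hon := h.seg L hL (by omega)
  have hcl0 := hon.closed
  have hle := hon.le
  rw [hsg] at hcl0 hle
  have hcl : Closed I.E I.root D1.fp (Pre D1.ord sg) :=
    closed_same (hr.same h hlen) hle h.root hcl0
  have hroot := hr.root h hlen hL
  have hjoin : Pre D1.ord sg (c d) := by rw [hr.ord]; exact hr.attach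
  refine ⟨hcl, ?_, fun j => ?_⟩
  · obtain ⟨k, hk⟩ := hcl.toRoot _ hjoin
    refine ⟨k + (d + 1), ?_⟩
    rw [Function.iterate_add_apply, hr.iterate le_rfl, hk]
  · rcases Nat.eq_zero_or_pos j with rfl | h1
    · exact h.lt L (by omega)
    rcases Nat.lt_or_ge d (j - 1) with h2 | h2
    · have := hcl.iterate hroot hjoin (j - 1 - d)
      rw [← hr.iterate le_rfl, ← Function.iterate_add_apply,
        show j - 1 - d + (d + 1) = j by omega] at this
      obtain ⟨l, hl, e⟩ := this
      rw [← e, hr.ord]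
      exact h.lt l (by omega)
    · have := hr.path_lt h2
      rwa [← hr.iterate h2, show j - 1 + 1 = j by omega] at this

/-- Pushing the chain of the redirected vertex completes the segment again. -/
theorem Redirected.rerouted {k : ℕ} (hr : Redirected I D L sg D1 c d) (h : Valid I D (L + 1))
    (hlen : D.len = L + 1) (hL : 1 ≤ L) (hsg : D.seg (D.ord L) = sg)
    (hB : D.fB (D.ord L) ≠ 0) (hp : Pushed D1 (D.ord L) sg k D')
    (hjoin : Pre D1.ord L (D1.fp^[k] (D.ord L))) : Rerouted I D L sg D' := by
  obtain ⟨hcl1, hto, hltn⟩ := hr.chain h hlen hL hsg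
  have hroot := hr.root h hlen hL
  have hon := h.seg L hL (by omega)
  have h1sg := hon.one_le
  have hle := hon.le
  have hst := hon.start
  have hnx := hon.next
  rw [hsg] at h1sg hle hst hnx
  have hlen1 := hr.len
  have hlen' := hp.len
  rw [hlen1] at hlen'
  have htopne : ¬ Pre D.ord L (D.ord L) := by
    rintro ⟨l, hl, e⟩
    have := h.inj l (by omega) L (by omega) e; omega
  have hoff := hp.off
  rw [hlen1, hr.ord] at hoff
  rw [hr.ord] at hjoin
  -- the number of pushed vertices
  obtain rfl : k = d + 1 := by
    have h1 : ¬ d + 1 < k := fun h1 => hoff (d + 1) h1 (by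
      rw [hr.iterate le_rfl]; exact hr.attach.mono hle)
    rcases Nat.lt_or_ge k (d + 1) with h2 | h2
    · rcases Nat.eq_zero_or_pos k with rfl | h3
      · exact absurd hjoin htopne
      · refine absurd hjoin ?_
        have := hr.iterate (e := k - 1) (by omega)
        rw [show k - 1 + 1 = k by omega] at this
        rw [this]
        exact hr.off (k - 1) (by omega)
    · omega
  have hordL : D'.ord L = D.ord L := by
    have := hp.new 0 (by omega)
    rwa [hlen1] at this
  have hordc : ∀ l, L < l → l < D'.len → D'.ord l = c (l - L - 1) := by
    intro l h1 h2
    have := hp.new (l - L) (by omega)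
    rw [hlen1, show L + (l - L) = l by omega, show l - L = (l - L - 1) + 1 by omega,
      hr.iterate (by omega)] at this
    exact this
  have hs : Same I D D' L := by
    have h1 := hp.same (I := I)
    rw [hlen1] at h1
    exact (hr.same h hlen).trans h1
  have hpreL : ∀ u, Pre D.ord (L + 1) u → Pre D'.ord D'.len u := by
    intro u hu
    rcases Pre.succ.1 hu with hu | rfl
    · exact ((hs.pre le_rfl u).2 hu).mono (by omega)
    · exact ⟨L, by omega, hordL⟩
  have hcpre : ∀ e < d, Pre D'.ord D'.len (c e) := fun e he =>
    ⟨L + 1 + e, by omega, by rw [hordc _ (by omega) (by omega)]; congr 1; omega⟩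
  -- the new vertices were not on the stack
  have hnew : ∀ l, L < l → l < D'.len → ¬ Pre D.ord D.len (D'.ord l) := by
    intro l h1 h2 h3
    rw [hordc l h1 h2] at h3
    rw [hlen, Pre.succ] at h3
    rcases h3 with h3 | h3
    · exact hr.off _ (by omega) h3
    · exact hr.ne_top _ (by omega) h3.symm
  have hexc : ∀ u, u ≠ D.ord L → u < I.n → ∀ j, I.off u ≤ j → j < I.off (u + 1) →
      D'.exc j = D.exc j := by
    intro u hu hun j h1 h2
    rw [hp.exc]
    refine hr.exc j ?_
    rintro ⟨h3, h4⟩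
    exact hu (I.arc_unique hun (h.lt _ (by omega)) h1 h2 h3 h4)
  have hnewn : ∀ l, L < l → l < D'.len → D'.ord l < I.n := fun l h1 h2 => by
    rw [hordc l h1 h2]; exact hr.path_lt (by omega)
  have hnewx : ∀ l, L < l → l < D'.len →
      ∀ a, I.off (D'.ord l) ≤ a → a < I.off (D'.ord l + 1) → D'.exc a = 0 := by
    intro l h1 h2 a h3 h4
    have hne : D'.ord l ≠ D.ord L := fun e => hnew l h1 h2 ⟨L, by omega, e.symm⟩
    rw [hexc _ hne (hnewn l h1 h2) a h3 h4]
    exact h.cleanArc _ (hnew l h1 h2) a h3 h4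
  have hosg : D'.ord sg = D.ord sg := by
    rcases Nat.lt_or_eq_of_le hle with h1 | rfl
    · exact hs.ord _ h1
    · exact hordL
  have hord1 : ∀ l, l ≤ L → D'.ord l = D.ord l := by
    intro l h1
    rcases Nat.lt_or_eq_of_le h1 with h1 | rfl
    · exact hs.ord _ h1
    · exact hordL
  have hcl : Closed I.E I.root D'.fp (Pre D'.ord sg) := by
    have h1 := hp.same (I := I)
    rw [hlen1] at h1
    exact closed_same h1 hle hroot hcl1
  have hseg : ∀ l, sg ≤ l → l < D'.len → D'.seg (D'.ord l) = sg := by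
    intro l h1 h2
    rcases Nat.lt_or_ge l L with h3 | h3
    · rw [hs.ord l h3, hs.seg l h3]; exact (hnx l h1 h3).2.2
    · rw [(hp.up (by omega) h2).1]; exact hp.segNew _ (by omega)
  have hup : ∀ l, sg ≤ l → l < D'.len → I.E (D'.ord l) (D'.fp (D'.ord l)) ∧
      (l + 1 = D'.len ∧ Pre D'.ord sg (D'.fp (D'.ord l)) ∨
        l + 1 < D'.len ∧ D'.fp (D'.ord l) = D'.ord (l + 1)) := by
    intro l h1 h2
    rcases Nat.lt_or_ge l L with h3 | h3
    · have h4 := hnx l h1 h3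
      rw [hs.ord l h3, hs.fp l h3, hord1 (l + 1) (by omega), h4.1]
      exact ⟨h4.2.1, .inr ⟨by omega, rfl⟩⟩
    · have h5 : D'.fp (D'.ord l) = c (l - L) := by
        rcases Nat.lt_or_eq_of_le h3 with h3 | rfl
        · rw [hordc l h3 h2, hp.fp, hr.fp_path _ (by omega)]
          congr 1; omega
        · rw [hordL, hp.fp, hr.fp_top, Nat.sub_self]
      have h6 : I.E (D'.ord l) (D'.fp (D'.ord l)) := by
        rw [h5]
        rcases Nat.lt_or_eq_of_le h3 with h3 | rfl
        · rw [hordc l h3 h2]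
          have := hr.adj (l - L - 1) (by omega)
          rwa [show l - L - 1 + 1 = l - L by omega] at this
        · rw [hordL, Nat.sub_self]; exact hr.arc.E
      refine ⟨h6, ?_⟩
      rcases Nat.lt_or_ge (l + 1) D'.len with h7 | h7
      · refine .inr ⟨h7, ?_⟩
        rw [h5, hordc (l + 1) (by omega) h7]
        congr 1; omega
      · refine .inl ⟨by omega, ?_⟩
        rw [h5, show l - L = d by omega, hs.pre hle]
        exact hr.attach
  have hfA : ∀ l, L < l → l < D'.len → D'.fA (D'.ord l) = 0 := by
    intro l h1 h2
    rw [hp.fA, hr.fA]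
    exact (h.clean _ (hnew l h1 h2)).2.2
  have hinj1 : ∀ i < D1.len, ∀ j < D1.len, D1.ord i = D1.ord j → i = j := by
    rw [hlen1, hr.ord]
    exact fun i hi j hj => h.inj i (by omega) j (by omega)
  have hrT : Pre D1.ord D1.len I.root := hcl1.root.mono (by omega)
  have hext : Valid I D' L ∧ Complete I D' := by
    refine h.extend (D' := D') (b' := L) (sg := sg) hs hL (by omega) (by omega) le_rfl (by omega)
      ?_ (hp.inj hinj1 hroot hrT hto) hp.pos ?_ ?_ h1sg hle (by rw [hosg]; exact hst) hcl hseg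
      hup ?_
    · intro i hi
      rcases Nat.lt_or_ge L i with h1 | h1
      · exact hnewn i h1 hi
      · rw [hord1 i h1]; exact h.lt i (by omega)
    · intro u hu
      have h1 : ¬ Pre D.ord D.len u := by rw [hlen]; exact mt (hpreL u) hu
      rw [hp.fp, hp.f0, hp.fB, hp.fA, hr.f0, hr.fB, hr.fA, hr.fp_off u]
      · exact h.clean u h1
      · rintro rfl; exact hu ⟨L, by omega, hordL⟩
      · rintro e he rfl; exact hu (hcpre e he)
    · intro u hu j h1 h2
      have h3 : ¬ Pre D.ord D.len u := by rw [hlen]; exact mt (hpreL u) hu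
      rw [hp.exc, hr.exc]
      · exact h.cleanArc u h3 j h1 h2
      · rintro ⟨h4, h5⟩
        rcases Nat.lt_or_ge u I.n with hun | hun
        · exact hu ⟨L, by omega,
            hordL.trans (I.arc_unique hun (h.lt L (by omega)) h1 h2 h4 h5).symm⟩
        · have := I.off_ge u hun; omega
    · intro l h1 h2 h3
      rcases Nat.lt_or_eq_of_le h1 with h1 | rfl
      · exact absurd (hfA l h1 h2) h3
      · rw [hordL, hp.fA, hr.fA] at h3
        obtain ⟨-, h4, h5⟩ := h.flagA L (by omega) h3
        refine ⟨rfl, by omega, ?_⟩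
        rw [hs.altA le_rfl hordL]; exact h5
  obtain ⟨hv, hcp⟩ := hext
  refine ⟨h1sg, hle, by omega, hv, hcp, fun l h1 => hseg l (by omega), hup, fun f hf => ?_⟩
  -- the solutions of the branch at `L` are those that agree with the stack below `L` and leave the
  -- path at the vertex of position `L` by an arc that is still admissible
  have hpart := partition (I := I) (D := D') (j := L) (L := D'.len) (by omega)
    (fun l h1 h2 => ⟨hv.seg l (by omega) h2, hv.ne_root (by omega) h2⟩)
    (fun l h1 h2 => ?_) hnewx hf
  · rw [add_assoc, ← hpart]
    have e1 : ind (Agree D' L f ∧ Allowed I D' (D'.ord L) (f (D'.ord L))) =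
        ind (D.fB (D.ord L) ≠ 0 ∧ SolB I D L f) := by
      refine ind_congr ?_
      rw [hs.agree le_rfl, hordL, SolB, and_iff_right hB]
      have := hr.allowed (f (D.ord L))
      rw [← this.trans and_comm]
      exact and_congr Iff.rfl (by simp only [Allowed, hp.exc])
    rw [e1, pend, pend, hlen, Finset.sum_range_succ, Finset.sum_range_succ]
    have e2 : ∑ i ∈ Finset.range D'.len, ind (D'.fA (D'.ord i) ≠ 0 ∧ SolA I D' i f) =
        ∑ i ∈ Finset.range L, ind (D.fA (D.ord i) ≠ 0 ∧ SolA I D i f) +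
          ind (D.fA (D.ord L) ≠ 0 ∧ SolA I D L f) := by
      rw [← Finset.sum_range_add_sum_Ico (n := D'.len) _ (show L + 1 ≤ D'.len by omega),
        Finset.sum_range_succ]
      have e3 : ∑ i ∈ Finset.Ico (L + 1) D'.len, ind (D'.fA (D'.ord i) ≠ 0 ∧ SolA I D' i f) =
          0 := by
        refine Finset.sum_eq_zero fun l hl => ind_false fun h' => h'.1 ?_
        rw [Finset.mem_Ico] at hl
        exact hfA l (by omega) hl.2
      rw [e3, add_zero]
      refine congrArg₂ (· + ·) (Finset.sum_congr rfl fun i hi => ?_) ?_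
      · rw [Finset.mem_range] at hi
        rw [hs.solA hi.le (hs.ord i hi), hs.ord i hi, hs.fA i hi]
      · rw [hs.solA le_rfl hordL, hordL, hp.fA, hr.fA]
    have e4 : ∑ i ∈ Finset.range L, ind (D'.fB (D'.ord i) ≠ 0 ∧ SolB I D' i f) =
        ∑ i ∈ Finset.range L, ind (D.fB (D.ord i) ≠ 0 ∧ SolB I D i f) := by
      refine Finset.sum_congr rfl fun i hi => ?_
      rw [Finset.mem_range] at hi
      rw [hs.solB hi, hs.ord i hi, hs.fB i hi]
    rw [e2, e4]
    omega
  · rcases Nat.lt_or_eq_of_le h1 with h3 | rfl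
    · exact allowed_of_clean (hup l (by omega) h2).1 (hnewx l h3 h2)
    · have := hr.arc
      rw [hordL, hp.fp, hr.fp_top]
      simpa only [Allowed, hp.exc] using this

end

end

section

variable {μ : Mach} {I : Inst}

attribute [local simp] SearchAt GrownAt

/-- A search from the subtree below the segment, in which the path up to the top vertex is blocked,
finds the new path; it exists as the flag of the top vertex is set. -/
theorem reroute_spec {s : Cf} {L sg : ℕ} (hc : Ctx μ I s) (hL : s.regs .len = L + 1) (hL1 : 1 ≤ L)
    (h : Valid I (stk s) (L + 1)) (hB : s.mem .fB (s.mem .ord L) ≠ 0)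
    (hsg : s.mem .seg (s.mem .ord L) = sg) :
    vc μ reroute (fun t s' => t ≤ 200 * (I.off I.n + I.n) + 200 ∧ Ctx μ I s' ∧
      Rerouted I (stk s) L sg (stk s') ∧ s'.regs .s = sg ∧ s'.regs .j0 = L) s := by
  have hbd := hc.bound
  have hlen : (stk s).len = L + 1 := hL
  have hLlt : L < (stk s).len := by omega
  obtain ⟨v, hv⟩ : ∃ v, s.mem .ord L = v := ⟨_, rfl⟩
  have hvn : v < I.n := by rw [← hv]; exact h.lt L hLlt
  have hLn : L + 1 ≤ I.n := by have := h.le_n; omega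
  have hlt : ∀ i < L + 1, s.mem .ord i < I.n := fun i hi => h.lt i (by omega)
  have hinj : ∀ i < L + 1, ∀ j < L + 1, s.mem .ord i = s.mem .ord j → i = j := fun i hi j hj =>
    h.inj i (by omega) j (by omega)
  have hle : sg ≤ L := by rw [← hsg]; exact (h.seg L hL1 hLlt).le
  obtain ⟨u0, hu0, hne0, hav0⟩ := (h.flagB L (by omega) hB).2
  rw [hv] at hB hsg
  simp only [stk_seg, stk_ord, stk_fp, hv, hsg] at hu0 hne0 hav0
  have hdeg := I.deg_le hvn
  unfold reroute
  simp only [vc, Expr.Idx, Expr.Small, Expr.eval, Op.eval, true_and, hL, Nat.add_sub_cancel, hv,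
    Config.setR_regs, Config.setR_mem, if_true, hsg]
  set s1 := (s.setR .v v).setR .s sg with hs1
  have hc1 : Ctx μ I s1 := (hc.setR rfl).setR rfl
  obtain ⟨y0, hy0⟩ : ∃ y0, s.mem .fp v = y0 := ⟨_, rfl⟩
  rw [hy0] at hne0
  -- all copies of the arc to the old parent are excluded
  refine vc_call (vc_forArcs (K := 3) (v := v)
    (fun j s' => ∀ a, s'.mem .exc a = if I.off v ≤ a ∧ a < j ∧ I.adj a = y0 then 1
      else s.mem .exc a)
    (by decide) (by decide) hc1 (by simp [hs1]) hvn ?_ ?_ ?_) ?_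
  · rintro j s' q x (rfl | rfl | rfl) h <;> simpa using h
  · intro a
    rw [if_neg (by omega)]; simp [hs1]
  · rintro j s2 hj1 hj2 hinv hf2 hc2 hx hj hy
    have efp : s2.mem .fp = s.mem .fp := by rw [hf2.mem _ (by decide)]; simp [hs1]
    simp only [vc, Expr.Idx, Expr.Small, Expr.eval, Op.eval, true_and, hx, hj, hy, efp, hy0]
    refine ⟨fun h0 => ⟨by omega, by omega, fun a => ?_⟩, fun h0 => ⟨Nat.zero_le _, by omega,
      fun a => ?_⟩⟩
    · replace h0 : I.adj j = y0 := by simpa using h0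
      simp only [Config.setA_mem, if_true, Function.update_apply]
      by_cases ha : a = j
      · subst ha; rw [if_pos rfl, if_pos ⟨hj1, by omega, h0⟩]
      · rw [if_neg ha, hinv a]
        refine if_congr ?_ rfl rfl
        constructor
        · rintro ⟨h1, h2, h3⟩; exact ⟨h1, by omega, h3⟩
        · rintro ⟨h1, h2, h3⟩; exact ⟨h1, by omega, h3⟩
    · replace h0 : I.adj j ≠ y0 := by simpa using h0
      simp only [Config.setR_mem]
      rw [hinv a]
      refine if_congr ?_ rfl rfl
      constructor
      · rintro ⟨h1, h2, h3⟩; exact ⟨h1, by omega, h3⟩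
      · rintro ⟨h1, h2, h3⟩
        refine ⟨h1, ?_, h3⟩
        rcases Nat.lt_succ_iff_lt_or_eq.1 h2 with h2 | rfl
        · exact h2
        · exact absurd h3 h0
  rintro t2 s2 ⟨ht2, hx2, -, hc2⟩ hf2
  have es2 : s2.regs .s = sg := by rw [hf2.regs _ (by decide)]; simp [hs1]
  have el2 : s2.regs .len = L + 1 := by rw [hf2.regs _ (by decide)]; simp [hs1, hL]
  have eo2 : s2.mem .ord = s.mem .ord := by rw [hf2.mem _ (by decide)]; simp [hs1]
  simp only [es2, reduceCtorEq, if_false, el2]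
  set s3 := (s2.setR .t sg).setR .hi (L + 1) with hs3
  have hc3 : Ctx μ I s3 := (hc2.setR rfl).setR rfl
  have eo3 : s3.mem .ord = s.mem .ord := by simp [hs3, eo2]
  refine vc_call (initSearch_spec (t := sg) (hi := L + 1) hc3 (by simp [hs3]) (by simp [hs3])
    (by omega) (by rw [eo3]; exact hlt) (by rw [eo3]; exact hinj)) ?_
  rw [eo3]
  rintro t4 s4 ⟨ht4, hc4, hT4, hP4, hO4, hse4, hhd4, htl4, hq4⟩ hf4
  refine vc_call (explore_spec (Src := Pre (s.mem .ord) sg) hc4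
    (by rw [hhd4, htl4]; exact hse4)) ?_
  rintro t5 s5 ⟨hse5, hhd5, hg5, ht5, hc5⟩ hf5
  have hsp5 : I.spent (s5.mem .que) (s5.regs .tail) ≤ I.off I.n + I.n :=
    I.spent_le hse5.lt hse5.inj
  simp only [hhd4, Inst.spent, Finset.range_zero, Finset.sum_empty] at ht5 hsp5
  -- the blocked vertices are those of the segment
  have hone5 : ∀ u < I.n, s5.mem .lab u = 1 ↔ ∃ l, sg ≤ l ∧ l ≤ L ∧ s.mem .ord l = u := by
    intro u hu
    by_cases hz : s4.mem .lab u = 0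
    · refine iff_of_false (hg5.new u hz) ?_
      rintro ⟨l, h2, h3, rfl⟩
      have := hP4 l h2 (by omega); omega
    · rw [hg5.lab_eq u hz]
      constructor
      · intro h1
        by_cases hp : Pre (s.mem .ord) (L + 1) u
        · obtain ⟨l, hl, rfl⟩ := hp
          refine ⟨l, ?_, by omega, rfl⟩
          by_contra hcon
          have := hT4 l (by omega); omega
        · have := hO4 u hu hp; omega
      · rintro ⟨l, h2, h3, rfl⟩; exact hP4 l h2 (by omega)
  have hlv5 : s5.mem .lab v = 1 := (hone5 v hvn).2 ⟨L, hle, le_rfl, hv⟩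
  have hav5 := fun {u} (hu : u < I.n) => hse5.av_iff hone5 hu
  obtain ⟨-, a0, ha1, ha2, ha3, ha4⟩ := hu0
  have hu0n : u0 < I.n := by
    rw [← ha3]; exact I.adj_lt a0 (by have := I.off_mono (u := v + 1) hvn le_rfl; omega)
  have hlu0 : 2 ≤ s5.mem .lab u0 := (hav5 hu0n).2 hav0
  have hx5 : ∀ a, s5.mem .exc a = if I.off v ≤ a ∧ a < I.off (v + 1) ∧ I.adj a = y0 then 1
      else s.mem .exc a := by
    rw [hf5.mem _ (by decide), hf4.mem _ (by decide)]; simpa [hs3] using hx2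
  have ev5 : s5.regs .v = v := by
    rw [hf5.regs _ (by decide), hf4.regs _ (by decide)]
    simp [hs3, hf2.regs .v (by decide), hs1]
  have efp5 : s5.mem .fp = s.mem .fp := by
    rw [hf5.mem _ (by decide), hf4.mem _ (by decide)]
    simp [hs3, hf2.mem .fp (by decide), hs1]
  have el5 : s5.regs .len = L + 1 := by
    rw [hf5.regs _ (by decide), hf4.regs _ (by decide)]; simp [hs3, el2]
  have es5 : s5.regs .s = sg := by
    rw [hf5.regs _ (by decide), hf4.regs _ (by decide)]; simp [hs3, es2]
  -- the choice of the new arc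
  refine vc_call (vc_forArcs (K := 3) (v := v)
    (fun j s' => (∀ u, u ≠ v → s'.mem .fp u = s.mem .fp u) ∧
      ((∀ a, I.off v ≤ a → a < j → ¬ (s5.mem .exc a = 0 ∧ 2 ≤ s5.mem .lab (I.adj a))) ∨
        ∃ a, I.off v ≤ a ∧ a < I.off (v + 1) ∧ I.adj a = s'.mem .fp v ∧ s5.mem .exc a = 0 ∧
          2 ≤ s5.mem .lab (I.adj a)))
    (by decide) (by decide) hc5 ev5 hvn ?_ ?_ ?_) ?_
  · rintro j s' q x (rfl | rfl | rfl) h <;> simpa using h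
  · exact ⟨fun u _ => by rw [efp5], .inl fun a _ _ => by omega⟩
  · rintro j s6 hj1 hj2 ⟨hinv1, hinv2⟩ hf6 hc6 hx hj hy
    have eexc : s6.mem .exc = s5.mem .exc := hf6.mem _ (by decide)
    have elb : s6.mem .lab = s5.mem .lab := hf6.mem _ (by decide)
    simp only [vc, Expr.Idx, Expr.Small, Expr.eval, true_and, hx, hj, hy, eexc, elb, ne_eq,
      Op.mul_eq_zero, Op.lt_eq_zero, Op.eq_eq_zero, not_or, not_le, not_not]
    refine ⟨fun h0 => ⟨by omega, fun u hu => ?_, .inr ⟨j, hj1, hj2, ?_, h0.1, h0.2⟩⟩,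
      fun h0 => ⟨Nat.zero_le _, by omega, fun u hu => ?_, ?_⟩⟩
    · simp only [Config.setA_mem, if_true, Function.update_of_ne hu]; exact hinv1 u hu
    · simp
    · simpa using hinv1 u hu
    · simp only [Config.setR_mem]
      refine hinv2.imp_left fun hn a h1 h2 => ?_
      rcases Nat.lt_succ_iff_lt_or_eq.1 h2 with h2 | rfl
      · exact hn a h1 h2
      · rintro ⟨h3, h4⟩
        rcases h0 with h0 | h0
        · exact h0 h3
        · omega
  rintro t6 s6 ⟨ht6, ⟨hfp6, hch6⟩, hf6, hc6⟩ -
  obtain ⟨x, hx⟩ : ∃ x, s6.mem .fp v = x := ⟨_, rfl⟩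
  rw [hx] at hch6
  obtain ⟨ax, hax1, hax2, hax3, hax4, hax5⟩ : ∃ a, I.off v ≤ a ∧ a < I.off (v + 1) ∧
      I.adj a = x ∧ s5.mem .exc a = 0 ∧ 2 ≤ s5.mem .lab (I.adj a) := by
    refine hch6.resolve_left fun hn => hn a0 ha1 ha2 ⟨?_, by rw [ha3]; exact hlu0⟩
    rw [hx5, if_neg]
    · exact ha4
    · rintro ⟨-, -, h3⟩; exact hne0 (ha3.symm.trans h3)
  rw [hax3] at hax5
  have ev6 : s6.regs .v = v := by rw [hf6.regs _ (by decide), ev5]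
  have el6 : s6.regs .len = L + 1 := by rw [hf6.regs _ (by decide), el5]
  simp only [ev6, Config.setA_regs, el6, Nat.add_sub_cancel, Config.setA_mem, reduceCtorEq,
    if_false, hx]
  refine ⟨by omega, ?_⟩
  set s7 := (((s6.setA .pos v 0).setR .len L).setR .j0 L).setR .z x with hs7
  have hc7 : Ctx μ I s7 := (((hc6.setA (by decide)).setR rfl).setR rfl).setR rfl
  have epos6 : s6.mem .pos = s.mem .pos := by
    rw [hf6.mem _ (by decide), hf5.mem _ (by decide), hf4.mem _ (by decide)]
    simp [hs3, hf2.mem .pos (by decide), hs1]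
  have hpos7 : ∀ u, s7.mem .pos u ≠ 0 ↔ Pre (s.mem .ord) L u := by
    intro u
    simp only [hs7, Config.setR_mem, Config.setA_mem, if_true, epos6, Function.update_apply]
    split_ifs with hu
    · refine iff_of_false (fun h => h rfl) ?_
      rintro ⟨l, hl, e⟩
      have := hinj l (by omega) L (by omega) (by rw [e, hu, hv]); omega
    · have := h.pos u
      rw [hlen] at this
      rw [show s.mem .pos u ≠ 0 ↔ _ from this, Pre.succ]
      exact or_iff_left fun e => hu (e.symm.trans hv)
  have enp : s7.mem .np = s5.mem .np := by simp [hs7, hf6.mem .np (by decide)]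
  have efp7 : s7.mem .fp = s6.mem .fp := by simp [hs7]
  have ez7 : s7.regs .z = x := by simp [hs7]
  have hmem7 : ∀ a : Arr, a ≠ .lab → a ≠ .que → a ≠ .np → a ≠ .exc → a ≠ .fp → a ≠ .pos →
      s7.mem a = s.mem a := by
    intro a h1 h2 h3 h4 h5 h6
    simp only [hs7, Config.setR_mem, Config.setA_mem, if_neg h6]
    rw [hf6.mem, hf5.mem, hf4.mem]
    · simp only [hs3, Config.setR_mem]
      rw [hf2.mem]
      · simp [hs1]
      · simpa [forArcs, Cmd.wa, inc] using h4
    · simpa [initSearch, Cmd.wa, inc] using ⟨h1, ⟨h1, h2⟩, h1⟩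
    · simpa [explore, forArcs, Cmd.wa, inc] using ⟨h1, h3, h2⟩
    · simpa [forArcs, Cmd.wa, inc] using h5
  have eexc7 : s7.mem .exc = s5.mem .exc := by simp [hs7, hf6.mem .exc (by decide)]
  have el7 : s7.regs .len = L := by simp [hs7]
  have ej7 : s7.regs .j0 = L := by simp [hs7]
  have ev7 : s7.regs .v = v := by simp [hs7, ev6]
  have es7 : s7.regs .s = sg := by simp [hs7, hf6.regs .s (by decide), es5]
  clear_value s7
  obtain ⟨i0, hi0, hi0x⟩ := (hse5.mem x (hax3 ▸ I.adj_lt ax (by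
    have := I.off_mono (u := v + 1) hvn le_rfl; omega))).1 hax5
  have htl5 := hse5.tail_le
  -- the chain of search parents, down to the subtree
  refine vc_call (vc_loop_ghost (Q := fun t s' => t ≤ 8 * I.n + 1 ∧ ∃ d,
      (∀ e < d, ¬ Pre (s.mem .ord) L ((s5.mem .np)^[e] x)) ∧
      Pre (s.mem .ord) sg ((s5.mem .np)^[d] x) ∧
      (∀ e ≤ d, 2 ≤ s5.mem .lab ((s5.mem .np)^[e] x)) ∧
      (∀ e < d, I.E ((s5.mem .np)^[e] x) ((s5.mem .np)^[e + 1] x)) ∧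
      (∀ e < d, s'.mem .fp ((s5.mem .np)^[e] x) = (s5.mem .np)^[e + 1] x) ∧
      ∀ u, (∀ e < d, (s5.mem .np)^[e] x ≠ u) → s'.mem .fp u = s7.mem .fp u)
    (fun m s' => ∃ d i, m = 8 * i ∧ s'.regs .z = (s5.mem .np)^[d] x ∧ i < s5.regs .tail ∧
      s5.mem .que i = (s5.mem .np)^[d] x ∧
      (∀ e < d, ¬ Pre (s.mem .ord) L ((s5.mem .np)^[e] x)) ∧
      (∀ e ≤ d, 2 ≤ s5.mem .lab ((s5.mem .np)^[e] x)) ∧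
      (∀ e < d, I.E ((s5.mem .np)^[e] x) ((s5.mem .np)^[e + 1] x)) ∧
      (∀ e < d, s'.mem .fp ((s5.mem .np)^[e] x) = (s5.mem .np)^[e + 1] x) ∧
      ∀ u, (∀ e < d, (s5.mem .np)^[e] x ≠ u) → s'.mem .fp u = s7.mem .fp u)
    (8 * i0) (by decide) ⟨0, i0, rfl, ez7, hi0, hi0x, by omega, ?_, by omega, by omega,
      fun _ _ => rfl⟩ ?_ ?_) ?_
  · intro e he
    obtain rfl : e = 0 := by omega
    exact hax5
  · rintro m s8 ⟨d, i, hm, hz, hi, hqi, hoff, hlab, hE, hfp, hfo⟩ hf8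
    refine ⟨by simp [Expr.Idx, Expr.Small], fun h0 => ?_⟩
    have epos : s8.mem .pos = s7.mem .pos := hf8.mem _ (by decide)
    have enp8 : s8.mem .np = s5.mem .np := (hf8.mem _ (by decide)).trans enp
    simp only [Expr.eval, ne_eq, Op.eq_eq_zero, not_not, hz, epos] at h0
    have hnp : ¬ Pre (s.mem .ord) L ((s5.mem .np)^[d] x) := fun hp => (hpos7 _).2 hp h0
    obtain ⟨-, i', hi', hq1, hq2, hq3⟩ := (hse5.src i hi).resolve_left fun hs => hnp (by
      rw [← hqi]; exact hs.mono hle)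
    rw [hqi] at hq1 hq2 hq3
    have hzn : (s5.mem .np)^[d] x < I.n := by rw [← hqi]; exact hse5.lt i hi
    simp only [vc, Expr.Idx, Expr.Small, Expr.eval, true_and, hz, enp8, Config.setA_mem, if_true,
      Config.setA_regs, Function.update_self]
    rw [← Function.iterate_succ_apply' (s5.mem .np)] at hq1 ⊢
    refine ⟨8 * i', ⟨d + 1, i', rfl, by simp, by omega, hq1.symm, ?_, ?_, ?_, ?_, ?_⟩,
      by omega⟩
    · intro e he
      rcases Nat.lt_succ_iff_lt_or_eq.1 he with he | rfl
      · exact hoff e he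
      · exact hnp
    · intro e he
      rcases Nat.lt_or_eq_of_le he with he | rfl
      · exact hlab e (by omega)
      · rw [hq1, ← hq3]; exact hlab d le_rfl
    · intro e he
      rcases Nat.lt_succ_iff_lt_or_eq.1 he with he | rfl
      · exact hE e he
      · rw [hq1]; exact I.E_symm hq2
    · intro e he
      simp only [Config.setR_mem, Config.setA_mem, if_true, Function.update_apply]
      split_ifs with he'
      · rw [Function.iterate_succ_apply', Function.iterate_succ_apply', he']
      · rcases Nat.lt_succ_iff_lt_or_eq.1 he with he | rfl
        · exact hfp e he
        · exact absurd rfl he'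
    · intro u hu
      simp only [Config.setR_mem, Config.setA_mem, if_true]
      rw [Function.update_of_ne (fun e => hu d (by omega) e.symm)]
      exact hfo u fun e he => hu e (by omega)
  · rintro t m s8 ⟨d, i, hm, hz, hi, hqi, hoff, hlab, hE, hfp, hfo⟩ h0 ht hf8
    have epos : s8.mem .pos = s7.mem .pos := hf8.mem _ (by decide)
    simp only [Expr.eval, Op.eq_eq_zero, hz, epos] at h0
    obtain ⟨l, hl, he⟩ := (hpos7 _).1 h0
    refine ⟨by omega, d, hoff, ⟨l, ?_, he⟩, hlab, hE, hfp, hfo⟩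
    by_contra hcon
    have h1 := (hone5 _ (hlt l (by omega))).2 ⟨l, by omega, by omega, rfl⟩
    have h2 := hlab d le_rfl
    rw [← he] at h2
    omega
  rintro t8 s8 ⟨ht8, d, hoff, hjoin, hlab, hE, hfp8, hfo8⟩ hf8
  have hc8 : Ctx μ I s8 := hc7.frame hf8 (by decide)
  obtain ⟨c, hcdef⟩ : ∃ c : ℕ → ℕ, ∀ e, (s5.mem .np)^[e] x = c e := ⟨_, fun _ => rfl⟩
  simp only [hcdef] at hoff hjoin hlab hE hfp8 hfo8
  have hc0 : x = c 0 := hcdef 0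
  have hcv : ∀ e < d, c e ≠ v := fun e he e' => by
    have := hlab e he.le; rw [e'] at this; omega
  have ev8 : s8.regs .v = v := by rw [hf8.regs _ (by decide), ev7]
  have emem8 : ∀ a : Arr, a ≠ .fp → s8.mem a = s7.mem a := fun a ha =>
    hf8.mem _ (by simpa [Cmd.wa] using ha)
  simp only [ev8]
  set s9 := s8.setR .w v with hs9
  have hc9 : Ctx μ I s9 := hc8.setR rfl
  have emem9 : s9.mem = s8.mem := rfl
  have ereg9 : ∀ x : Reg, x ≠ .w → x ≠ .z → s9.regs x = s7.regs x := fun x h1 h2 => by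
    rw [hs9, Config.setR_regs, if_neg h1]
    exact hf8.regs _ (by simpa [Cmd.wr] using h2)
  have eo9 : s9.mem .ord = s.mem .ord := by
    rw [emem9, emem8 _ (by decide)]; exact hmem7 _ (by decide) (by decide) (by decide) (by decide)
      (by decide) (by decide)
  have exc9 : s9.mem .exc = s5.mem .exc := by rw [emem9, emem8 _ (by decide), eexc7]
  have el9 : s9.regs .len = L := by rw [ereg9 _ (by decide) (by decide), el7]
  have hpos9 : ∀ u, s9.mem .pos u ≠ 0 ↔ Pre (s.mem .ord) L u := by
    rw [emem9, emem8 _ (by decide)]; exact hpos7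
  have hall : ∀ y, Allowed I (stk s9) v y ↔ Allowed I (stk s) v y ∧ y ≠ y0 := by
    intro y
    simp only [Allowed, stk_exc, exc9]
    constructor
    · rintro ⟨h1, j, h2, h3, h4, h5⟩
      rw [hx5] at h5
      split_ifs at h5 with h6
      exact ⟨⟨h1, j, h2, h3, h4, h5⟩, fun e => h6 ⟨h2, h3, h4.trans e⟩⟩
    · rintro ⟨⟨h1, j, h2, h3, h4, h5⟩, h6⟩
      refine ⟨h1, j, h2, h3, h4, ?_⟩
      rw [hx5, if_neg fun h7 => h6 (h4.symm.trans h7.2.2)]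
      exact h5
  have hred : Redirected I (stk s) L sg (stk s9) c d := by
    have hm : ∀ a : Arr, a ≠ .lab → a ≠ .que → a ≠ .np → a ≠ .exc → a ≠ .fp → a ≠ .pos →
        s9.mem a = s.mem a := fun a h1 h2 h3 h4 h5 h6 =>
      (emem8 a h5).trans (hmem7 a h1 h2 h3 h4 h5 h6)
    constructor
    case len => exact el9
    case ord => exact eo9
    case seg => apply hm <;> decide
    case f0 => apply hm <;> decide
    case fB => apply hm <;> decide
    case fA => apply hm <;> decide
    case exc =>
      intro j hj
      simp only [stk_ord, hv] at hj
      simp only [stk_exc, exc9, hx5]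
      rw [if_neg fun h1 => hj ⟨h1.1, h1.2.1⟩]
    case allowed => simp only [stk_ord, hv, stk_fp, hy0]; exact hall
    case fp_top =>
      simp only [stk_ord, hv, stk_fp, emem9]
      rw [hfo8 v hcv, efp7, hx, hc0]
    case fp_path => exact hfp8
    case fp_off =>
      intro u h1 h2
      simp only [stk_ord, hv] at h1
      simp only [stk_fp, emem9]
      rw [hfo8 u h2, efp7, hfp6 u h1]
    case ne_top => simp only [stk_ord, hv]; exact hcv
    case off => exact hoff
    case attach => exact hjoin
    case arc =>
      simp only [stk_ord, hv]
      refine ⟨hvn, ax, hax1, hax2, hax3.trans hc0, ?_⟩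
      simp only [stk_exc, exc9]; exact hax4
    case adj => exact hE
  obtain ⟨hcl9, hto9, hltn9⟩ := hred.chain h hlen hL1 (by simpa [hv] using hsg)
  simp only [stk_ord, stk_fp, hv, eo9] at hcl9 hto9 hltn9
  refine vc_call (pushPath_spec (w := v) (sg := sg) hc9 (by simp [hs9])
    (by rw [ereg9 _ (by decide) (by decide), es7]) (by rw [el9, eo9]; exact hpos9)
    (by rw [el9, eo9]; exact fun i hi => hlt i (by omega))
    (by rw [el9, eo9]; exact fun i hi j hj => hinj i (by omega) j (by omega))
    (hred.root h hlen hL1) (by rw [el9, eo9]; exact hcl9.root.mono hle) hto9 hltn9) ?_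
  rintro t10 s10 ⟨ht10, hc10, k, hp, hst10⟩ hf10
  rw [el9] at hst10
  refine ⟨by omega, hc10, hred.rerouted h hlen hL1 (by simpa [hv] using hsg)
    (by simpa [hv] using hB) (by simpa [hv] using hp) (by simpa [hv] using hst10), ?_, ?_⟩
  · rw [hf10.regs _ (by decide), ereg9 _ (by decide) (by decide), es7]
  · rw [hf10.regs _ (by decide), ereg9 _ (by decide) (by decide), ej7]

end

/-! ### One round of the enumeration -/

section

variable {μ : Mach} {I : Inst}

/-- Only the parents of the vertices in the tree matter for the output. -/
theorem desc_prune {f : ℕ → ℕ} {out : List ℕ} (h : Desc I f out) : Desc I (prune I.W f) out := by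
  obtain ⟨us, h1, h2, rfl⟩ := h
  refine ⟨us, h1, fun u => (h2 u).trans (and_congr (used_prune u).symm Iff.rfl), ?_⟩
  refine List.flatMap_congr fun u hu => ?_
  rw [prune_used ((h2 u).1 hu).1]

theorem Tree.sol {ord fp : ℕ → ℕ} {t : ℕ} (h : Tree I ord fp t) :
    Sol I.E I.W I.root (prune I.W fp) := sol_prune h.root h.toRoot h.adj

/-- Exploring a branch of the first kind outputs one of its solutions. -/
theorem popB_spec {s : Cf} {L : ℕ} (hc : Ctx μ I s) (hL : s.regs .len = L + 1) (hL1 : 1 ≤ L)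
    (h : Valid I (stk s) (L + 1)) (hB : s.mem .fB (s.mem .ord L) ≠ 0) (hcur : s.current = []) :
    vc μ popB (fun t s' => t ≤ 400 * (I.off I.n + I.n) + 400 ∧ Ctx μ I s' ∧
      Valid I (stk s') (s'.regs .len) ∧ Complete I (stk s') ∧ s'.current = [] ∧
      Sol I.E I.W I.root (prune I.W (s'.mem .fp)) ∧
      (∃ out, Desc I (prune I.W (s'.mem .fp)) out ∧ s'.solutions = s.solutions ++ [out]) ∧
      ∀ f, Sol I.E I.W I.root f → pend I (stk s) (L + 1) f =
        ind (f = prune I.W (s'.mem .fp)) + pend I (stk s') (s'.regs .len) f +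
        ind (Agree (stk s') (s'.regs .len) f ∧ f ≠ prune I.W (s'.mem .fp))) s := by
  obtain ⟨sg, hsg⟩ : ∃ sg, s.mem .seg (s.mem .ord L) = sg := ⟨_, rfl⟩
  unfold popB
  simp only [vc]
  refine vc_call (reroute_spec hc hL hL1 h hB hsg) ?_
  rintro t1 s1 ⟨ht1, hc1, hr, hs1, hj1⟩ hf1
  have hcur1 : s1.current = [] := (hf1.cur (by decide)).trans hcur
  have hsol1 : s1.solutions = s.solutions := hf1.sols (by decide)
  obtain ⟨L', hL'⟩ : ∃ L', s1.regs .len = L' := ⟨_, rfl⟩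
  have hlen1 : (stk s1).len = L' := hL'
  have hT : Tree I (s1.mem .ord) (s1.mem .fp) L' := by
    have := hr.valid.tree hr.complete; rwa [hlen1] at this
  refine vc_call (output_spec hc1 hT hcur1) ?_
  rintro t2 s2 ⟨ht2, hc2, hcur2, out, hout, hsol2⟩ hf2
  have e2 : stk s2 = stk s1 := stk_frame hf2 (by decide)
  have eo2 : s2.mem .ord = s1.mem .ord := congrArg Stack.ord e2
  have ef2 : s2.mem .fp = s1.mem .fp := congrArg Stack.fp e2
  have eg2 : s2.mem .seg = s1.mem .seg := congrArg Stack.seg e2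
  have hlt := hr.lt
  rw [hlen1] at hlt
  have hseg := hr.seg
  have hup := hr.up
  rw [hlen1] at hseg hup
  have hL2 : s2.regs .len = L' := (congrArg Stack.len e2).trans hL'
  refine vc_call (setFlags_valid (sg := sg) (j0 := L) (L := L') hc2
    (by rw [hf2.regs _ (by decide), hs1]) (by rw [hf2.regs _ (by decide), hj1]) hL2
    hr.one_le hr.le hlt.le (by rw [e2]; exact hr.valid)
    (by rw [eo2, eg2]; exact hseg) (by rw [eo2, ef2]; exact hup)) ?_
  rw [e2]
  rintro t3 s3 ⟨ht3, hc3, e3, hv3, hp3, -⟩ hf3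
  have hL3 : s3.regs .len = L' := (congrArg Stack.len e3).trans hL'
  have ef3 : s3.mem .fp = s1.mem .fp := congrArg Stack.fp e3
  rw [hL3, ef3]
  refine ⟨by omega, hc3, hv3, by rw [e3]; exact hr.complete, (hf3.cur (by decide)).trans hcur2,
    hT.sol, ⟨out, desc_prune hout, ?_⟩, fun f hf => ?_⟩
  · rw [hf3.sols (by decide), hsol2, hsol1]
  · have hag := hr.valid.ind_agree (f := f)
    rw [hlen1] at hag
    rw [hr.count f hf, hp3 f hf, hlen1, hag]
    have : ind (Agree (stk s3) L' f ∧ f ≠ prune I.W (s1.mem .fp)) =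
        ind (Agree (stk s1) L' f ∧ f ≠ prune I.W (stk s1).fp) := by
      rw [e3]; rfl
    rw [this]
    simp only [stk_fp]
    omega

open Classical in
/-- The invariant of the enumeration: `gs` lists the solutions that have been output, and every
solution either is one of them or belongs to exactly one pending branch. -/
structure Stage (I : Inst) (gs : List (ℕ → ℕ)) (s : Cf) : Prop where
  valid : Valid I (stk s) (s.regs .len)
  current : s.current = []
  sol : ∀ g ∈ gs, Sol I.E I.W I.root g
  desc : List.Forall₂ (Desc I) gs s.solutions
  count : ∀ f, Sol I.E I.W I.root f → gs.count f + pend I (stk s) (s.regs .len) f = 1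

/-- No branches are pending at the root. -/
theorem pend_one {D : Stack} {b : ℕ} (h : Valid I D b) (hb : b = 1) (hl : D.len = 1)
    (f : ℕ → ℕ) : pend I D b f = 0 := by
  have hB : D.fB (D.ord 0) = 0 := by
    by_contra hcon
    have := (h.flagB 0 (by omega) hcon).1; omega
  have hA : D.fA (D.ord 0) = 0 := by
    by_contra hcon
    have := (h.flagA 0 (by omega) hcon).1; omega
  rw [pend, hb, hl, Finset.sum_range_one, Finset.sum_range_one, ind_false fun h => h.1 hB,
    ind_false fun h => h.1 hA]

open Classical in
/-- A round outputs another solution, or it finds that there are no pending branches. -/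
theorem round_spec {s : Cf} {gs : List (ℕ → ℕ)} (hc : Ctx μ I s) (h : Stage I gs s)
    (hct : s.regs .cont = 1) :
    vc μ round (fun t s' => t ≤ 3000 * (I.off I.n + I.n) + 3000 ∧ Ctx μ I s' ∧
      ((s'.regs .cont = 1 ∧ ∃ g, Stage I (gs ++ [g]) s') ∨
        s'.regs .cont = 0 ∧ Stage I gs s' ∧ ∀ f, Sol I.E I.W I.root f → gs.count f = 1)) s := by
  -- the second half of a round, once a branch of the first kind is on top
  have main : ∀ s2 : Cf, Ctx μ I s2 → Valid I (stk s2) (s2.regs .len) → 2 ≤ s2.regs .len →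
      s2.mem .fB (s2.mem .ord (s2.regs .len - 1)) ≠ 0 → s2.current = [] →
      s2.solutions = s.solutions → s2.regs .cont = 1 →
      (∀ f, Sol I.E I.W I.root f → gs.count f + pend I (stk s2) (s2.regs .len) f = 1) →
      vc μ popB (fun t s3 => t ≤ 400 * (I.off I.n + I.n) + 400 ∧
        vc μ expand (fun t' s4 => t' ≤ 600 * (I.off I.n + I.n) + 600 ∧ Ctx μ I s4 ∧
          s4.regs .cont = 1 ∧ ∃ g, Stage I (gs ++ [g]) s4) s3) s2 := by
    intro s2 hc2 hv2 hl2 hB2 hcur2 hsol2 hct2 hcount2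
    obtain ⟨L, hL⟩ : ∃ L, s2.regs .len = L + 1 := ⟨s2.regs .len - 1, by omega⟩
    rw [hL, Nat.add_sub_cancel] at hB2
    rw [hL] at hv2 hcount2
    refine vc_call (popB_spec hc2 hL (by omega) hv2 hB2 hcur2) ?_
    rintro t3 s3 ⟨ht3, hc3, hv3, hcp3, hcur3, hg, ⟨out, hout, hsol3⟩, hp3⟩ hf3
    refine ⟨ht3, ?_⟩
    obtain ⟨g, hgd⟩ : ∃ g, prune I.W (s3.mem .fp) = g := ⟨_, rfl⟩
    rw [hgd] at hg hout
    have hcnt : ∀ f, (gs ++ [g]).count f = gs.count f + ind (f = g) := by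
      intro f
      rw [List.count_append]
      congr 1
      by_cases hfg : f = g
      · rw [ind_true hfg, hfg, List.count_singleton_self]
      · rw [ind_false hfg]
        exact List.count_eq_zero.2 (by simpa using hfg)
    refine vc_call (expand_spec (C := fun f => (gs ++ [g]).count f) hc3 hv3 hcp3 fun f hf => ?_) ?_
    · have h1 := hcount2 f hf
      have h2 := hp3 f hf
      rw [hgd] at h2 ⊢
      simp only [hcnt]
      omega
    · rintro t4 s4 ⟨ht4, hc4, hv4, hp4, -⟩ hf4
      refine ⟨ht4, hc4, ?_, g, hv4, (hf4.cur (by decide)).trans hcur3, ?_, ?_, hp4⟩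
      · rw [hf4.regs _ (by decide), hf3.regs _ (by decide), hct2]
      · intro g' hg'
        rw [List.mem_append, List.mem_singleton] at hg'
        rcases hg' with hg' | rfl
        · exact h.sol g' hg'
        · exact hg
      · rw [hf4.sols (by decide), hsol3, hsol2]
        exact List.rel_append h.desc (.cons hout .nil)
  unfold round
  simp only [vc, Expr.Idx, Expr.Small, Expr.eval, ne_eq, Op.lt_eq_zero, Op.eq_eq_zero, Op.sub_eq,
    not_le, not_not, true_and]
  refine vc_call (undo_spec hc h.valid) ?_
  rintro t1 s1 ⟨ht1, hc1, hv1, hp1, hend1, -⟩ hf1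
  have hcur1 : s1.current = [] := (hf1.cur (by decide)).trans h.current
  have hsol1 : s1.solutions = s.solutions := hf1.sols (by decide)
  have hct1 : s1.regs .cont = 1 := (hf1.regs _ (by decide)).trans hct
  have hcount1 : ∀ f, Sol I.E I.W I.root f →
      gs.count f + pend I (stk s1) (s1.regs .len) f = 1 := by
    intro f hf; rw [hp1]; exact h.count f hf
  refine ⟨fun hl1 => ⟨fun hB1 => ?_, fun hB1 => ?_⟩, fun hl1 => ?_⟩
  · -- a branch of the second kind is on top
    obtain ⟨L, hL⟩ : ∃ L, s1.regs .len = L + 1 := ⟨s1.regs .len - 1, by omega⟩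
    have hA1 : s1.mem .fA (s1.mem .ord L) ≠ 0 := by
      have := (hend1.resolve_left (by omega)).2.resolve_left (fun h => h hB1)
      rwa [hL, Nat.add_sub_cancel] at this
    rw [hL, Nat.add_sub_cancel] at hB1
    rw [hL] at hv1 hcount1
    refine vc_call (popA_spec hc1 hL (by omega) hv1 hB1 hA1) ?_
    rintro t2 s2 ⟨ht2, hc2, hv2, hcp2, hp2, hA2⟩ hf2
    refine vc_call (expand_spec (C := fun f => gs.count f) hc2 hv2 hcp2 fun f hf => ?_) ?_
    · have := hcount1 f hf
      have := hp2 f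
      omega
    rintro t3 s3 ⟨ht3, hc3, hv3, hp3, hpr3⟩ hf3
    refine vc_call (undo_spec hc3 hv3) ?_
    rintro t4 s4 ⟨ht4, hc4, hv4, hp4, -, hpr4⟩ hf4
    obtain ⟨hl4, hB4⟩ := hpr4 (hpr3 hA2)
    refine vc_mono (main s4 hc4 hv4 hl4 hB4 ?_ ?_ ?_ ?_) ?_
    · rw [hf4.cur (by decide), hf3.cur (by decide), hf2.cur (by decide), hcur1]
    · rw [hf4.sols (by decide), hf3.sols (by decide), hf2.sols (by decide), hsol1]
    · rw [hf4.regs _ (by decide), hf3.regs _ (by decide), hf2.regs _ (by decide), hct1]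
    · intro f hf; rw [hp4]; exact hp3 f hf
    · rintro t5 s5 ⟨ht5, h5⟩
      refine vc_mono h5 ?_
      rintro t6 s6 ⟨ht6, hc6, hct6, hg⟩
      exact ⟨by omega, hc6, .inl ⟨hct6, hg⟩⟩
  · have e2 : stk (s1.setR .skip 0) = stk s1 := by simp [stk]
    refine ⟨Nat.zero_le _, vc_mono (main (s1.setR .skip 0) (hc1.setR rfl) ?_ ?_ ?_ ?_ ?_ ?_ ?_) ?_⟩
    · rw [e2]; simpa using hv1
    · rw [Config.setR_regs, if_neg (by decide)]; exact hl1
    · simpa using hB1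
    · simpa using hcur1
    · simpa using hsol1
    · simpa using hct1
    · rw [e2]; simpa using hcount1
    · rintro t5 s5 ⟨ht5, h5⟩
      refine vc_mono h5 ?_
      rintro t6 s6 ⟨ht6, hc6, hct6, hg⟩
      exact ⟨by omega, hc6, .inl ⟨hct6, hg⟩⟩
  · have hl : s1.regs .len = 1 := by
      have : 1 ≤ s1.regs .len := hv1.len_pos
      omega
    have e2 : stk (s1.setR .cont 0) = stk s1 := by simp [stk]
    refine ⟨Nat.zero_le _, by omega, hc1.setR rfl, .inr ⟨by simp, ⟨?_, ?_, h.sol, ?_, ?_⟩, ?_⟩⟩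
    · rw [e2]; simpa using hv1
    · simpa using hcur1
    · simpa [hsol1] using h.desc
    · rw [e2]; simpa using hcount1
    · intro f hf
      have := hcount1 f hf
      rwa [pend_one hv1 hl hl] at this

end

/-! ### The initial tree -/

section

variable {μ : Mach} {I : Inst}

/-- The parameters of the input are in memory; all else is zero, and nothing has been output. -/
structure Loaded (μ : Mach) (I : Inst) (s : Cf) : Prop where
  bound : 3 * I.n + I.off I.n + 20 ≤ μ.M
  n : s.mem .inp 0 = I.n
  k : s.mem .inp 2 = I.k
  off : ∀ i ≤ I.n, s.mem .inp (i + 3) = I.off i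
  adj : ∀ j < I.off I.n, s.mem .inp (I.n + 4 + j) = I.adj j
  term : ∀ i < I.k, s.mem .inp (I.n + 4 + I.off I.n + i) = I.term i
  zero : ∀ a : Arr, a ≠ .inp → ∀ i, s.mem a i = 0
  current : s.current = []
  solutions : s.solutions = []

/-- The search parents of a complete search from the root describe a spanning tree. -/
theorem Search.spanning {lab que np F : ℕ → ℕ} {tail : ℕ}
    (h : Search I (fun u => u = I.root) lab que np tail tail) (h1 : ∀ u < I.n, lab u ≠ 1)
    (hF : ∀ u < I.n, u ≠ I.root → F u = np u) (hr : F I.root = I.root) :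
    Spanning I.E I.root (fun u => u < I.n ∧ 2 ≤ lab u) F := by
  refine ⟨hr, ?_, fun u => sInf {i | i < tail ∧ que i = u}, ?_⟩
  · rintro u v ⟨hu, hl⟩ hE
    obtain ⟨i, hi, rfl⟩ := (h.mem u hu).1 hl
    have hv := I.E_lt_right hE
    have h2 := h.done i hi v hE
    have h3 := h1 v hv
    exact ⟨hv, by omega⟩
  · have key : ∀ i < tail, sInf {i' | i' < tail ∧ que i' = que i} = i := by
      intro i hi
      have : {i' | i' < tail ∧ que i' = que i} = {i} := by
        ext i'
        simp only [Set.mem_ofPred_eq, Set.mem_singleton_iff]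
        exact ⟨fun h' => h.inj i' h'.1 i hi h'.2, fun h' => by subst h'; exact ⟨hi, rfl⟩⟩
      rw [this, csInf_singleton]
    rintro u ⟨hu, hl⟩ hur
    obtain ⟨i, hi, rfl⟩ := (h.mem u hu).1 hl
    obtain ⟨-, i', hi', h2, h3, -⟩ := (h.src i hi).resolve_left hur
    rw [hF _ hu hur, h2]
    refine ⟨I.E_symm h3, ?_⟩
    dsimp only
    rw [key i hi, key i' (hi'.trans hi)]
    exact hi'

/-- Terminals that the search does not reach are not contained in any tree. -/
theorem Search.not_sol {lab que np f : ℕ → ℕ} {tail w : ℕ}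
    (h : Search I (fun u => u = I.root) lab que np tail tail) (h1 : ∀ u < I.n, lab u ≠ 1)
    (hw : I.W w) (hl : lab w = 0) : ¬ Sol I.E I.W I.root f := by
  intro hf
  obtain ⟨k, hk⟩ := hf.toRoot w hw
  have key : ∀ j ≤ k, 2 ≤ lab (f^[k - j] w) := by
    intro j
    induction j with
    | zero => intro _; rw [Nat.sub_zero, hk]; exact h.sub _ rfl
    | succ j ih =>
      intro hj
      have h2 := ih (by omega)
      rw [show k - j = (k - (j + 1)) + 1 by omega, Function.iterate_succ_apply'] at h2
      obtain ⟨x, hx⟩ : ∃ x, f^[k - (j + 1)] w = x := ⟨_, rfl⟩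
      rw [hx] at h2 ⊢
      by_cases hxr : x = I.root
      · exact h.sub _ hxr
      · have hE := hf.adj x ⟨w, hw, _, hx⟩ hxr
        obtain ⟨i, hi, he⟩ := (h.mem _ (I.E_lt_right hE)).1 h2
        have h3 := h.done i hi x (by rw [he]; exact I.E_symm hE)
        have h4 := h1 x hE.1
        omega
  have := key k le_rfl
  rw [Nat.sub_self] at this
  simp only [Function.iterate_zero, id] at this
  omega

/-- The search from the root reaches its component; the stack consists of the root. -/
theorem startSearch_spec {s : Cf} (hl : Loaded μ I s) :
    vc μ startSearch (fun t s' => t ≤ 120 * (I.off I.n + I.n) + 120 ∧ Ctx μ I s' ∧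
      Search I (fun u => u = I.root) (s'.mem .lab) (s'.mem .que) (s'.mem .np) (s'.regs .tail)
        (s'.regs .tail) ∧
      (∀ u < I.n, s'.mem .lab u ≠ 1) ∧ s'.mem .ord 0 = I.root ∧
      (∀ u, s'.mem .pos u ≠ 0 ↔ u = I.root) ∧
      (∀ a : Arr, a ≠ .inp → a ≠ .ord → a ≠ .pos → a ≠ .lab → a ≠ .que → a ≠ .np →
        ∀ i, s'.mem a i = 0) ∧
      s'.regs .len = 1 ∧ s'.current = [] ∧ s'.solutions = []) s := by
  have hb := hl.bound
  have h0n : 0 < I.n := (Nat.zero_le _).trans_lt I.root_lt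
  have hr0 := I.root_lt
  have hoffn : s.mem .inp (I.n + 3) = I.off I.n := hl.off I.n le_rfl
  have hterm0 : s.mem .inp (I.n + 4 + I.off I.n) = I.root := hl.term 0 I.k_pos
  have hk := I.k_le
  unfold startSearch
  simp only [vc, Expr.Idx, Expr.Small, Expr.eval, Op.eval, true_and, Config.setR_regs,
    Config.setR_mem, Config.setA_regs, if_true, reduceCtorEq, if_false, hl.n,
    hl.k, hoffn, hterm0]
  refine ⟨by omega, by omega, by omega, by omega, by omega, by omega, by omega, by omega,
    by omega, by omega, by omega, ?_⟩
  set s1 := ((((((((((s.setR .n I.n).setR .k I.k).setR .base (I.n + 4)).setR .tb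
    (I.n + 4 + I.off I.n)).setR .root I.root).setR .rl (I.root + 2)).setA .ord 0 I.root).setA
    .pos I.root 1).setR .len 1).setR .t 1).setR .hi 1 with hs1
  have hc1 : Ctx μ I s1 := by
    constructor
    case bound => exact hb
    case off => simpa [hs1] using hl.off
    case adj => simpa [hs1] using hl.adj
    case term => simpa [hs1] using hl.term
    all_goals simp [hs1]
  have eo1 : s1.mem .ord 0 = I.root := by simp [hs1]
  have ep1 : ∀ u, s1.mem .pos u ≠ 0 ↔ u = I.root := by
    intro u
    simp only [hs1, Config.setR_mem, Config.setA_mem, if_true, reduceCtorEq, if_false,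
      Function.update_apply, hl.zero .pos (by decide)]
    split_ifs with h <;> simp [h]
  have ez1 : ∀ a : Arr, a ≠ .inp → a ≠ .ord → a ≠ .pos → ∀ i, s1.mem a i = 0 := by
    intro a h1 h2 h3 i
    simp only [hs1, Config.setR_mem, Config.setA_mem, if_neg h2, if_neg h3]
    exact hl.zero a h1 i
  have ecur1 : s1.current = [] := by simpa [hs1] using hl.current
  have esol1 : s1.solutions = [] := by simpa [hs1] using hl.solutions
  have et1 : s1.regs .t = 1 := by simp [hs1]
  have eh1 : s1.regs .hi = 1 := by simp [hs1]
  have el1 : s1.regs .len = 1 := by simp [hs1]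
  clear_value s1
  have hlt1 : ∀ i < 1, s1.mem .ord i < I.n := by
    intro i hi
    obtain rfl : i = 0 := by omega
    rw [eo1]; exact I.root_lt
  have hinj1 : ∀ i < 1, ∀ j < 1, s1.mem .ord i = s1.mem .ord j → i = j := by omega
  have hpre1 : Pre (s1.mem .ord) 1 = fun u => u = I.root := by
    funext u
    refine propext ⟨?_, fun h => ⟨0, by omega, by rw [eo1, h]⟩⟩
    rintro ⟨i, hi, rfl⟩
    obtain rfl : i = 0 := by omega
    exact eo1
  refine vc_call (initSearch_spec (t := 1) (hi := 1) hc1 et1 eh1 le_rfl hlt1 hinj1) ?_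
  rintro t2 s2 ⟨ht2, hc2, hT2, -, hO2, hse2, hhd2, htl2, hq2⟩ hf2
  rw [hpre1] at hse2 hO2
  refine vc_call (explore_spec (Src := fun u => u = I.root) hc2
    (by rw [hhd2, htl2]; exact hse2)) ?_
  rintro t3 s3 ⟨hse3, hhd3, hg3, ht3, hc3⟩ hf3
  have hsp3 : I.spent (s3.mem .que) (s3.regs .tail) ≤ I.off I.n + I.n :=
    I.spent_le hse3.lt hse3.inj
  simp only [hhd2, Inst.spent, Finset.range_zero, Finset.sum_empty] at ht3 hsp3
  have hno3 : ∀ u < I.n, s3.mem .lab u ≠ 1 := by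
    intro u hu
    by_cases hz : s2.mem .lab u = 0
    · exact hg3.new u hz
    · rw [hg3.lab_eq u hz]
      by_cases hur : u = I.root
      · have := hT2 0 (by omega)
        rw [eo1] at this
        rw [hur]; omega
      · exact fun _ => hz (hO2 u hu hur)
  have ezz3 : ∀ a : Arr, a ≠ .lab → a ≠ .que → a ≠ .np → s3.mem a = s1.mem a := by
    intro a h1 h2 h3
    rw [hf3.mem, hf2.mem]
    · simpa [initSearch, Cmd.wa, inc] using ⟨h1, ⟨h1, h2⟩, h1⟩
    · simpa [explore, forArcs, Cmd.wa, inc] using ⟨h1, h3, h2⟩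
  have el3 : s3.regs .len = 1 := by
    rw [hf3.regs _ (by decide), hf2.regs _ (by decide), el1]
  have ecur3 : s3.current = [] := by rw [hf3.cur (by decide), hf2.cur (by decide), ecur1]
  have esol3 : s3.solutions = [] := by rw [hf3.sols (by decide), hf2.sols (by decide), esol1]
  exact ⟨by omega, hc3, hse3, hno3, by rw [ezz3 _ (by decide) (by decide) (by decide), eo1],
    fun u => by rw [ezz3 _ (by decide) (by decide) (by decide)]; exact ep1 u,
    fun a h1 h2 h3 h4 h5 h6 i => by rw [ezz3 a h4 h5 h6]; exact ez1 a h1 h2 h3 i,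
    el3, ecur3, esol3⟩

theorem copyTree_spec {s3 : Cf} (hc3 : Ctx μ I s3) (hz0 : ∀ u, s3.mem .f0 u = 0)
    (hzp : ∀ u, s3.mem .fp u = 0) :
    vc μ copyTree (fun t s' => t ≤ 12 * I.n + 10 ∧
      (∀ u, s'.mem .f0 u = if u = I.root then I.root else
        if u < I.n then s3.mem .np u else 0) ∧ s'.mem .fp = s'.mem .f0) s3 := by
  have hb := hc3.bound
  have hr0 := I.root_lt
  unfold copyTree
  simp only [vc, Expr.Idx, Expr.Small, Expr.eval, true_and]
  refine ⟨by omega, ?_⟩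
  refine vc_call (vc_loop (Q := fun t s' => t ≤ 12 * I.n + 1 ∧
      (∀ u, s'.mem .f0 u = if u < I.n then s3.mem .np u else 0) ∧
      ∀ u, s'.mem .fp u = if u < I.n then s3.mem .np u else 0)
    (fun s' => ∃ c, s'.regs .i = c ∧ c ≤ I.n ∧
      (∀ u, s'.mem .f0 u = if u < c then s3.mem .np u else 0) ∧
      ∀ u, s'.mem .fp u = if u < c then s3.mem .np u else 0)
    (fun s' => 12 * (I.n - s'.regs .i)) (by decide) ⟨0, by simp, Nat.zero_le _, ?_, ?_⟩ ?_ ?_) ?_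
  · intro u
    simpa using hz0 u
  · intro u
    simpa using hzp u
  · rintro s4 ⟨c, hi, hcn, h1, h2⟩ hf4 -
    have hc4 : Ctx μ I s4 := (hc3.setR (x := .i) (v := 0) rfl).frame hf4 (by decide)
    have enp : s4.mem .np = s3.mem .np := by rw [hf4.mem _ (by decide)]; simp
    refine ⟨by simp [Expr.Idx], fun hlt => ?_⟩
    simp only [Expr.eval, ne_eq, Op.lt_eq_zero, not_le, hi, hc4.n] at hlt
    simp only [inc, vc, Expr.Idx, Expr.Small, Expr.eval, Op.eval, true_and, hi, Config.setA_regs,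
      Config.setA_mem, reduceCtorEq, if_false, enp]
    refine ⟨by omega, ⟨c + 1, by simp, by omega, ?_, ?_⟩, by simp; omega⟩
    · intro u
      simp only [Config.setR_mem, Config.setA_mem, reduceCtorEq, if_false, if_true,
        Function.update_apply, h1]
      by_cases hu : u = c
      · rw [if_pos hu, if_pos (by omega), hu]
      · rw [if_neg hu]; exact if_congr (by omega) rfl rfl
    · intro u
      simp only [Config.setR_mem, Config.setA_mem, reduceCtorEq, if_false, if_true,
        Function.update_apply, h2]
      by_cases hu : u = c
      · rw [if_pos hu, if_pos (by omega), hu]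
      · rw [if_neg hu]; exact if_congr (by omega) rfl rfl
  · rintro t s4 ⟨c, hi, hcn, h1, h2⟩ h0 ht hf4
    have hc4 : Ctx μ I s4 := (hc3.setR (x := .i) (v := 0) rfl).frame hf4 (by decide)
    simp only [Expr.eval, Op.lt_eq_zero, hi, hc4.n] at h0
    obtain rfl : c = I.n := by omega
    simp only [Config.setR_regs, if_true] at ht
    exact ⟨by omega, h1, h2⟩
  rintro t4 s4 ⟨ht4, hF4, hP4⟩ hf4
  have hc4 : Ctx μ I s4 := (hc3.setR (x := .i) (v := 0) rfl).frame hf4 (by decide)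
  simp only [hc4.root, Config.setA_regs]
  refine ⟨by omega, ?_, ?_⟩
  · intro u
    simp [Function.update_apply, hF4]
  · funext u
    simp [Function.update_apply, hF4, hP4]

theorem checkTerminals_spec {s3 : Cf} (hc3 : Ctx μ I s3) :
    vc μ checkTerminals (fun t s' => t ≤ 15 * I.n + 10 ∧
      (s'.regs .ok ≠ 0 → ∀ i < I.k, s3.mem .lab (I.term i) ≠ 0) ∧
      (s'.regs .ok = 0 → ∃ i < I.k, s3.mem .lab (I.term i) = 0)) s3 := by
  have hb := hc3.bound
  have hk := I.k_le
  unfold checkTerminals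
  simp only [vc, Expr.Idx, Expr.Small, Expr.eval, true_and]
  refine ⟨by omega, by omega, ?_⟩
  have hc5 : Ctx μ I ((s3.setR .ok 1).setR .i 0) := (hc3.setR rfl).setR rfl
  refine vc_call (vc_loop (Q := fun t s' => t ≤ 15 * I.n + 1 ∧
      (s'.regs .ok ≠ 0 → ∀ i < I.k, s3.mem .lab (I.term i) ≠ 0) ∧
      (s'.regs .ok = 0 → ∃ i < I.k, s3.mem .lab (I.term i) = 0))
    (fun s' => ∃ c, s'.regs .i = c ∧ c ≤ I.k ∧
      (s'.regs .ok ≠ 0 → ∀ i < c, s3.mem .lab (I.term i) ≠ 0) ∧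
      (s'.regs .ok = 0 → ∃ i < I.k, s3.mem .lab (I.term i) = 0))
    (fun s' => 15 * (I.k - s'.regs .i)) (by decide)
    ⟨0, by simp, Nat.zero_le _, fun _ => by omega, by simp⟩ ?_ ?_) ?_
  · rintro s6 ⟨c, hi, hck, h1, h2⟩ hf6 -
    have hc6 : Ctx μ I s6 := hc5.frame hf6 (by decide)
    have elb : s6.mem .lab = s3.mem .lab := by rw [hf6.mem _ (by decide)]; rfl
    refine ⟨by simp [Expr.Idx], fun hlt => ?_⟩
    simp only [Expr.eval, ne_eq, Op.lt_eq_zero, not_le, hi, hc6.k] at hlt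
    have hte := hc6.term c hlt
    have htn := I.term_lt c hlt
    simp only [inc, vc, Expr.Idx, Expr.Small, Expr.eval, ne_eq, Op.eq_eq_zero, not_not, true_and,
      hi, hc6.tb, show ∀ a b, Op.add.eval a b = a + b from fun _ _ => rfl, hte, elb]
    refine ⟨⟨⟨by omega, trivial⟩, trivial⟩,
      fun h0 => ⟨Nat.zero_le _, ?_, ⟨c + 1, ?_, by omega, ?_, ?_⟩, ?_⟩,
      fun h0 => ⟨Nat.zero_le _, ?_, ⟨c + 1, ?_, by omega, ?_, ?_⟩, ?_⟩⟩
    · simp [hi]; omega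
    · simp [hi]
    · simp
    · intro _; exact ⟨c, hlt, h0⟩
    · simp [hi]; omega
    · simp [hi]; omega
    · simp [hi]
    · intro h3 i h4
      rcases Nat.lt_succ_iff_lt_or_eq.1 h4 with h4 | rfl
      · exact h1 (by simpa using h3) i h4
      · exact h0
    · intro h3; exact h2 (by simpa using h3)
    · simp [hi]; omega
  · rintro t s6 ⟨c, hi, hck, h1, h2⟩ h0 ht hf6
    have hc6 : Ctx μ I s6 := hc5.frame hf6 (by decide)
    simp only [Expr.eval, Op.lt_eq_zero, hi, hc6.k] at h0
    obtain rfl : c = I.k := by omega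
    refine ⟨?_, h1, h2⟩
    simp at ht
    omega
  rintro t6 s6 ⟨ht6, hok, hnok⟩ hf6
  exact ⟨by omega, hok, hnok⟩

/-- After the setup the stack consists of the root, and the current tree is the search tree, if the
terminals are connected; otherwise there is no solution. -/
theorem setup_spec {s : Cf} (hl : Loaded μ I s) :
    vc μ setup (fun t s' => t ≤ 200 * (I.off I.n + I.n) + 200 ∧ Ctx μ I s' ∧
      s'.current = [] ∧ s'.solutions = [] ∧
      (s'.regs .ok ≠ 0 → s'.regs .len = 1 ∧ Valid I (stk s') 1 ∧ Complete I (stk s')) ∧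
      (s'.regs .ok = 0 → ∀ f, ¬ Sol I.E I.W I.root f)) s := by
  unfold setup
  simp only [vc]
  refine vc_call (startSearch_spec hl) ?_
  rintro t3 s3 ⟨ht3, hc3, hse3, hno3, eo3, ep3, ez3, el3, ecur3, esol3⟩ -
  refine vc_call (copyTree_spec hc3
    (ez3 .f0 (by decide) (by decide) (by decide) (by decide) (by decide) (by decide))
    (ez3 .fp (by decide) (by decide) (by decide) (by decide) (by decide) (by decide))) ?_
  rintro t4 s4 ⟨ht4, ef4, eg4⟩ hf4
  have hc4 : Ctx μ I s4 := hc3.frame hf4 (by decide)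
  refine vc_mono (vc_frame (checkTerminals_spec hc4)) ?_
  rintro t6 s6 ⟨⟨ht6, hok, hnok⟩, hf6⟩
  have elb : s4.mem .lab = s3.mem .lab := hf4.mem _ (by decide)
  rw [elb] at hok hnok
  have hm6 : ∀ a, s6.mem a = s4.mem a := fun a => hf6.mem a (by cases a <;> decide)
  have hm4 : ∀ a : Arr, a ≠ .f0 → a ≠ .fp → s6.mem a = s3.mem a := fun a h1 h2 => by
    rw [hm6, hf4.mem a (by cases a <;> simp_all <;> decide)]
  have el6 : s6.regs .len = 1 := by
    rw [hf6.regs _ (by decide), hf4.regs _ (by decide), el3]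
  have eo6 : s6.mem .ord = s3.mem .ord := hm4 _ (by decide) (by decide)
  have ep6 : s6.mem .pos = s3.mem .pos := hm4 _ (by decide) (by decide)
  have ez6 : ∀ a : Arr, a ≠ .f0 → a ≠ .fp → a ≠ .inp → a ≠ .ord → a ≠ .pos → a ≠ .lab →
      a ≠ .que → a ≠ .np → ∀ i, s6.mem a i = 0 := fun a h1 h2 h3 h4 h5 h6 h7 h8 i => by
    rw [hm4 a h1 h2]; exact ez3 a h3 h4 h5 h6 h7 h8 i
  have ex6 := ez6 .exc (by decide) (by decide) (by decide) (by decide) (by decide) (by decide)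
    (by decide) (by decide)
  have eB6 := ez6 .fB (by decide) (by decide) (by decide) (by decide) (by decide) (by decide)
    (by decide) (by decide)
  have eA6 := ez6 .fA (by decide) (by decide) (by decide) (by decide) (by decide) (by decide)
    (by decide) (by decide)
  have ef6 : ∀ u, s6.mem .f0 u = if u = I.root then I.root else
      if u < I.n then s3.mem .np u else 0 := by rw [hm6]; exact ef4
  have eg6 : s6.mem .fp = s6.mem .f0 := by rw [hm6, hm6, eg4]
  have hroot : s6.mem .fp I.root = I.root := by rw [eg6, ef6, if_pos rfl]
  have hlt1 : ∀ i < 1, s3.mem .ord i < I.n := by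
    intro i hi
    obtain rfl : i = 0 := by omega
    rw [eo3]; exact I.root_lt
  have hinj1 : ∀ i < 1, ∀ j < 1, s3.mem .ord i = s3.mem .ord j → i = j := by omega
  have hpre1 : Pre (s3.mem .ord) 1 = fun u => u = I.root := by
    funext u
    refine propext ⟨?_, fun h => ⟨0, by omega, by rw [eo3, h]⟩⟩
    rintro ⟨i, hi, rfl⟩
    obtain rfl : i = 0 := by omega
    exact eo3
  refine ⟨by omega, hc4.frame hf6 (by decide), ?_, ?_, fun h => ?_, fun h f => ?_⟩
  · rw [hf6.cur (by decide), hf4.cur (by decide), ecur3]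
  · rw [hf6.sols (by decide), hf4.sols (by decide), esol3]
  · refine ⟨el6, ⟨?_, ?_, ?_, ?_, ?_, ⟨_, hse3.spanning hno3 ?_ ?_, ?_⟩, hroot, ?_, ?_, ?_, ?_, ?_⟩,
      ?_⟩
    · simp [el6]
    · simpa [el6, eo6] using hlt1
    · simp [el6, eo6]
    · simpa [eo6] using eo3
    · intro u
      simp only [stk_pos, stk_ord, stk_len, el6, ep6, eo6, hpre1]
      exact ep3 u
    · intro u hu hur
      simp only [stk_f0]
      rw [ef6, if_neg hur, if_pos hu]
    · simp only [stk_f0]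
      rw [ef6, if_pos rfl]
    · rintro w ⟨i, hi, rfl⟩
      have h1 := hok h i hi
      have h2 := I.term_lt i hi
      have h3 := hno3 _ h2
      exact ⟨h2, by omega⟩
    · intro u _
      simp only [stk_fp, stk_f0, stk_fB, stk_fA, eg6, eB6, eA6, and_self]
    · intro u _ j _ _
      exact ex6 j
    · intro i h1 h2
      simp only [stk_len, el6] at h2
      omega
    · intro i _ h2
      exact absurd (eB6 _) h2
    · intro i _ h2
      exact absurd (eA6 _) h2
    · simp only [Complete, stk_fp, stk_ord, stk_len, el6, eo6, hpre1]
      exact ⟨rfl, fun u h1 h2 => absurd h1 h2, fun u h1 h2 => absurd h1 h2,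
        fun u h1 => ⟨0, h1⟩⟩
  · obtain ⟨i, hi, hz⟩ := hnok h
    exact hse3.not_sol hno3 ⟨i, hi, rfl⟩ hz

end

/-! ### The run of the program -/

section Delay

variable {R A : Type} [DecidableEq R] [DecidableEq A]

/-- A run from `σ` to the final configuration `τ` that is cut into `j + 1` pieces of length at most
`d`, such that each of them but the last one completes a solution. -/
inductive Paced (B S d : ℕ) : Config R A → ℕ → Config R A → Prop
  | last {σ τ : Config R A} {t : ℕ} : Reaches B S σ t τ → t ≤ d → τ.control = [] →
      Paced B S d σ 0 τ
  | step {σ σ' τ : Config R A} {t j : ℕ} : Reaches B S σ t σ' → t ≤ d →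
      σ.solutions.length < σ'.solutions.length → Paced B S d σ' j τ → Paced B S d σ (j + 1) τ

theorem Config.step_of_halted {σ : Config R A} (h : σ.control = []) : σ.step = σ := by
  unfold Config.step; rw [h]

theorem Config.iterate_of_halted {σ : Config R A} (h : σ.control = []) (k : ℕ) :
    Config.step^[k] σ = σ := Function.iterate_fixed (Config.step_of_halted h) k

theorem Reaches.iterate_eq {B S T k : ℕ} {σ τ : Config R A} (h : Reaches B S σ T τ)
    (hτ : τ.control = []) (hk : T ≤ k) : Config.step^[k] σ = τ := by
  obtain ⟨m, rfl⟩ := Nat.exists_eq_add_of_le hk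
  rw [Nat.add_comm, Function.iterate_add_apply, h.1, Config.iterate_of_halted hτ]

theorem Config.length_le_step (σ : Config R A) :
    σ.solutions.length ≤ σ.step.solutions.length := by
  unfold Config.step
  split <;> simp

theorem Config.length_le_iterate (σ : Config R A) (k : ℕ) :
    σ.solutions.length ≤ (Config.step^[k] σ).solutions.length := by
  induction k with
  | zero => exact le_rfl
  | succ k ih => rw [Function.iterate_succ_apply']; exact ih.trans (Config.length_le_step _)

theorem Config.length_mono (σ : Config R A) {k l : ℕ} (h : k ≤ l) :
    (Config.step^[k] σ).solutions.length ≤ (Config.step^[l] σ).solutions.length := by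
  obtain ⟨m, rfl⟩ := Nat.exists_eq_add_of_le h
  rw [Nat.add_comm, Function.iterate_add_apply]
  exact Config.length_le_iterate _ _

variable {B S d j : ℕ} {σ τ : Config R A}

theorem Paced.reaches (h : Paced B S d σ j τ) :
    ∃ T ≤ d * (j + 1), Reaches B S σ T τ ∧ τ.control = [] ∧
      σ.solutions.length + j ≤ τ.solutions.length := by
  induction h with
  | last h1 h2 h3 =>
    refine ⟨_, by omega, h1, h3, ?_⟩
    rw [← h1.1]; exact Config.length_le_iterate _ _
  | step h1 h2 h3 _ ih =>
    obtain ⟨T, hT, h4, h5, h6⟩ := ih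
    refine ⟨_, ?_, h1.trans h4, h5, by omega⟩
    rw [Nat.mul_succ]; omega

theorem Paced.fits (h : Paced B S d σ j τ) (k : ℕ) : (Config.step^[k] σ).Fits B S := by
  obtain ⟨T, -, h1, h3, -⟩ := h.reaches
  rcases lt_or_ge k T with hk | hk
  · exact h1.2 k hk
  · rw [h1.iterate_eq h3 hk]
    unfold Config.Fits; rw [h3]; trivial

/-- The piece that follows the current one completes another solution or ends the run. -/
theorem Paced.delay (h : Paced B S d σ j τ) (k : ℕ) (hk : (Config.step^[k] σ).control ≠ []) :
    ∃ l, k < l ∧ l ≤ k + 2 * d ∧ ((Config.step^[l] σ).control = [] ∨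
      (Config.step^[k] σ).solutions.length < (Config.step^[l] σ).solutions.length) := by
  induction h generalizing k with
  | @last σ τ t h1 h2 h3 =>
    have hkt : k < t := by
      by_contra hcon
      rw [h1.iterate_eq h3 (not_lt.1 hcon)] at hk
      exact hk h3
    exact ⟨t, hkt, by omega, .inl (by rw [h1.1]; exact h3)⟩
  | @step σ σ' τ t j h1 h2 h3 h4 ih =>
    rcases lt_or_ge k t with hkt | hkt
    · have hle : (Config.step^[k] σ).solutions.length ≤ σ'.solutions.length := by
        rw [← h1.1]; exact Config.length_mono σ hkt.le
      cases h4 with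
      | @last _ _ t' h5 h6 h7 =>
        refine ⟨t + t', by omega, by omega, .inl ?_⟩
        rw [(h1.trans h5).1]; exact h7
      | @step _ σ'' _ t' _ h5 h6 h7 _ =>
        refine ⟨t + t', by omega, by omega, .inr ?_⟩
        rw [(h1.trans h5).1]; omega
    · obtain ⟨m, rfl⟩ := Nat.exists_eq_add_of_le hkt
      have hs : ∀ m, Config.step^[t + m] σ = Config.step^[m] σ' := fun m => by
        rw [Nat.add_comm, Function.iterate_add_apply, h1.1]
      rw [hs] at hk ⊢
      obtain ⟨l, h5, h6, h7⟩ := ih m hk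
      exact ⟨t + l, by omega, by omega, by rw [hs]; exact h7⟩

end Delay

section

variable {μ : Mach} {I : Inst}

theorem Inst.used_lt {f : ℕ → ℕ} (hf : Sol I.E I.W I.root f) {u : ℕ} (hu : Used I.W f u) :
    u < I.n := by
  by_cases hur : u = I.root
  · rw [hur]; exact I.root_lt
  · exact (hf.adj u hu hur).1

theorem Inst.finite_sol (I : Inst) : {f | Sol I.E I.W I.root f}.Finite := by
  refine Set.Finite.of_injOn (f := fun f (i : Fin I.n) => f i)
    (t := Set.pi Set.univ fun _ => Set.Iic I.n) ?_ ?_ (Set.Finite.pi fun _ => Set.finite_Iic _)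
  · intro f hf i _
    by_cases hu : Used I.W f i
    · exact (I.used_lt hf hu.next).le
    · simp only [Set.mem_Iic]; rw [hf.unused _ hu]; exact i.2.le
  · intro f hf g hg h
    funext u
    by_cases hu : u < I.n
    · exact congrFun h ⟨u, hu⟩
    · rw [hf.unused u fun h => hu (I.used_lt hf h), hg.unused u fun h => hu (I.used_lt hg h)]

/-- The first solution has been output, or there is none. -/
theorem start_spec {s : Cf} (hl : Loaded μ I s) (h0 : s.regs .cont = 0) :
    vc μ start (fun t s' => t ≤ 1000 * (I.off I.n + I.n) + 1000 ∧ Ctx μ I s' ∧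
      ((s'.regs .cont = 1 ∧ ∃ g, Stage I [g] s') ∨
        (s'.regs .cont = 0 ∧ s'.current = [] ∧ s'.solutions = [] ∧
          ∀ f, ¬ Sol I.E I.W I.root f))) s := by
  have hb := hl.bound
  have hk := I.k_pos
  unfold start
  simp only [vc, Expr.Idx, Expr.Small, Expr.eval, ne_eq, Op.eq_eq_zero, not_not, true_and,
    and_true, hl.k]
  refine ⟨by omega, fun h => by omega, fun _ => ?_⟩
  refine vc_call (setup_spec hl) ?_
  rintro t1 s1 ⟨ht1, hc1, hcur1, hsol1, hyes, hno⟩ hf1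
  refine ⟨fun hok => ?_, fun hok => ⟨Nat.zero_le _, by omega, hc1.setR rfl, .inr
    ⟨?_, hcur1, hsol1, hno hok⟩⟩⟩
  · obtain ⟨hlen1, hv1, hcp1⟩ := hyes hok
    have hT : Tree I (s1.mem .ord) (s1.mem .fp) 1 := by
      have := hv1.tree hcp1; rwa [stk_len, hlen1] at this
    refine vc_call (output_spec hc1 hT hcur1) ?_
    rintro t2 s2 ⟨ht2, hc2, hcur2, out, hout, hsol2⟩ hf2
    have e2 : stk s2 = stk s1 := stk_frame hf2 (by decide)
    have hlen2 : s2.regs .len = 1 := by rw [← hlen1]; exact congrArg Stack.len e2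
    have ef2 : s2.mem .fp = s1.mem .fp := congrArg Stack.fp e2
    obtain ⟨g, hg⟩ : ∃ g, prune I.W (s1.mem .fp) = g := ⟨_, rfl⟩
    have hgs : Sol I.E I.W I.root g := hg ▸ hT.sol
    classical
    refine vc_call (expand_spec (C := fun f => [g].count f) hc2 (by rw [e2, hlen2]; exact hv1)
      (by rw [e2]; exact hcp1) fun f hf => ?_) ?_
    · rw [ef2, hg, e2, hlen2, pend_one hv1 rfl hlen1]
      have ha : Agree (stk s1) 1 f := by
        intro u hu
        obtain ⟨i, hi, rfl⟩ := hu
        obtain rfl : i = 0 := by omega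
        rw [show (stk s1).ord 0 = I.root from hv1.head, hf.root]
        exact hv1.root.symm
      by_cases hfg : f = g
      · rw [ind_false fun h => h.2 hfg, hfg]; simp
      · rw [ind_true ⟨ha, hfg⟩, List.count_eq_zero.2 (by simpa using hfg)]
    · rintro t3 s3 ⟨ht3, hc3, hv3, hp3, -⟩ hf3
      have e3 : stk (s3.setR .cont 1) = stk s3 := by simp [stk]
      refine ⟨by omega, by omega, hc3.setR rfl, .inl ⟨by simp, g, ?_, ?_, ?_, ?_, ?_⟩⟩
      · rw [e3]; simpa using hv3
      · simpa using (hf3.cur (by decide)).trans hcur2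
      · intro g' hg'
        rw [List.mem_singleton] at hg'
        rw [hg']; exact hgs
      · rw [Config.setR_solutions, hf3.sols (by decide), hsol2, hsol1, ← hg]
        exact .cons (desc_prune hout) .nil
      · rw [e3]; simpa using hp3
  · rw [Config.setR_regs, if_neg (by decide), hf1.regs _ (by decide), h0]

theorem Stage.nodup {gs : List (ℕ → ℕ)} {s : Cf} (h : Stage I gs s) : gs.Nodup := by
  classical
  rw [List.nodup_iff_count_le_one]
  intro f
  by_cases hf : f ∈ gs
  · have := h.count f (h.sol f hf)
    convert (show _ ≤ 1 by omega : gs.count f ≤ 1)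
  · rw [List.count_eq_zero.2 hf]; omega

/-- There are finitely many solutions, so the number of rounds is bounded. -/
theorem Stage.length_le {gs : List (ℕ → ℕ)} {s : Cf} (h : Stage I gs s) :
    gs.length ≤ I.finite_sol.toFinset.card := by
  classical
  rw [← List.toFinset_card_of_nodup h.nodup]
  refine Finset.card_le_card fun f hf => ?_
  simpa using h.sol f (by simpa using hf)

/-- The outcome of a run: each solution has been output once. -/
def Done (I : Inst) (τ : Cf) : Prop :=
  τ.current = [] ∧ ∃ gs, List.Forall₂ (Desc I) gs τ.solutions ∧ gs.Nodup ∧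
    ∀ f, f ∈ gs ↔ Sol I.E I.W I.root f

/-- The main loop, one piece of the run for each round. -/
theorem loop_paced : ∀ (N : ℕ) (gs : List (ℕ → ℕ)) (s : Cf),
    I.finite_sol.toFinset.card < gs.length + N → Ctx μ I s → Stage I gs s → s.regs .cont = 1 →
    s.Bdd μ.M → ∃ j τ, Paced μ.B (μ.M + 1) (4000 * (I.off I.n + I.n) + 4000)
      (s.withC [.loop (rg .cont) round]) j τ ∧ Done I τ := by
  intro N
  induction N with
  | zero => intro gs s hN _ h; have := h.length_le; omega
  | succ N ih =>
    intro gs s hN hc h hct hb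
    have hfit : ∀ s : Cf, s.Bdd μ.M →
        Config.Fits (s.withC [.loop (rg .cont) round]) μ.B (μ.M + 1) :=
      fun s hb => Expr.fits hb (rg .cont) (by decide) trivial _
    have hst : Reaches μ.B (μ.M + 1) (s.withC [.loop (rg .cont) round]) 1
        (s.withC [round, .loop (rg .cont) round]) := by
      refine Reaches.one (hfit s hb) ?_
      simp only [Config.step, Config.withC_control, Expr.eval, Config.withC_regs, hct]; rfl
    obtain ⟨t, s', hr, hb', ht, hc', hcase⟩ :=
      vc_sound (by decide) hb (round_spec hc h hct)
    have hrun := hst.trans (hr [.loop (rg .cont) round])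
    rcases hcase with ⟨hct', g, hs'⟩ | ⟨hct', hs', hall⟩
    · obtain ⟨j, τ, hp, hd⟩ := ih (gs ++ [g]) s'
        (by rw [List.length_append, List.length_singleton]; omega) hc' hs' hct' hb'
      refine ⟨j + 1, τ, .step hrun (by omega) ?_ hp, hd⟩
      rw [Config.withC_solutions, Config.withC_solutions, ← h.desc.length_eq,
        ← hs'.desc.length_eq, List.length_append, List.length_singleton]
      omega
    · have hend : Reaches μ.B (μ.M + 1) (s'.withC [.loop (rg .cont) round]) 1 (s'.withC []) := by
        refine Reaches.one (hfit s' hb') ?_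
        simp only [Config.step, Config.withC_control, Expr.eval, Config.withC_regs, hct']; rfl
      refine ⟨0, _, .last (hrun.trans hend) (by omega) rfl, hs'.current, gs, hs'.desc, hs'.nodup,
        fun f => ⟨hs'.sol f, fun hf => ?_⟩⟩
      classical
      have h1 := hall f hf
      by_contra hcon
      rw [List.count_eq_zero.2 hcon] at h1
      omega

/-- The run of the program on an instance with terminals. -/
theorem mainCmd_paced {s : Cf} (hl : Loaded μ I s) (h0 : s.regs .cont = 0) (hb : s.Bdd μ.M) :
    ∃ j τ, Paced μ.B (μ.M + 1) (4000 * (I.off I.n + I.n) + 4000) (s.withC [mainCmd]) j τ ∧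
      Done I τ := by
  obtain ⟨t, s', hr, hb', ht, hc', hcase⟩ := vc_sound (by decide) hb (start_spec hl h0)
  have hrun : Reaches μ.B (μ.M + 1) (s.withC [mainCmd]) (1 + t)
      (s'.withC [.loop (rg .cont) round]) :=
    Reaches.trans (Reaches.one (σ' := s.withC [start, .loop (rg .cont) round]) trivial rfl) (hr _)
  rcases hcase with ⟨hct, g, hs⟩ | ⟨hct, hcur, hsol, hno⟩
  · obtain ⟨j, τ, hp, hd⟩ := loop_paced I.finite_sol.toFinset.card [g] s' (by simp) hc' hs hct hb'
    refine ⟨j + 1, τ, .step hrun (by omega) ?_ hp, hd⟩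
    rw [Config.withC_solutions, Config.withC_solutions, hl.solutions, ← hs.desc.length_eq]
    simp
  · refine ⟨0, s'.withC [], .last (hrun.trans (t' := 1) (Reaches.one ?_ ?_)) (by omega) rfl, hcur,
      [], ?_, List.nodup_nil, fun f => ⟨fun h => by simp at h, fun h => absurd h (hno f)⟩⟩
    · exact Expr.fits hb' (rg .cont) (by decide) trivial _
    · simp only [Config.step, Config.withC_control, Expr.eval, Config.withC_regs, hct]; rfl
    · rw [Config.withC_solutions, hsol]; exact .nil

/-- Without terminals the program outputs the empty tree. -/
theorem mainCmd_paced_empty {s : Cf} (hk : s.mem .inp 2 = 0) (h0 : s.regs .cont = 0)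
    (hb : s.Bdd μ.M) (hM : 20 ≤ μ.M) (hcur : s.current = []) (hsol : s.solutions = []) (d : ℕ) :
    ∃ j τ, Paced μ.B (μ.M + 1) (d + 4000) (s.withC [mainCmd]) j τ ∧ τ.current = [] ∧
      τ.solutions = [[]] := by
  have h : vc μ start (fun t s' => t = 2 ∧ s'.regs .cont = 0 ∧ s'.current = [] ∧
      s'.solutions = [[]]) s := by
    unfold start
    simp only [vc, Expr.Idx, Expr.Small, Expr.eval, ne_eq, Op.eq_eq_zero, not_not, true_and,
      and_true, hk]
    refine ⟨by omega, fun _ => ?_, fun h => absurd trivial h⟩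
    simp [hcur, hsol, h0]
  obtain ⟨t, s', hr, hb', ht, hct, hcur', hsol'⟩ := vc_sound (by decide) hb h
  have hrun : Reaches μ.B (μ.M + 1) (s.withC [mainCmd]) (1 + t)
      (s'.withC [.loop (rg .cont) round]) :=
    Reaches.trans (Reaches.one (σ' := s.withC [start, .loop (rg .cont) round]) trivial rfl) (hr _)
  refine ⟨0, s'.withC [], .last (hrun.trans (t' := 1) (Reaches.one ?_ ?_)) (by omega) rfl, hcur',
    hsol'⟩
  · exact Expr.fits hb' (rg .cont) (by decide) trivial _
  · simp only [Config.step, Config.withC_control, Expr.eval, Config.withC_regs, hct]; rfl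

end

/-! ### Parent functions and minimal Steiner trees -/

section

variable {n : ℕ} {G : SimpleGraph (Fin n)} {W : Finset (Fin n)} {I : Inst}

/-- The instance is the graph `G` with the terminals `W`. -/
structure Encodes (G : SimpleGraph (Fin n)) (W : Finset (Fin n)) (I : Inst) : Prop where
  card : I.n = n
  adj : ∀ u v : Fin n, I.E u v ↔ G.Adj u v
  term : ∀ w : Fin n, I.W w ↔ w ∈ W

/-- Connectedness of the terminals without reference to subtypes. -/
theorem isSteinerSubgraph_iff {H : G.Subgraph} : IsSteinerSubgraph W H ↔
    ∀ u ∈ W, u ∈ H.verts ∧ ∀ v ∈ W, Relation.ReflTransGen H.Adj u v := by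
  have key : ∀ {u v : Fin n} (hu : u ∈ H.verts) (hv : v ∈ H.verts),
      H.coe.Reachable ⟨u, hu⟩ ⟨v, hv⟩ ↔ Relation.ReflTransGen H.Adj u v := by
    intro u v hu hv
    rw [SimpleGraph.reachable_iff_reflTransGen]
    constructor
    · intro h
      exact Relation.ReflTransGen.lift (r := H.coe.Adj) (p := H.Adj)
        (fun x : H.verts => (x : Fin n))
        (fun a b h => h) ⟨u, hu⟩ ⟨v, hv⟩ h
    · intro h
      induction h using Relation.ReflTransGen.head_induction_on with
      | refl => exact .refl
      | @head a b h1 _ ih =>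
        have hb : H.coe.Adj ⟨a, hu⟩ ⟨b, h1.snd_mem⟩ := h1
        exact .head hb (ih _)
  constructor
  · intro h u hu
    obtain ⟨h1, -, -⟩ := h u hu u hu
    refine ⟨h1, fun v hv => ?_⟩
    obtain ⟨h1, h2, h3⟩ := h u hu v hv
    exact (key h1 h2).1 h3
  · intro h u hu v hv
    exact ⟨(h u hu).1, (h v hv).1, (key _ _).2 ((h u hu).2 v hv)⟩

variable (G) in
/-- The subgraph that a parent function describes. -/
def treeOf (I : Inst) (f : ℕ → ℕ) : G.Subgraph where
  verts := {v | Used I.W f v}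
  Adj u v := G.Adj u v ∧ ((Used I.W f u ∧ (u : ℕ) ≠ I.root ∧ f u = v) ∨
    (Used I.W f v ∧ (v : ℕ) ≠ I.root ∧ f v = u))
  adj_sub h := h.1
  edge_vert := by
    rintro u v ⟨-, h | h⟩
    · exact h.1
    · show Used I.W f u
      rw [← h.2.2]; exact h.1.next
  symm := ⟨fun u v h => ⟨h.1.symm, h.2.symm⟩⟩

theorem Encodes.parent (he : Encodes G W I) {f : ℕ → ℕ} (hf : Sol I.E I.W I.root f) {u : Fin n}
    (hu : Used I.W f u) (hr : (u : ℕ) ≠ I.root) :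
    ∃ v : Fin n, f u = v ∧ G.Adj u v ∧ (treeOf G I f).Adj u v := by
  have h1 := hf.adj u hu hr
  have h2 := I.E_lt_right h1
  rw [he.card] at h2
  have h3 : G.Adj u ⟨f u, h2⟩ := (he.adj _ _).1 h1
  exact ⟨⟨f u, h2⟩, rfl, h3, h3, .inl ⟨hu, hr, rfl⟩⟩

theorem Encodes.root_lt (he : Encodes G W I) : I.root < n := he.card ▸ I.root_lt

theorem Encodes.root_mem (he : Encodes G W I) : (⟨I.root, he.root_lt⟩ : Fin n) ∈ W :=
  (he.term _).1 I.root_W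

theorem Encodes.isSteinerSubgraph (he : Encodes G W I) {f : ℕ → ℕ}
    (hf : Sol I.E I.W I.root f) : IsSteinerSubgraph W (treeOf G I f) := by
  have key : ∀ (k : ℕ) (u : Fin n), Used I.W f u → f^[k] u = I.root →
      Relation.ReflTransGen (treeOf G I f).Adj u ⟨I.root, he.root_lt⟩ := by
    intro k
    induction k with
    | zero => intro u _ h; rw [show u = ⟨I.root, he.root_lt⟩ from Fin.ext h]
    | succ k ih =>
      intro u hu hk
      by_cases hr : (u : ℕ) = I.root
      · rw [show u = ⟨I.root, he.root_lt⟩ from Fin.ext hr]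
      · obtain ⟨v, hv, -, h⟩ := he.parent hf hu hr
        refine .head h (ih v ?_ ?_)
        · rw [← hv]; exact hu.next
        · rw [← hv]; exact hk
  have key' : ∀ u ∈ W, Relation.ReflTransGen (treeOf G I f).Adj u ⟨I.root, he.root_lt⟩ := by
    intro u hu
    have h1 := (he.term u).2 hu
    obtain ⟨k, hk⟩ := hf.toRoot _ h1
    exact key k u (Used.terminal h1) hk
  rw [isSteinerSubgraph_iff]
  intro u hu
  refine ⟨Used.terminal ((he.term u).2 hu), fun v hv => (key' u hu).trans ?_⟩
  have : Std.Symm (treeOf G I f).Adj := ⟨fun _ _ h => h.symm⟩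
  exact Std.Symm.symm _ _ (key' v hv)

/-- Deleting the edge from `u` to its parent separates the terminals below `u` from the root. -/
theorem Encodes.isMinimalSteinerTree (he : Encodes G W I) {f : ℕ → ℕ}
    (hf : Sol I.E I.W I.root f) : IsMinimalSteinerTree W (treeOf G I f) := by
  refine ⟨he.isSteinerSubgraph hf, fun H hH hle => ?_⟩
  rw [isSteinerSubgraph_iff] at hH
  have key : ∀ u v : Fin n, Used I.W f u → (u : ℕ) ≠ I.root → f u = v → H.Adj u v := by
    rintro u v ⟨w, hw, k, hk⟩ hr hv
    by_contra hcon
    have hwn : w < n := he.card ▸ I.W_lt hw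
    have hpath := (hH ⟨w, hwn⟩ ((he.term ⟨w, hwn⟩).1 hw)).2 _ he.root_mem
    have hclosed : ∀ x : Fin n, Relation.ReflTransGen H.Adj ⟨w, hwn⟩ x → ∃ i, f^[i] x = u := by
      intro x hx
      induction hx with
      | refl => exact ⟨k, hk⟩
      | @tail x y _ hxy ih =>
        obtain ⟨i, hi⟩ := ih
        rcases (hle.2 hxy).2 with ⟨-, -, h⟩ | ⟨-, -, h⟩
        · cases i with
          | zero =>
            obtain rfl : x = u := Fin.ext hi
            obtain rfl : y = v := Fin.ext (h.symm.trans hv)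
            exact absurd hxy hcon
          | succ i => exact ⟨i, by rw [← h]; exact hi⟩
        · exact ⟨i + 1, by rw [Function.iterate_succ_apply, h, hi]⟩
    obtain ⟨i, hi⟩ := hclosed _ hpath
    rw [iterate_root hf.root] at hi
    exact hr hi.symm
  refine ⟨fun u hu => ?_, fun u v h => ?_⟩
  · by_cases hr : (u : ℕ) = I.root
    · rw [show u = ⟨I.root, he.root_lt⟩ from Fin.ext hr]
      exact (hH _ he.root_mem).1
    · obtain ⟨v, hv, -⟩ := he.parent hf hu hr
      exact (key u v hu hr hv).fst_mem
  · rcases h.2 with ⟨h1, h2, h3⟩ | ⟨h1, h2, h3⟩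
    · exact key u v h1 h2 h3
    · exact (key v u h1 h2 h3).symm

/-- Parents are determined by the tree: if the parent of `u` with respect to `f` were a child of
`u` with respect to `g`, the same would hold for all ancestors of `u`. -/
theorem Encodes.treeOf_injOn (he : Encodes G W I) {f g : ℕ → ℕ} (hf : Sol I.E I.W I.root f)
    (hg : Sol I.E I.W I.root g) (h : treeOf G I f = treeOf G I g) : f = g := by
  have hused : ∀ u : Fin n, Used I.W f u ↔ Used I.W g u := fun u =>
    Set.ext_iff.1 (congrArg SimpleGraph.Subgraph.verts h) u
  have hstep : ∀ u, Used I.W f u → u ≠ I.root → g u = f u ∨ (f u ≠ I.root ∧ g (f u) = u) := by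
    intro u hu hr
    have hun : u < n := he.card ▸ I.used_lt hf hu
    obtain ⟨v, hv, -, hadj⟩ := he.parent (u := ⟨u, hun⟩) hf hu hr
    rw [h] at hadj
    change f u = v at hv
    rw [hv]
    rcases hadj.2 with h1 | h1
    · exact .inl h1.2.2
    · exact .inr h1.2
  funext u
  by_cases hu : Used I.W f u
  · by_cases hr : u = I.root
    · rw [hr, hf.root, hg.root]
    · by_contra hcon
      obtain ⟨k, hk⟩ := hu.toRoot hf.root hf.toRoot
      have key : ∀ i, f^[i + 1] u ≠ I.root ∧ g (f^[i + 1] u) = f^[i] u := by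
        intro i
        induction i with
        | zero => exact (hstep u hu hr).resolve_left fun h => hcon h.symm
        | succ i ih =>
          obtain ⟨h1, h2⟩ := ih
          obtain ⟨x, hx⟩ : ∃ x, f^[i] u = x := ⟨_, rfl⟩
          have hux : Used I.W f x := hx ▸ hu.iterate i
          simp only [Function.iterate_succ_apply', hx] at h1 h2 ⊢
          refine (hstep _ hux.next h1).resolve_left fun h3 => h1 ?_
          have : x = I.root :=
            (hux.toRoot hf.root hf.toRoot).eq_root (c := 1) hf.root (by
              show f (f x) = x
              rw [← h3, h2])
          rw [this, hf.root]
      refine (key k).1 ?_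
      rw [Function.iterate_succ_apply', hk, hf.root]
  · have hu' : ¬ Used I.W g u := by
      intro h1
      have hun : u < n := he.card ▸ I.used_lt hg h1
      exact hu ((hused ⟨u, hun⟩).2 h1)
    rw [hf.unused u hu, hg.unused u hu']

/-- The parents of a shortest path tree towards the root describe a given minimal Steiner tree. -/
theorem Encodes.exists_sol (he : Encodes G W I) {T : G.Subgraph}
    (hT : IsMinimalSteinerTree W T) : ∃ f, Sol I.E I.W I.root f ∧ treeOf G I f = T := by
  classical
  have hS := isSteinerSubgraph_iff.1 hT.1
  set r : Fin n := ⟨I.root, he.root_lt⟩ with hr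
  have hpar : ∀ u : Fin n, u ≠ r → T.spanningCoe.Reachable u r → ∃ v : Fin n, T.Adj u v ∧
      T.spanningCoe.Reachable v r ∧ T.spanningCoe.dist v r < T.spanningCoe.dist u r := by
    intro u hu h
    obtain ⟨p, hp⟩ := h.exists_walk_length_eq_dist
    cases p with
    | nil => exact absurd rfl hu
    | cons h q =>
      refine ⟨_, h, q.reachable, ?_⟩
      rw [← hp, SimpleGraph.Walk.length_cons]
      exact Nat.lt_succ_of_le (SimpleGraph.dist_le q)
  choose! P hP1 hP2 hP3 using hpar
  obtain ⟨F, hF⟩ : ∃ F : ℕ → ℕ, ∀ u, F u = if h : u < n then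
      if (⟨u, h⟩ : Fin n) = r then u else P ⟨u, h⟩ else u := ⟨_, fun _ => rfl⟩
  have hFr : F I.root = I.root := by rw [hF, dif_pos he.root_lt, if_pos rfl]
  have hFP : ∀ u : Fin n, u ≠ r → F u = P u := fun u hu => by rw [hF, dif_pos u.2, if_neg hu]
  have hto : ∀ (N : ℕ) (u : Fin n), T.spanningCoe.dist u r < N → T.spanningCoe.Reachable u r →
      ToRoot I.root F u := by
    intro N
    induction N with
    | zero => intro u h; omega
    | succ N ih =>
      intro u hN h
      by_cases hu : u = r
      · rw [hu]; exact ⟨0, rfl⟩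
      · have := hP3 u hu h
        refine ToRoot.of_next ?_
        rw [hFP u hu]
        exact ih _ (by omega) (hP2 u hu h)
  have hWr : ∀ w : Fin n, w ∈ W → T.spanningCoe.Reachable w r := by
    intro w hw
    rw [SimpleGraph.reachable_iff_reflTransGen]
    exact (hS w hw).2 r he.root_mem
  have hused : ∀ u, Used I.W F u → ∃ x : Fin n, u = x ∧ T.spanningCoe.Reachable x r := by
    rintro u ⟨w, hw, k, rfl⟩
    induction k with
    | zero =>
      have hwn : w < n := he.card ▸ I.W_lt hw
      exact ⟨⟨w, hwn⟩, rfl, hWr _ ((he.term ⟨w, hwn⟩).1 hw)⟩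
    | succ k ih =>
      obtain ⟨x, hx, h⟩ := ih
      rw [Function.iterate_succ_apply', hx]
      by_cases hxr : x = r
      · exact ⟨r, by rw [hxr]; exact hFr, .refl _⟩
      · exact ⟨P x, hFP x hxr, hP2 x hxr h⟩
  have hsol : Sol I.E I.W I.root (prune I.W F) := by
    refine sol_prune hFr (fun w hw => ?_) fun u hu hur => ?_
    · obtain ⟨x, rfl, h⟩ := hused w (Used.terminal hw)
      exact hto _ x (Nat.lt_succ_self _) h
    · obtain ⟨x, rfl, h⟩ := hused u hu
      have hxr : x ≠ r := fun h => hur (by rw [h])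
      rw [hFP x hxr, he.adj]
      exact (hP1 x hxr h).adj_sub
  refine ⟨_, hsol, ?_⟩
  have hadj : ∀ u v : Fin n, Used I.W (prune I.W F) u → (u : ℕ) ≠ I.root →
      prune I.W F u = v → T.Adj u v := by
    intro u v hu hur huv
    rw [used_prune] at hu
    rw [prune_used hu] at huv
    obtain ⟨x, hx, h⟩ := hused u hu
    obtain rfl := Fin.ext hx
    have hxr : u ≠ r := fun h => hur (by rw [h])
    rw [hFP u hxr] at huv
    obtain rfl := Fin.ext huv
    exact hP1 u hxr h
  have hle : treeOf G I (prune I.W F) ≤ T := by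
    refine ⟨fun u hu => ?_, fun u v h => ?_⟩
    · by_cases hur : (u : ℕ) = I.root
      · rw [show u = r from Fin.ext hur]; exact (hS _ he.root_mem).1
      · obtain ⟨v, hv, -⟩ := he.parent hsol hu hur
        exact (hadj u v hu hur hv).fst_mem
    · rcases h.2 with ⟨h1, h2, h3⟩ | ⟨h1, h2, h3⟩
      · exact hadj u v h1 h2 h3
      · exact (hadj v u h1 h2 h3).symm
  exact le_antisymm hle (hT.2 (he.isSteinerSubgraph hsol) hle)

theorem Encodes.describes (he : Encodes G W I) {f : ℕ → ℕ} {out : List ℕ}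
    (hf : Sol I.E I.W I.root f) (h : Desc I f out) : Describes (treeOf G I f) out := by
  obtain ⟨us, hnd, hmem, rfl⟩ := h
  have hlt : ∀ u ∈ us, u < n := fun u hu => he.card ▸ I.used_lt hf ((hmem u).1 hu).1
  have hlt' : ∀ u ∈ us, f u < n := fun u hu => he.card ▸ I.used_lt hf ((hmem u).1 hu).1.next
  refine ⟨us.pmap (fun u hu => (⟨u, hlt u hu⟩, ⟨f u, hlt' u hu⟩)) fun _ h => h, ?_, ?_, ?_⟩
  · rw [List.flatMap_def, List.flatMap_def, List.map_pmap]
    exact congrArg List.flatten (List.pmap_eq_map (f := fun u => [u, f u]) _).symm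
  · rw [List.map_pmap]
    refine hnd.pmap ?_
    intro u hu v hv huv
    simp only [Sym2.eq_iff, Fin.mk.injEq] at huv
    rcases huv with huv | ⟨h1, h2⟩
    · exact huv.1
    · have : u = I.root := by
        refine (((hmem u).1 hu).1.toRoot hf.root hf.toRoot).eq_root hf.root (c := 1) ?_
        show f (f u) = u
        rw [h2, h1]
      exact absurd this ((hmem u).1 hu).2
  · intro e
    induction e with
    | h a b =>
    rw [List.map_pmap, List.mem_pmap, SimpleGraph.Subgraph.mem_edgeSet]
    constructor
    · rintro ⟨u, hu, h⟩
      obtain ⟨h1, h2⟩ := (hmem u).1 hu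
      obtain ⟨v, hv, -, hadj⟩ := he.parent (u := ⟨u, hlt u hu⟩) hf h1 h2
      have hv' : (⟨f u, hlt' u hu⟩ : Fin n) = v := Fin.ext hv
      rw [← SimpleGraph.Subgraph.mem_edgeSet, ← h, hv']
      exact hadj
    · rintro ⟨-, ⟨h1, h2, h3⟩ | ⟨h1, h2, h3⟩⟩
      · refine ⟨a, (hmem _).2 ⟨h1, h2⟩, ?_⟩
        simp [h3]
      · refine ⟨b, (hmem _).2 ⟨h1, h2⟩, ?_⟩
        simp [h3, Sym2.eq_swap]

theorem Encodes.isEnumeration (he : Encodes G W I) {τ : Cf} (h : Done I τ) :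
    IsEnumeration G W τ.solutions ∧ τ.solutions.length = numMinimalSteinerTrees G W := by
  classical
  obtain ⟨-, gs, hdesc, hnd, hmem⟩ := h
  have hnd' : (gs.map (treeOf G I)).Nodup := by
    refine hnd.map_on fun f hf g hg => he.treeOf_injOn ((hmem f).1 hf) ((hmem g).1 hg)
  have hmem' : ∀ T, T ∈ gs.map (treeOf G I) ↔ IsMinimalSteinerTree W T := by
    intro T
    rw [List.mem_map]
    constructor
    · rintro ⟨f, hf, rfl⟩; exact he.isMinimalSteinerTree ((hmem f).1 hf)
    · intro hT
      obtain ⟨f, hf, rfl⟩ := he.exists_sol hT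
      exact ⟨f, (hmem f).2 hf, rfl⟩
  refine ⟨⟨gs.map (treeOf G I), hnd', hmem', ?_⟩, ?_⟩
  · rw [List.forall₂_map_left_iff]
    obtain ⟨sols, hs⟩ : ∃ sols, τ.solutions = sols := ⟨_, rfl⟩
    rw [hs] at hdesc ⊢
    have hsol := fun f hf => (hmem f).1 hf
    clear hnd hmem hnd' hmem' hs
    induction hdesc with
    | nil => exact .nil
    | cons h1 _ ih =>
      exact .cons (he.describes (hsol _ (by simp)) h1)
        (ih fun f hf => hsol f (List.mem_cons_of_mem _ hf))
  · rw [← hdesc.length_eq, numMinimalSteinerTrees, ← List.length_map (f := treeOf G I),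
      ← List.toFinset_card_of_nodup hnd', ← Set.ncard_coe_finset]
    congr 1
    ext T
    simpa using hmem' T

end

/-! ### The input words -/

section

variable {n : ℕ} (adj : Fin n → List (Fin n)) (terminals : List (Fin n))

/-- The position at which an adjacency list starts. -/
def offs (i : ℕ) : ℕ := (((List.finRange n).take i).map (fun v => (adj v).length)).sum

/-- The concatenation of the adjacency lists. -/
def heads : List ℕ := (List.finRange n).flatMap (fun v => (adj v).map Fin.val)

theorem offs_succ {u : ℕ} (hu : u < n) : offs adj (u + 1) = offs adj u + (adj ⟨u, hu⟩).length := by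
  unfold offs
  rw [List.take_add_one, List.map_append, List.sum_append]
  simp [hu]

theorem offs_of_le {u : ℕ} (hu : n ≤ u) : offs adj u = offs adj n := by
  unfold offs
  rw [List.take_of_length_le (by simpa using hu), List.take_of_length_le (by simp)]

theorem offs_mono {u v : ℕ} (huv : u ≤ v) (hv : v ≤ n) : offs adj u ≤ offs adj v := by
  induction v, huv using Nat.le_induction with
  | base => exact le_rfl
  | succ m hm ih =>
    rw [offs_succ adj (by omega : m < n)]
    have := ih (by omega)
    omega

theorem length_heads : (heads adj).length = offs adj n := by
  unfold heads offs
  rw [List.length_flatMap, List.take_of_length_le (by simp)]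
  simp

/-- The layout of the concatenated adjacency lists. -/
theorem heads_getElem {u x : ℕ} (hu : u < n) (hx : x < (adj ⟨u, hu⟩).length) :
    (heads adj).getD (offs adj u + x) 0 = ((adj ⟨u, hu⟩)[x] : ℕ) := by
  have hsplit : List.finRange n = (List.finRange n).take u ++ ⟨u, hu⟩ ::
      (List.finRange n).drop (u + 1) := by
    conv_lhs => rw [← List.take_append_drop u (List.finRange n)]
    rw [List.drop_eq_getElem_cons (by simpa using hu)]
    simp
  have hlen : (((List.finRange n).take u).flatMap fun v => (adj v).map Fin.val).length =
      offs adj u := by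
    rw [List.length_flatMap]; simp [offs]
  unfold heads
  rw [hsplit, List.flatMap_append, List.flatMap_cons,
    List.getD_append_right _ _ _ _ (by rw [hlen]; omega), hlen, Nat.add_sub_cancel_left,
    List.getD_append _ _ _ _ (by simpa using hx)]
  simp [List.getD_eq_getElem?_getD, hx]

theorem exists_offs {j : ℕ} (hj : j < offs adj n) :
    ∃ (u : ℕ) (hu : u < n) (x : ℕ), x < (adj ⟨u, hu⟩).length ∧ j = offs adj u + x := by
  have key : ∀ m ≤ n, j < offs adj m →
      ∃ (u : ℕ) (hu : u < n) (x : ℕ), x < (adj ⟨u, hu⟩).length ∧ j = offs adj u + x := by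
    intro m
    induction m with
    | zero => intro _ h; simp [offs] at h
    | succ m ih =>
      intro hm h
      rw [offs_succ adj (by omega)] at h
      by_cases h' : j < offs adj m
      · exact ih (by omega) h'
      · exact ⟨m, by omega, j - offs adj m, by omega, by omega⟩
  exact key n le_rfl hj

theorem heads_lt {j : ℕ} (hj : j < offs adj n) : (heads adj).getD j 0 < n := by
  obtain ⟨u, hu, x, hx, rfl⟩ := exists_offs adj hj
  rw [heads_getElem adj hu hx]
  exact Fin.is_lt _

theorem exists_heads_iff (u v : Fin n) : (∃ j, offs adj u ≤ j ∧ j < offs adj (u + 1) ∧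
    (heads adj).getD j 0 = v) ↔ v ∈ adj u := by
  rw [offs_succ adj u.2]
  constructor
  · rintro ⟨j, h1, h2, h3⟩
    obtain ⟨x, rfl⟩ := Nat.exists_eq_add_of_le h1
    have hx : x < (adj u).length := by
      have : (adj ⟨u, u.2⟩).length = (adj u).length := rfl
      omega
    rw [heads_getElem adj u.2 hx] at h3
    rw [← Fin.ext h3]
    exact List.getElem_mem _
  · intro h
    obtain ⟨x, hx, rfl⟩ := List.getElem_of_mem h
    exact ⟨offs adj u + x, by omega, by simpa using hx, heads_getElem adj u.2 hx⟩

variable {adj terminals} {G : SimpleGraph (Fin n)} {W : Finset (Fin n)}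

/-- The total length of the adjacency lists, by the handshake lemma. -/
theorem offs_eq (hadj : IsAdjacencyLists G adj) : offs adj n = 2 * numEdges G := by
  classical
  unfold offs
  rw [List.take_of_length_le (by simp), numEdges, ← SimpleGraph.coe_edgeFinset,
    Set.ncard_coe_finset, ← SimpleGraph.sum_degrees_eq_twice_card_edges,
    ← List.sum_toFinset _ (List.nodup_finRange n)]
  refine Finset.sum_congr (by ext; simp) fun v _ => ?_
  rw [← List.toFinset_card_of_nodup (hadj v).1, ← SimpleGraph.card_neighborFinset_eq_degree]
  congr 1
  ext u
  simp [(hadj v).2]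

/-- The instance that the input words encode. -/
def instOf (hadj : IsAdjacencyLists G adj) (hnd : terminals.Nodup) (hne : terminals ≠ []) :
    Inst where
  n := n
  k := terminals.length
  off := offs adj
  adj j := (heads adj).getD j 0
  term i := (terminals.map Fin.val).getD i 0
  off_zero := by simp [offs]
  off_le u hu := by rw [offs_succ adj hu]; omega
  off_ge u hu := by rw [offs_of_le adj hu, offs_of_le adj (by omega : n ≤ u + 1)]
  adj_lt j hj := heads_lt adj hj
  term_lt i hi := by simp [List.getD_eq_getElem?_getD, hi]
  k_le := by
    rw [← List.toFinset_card_of_nodup hnd]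
    exact (Finset.card_le_univ _).trans_eq (Fintype.card_fin n)
  k_pos := List.length_pos_iff.2 hne
  symm' := by
    rintro u v ⟨hu, j, h1, h2, h3⟩
    have hv : v < n := by
      rw [← h3]
      exact heads_lt adj (h2.trans_le (offs_mono adj hu le_rfl))
    refine ⟨hv, (exists_heads_iff adj ⟨v, hv⟩ ⟨u, hu⟩).2 ?_⟩
    have := (exists_heads_iff adj ⟨u, hu⟩ ⟨v, hv⟩).1 ⟨j, h1, h2, h3⟩
    rw [(hadj _).2] at this ⊢
    exact this.symm

theorem instOf_encodes (hadj : IsAdjacencyLists G adj) (hnd : terminals.Nodup)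
    (hne : terminals ≠ []) (hW : terminals.toFinset = W) :
    Encodes G W (instOf hadj hnd hne) where
  card := rfl
  adj u v := by
    rw [← (hadj u).2, ← exists_heads_iff]
    exact ⟨fun h => h.2, fun h => ⟨u.2, h⟩⟩
  term w := by
    rw [← hW, List.mem_toFinset]
    constructor
    · rintro ⟨i, hi, h⟩
      change i < terminals.length at hi
      simp only [instOf, List.getD_eq_getElem?_getD, List.getElem?_map,
        List.getElem?_eq_getElem hi, Option.map_some, Option.getD_some] at h
      rw [← Fin.ext h]
      exact List.getElem_mem hi
    · intro h
      obtain ⟨i, hi, rfl⟩ := List.getElem_of_mem h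
      exact ⟨i, hi, by simp [instOf, List.getD_eq_getElem?_getD, hi]⟩

theorem inputWords_zero : (inputWords G adj terminals).getD 0 0 = n := by
  simp [inputWords]

theorem inputWords_two : (inputWords G adj terminals).getD 2 0 = terminals.length := by
  simp [inputWords]

theorem inputWords_eq : inputWords G adj terminals = [n, numEdges G, terminals.length] ++
    ((List.range (n + 1)).map (offs adj) ++ (heads adj ++ terminals.map Fin.val)) := by
  simp only [inputWords, heads, List.append_assoc]; rfl

theorem inputWords_off {i : ℕ} (hi : i ≤ n) :
    (inputWords G adj terminals).getD (i + 3) 0 = offs adj i := by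
  rw [inputWords_eq, List.getD_append_right _ _ _ _ (by simp),
    List.getD_append _ _ _ _ (by simp; omega)]
  simp [List.getD_eq_getElem?_getD, Nat.lt_succ_of_le hi]

theorem inputWords_adj {j : ℕ} (hj : j < offs adj n) :
    (inputWords G adj terminals).getD (n + 4 + j) 0 = (heads adj).getD j 0 := by
  rw [inputWords_eq, List.getD_append_right _ _ _ _ (by simp; omega),
    List.getD_append_right _ _ _ _ (by simp; omega),
    List.getD_append _ _ _ _ (by rw [length_heads]; simp; omega)]
  congr 1
  simp; omega

theorem inputWords_term (i : ℕ) :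
    (inputWords G adj terminals).getD (n + 4 + offs adj n + i) 0 =
      (terminals.map Fin.val).getD i 0 := by
  rw [inputWords_eq, List.getD_append_right _ _ _ _ (by simp; omega),
    List.getD_append_right _ _ _ _ (by simp; omega),
    List.getD_append_right _ _ _ _ (by rw [length_heads]; simp; omega), length_heads]
  congr 1
  simp; omega

theorem inputWords_le (hadj : IsAdjacencyLists G adj) (hnd : terminals.Nodup) (i : ℕ) :
    (inputWords G adj terminals).getD i 0 ≤ 3 * n + 2 * numEdges G + 20 := by
  have hall : ∀ x ∈ inputWords G adj terminals, x ≤ 3 * n + 2 * numEdges G + 20 := by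
    intro x hx
    rw [inputWords_eq] at hx
    simp only [List.mem_append, List.mem_cons, List.not_mem_nil, or_false, List.mem_map,
      List.mem_range] at hx
    rcases hx with (rfl | rfl | rfl) | ⟨i, hi, rfl⟩ | hx | ⟨w, -, rfl⟩
    · omega
    · omega
    · have := (Finset.card_le_univ terminals.toFinset).trans_eq (Fintype.card_fin n)
      rw [List.toFinset_card_of_nodup hnd] at this
      omega
    · have := offs_mono adj (show i ≤ n by omega) le_rfl
      rw [offs_eq hadj] at this
      omega
    · simp only [heads, List.mem_flatMap, List.mem_map] at hx
      obtain ⟨-, -, w, -, rfl⟩ := hx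
      have := w.2
      omega
    · have := w.2
      omega
  rcases lt_or_ge i (inputWords G adj terminals).length with h | h
  · rw [List.getD_eq_getElem _ _ h]
    exact hall _ (List.getElem_mem h)
  · rw [List.getD_eq_default _ _ h]
    exact Nat.zero_le _

end

/-! ### The enumeration algorithm -/

/-- The enumeration algorithm as a program. -/
def steinerProgram : Program where
  Reg := Reg
  Arr := Arr
  inp := .inp
  body := mainCmd

section

variable {n : ℕ} {adj : Fin n → List (Fin n)} {terminals : List (Fin n)}
  {G : SimpleGraph (Fin n)} {W : Finset (Fin n)}

/-- A graph has at most `n ^ 2 / 2` edges; so `O(n + m)` space is `O(n ^ 2)`, and all words have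
`O(log (n + 1))` bits. -/
theorem two_mul_numEdges_le (hadj : IsAdjacencyLists G adj) : 2 * numEdges G ≤ n * n := by
  rw [← offs_eq hadj]
  unfold offs
  rw [List.take_of_length_le (by simp)]
  refine (List.sum_le_card_nsmul _ n ?_).trans_eq (by simp)
  intro x hx
  obtain ⟨v, -, rfl⟩ := List.mem_map.1 hx
  rw [← List.toFinset_card_of_nodup (hadj v).1]
  exact (Finset.card_le_univ _).trans_eq (Fintype.card_fin n)

/-- The bounds on words, for a graph with `n` vertices and `m` edges. -/
def machOf (n m C : ℕ) (hn : 0 < n) (hm : 2 * m ≤ n * n) (hC : 97 ≤ C) : Mach where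
  B := (n + 1) ^ C
  M := 3 * n + 2 * m + 20
  one_le := by omega
  big := by
    -- `M + 18 ≤ (n + 1) ^ 6`, hence the exponent `97 > 6 * 16`
    have h1 : 3 * n + 2 * m + 20 + 18 ≤ (n + 1) ^ 6 := by
      have h2 : 4 ≤ (n + 1) ^ 2 := by nlinarith
      calc 3 * n + 2 * m + 20 + 18 ≤ 4 * 4 * (n + 1) ^ 2 := by nlinarith
        _ ≤ (n + 1) ^ 2 * (n + 1) ^ 2 * (n + 1) ^ 2 :=
          Nat.mul_le_mul_right _ (Nat.mul_le_mul h2 h2)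
        _ = (n + 1) ^ 6 := by ring
    calc (3 * n + 2 * m + 20 + 18) ^ 16 ≤ ((n + 1) ^ 6) ^ 16 := Nat.pow_le_pow_left h1 16
      _ = (n + 1) ^ 96 := by rw [← pow_mul]
      _ < (n + 1) ^ C := Nat.pow_lt_pow_right (by omega) (by omega)

/-- With no terminals, the empty graph is the only minimal Steiner tree. -/
theorem isMinimalSteinerTree_empty (T : G.Subgraph) : IsMinimalSteinerTree ∅ T ↔ T = ⊥ := by
  have h0 : ∀ H : G.Subgraph, IsSteinerSubgraph ∅ H := fun H u hu => by simp at hu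
  constructor
  · intro h
    exact le_antisymm (h.2 (h0 ⊥) bot_le) bot_le
  · rintro rfl
    exact ⟨h0 _, fun _ _ _ => bot_le⟩

/-- The run of the program: it is a sequence of linearly long pieces, and it enumerates the minimal
Steiner trees. -/
theorem steinerProgram_paced (hn : 0 < n) (hadj : IsAdjacencyLists G adj) (hnd : terminals.Nodup)
    (hW : terminals.toFinset = W) {C : ℕ} (hC : 97 ≤ C) :
    ∃ (j : ℕ) (τ : Cf), Paced ((n + 1) ^ C) (3 * n + 2 * numEdges G + 20 + 1)
      (4000 * (2 * numEdges G + n) + 4000)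
      (steinerProgram.init (inputWords G adj terminals)) j τ ∧ τ.current = [] ∧
      IsEnumeration G W τ.solutions ∧ τ.solutions.length = numMinimalSteinerTrees G W := by
  obtain ⟨s, hs⟩ : ∃ s : Cf, steinerProgram.init (inputWords G adj terminals) = s := ⟨_, rfl⟩
  set μ := machOf n (numEdges G) C hn (two_mul_numEdges_le hadj) hC with hμ
  have hmem : ∀ i, s.mem .inp i = (inputWords G adj terminals).getD i 0 := by
    intro i; rw [← hs]; rfl
  have hmem' : ∀ a : Arr, a ≠ .inp → ∀ i, s.mem a i = 0 := by
    intro a ha i; rw [← hs]; exact if_neg ha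
  have hregs : ∀ x : Reg, s.regs x = 0 := by intro x; rw [← hs]; rfl
  have hcur : s.current = [] := by rw [← hs]; rfl
  have hsol : s.solutions = [] := by rw [← hs]; rfl
  have hbody : s = s.withC [mainCmd] := by rw [← hs]; rfl
  have hb : s.Bdd μ.M := by
    refine ⟨fun x => by rw [hregs]; exact Nat.zero_le _, fun a i => ?_⟩
    by_cases ha : a = .inp
    · rw [ha, hmem]; exact inputWords_le hadj hnd i
    · rw [hmem' a ha]; exact Nat.zero_le _
  rw [hs, hbody]
  by_cases hne : terminals = []
  · obtain ⟨j, τ, hp, h1, h2⟩ := mainCmd_paced_empty (μ := μ)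
      (by rw [hmem, inputWords_two, hne]; rfl) (hregs .cont) hb (by simp [hμ, machOf]) hcur hsol
      (4000 * (2 * numEdges G + n))
    have hW0 : W = ∅ := by rw [← hW, hne]; rfl
    refine ⟨j, τ, hp, h1, ⟨[⊥], by simp, fun T => ?_, ?_⟩, ?_⟩
    · rw [hW0, isMinimalSteinerTree_empty, List.mem_singleton]
    · rw [h2]
      exact .cons ⟨[], rfl, List.nodup_nil, by simp⟩ .nil
    · rw [h2, numMinimalSteinerTrees, hW0]
      simp [isMinimalSteinerTree_empty]
  · have he := instOf_encodes hadj hnd hne hW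
    set I := instOf hadj hnd hne with hI
    have hoff : I.off I.n = 2 * numEdges G := offs_eq hadj
    have hl : Loaded μ I s := by
      constructor
      · rw [hoff]; exact le_rfl
      · rw [hmem, inputWords_zero]; rfl
      · rw [hmem, inputWords_two]; rfl
      · intro i hi; rw [hmem]; exact inputWords_off hi
      · intro j hj; rw [hmem]; exact inputWords_adj hj
      · intro i _; rw [hmem]; exact inputWords_term i
      · exact hmem'
      · exact hcur
      · exact hsol
    obtain ⟨j, τ, hp, hd⟩ := mainCmd_paced hl (hregs .cont) hb
    rw [hoff] at hp
    exact ⟨j, τ, hp, hd.1, he.isEnumeration hd⟩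

variable {C : ℕ}

/-- The bounds for both parts of the theorem; as no preprocessing is needed, `pre` is arbitrary. -/
theorem steinerProgram_spec (hn : 0 < n) (hadj : IsAdjacencyLists G adj) (hnd : terminals.Nodup)
    (hW : terminals.toFinset = W) (hC : 16000 ≤ C) :
    steinerProgram.Enumerates (inputWords G adj terminals) G W ∧
    (∀ pre, steinerProgram.HasDelay (inputWords G adj terminals) pre (C * (n + numEdges G))) ∧
    steinerProgram.HaltedAt (inputWords G adj terminals)
      (C * (n + numEdges G) * max 1 (numMinimalSteinerTrees G W)) ∧
    ∀ sp, 342 * n + 26 * numEdges G ≤ sp →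
      steinerProgram.RunsInSpace (inputWords G adj terminals) ((n + 1) ^ C) sp := by
  obtain ⟨j, τ, hp, hcur, henum, hlen⟩ := steinerProgram_paced hn hadj hnd hW (show 97 ≤ C by omega)
  have hd : 2 * (4000 * (2 * numEdges G + n) + 4000) ≤ C * (n + numEdges G) :=
    le_trans (by clear hC hp; omega) (Nat.mul_le_mul_right _ hC)
  obtain ⟨T, hT, hreach, hctl, hjlen⟩ := hp.reaches
  have hr := hreach.1
  have hT' : T ≤ C * (n + numEdges G) * max 1 (numMinimalSteinerTrees G W) := by
    have h0 : (steinerProgram.init (inputWords G adj terminals)).solutions.length = 0 := rfl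
    have hj : j + 1 ≤ 2 * max 1 (numMinimalSteinerTrees G W) := by
      rw [hlen] at hjlen; omega
    calc T ≤ (4000 * (2 * numEdges G + n) + 4000) * (2 * max 1 (numMinimalSteinerTrees G W)) :=
          hT.trans (Nat.mul_le_mul_left _ hj)
      _ = 2 * (4000 * (2 * numEdges G + n) + 4000) * max 1 (numMinimalSteinerTrees G W) := by ring
      _ ≤ _ := Nat.mul_le_mul_right _ hd
  refine ⟨⟨T, ?_, ?_, ?_⟩, fun pre => ⟨0, Nat.zero_le _, rfl, fun k _ hk => ?_⟩, ?_, fun sp hsp =>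
    ⟨3 * n + 2 * numEdges G + 20 + 1, ?_, fun k => hp.fits k⟩⟩
  · exact (congrArg Config.control hr).trans hctl
  · exact (congrArg Config.current hr).trans hcur
  · have : (steinerProgram.after (inputWords G adj terminals) T).solutions = τ.solutions :=
      congrArg Config.solutions hr
    rw [this]; exact henum
  · obtain ⟨l, h1, h2, h3⟩ := hp.delay k hk
    exact ⟨l, h1, by omega, h3⟩
  · exact (congrArg Config.control (hreach.iterate_eq hctl hT')).trans hctl
  · have h1 : Fintype.card steinerProgram.Reg = 30 := rfl
    have h2 : Fintype.card steinerProgram.Arr = 13 := rfl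
    rw [h1, h2]
    clear hT hT' hd hp hC
    omega

end

end SteinerEnum

theorem mainTheorem1 :
    -- linear delay, quadratic space, after `O(n m)` preprocessing
    (∃ (p : SteinerEnum.Program) (C : ℕ),
      ∀ (n : ℕ) (_ : 0 < n) (G : SimpleGraph (Fin n)) (W : Finset (Fin n))
        (adj : Fin n → List (Fin n)) (_ : SteinerEnum.IsAdjacencyLists G adj)
        (terminals : List (Fin n)) (_ : terminals.Nodup) (_ : terminals.toFinset = W),
        p.Enumerates (SteinerEnum.inputWords G adj terminals) G W ∧
        p.HasDelay (SteinerEnum.inputWords G adj terminals)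
          (C * (n * SteinerEnum.numEdges G)) (C * (n + SteinerEnum.numEdges G)) ∧
        p.RunsInSpace (SteinerEnum.inputWords G adj terminals) ((n + 1) ^ C) (C * n ^ 2)) ∧
    -- linear amortized time per solution, linear space, no preprocessing
    (∃ (p : SteinerEnum.Program) (C : ℕ),
      ∀ (n : ℕ) (_ : 0 < n) (G : SimpleGraph (Fin n)) (W : Finset (Fin n))
        (adj : Fin n → List (Fin n)) (_ : SteinerEnum.IsAdjacencyLists G adj)
        (terminals : List (Fin n)) (_ : terminals.Nodup) (_ : terminals.toFinset = W),
        p.Enumerates (SteinerEnum.inputWords G adj terminals) G W ∧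
        p.HaltedAt (SteinerEnum.inputWords G adj terminals)
          (C * (n + SteinerEnum.numEdges G) * max 1 (SteinerEnum.numMinimalSteinerTrees G W)) ∧
        p.RunsInSpace (SteinerEnum.inputWords G adj terminals) ((n + 1) ^ C)
          (C * (n + SteinerEnum.numEdges G))) := by
  have key := @SteinerEnum.steinerProgram_spec
  refine ⟨⟨SteinerEnum.steinerProgram, 16000, ?_⟩, ⟨SteinerEnum.steinerProgram, 16000, ?_⟩⟩
  · intro n hn G W adj hadj terminals hnd hW
    obtain ⟨h1, h2, -, h4⟩ := key hn hadj hnd hW le_rfl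
    refine ⟨h1, h2 _, h4 _ ?_⟩
    have := SteinerEnum.two_mul_numEdges_le hadj
    nlinarith
  · intro n hn G W adj hadj terminals hnd hW
    obtain ⟨h1, -, h3, h4⟩ := key hn hadj hnd hW le_rfl
    exact ⟨h1, h3, h4 _ (by omega)⟩
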